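/- **Setting.** Let $d\ge 2$, let $W\subseteq\mathbb R^d$ be measurable, and suppose that for every bounded measurable $A\subseteq W$ $$\limsup_{r\downarrow 0} r^{-1}\lambda_d(\{x\in A:\operatorname{dist}(x,\partial W)\le r\})<\infty ,$$ where $\lambda_d$ is Lebesgue measure, $\operatorname{dist}(x,B)=\inf_{y\in B}\|x-y\|$ and $\operatorname{dist}(x,\emptyset)=\infty$. Let $g:W\to[0,\infty)$ be bounded and Lipschitz. Let $A_1,\dots,A_m\subseteq W$ be bounded and measurable with $\lambda_d(A_i)>0$ and $\limsup_{r\downarrow0} r^{-1}\lambda_d(\{x\in\mathbb R^d:\operatorname{dist}(x,\partial A_i)\le r\})<\infty$, and let $f_i:A_i\to\mathbb R$ be Lipschitz with constant $1$ and $\lambda_d(\{f_i\neq0\})>0$. Let $(\mathbb M,\mathcal F,\mathbb Q)$ be a probability space of marks, and let $\mathbf N$ be the set of configurations $\mathcal M\subseteq\mathbb R^d\times\mathbb M$ having finitely many points in $B\times\mathbb M$ for each bounded $B$, with the $\sigma$-field generated by the numbers of points in measurable sets. For $s\ge1$ let $\mathcal P_{sg}$ be a Poisson process on $\mathbb R^d\times\mathbb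 M$ with intensity measure $s\,(g\mathbf 1_W\lambda_d)\otimes\mathbb Q$, and for $u>0$ let $\mathcal P_u$ be a Poisson process with intensity measure $u\,\lambda_d\otimes\mathbb Q$. Marks $M_x$, $x\in\mathbb R^d$, are independent with distribution $\mathbb Q$ and independent of these processes; for finite $\mathcal A\subset\mathbb R^d$ let $(\mathcal A,M_{\mathcal A})=\{(z,M_z):z\in\mathcal A\}$. Write $\mathcal M^{\hat x}=\mathcal M\cup\{\hat x\}$, $\mathcal M+y=\{(z+y,m_z):(z,m_z)\in\mathcal M\}$, $x+a(\mathcal M-x)=\{(x+a(z-x),m_z):(z,m_z)\in\mathcal M\}$, and $\widehat B(x,r)=B(x,r)\times\mathbb M$ with $B(x,r)$ the closed ball. **Scores.** Let $\xi^{(1)},\dots,\xi^{(m)}:(\mathbb R^d\times\mathbb M)\times\mathbf N\to\mathbb R$ be measurable and put $\xi^{(i)}_s((x,m_x),\mathcal M)=\xi^{(i)}((x,m_x),x+s^{1/d}(\mathcal M-x))$, $s\ge1$. Assume $\xi^{(i)}_s(\hat x,\mathcal M)=\xi_s^{(i)}(\hat x,\mathcal M^{\hat x})$ for $\hat x\in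 W\times\mathbb M$, $\hat x\notin\mathcal M$, and that there are constants $C^{(i)},C_{stab},c_{stab},p,C_{mom}\in(0,\infty)$ such that the following hold. 1. $|\xi^{(i)}((x,m_x),\mathcal M)-\xi^{(i)}((x+y,m_x),\mathcal M+y)|\le C^{(i)}\|y\|$ whenever $x,x+y\in W$, $m_x\in\mathbb M$, $\mathcal M\in\mathbf N$. 2. For each $s\ge1$ there is a measurable $R_s:(W\times\mathbb M)\times\mathbf N\to[0,\infty)$ such that for all $i$, $\hat x=(x,m_x)\in W\times\mathbb M$, $\mathcal M\in\mathbf N$: - $\xi^{(i)}_s(\hat x,(\mathcal M\cup\widehat{\mathcal A})\cap\widehat B(x,R_s(\hat x,\mathcal M)))=\xi_s^{(i)}(\hat x,\mathcal M\cup\widehat{\mathcal A})$ for all $\widehat{\mathcal A}\subset\mathbb R^d\times\mathbb M$ with $|\widehat{\mathcal A}|\le9$; - $R_s(\hat x,\mathcal M_1)\ge R_s(\hat x,\mathcal M_2)$ if $\mathcal M_1\subseteq\mathcal M_2$; - $R_s(\hat x,\mathcal M)\le r$ if and only if $R_s(\hat x,\mathcal M\cap\widehat B(x,r))\le r$, for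 all $r\ge0$; - $\mathbb P(R_s((x,M_x),\mathcal P_{sg})\ge r)\le C_{stab}e^{-c_{stab}sr^d}$ and $\mathbb P(R_s((x,M_x),\mathcal P_{sg(y)})\ge r)\le C_{stab}e^{-c_{stab}sr^d}$ for all $r\ge0$, $x\in W$, and $y\in W$ with $g(y)>0$. 3. For all $i$, $s\ge1$, $x\in W$: $\mathbb E|\xi^{(i)}_s((x,M_x),\mathcal P_{sg}\cup(\mathcal A,M_{\mathcal A}))|^{6+p}\le C_{mom}$ for all $\mathcal A\subset W$ with $|\mathcal A|\le9$, and $\mathbb E|\xi^{(i)}_s((x,M_x),\mathcal P_{sg(y)}\cup(\mathcal A,M_{\mathcal A}))|^{6+p}\le C_{mom}$ for all $\mathcal A\subset\mathbb R^d$ with $|\mathcal A|\le9$ and all $y\in W$ with $g(y)>0$. Put $\langle\mu^{(i)}_s,f_i\rangle=\sum_{(x,m_x)\in\mathcal P_{sg},\,x\in A_i}f_i(x)\,\xi^{(i)}_s((x,m_x),\mathcal P_{sg})$, $\langle\bar\mu^{(i)}_s,f_i\rangle=\langle\mu^{(i)}_s,f_i\rangle-\mathbb E\langle\mu^{(i)}_s,f_i\rangle$,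 and $$\begin{aligned}\sigma_{ij}={}&\int_{A_i\cap A_j}\mathbb E\big[\xi^{(i)}((x,M_x),\mathcal P_{g(x)})\,\xi^{(j)}((x,M_x),\mathcal P_{g(x)})\big]f_i(x)f_j(x)g(x)\,dx\\&+\int_{A_i\cap A_j}\int_{\mathbb R^d}\Big(\mathbb E\big[\xi^{(i)}((x,M_x),\mathcal P_{g(x)}^{(x+y,M_{x+y})})\,\xi^{(j)}((x,M_{x+y}),\mathcal P_{g(x)}^{(x,M_x)}-y)\big]\\&\qquad-\mathbb E\,\xi^{(i)}((x,M_x),\mathcal P_{g(x)})\;\mathbb E\,\xi^{(j)}((x,M_{x+y}),\mathcal P_{g(x)}-y)\Big)f_i(x)f_j(x)g(x)^2\,dy\,dx,\end{aligned}$$ the integrands being $0$ where $g(x)=0$. **Proposition.** The variables $\langle\mu_s^{(i)},f_i\rangle$ are square integrable, the integrals defining $\sigma_{ij}$ converge absolutely, and there is a constant $C_{cov}\in(0,\infty)$, depending only on $d$, $W$, $g$, $m$, $A_1,\dots,A_m$, $\|f_1\|_\infty,\dots,\|f_m\|_\infty$, $C^{(1)},\dots,C^{(m)}$, $C_{stab}$,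 $c_{stab}$, $p$ and $C_{mom}$, such that $$\Big|\sigma_{ij}-\frac{\operatorname{Cov}(\langle\bar\mu_s^{(i)},f_i\rangle,\langle\bar\mu_s^{(j)},f_j\rangle)}{s}\Big|\le C_{cov}\,s^{-1/d}\qquad\text{for all }s\ge1,\ i,j\in\{1,\dots,m\}.$$ In particular, $|\sigma_{ii}-s^{-1}\operatorname{Var}\langle\mu_s^{(i)},f_i\rangle|\le C_{cov}\,s^{-1/d}$ for all $s\ge1$ and $i$. -/

import Mathlib

open MeasureTheory ProbabilityTheory Filter Topology Set
open scoped NNReal ENNReal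

noncomputable section

namespace StabScores

/-- Euclidean space of dimension `d`. -/
abbrev E (d : ℕ) : Type := EuclideanSpace ℝ (Fin d)

/-- Simple locally finite configurations of marked points in `E d × 𝕄`, identified with
their supports. -/
@[ext]
structure Config (d : ℕ) (𝕄 : Type*) where
  /-- the points of the configuration -/
  pts : Set (E d × 𝕄)
  locFin : ∀ B : Set (E d), Bornology.IsBounded B → (pts ∩ B ×ˢ univ).Finite

namespace Config

variable {d : ℕ} {𝕄 : Type*}

/-- Number of points in a set. -/
def count (S : Config d 𝕄) (B : Set (E d × 𝕄)) : ℕ∞ := (S.pts ∩ B).encard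

/-- The σ-field generated by the counts of measurable sets. -/
instance instMeasurableSpace [MeasurableSpace 𝕄] : MeasurableSpace (Config d 𝕄) :=
  ⨆ B : {B : Set (E d × 𝕄) // MeasurableSet B},
    MeasurableSpace.comap (fun S : Config d 𝕄 => S.count B.1) inferInstance

/-- Union with finitely many further points. -/
def addFinset (S : Config d 𝕄) (F : Finset (E d × 𝕄)) : Config d 𝕄 where
  pts := S.pts ∪ ↑F
  locFin B hB := by
    rw [union_inter_distrib_right]
    exact (S.locFin B hB).union (F.finite_toSet.inter_of_left _)

/-- The configuration `S ∪ {p}`. -/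
def add (S : Config d 𝕄) (p : E d × 𝕄) : Config d 𝕄 := S.addFinset {p}

/-- Intersection of `S` with `closedBall x r × 𝕄`. -/
def inBall (S : Config d 𝕄) (x : E d) (r : ℝ) : Config d 𝕄 where
  pts := S.pts ∩ Metric.closedBall x r ×ˢ univ
  locFin B hB := (S.locFin B hB).subset fun _ h => ⟨h.1.1, h.2⟩

/-- The translated configuration `S + y` (marks are kept). -/
def translate (S : Config d 𝕄) (y : E d) : Config d 𝕄 where
  pts := (fun p : E d × 𝕄 => (p.1 + y, p.2)) '' S.pts
  locFin B hB := by
    obtain ⟨r, hr⟩ := hB.subset_closedBall 0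
    refine ((S.locFin (Metric.closedBall 0 (r + ‖y‖)) Metric.isBounded_closedBall).image
      (fun p : E d × 𝕄 => (p.1 + y, p.2))).subset ?_
    rintro _ ⟨⟨p, hp, rfl⟩, hpB⟩
    refine ⟨p, ⟨hp, ?_, mem_univ _⟩, rfl⟩
    have h1 := hr hpB.1
    simp only [Metric.mem_closedBall, dist_zero_right] at h1 ⊢
    calc ‖p.1‖ = ‖(p.1 + y) - y‖ := by simp
      _ ≤ ‖p.1 + y‖ + ‖y‖ := norm_sub_le _ _
      _ ≤ r + ‖y‖ := by gcongr

/-- The dilated configuration `x + a (S - x)` for `a > 0` (marks are kept); the value is the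
empty configuration for `a ≤ 0`, which is never used. -/
def dilate (S : Config d 𝕄) (x : E d) (a : ℝ) : Config d 𝕄 where
  pts := {q | 0 < a ∧ ∃ p ∈ S.pts, q = (x + a • (p.1 - x), p.2)}
  locFin B hB := by
    obtain ⟨r, hr⟩ := hB.subset_closedBall x
    refine ((S.locFin (Metric.closedBall x (r / a)) Metric.isBounded_closedBall).image
      (fun p : E d × 𝕄 => (x + a • (p.1 - x), p.2))).subset ?_
    rintro _ ⟨⟨ha, p, hp, rfl⟩, hpB⟩
    refine ⟨p, ⟨hp, ?_, mem_univ _⟩, rfl⟩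
    have h1 := hr hpB.1
    simp only [Metric.mem_closedBall, dist_self_add_left, norm_smul, Real.norm_eq_abs,
      abs_of_pos ha] at h1
    rw [Metric.mem_closedBall, dist_eq_norm, le_div_iff₀ ha]
    linarith

end Config

/-- `X` is a Poisson process with intensity measure `Λ`: the numbers of points in disjoint
measurable sets are independent, and the number of points in a measurable set `B` of finite
intensity is Poisson distributed with parameter `Λ B`. -/
structure IsPoissonProcess {d : ℕ} {𝕄 Ω : Type*} [MeasurableSpace 𝕄] [MeasurableSpace Ω]
    (μ : Measure Ω) (X : Ω → Config d 𝕄) (Λ : Measure (E d × 𝕄)) : Prop where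
  measurable : Measurable X
  count_law : ∀ B : Set (E d × 𝕄), MeasurableSet B → Λ B ≠ ∞ → ∀ k : ℕ,
    μ {ω | (X ω).count B = k} = poissonMeasure (Λ B).toNNReal {k}
  indep : ∀ (n : ℕ) (B : Fin n → Set (E d × 𝕄)), (∀ k, MeasurableSet (B k)) →
    Pairwise (fun k l => Disjoint (B k) (B l)) →
    iIndepFun (fun k ω => (X ω).count (B k)) μ

/-- The measure with Lebesgue density `g` on `W` and zero outside `W`. -/
def densityMeasure {d : ℕ} (W : Set (E d)) (g : E d → ℝ) : Measure (E d) :=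
  (volume.restrict W).withDensity fun x => ENNReal.ofReal (g x)

/-- Regularity of the boundary of the observation window `W`. The extended distance to an
empty boundary is `∞`. -/
def WindowBoundaryCondition {d : ℕ} (W : Set (E d)) : Prop :=
  ∀ A : Set (E d), MeasurableSet A → Bornology.IsBounded A → A ⊆ W →
    limsup (fun r : ℝ =>
      volume {x ∈ A | Metric.infEDist x (frontier W) ≤ ENNReal.ofReal r} / ENNReal.ofReal r)
      (𝓝[>] 0) < ∞

/-- Regularity of the boundary of a set `A`. -/
def BoundaryCondition {d : ℕ} (A : Set (E d)) : Prop :=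
  limsup (fun r : ℝ =>
    volume {x | Metric.infEDist x (frontier A) ≤ ENNReal.ofReal r} / ENNReal.ofReal r)
    (𝓝[>] 0) < ∞

/-- Score functions of a marked point and a configuration. -/
abbrev Score (d : ℕ) (𝕄 : Type*) := E d × 𝕄 → Config d 𝕄 → ℝ

section Scores

variable {d m : ℕ} {𝕄 Ω : Type*}

/-- The scaled score `ξ_s` generated by `ξ`. -/
def scaledScore (ξ : Score d 𝕄) (s : ℝ) : Score d 𝕄 :=
  fun p S => ξ p (S.dilate p.1 (s ^ (1 / (d : ℝ))))

/-- The Lipschitz condition of a score under translations within `W`. -/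
def TranslationLipschitz (W : Set (E d)) (ξ : Score d 𝕄) (C : ℝ) : Prop :=
  ∀ (x y : E d) (a : 𝕄) (S : Config d 𝕄), x ∈ W → x + y ∈ W →
    |ξ (x, a) S - ξ (x + y, a) (S.translate y)| ≤ C * ‖y‖

/-- The convention that a score at a point not belonging to the configuration is its value
after adding the point. -/
def InsertConvention (W : Set (E d)) (ξ : Score d 𝕄) : Prop :=
  ∀ (x : E d) (a : 𝕄) (S : Config d 𝕄), x ∈ W → (x, a) ∉ S.pts →
    ξ (x, a) S = ξ (x, a) (S.add (x, a))

/-- `R` is a radius of stabilization for the scores `ξ i`. -/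
def IsStabilizationRadius (W : Set (E d)) (ξ : Fin m → Score d 𝕄)
    (R : E d × 𝕄 → Config d 𝕄 → ℝ≥0) : Prop :=
  ∀ (i : Fin m) (x : E d) (a : 𝕄) (S : Config d 𝕄) (F : Finset (E d × 𝕄)),
    x ∈ W → F.card ≤ 9 →
    ξ i (x, a) ((S.addFinset F).inBall x (R (x, a) S)) = ξ i (x, a) (S.addFinset F)

/-- Monotonicity of a radius of stabilization. -/
def IsMonotoneRadius (W : Set (E d)) (R : E d × 𝕄 → Config d 𝕄 → ℝ≥0) : Prop :=
  ∀ (x : E d) (a : 𝕄) (S T : Config d 𝕄), x ∈ W → S.pts ⊆ T.pts → R (x, a) T ≤ R (x, a) S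

/-- The radius of stabilization is itself locally determined. -/
def IsLocallyDetermined (W : Set (E d)) (R : E d × 𝕄 → Config d 𝕄 → ℝ≥0) : Prop :=
  ∀ (x : E d) (a : 𝕄) (S : Config d 𝕄) (r : ℝ≥0), x ∈ W →
    (R (x, a) S ≤ r ↔ R (x, a) (S.inBall x r) ≤ r)

variable [MeasurableSpace 𝕄] [MeasurableSpace Ω]

/-- The families `(ξ i s)_{s ≥ 1}` are intrinsically exponentially stabilizing with constants
`Cstab`, `cstab`. Here `P s` is the Poisson process of intensity `s g` on `W` and `Z u`, for
`u > 0`, the stationary Poisson process of intensity `u`; the mark of `x` is distributed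
according to `Q` and independent of the process. -/
def IntrinsicallyExpStabilizing (W : Set (E d)) (g : E d → ℝ) (Q : Measure 𝕄) (μ : Measure Ω)
    (P Z : ℝ → Ω → Config d 𝕄) (ξ : Fin m → ℝ → Score d 𝕄) (Cstab cstab : ℝ) : Prop :=
  ∃ R : ℝ → E d × 𝕄 → Config d 𝕄 → ℝ≥0, ∀ s : ℝ, 1 ≤ s →
    Measurable (Function.uncurry (R s)) ∧
    IsStabilizationRadius W (fun i => ξ i s) (R s) ∧
    IsMonotoneRadius W (R s) ∧
    IsLocallyDetermined W (R s) ∧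
    (∀ r : ℝ, 0 ≤ r → ∀ x ∈ W,
      (μ.prod Q) {q | r ≤ R s (x, q.2) (P s q.1)} ≤
        ENNReal.ofReal (Cstab * Real.exp (-cstab * s * r ^ d))) ∧
    (∀ r : ℝ, 0 ≤ r → ∀ x ∈ W, ∀ y ∈ W, 0 < g y →
      (μ.prod Q) {q | r ≤ R s (x, q.2) (Z (s * g y) q.1)} ≤
        ENNReal.ofReal (Cstab * Real.exp (-cstab * s * r ^ d)))

open Classical in
/-- The points of the finite set `A` equipped with the marks `a`. -/
def markedPoints (A : Finset (E d)) (a : A → 𝕄) : Finset (E d × 𝕄) :=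
  A.attach.image fun z => (z.1, a z)

/-- The absolute moment of order `k` of the score `ξ` at `x` on the input
`X ∪ (A, M_A)`, the marks of `x` and of the points of `A` being i.i.d. with distribution `Q` and
independent of `X`. -/
def scoreMoment (Q : Measure 𝕄) (μ : Measure Ω) (ξ : Score d 𝕄) (X : Ω → Config d 𝕄)
    (k : ℝ) (x : E d) (A : Finset (E d)) : ℝ≥0∞ :=
  ∫⁻ q : Ω × 𝕄 × (A → 𝕄),
    ‖ξ (x, q.2.1) ((X q.1).addFinset (markedPoints A q.2.2))‖ₑ ^ k
    ∂(μ.prod (Q.prod (Measure.pi fun _ : A => Q)))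

/-- The `(6+p)`th moment condition with respect to `P s`, `s ≥ 1`. Sets `A` containing `x` need
not be considered: the marked point at `x` would then belong to the input, which by the insertion
convention does not change the score. -/
def MomentCondition (W : Set (E d)) (Q : Measure 𝕄) (μ : Measure Ω)
    (P : ℝ → Ω → Config d 𝕄) (ξ : Fin m → ℝ → Score d 𝕄) (p Cmom : ℝ) : Prop :=
  ∀ (i : Fin m) (A : Finset (E d)), (A : Set (E d)) ⊆ W → A.card ≤ 9 →
    ∀ s : ℝ, 1 ≤ s → ∀ x ∈ W, x ∉ A →
      scoreMoment Q μ (ξ i s) (P s) (6 + p) x A ≤ ENNReal.ofReal Cmom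

/-- The `(6+p)`th moment condition with respect to the stationary processes `Z (s g(y))`. -/
def StationaryMomentCondition (W : Set (E d)) (g : E d → ℝ) (Q : Measure 𝕄) (μ : Measure Ω)
    (Z : ℝ → Ω → Config d 𝕄) (ξ : Fin m → ℝ → Score d 𝕄) (p Cmom : ℝ) : Prop :=
  ∀ (i : Fin m) (A : Finset (E d)), A.card ≤ 9 →
    ∀ s : ℝ, 1 ≤ s → ∀ x ∈ W, x ∉ A → ∀ y ∈ W, 0 < g y →
      scoreMoment Q μ (ξ i s) (Z (s * g y)) (6 + p) x A ≤ ENNReal.ofReal Cmom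

/-- The statistic `⟨μ, f⟩ = ∑ f(x) ξ((x, m_x), X)`, the (finite) sum being over the points
`(x, m_x)` of `X` with `x ∈ A`. -/
def pairing (A : Set (E d)) (f : E d → ℝ) (ξ : Score d 𝕄) (X : Ω → Config d 𝕄) (ω : Ω) : ℝ :=
  ∑ᶠ q ∈ (X ω).pts ∩ A ×ˢ univ, f q.1 * ξ q (X ω)

/-- The centered statistic `⟨μ, f⟩ - 𝔼 ⟨μ, f⟩`. -/
def centeredPairing (μ : Measure Ω) (A : Set (E d)) (f : E d → ℝ) (ξ : Score d 𝕄)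
    (X : Ω → Config d 𝕄) (ω : Ω) : ℝ :=
  pairing A f ξ X ω - ∫ ω', pairing A f ξ X ω' ∂μ

/-- The integrand of the first term of the asymptotic covariance. -/
def sigmaDiag (Q : Measure 𝕄) (μ : Measure Ω) (Z : ℝ → Ω → Config d 𝕄) (g : E d → ℝ)
    (ξ₁ ξ₂ : Score d 𝕄) (f₁ f₂ : E d → ℝ) (x : E d) : ℝ :=
  (∫ q : Ω × 𝕄, ξ₁ (x, q.2) (Z (g x) q.1) * ξ₂ (x, q.2) (Z (g x) q.1) ∂(μ.prod Q))
    * (f₁ x * f₂ x * g x)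

/-- The integrand of the second term of the asymptotic covariance; in the first expectation
`q.2.1` is the mark of `x` and `q.2.2` the mark of `x + y`. -/
def sigmaOff (Q : Measure 𝕄) (μ : Measure Ω) (Z : ℝ → Ω → Config d 𝕄) (g : E d → ℝ)
    (ξ₁ ξ₂ : Score d 𝕄) (f₁ f₂ : E d → ℝ) (x y : E d) : ℝ :=
  ((∫ q : Ω × 𝕄 × 𝕄, ξ₁ (x, q.2.1) ((Z (g x) q.1).add (x + y, q.2.2)) *
        ξ₂ (x, q.2.2) (((Z (g x) q.1).add (x, q.2.1)).translate (-y)) ∂(μ.prod (Q.prod Q)))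
      - (∫ q : Ω × 𝕄, ξ₁ (x, q.2) (Z (g x) q.1) ∂(μ.prod Q)) *
        (∫ q : Ω × 𝕄, ξ₂ (x, q.2) ((Z (g x) q.1).translate (-y)) ∂(μ.prod Q)))
    * (f₁ x * f₂ x * g x ^ 2)

/-- The asymptotic covariance `σ_{ij}`. -/
def sigma (Q : Measure 𝕄) (μ : Measure Ω) (Z : ℝ → Ω → Config d 𝕄) (g : E d → ℝ)
    (A₁ A₂ : Set (E d)) (ξ₁ ξ₂ : Score d 𝕄) (f₁ f₂ : E d → ℝ) : ℝ :=
  (∫ x in A₁ ∩ A₂, sigmaDiag Q μ Z g ξ₁ ξ₂ f₁ f₂ x)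
    + ∫ x in A₁ ∩ A₂, ∫ y, sigmaOff Q μ Z g ξ₁ ξ₂ f₁ f₂ x y

end Scores

end StabScores

end

open StabScores

/-! ### Configurations as counting measures; measurability of the operations on them -/

noncomputable section

namespace StabScores

variable {d : ℕ} {𝕄 : Type*}

namespace Config

/-! Let $c_s(x,y)$ be the covariance of the scores at $x$ and $y$, each evaluated with the marked
point of the other added to the input. The Mecke formulas of first and second order write the
covariance of the two statistics as $s\int g f_i f_j\,\mathbb E[\xi_s^{(i)}\xi_s^{(j)}]\,dx +
s^2\iint g(x)g(y)f_i(x)f_j(y)c_s(x,y)\,dx\,dy$ (`IsModel.covariance_statistic`). Dilating the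
homogeneous process of intensity $s g(x)$ by $s^{1/d}$ about $x$ gives the one of intensity $g(x)$,
so $\sigma_{ij}$ has the same shape (`scoreMixed_scale`, `shiftCov_scale`) up to three changes: the
input of intensity $s g$ becomes homogeneous of intensity $s g(x)$; the score at $y=x+w$ becomes the
score at $x$ of the configuration translated by $-w$; the factor $g(y)f_j(y)$ becomes $g(x)f_j(x)$.
Each change has to cost $O(s^{-1/d})$.

The integral over $w$ is controlled by exponential decorrelation (`PairInput.enorm_covar_le`). If
both radii of stabilization are at most $\|x-y\|/3$, the inserted points are irrelevant and the two
scores are functions of the process in disjoint balls, hence independent. The complementary event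
has probability of order $\exp(-cs\|x-y\|^d)$, and Cauchy-Schwarz with fourth moments turns this
into a bound on $c_s$. The change of the second score is handled by the same estimate: the
difference of the two scores is again a stabilizing functional, uniformly bounded by a multiple of
$\|w\|$ (`PairInput.abs_covar_sub_right_le`).

The change of input rests on a coupling. Both inputs, restricted to a ball, are thinnings of one
Poisson process with an additional height coordinate; they differ by points of intensity $|s g(z)-s
g(x)|$, and a differing point at $z$ matters only if a radius of stabilization reaches it. The Mecke
equation turns this into `enorm_integral_sub_le`, and for covariances into
`PairInput.enorm_covar_sub_le`: the change of $c_s$ is at most a constant times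
$\exp(-cs\|x-y\|^d)\int|s g(z)-s g(x)|\exp(-cs\|z-x\|^d)\,dz$.

The Lipschitz conditions make the differences of $g$ and of $g f_j$ of order $\|w\|$, unless the
segment from $x$ to $x+w$ crosses the frontier of $W$ or of $A_j$. In that case $x$ is within
$\|w\|$ of the frontier, and the points of $A_i$ with this property have measure $O(\|w\|)$
(`lintegral_gapIntegrand_le`). After integration over $x$ all errors are thus multiples of $\int
s\|w\|\exp(-cs\|w\|^d)\,dw$, which equals a constant times $s^{-1/d}$ (`kernelMoment_scale`).

Poisson processes enter only through the Mecke equation, which determines the law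
(`IsMecke.map_eq`). Stationarity, scaling, independence over disjoint sets and the coupling are all
obtained by checking the Mecke equation for a transformed process. -/

/-- The spatial positions of the points of a configuration. -/
def proj (S : Config d 𝕄) : Set (E d) := Prod.fst '' S.pts

/-- The points whose norm has integer part `n`. -/
def shell (d : ℕ) (𝕄 : Type*) (n : ℕ) : Set (E d × 𝕄) := {p | ⌊‖p.1‖⌋₊ = n}

open Classical in
/-- Adds the point `p` unless its position is already occupied. -/
def ins (S : Config d 𝕄) (p : E d × 𝕄) : Config d 𝕄 := if p.1 ∈ S.proj then S else S.add p

lemma addFinset_pts (S : Config d 𝕄) (F : Finset (E d × 𝕄)) :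
    (S.addFinset F).pts = S.pts ∪ ↑F := rfl

lemma add_pts (S : Config d 𝕄) (p : E d × 𝕄) : (S.add p).pts = insert p S.pts := by
  rw [add, addFinset_pts, Finset.coe_singleton, union_singleton]

lemma inBall_pts (S : Config d 𝕄) (x : E d) (r : ℝ) :
    (S.inBall x r).pts = S.pts ∩ Metric.closedBall x r ×ˢ univ := rfl

lemma notMem_of_notMem_proj {S : Config d 𝕄} {p : E d × 𝕄} (h : p.1 ∉ S.proj) : p ∉ S.pts :=
  fun hp => h ⟨p, hp, rfl⟩

lemma ins_of_mem {S : Config d 𝕄} {p : E d × 𝕄} (h : p.1 ∈ S.proj) : S.ins p = S := if_pos h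

lemma ins_of_notMem {S : Config d 𝕄} {p : E d × 𝕄} (h : p.1 ∉ S.proj) : S.ins p = S.add p :=
  if_neg h

lemma addFinset_empty (S : Config d 𝕄) : S.addFinset ∅ = S := by
  ext1; simp [addFinset_pts]

lemma shell_bounded (n : ℕ) :
    shell d 𝕄 n ⊆ Metric.closedBall 0 ((n : ℝ) + 1) ×ˢ univ := by
  intro p hp
  simp only [shell, mem_ofPred_eq] at hp
  simp only [mem_prod, mem_univ, and_true, Metric.mem_closedBall, dist_zero_right]
  rw [← hp]
  exact (Nat.lt_floor_add_one _).le

lemma iUnion_shell : ⋃ n, shell d 𝕄 n = univ := by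
  ext p; simp [shell]

lemma pairwise_disjoint_shell : Pairwise (fun k l => Disjoint (shell d 𝕄 k) (shell d 𝕄 l)) := by
  intro k l hkl
  rw [Set.disjoint_left]
  intro p hp hp'
  exact hkl (hp.symm.trans hp')

lemma finite_inter_shell (S : Config d 𝕄) (n : ℕ) : (S.pts ∩ shell d 𝕄 n).Finite :=
  (S.locFin _ Metric.isBounded_closedBall).subset
    (inter_subset_inter_right _ (shell_bounded n))

lemma translate_injective (y : E d) :
    Function.Injective (fun p : E d × 𝕄 => (p.1 + y, p.2)) := by
  intro p q h
  simp only [Prod.mk.injEq, add_left_inj] at h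
  exact Prod.ext h.1 h.2

lemma dilate_injective (x : E d) {a : ℝ} (ha : 0 < a) :
    Function.Injective (fun p : E d × 𝕄 => (x + a • (p.1 - x), p.2)) := by
  intro p q h
  simp only [Prod.mk.injEq, add_right_inj] at h
  exact Prod.ext (sub_left_injective (smul_right_injective _ ha.ne' h.1)) h.2

lemma dilate_pts (S : Config d 𝕄) (x : E d) {a : ℝ} (ha : 0 < a) :
    (S.dilate x a).pts = (fun p : E d × 𝕄 => (x + a • (p.1 - x), p.2)) '' S.pts := by
  ext q
  simp only [dilate, ha, true_and, mem_ofPred_eq, mem_image]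
  exact ⟨fun ⟨p, hp, h⟩ => ⟨p, hp, h.symm⟩, fun ⟨p, hp, h⟩ => ⟨p, hp, h.symm⟩⟩

variable [MeasurableSpace 𝕄]

lemma measurableSet_shell (n : ℕ) : MeasurableSet (shell d 𝕄 n) := by
  have : Measurable (fun p : E d × 𝕄 => ⌊‖p.1‖⌋₊) := by fun_prop
  exact this (measurableSet_singleton n)

/-- The counting measure of a configuration. -/
def toMeasure (S : Config d 𝕄) : Measure (E d × 𝕄) :=
  Measure.sum fun p : S.pts => Measure.dirac p.1

lemma lintegral_toMeasure (S : Config d 𝕄) {F : E d × 𝕄 → ℝ≥0∞} (hF : Measurable F) :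
    ∫⁻ p, F p ∂S.toMeasure = ∑' p : S.pts, F p := by
  rw [toMeasure, lintegral_sum_measure]
  exact tsum_congr fun p => lintegral_dirac' _ hF

lemma toMeasure_apply (S : Config d 𝕄) {B : Set (E d × 𝕄)} (hB : MeasurableSet B) :
    S.toMeasure B = (S.count B : ℝ≥0∞) := by
  rw [← lintegral_indicator_one hB, S.lintegral_toMeasure (measurable_one.indicator hB),
    tsum_subtype S.pts (B.indicator 1), count, ← ENNReal.tsum_set_one,
    tsum_subtype (S.pts ∩ B) (fun _ => (1 : ℝ≥0∞))]
  refine tsum_congr fun p => ?_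
  rw [indicator_indicator]; rfl

lemma measurable_count {B : Set (E d × 𝕄)} (hB : MeasurableSet B) :
    Measurable (fun S : Config d 𝕄 => S.count B) := by
  have h : MeasurableSpace.comap (fun S : Config d 𝕄 => S.count B) inferInstance ≤
      (instMeasurableSpace : MeasurableSpace (Config d 𝕄)) :=
    le_iSup (fun B : {B : Set (E d × 𝕄) // MeasurableSet B} =>
      MeasurableSpace.comap (fun S : Config d 𝕄 => S.count B.1) inferInstance) ⟨B, hB⟩
  exact measurable_iff_comap_le.2 h

lemma measurable_of_count {α : Type*} [MeasurableSpace α] {X : α → Config d 𝕄}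
    (h : ∀ B, MeasurableSet B → Measurable fun a => (X a).count B) : Measurable X := by
  refine measurable_iff_comap_le.2 ?_
  rw [instMeasurableSpace, MeasurableSpace.comap_iSup]
  refine iSup_le fun B => ?_
  rw [MeasurableSpace.comap_comp]
  exact measurable_iff_comap_le.1 (h B.1 B.2)

lemma measurable_of_toMeasure {α : Type*} [MeasurableSpace α] {X : α → Config d 𝕄}
    (h : ∀ B, MeasurableSet B → Measurable fun a => (X a).toMeasure B) : Measurable X := by
  refine measurable_of_count fun B hB => ENat.measurable_iff.2 fun n => ?_
  have : (fun a => (X a).count B) ⁻¹' {(n : ℕ∞)} =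
      (fun a => (X a).toMeasure B) ⁻¹' {((n : ℕ∞) : ℝ≥0∞)} := by
    ext a
    simp only [mem_preimage, mem_singleton_iff, toMeasure_apply _ hB]
    exact ENat.toENNReal_inj.symm
  rw [this]
  exact h B hB (measurableSet_singleton _)

/-- The counting measures as a kernel. -/
def kern (d : ℕ) (𝕄 : Type*) [MeasurableSpace 𝕄] : Kernel (Config d 𝕄) (E d × 𝕄) where
  toFun := toMeasure
  measurable' := by
    refine Measure.measurable_of_measurable_coe _ fun B hB => ?_
    simp_rw [toMeasure_apply _ hB]
    exact (measurable_of_countable (fun n : ℕ∞ => (n : ℝ≥0∞))).comp (measurable_count hB)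

lemma kern_apply (S : Config d 𝕄) : kern d 𝕄 S = S.toMeasure := rfl

lemma measurableSet_count_eq {B : Set (E d × 𝕄)} (hB : MeasurableSet B) (k : ℕ∞) :
    MeasurableSet {S : Config d 𝕄 | S.count B = k} :=
  measurable_count hB (measurableSet_singleton k)

open Classical in
-- A configuration has finitely many points in each shell, but their number is not bounded uniformly
-- over configurations. The kernel is therefore cut both by the shell and by the exact number of
-- points there; each piece has mass at most this number.
instance : IsSFiniteKernel (kern d 𝕄) := by
  let κ : ℕ × ℕ → Kernel (Config d 𝕄) (E d × 𝕄) := fun a =>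
    Kernel.piecewise (measurableSet_count_eq (measurableSet_shell a.1) (a.2 : ℕ∞))
      ((kern d 𝕄).restrict (measurableSet_shell a.1)) 0
  have hκ : ∀ a, IsFiniteKernel (κ a) := by
    intro a
    refine ⟨⟨(a.2 : ℝ≥0∞), ENNReal.natCast_lt_top _, fun S => ?_⟩⟩
    simp only [κ, Kernel.piecewise_apply']
    split_ifs with h
    · rw [Kernel.restrict_apply, Measure.restrict_apply_univ, kern_apply,
        toMeasure_apply _ (measurableSet_shell a.1)]
      simp only [mem_ofPred_eq] at h
      rw [h]; simp
    · simp
  have hsum : kern d 𝕄 = Kernel.sum κ := by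
    ext S B hB
    rw [Kernel.sum_apply' _ _ hB, ENNReal.tsum_prod']
    have hn : ∀ n, ∑' k, κ (n, k) S B = S.toMeasure (B ∩ shell d 𝕄 n) := by
      intro n
      obtain ⟨k, hk⟩ : ∃ k : ℕ, S.count (shell d 𝕄 n) = k := by
        have := (S.finite_inter_shell n)
        exact ⟨_, (Set.Finite.cast_ncard_eq this).symm⟩
      rw [tsum_eq_single k]
      · simp only [κ, Kernel.piecewise_apply']
        rw [if_pos (by simpa using hk), Kernel.restrict_apply, Measure.restrict_apply hB,
          kern_apply]
      · intro k' hk'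
        simp only [κ, Kernel.piecewise_apply']
        rw [if_neg]
        · simp
        · simp only [mem_ofPred_eq, hk]
          exact_mod_cast hk'.symm
    simp_rw [hn]
    rw [kern_apply, ← measure_iUnion _ (fun n => hB.inter (measurableSet_shell n)),
      ← inter_iUnion, iUnion_shell, inter_univ]
    intro k l hkl
    exact (pairwise_disjoint_shell hkl).mono inter_subset_right inter_subset_right
  rw [hsum]
  infer_instance

lemma measurable_lintegral {α : Type*} [MeasurableSpace α] {X : α → Config d 𝕄}
    (hX : Measurable X) {F : α → E d × 𝕄 → ℝ≥0∞} (hF : Measurable (Function.uncurry F)) :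
    Measurable fun a => ∫⁻ p, F a p ∂(X a).toMeasure := by
  have h := Measurable.lintegral_kernel_prod_right (κ := (kern d 𝕄).comap X hX) hF
  simpa [Kernel.comap_apply, kern_apply] using h

/-- The measure of a configuration obtained by mapping part of the points injectively. -/
lemma lintegral_of_image {𝕄' : Type*} [MeasurableSpace 𝕄'] {S : Config d 𝕄} {T : Config d 𝕄'}
    {φ : E d × 𝕄 → E d × 𝕄'} {D : Set (E d × 𝕄)} (hφ : Measurable φ) (hD : MeasurableSet D)
    (hinj : InjOn φ (S.pts ∩ D)) (hT : T.pts = φ '' (S.pts ∩ D))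
    {F : E d × 𝕄' → ℝ≥0∞} (hF : Measurable F) :
    ∫⁻ q, F q ∂T.toMeasure = ∫⁻ p, D.indicator (fun p => F (φ p)) p ∂S.toMeasure := by
  have hm : Measurable fun p => F (φ p) := hF.comp hφ
  rw [lintegral_toMeasure _ hF, lintegral_toMeasure _ (hm.indicator hD), hT,
    tsum_image F hinj, tsum_subtype (S.pts ∩ D) (fun p => F (φ p)),
    tsum_subtype S.pts (D.indicator fun p => F (φ p))]
  refine tsum_congr fun p => ?_
  rw [indicator_indicator]

lemma lintegral_add {S : Config d 𝕄} {p : E d × 𝕄} (hp : p ∉ S.pts) {F : E d × 𝕄 → ℝ≥0∞}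
    (hF : Measurable F) :
    ∫⁻ q, F q ∂(S.add p).toMeasure = F p + ∫⁻ q, F q ∂S.toMeasure := by
  rw [lintegral_toMeasure _ hF, lintegral_toMeasure _ hF, add_pts, insert_eq,
    Summable.tsum_union_disjoint (by simpa using hp) ENNReal.summable ENNReal.summable]
  congr 1
  exact tsum_singleton p F

lemma measurableSet_mem_proj {α : Type*} [MeasurableSpace α] {X : α → Config d 𝕄} {x : α → E d}
    (hX : Measurable X) (hx : Measurable x) : MeasurableSet {a | x a ∈ (X a).proj} := by
  have hm : MeasurableSet {q : α × E d × 𝕄 | q.2.1 = x q.1} :=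
    measurableSet_eq_fun (by fun_prop) (by fun_prop)
  have h1 := measurable_lintegral hX (F := fun a p => {q : α × E d × 𝕄 | q.2.1 = x q.1}.indicator 1
    (a, p)) (measurable_one.indicator hm)
  have : {a | x a ∈ (X a).proj} =
      {a | (∫⁻ p, {q : α × E d × 𝕄 | q.2.1 = x q.1}.indicator 1 (a, p) ∂(X a).toMeasure) ≠ 0} := by
    ext a
    have hF : Measurable fun p : E d × 𝕄 =>
        ({q : α × E d × 𝕄 | q.2.1 = x q.1}.indicator 1 (a, p) : ℝ≥0∞) :=
      (measurable_one.indicator hm).comp measurable_prodMk_left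
    simp only [mem_ofPred_eq, lintegral_toMeasure _ hF, ne_eq, ENNReal.tsum_eq_zero, not_forall,
      proj, mem_image, Subtype.exists]
    constructor
    · rintro ⟨p, hp, hpx⟩
      exact ⟨p, hp, by simp [hpx]⟩
    · rintro ⟨p, hp, hpx⟩
      refine ⟨p, hp, ?_⟩
      by_contra hne
      exact hpx (by simp [hne])
  rw [this]
  exact h1 (measurableSet_singleton 0).compl

/-- The σ-field on the marks is arbitrary, so whether the marked point already belongs to the
configuration need not be a measurable question. Whether its position is occupied is one, because
the diagonal of `E d` is measurable. This is the reason for working with `ins` instead of `add`; the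
two agree almost surely for the processes considered here. -/
lemma measurable_ins {α : Type*} [MeasurableSpace α] {X : α → Config d 𝕄} {p : α → E d × 𝕄}
    (hX : Measurable X) (hp : Measurable p) : Measurable fun a => (X a).ins (p a) := by
  classical
  refine measurable_of_toMeasure fun B hB => ?_
  have hP := measurableSet_mem_proj hX (x := fun a => (p a).1) (by fun_prop)
  have : (fun a => ((X a).ins (p a)).toMeasure B) = fun a =>
      (X a).toMeasure B + {a | (p a).1 ∈ (X a).proj}ᶜ.indicator (fun a => B.indicator 1 (p a)) a := by
    ext a
    by_cases h : (p a).1 ∈ (X a).proj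
    · simp [ins_of_mem h, h]
    · rw [ins_of_notMem h, ← lintegral_indicator_one hB,
        lintegral_add (notMem_of_notMem_proj h) (measurable_one.indicator hB),
        lintegral_indicator_one hB, add_comm]
      congr 1
      simp [h]
  rw [this]
  refine Measurable.add (((kern d 𝕄).measurable_coe hB).comp hX) ?_
  exact ((measurable_one.indicator hB).comp hp).indicator hP.compl

/-- Injectivity makes the counting measure of the image a pushforward, so that counts become
integrals against the original counting measure. Translation, dilation, restriction and thinning are
all instances. -/
lemma measurable_of_image {𝕄' α : Type*} [MeasurableSpace 𝕄'] [MeasurableSpace α]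
    {X : α → Config d 𝕄} (hX : Measurable X) {T : α → Config d 𝕄'}
    {φ : α → E d × 𝕄 → E d × 𝕄'} {D : Set (α × E d × 𝕄)}
    (hφ : Measurable (Function.uncurry φ)) (hD : MeasurableSet D)
    (hinj : ∀ a, InjOn (φ a) ((X a).pts ∩ {p | (a, p) ∈ D}))
    (hT : ∀ a, (T a).pts = φ a '' ((X a).pts ∩ {p | (a, p) ∈ D})) : Measurable T := by
  refine measurable_of_toMeasure fun B hB => ?_
  have hDa : ∀ a, MeasurableSet {p | (a, p) ∈ D} := fun a => measurable_prodMk_left hD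
  have hφa : ∀ a, Measurable (φ a) := fun a => hφ.comp measurable_prodMk_left
  have : (fun a => (T a).toMeasure B) = fun a => ∫⁻ p,
      D.indicator (fun q => B.indicator 1 (φ q.1 q.2)) (a, p) ∂(X a).toMeasure := by
    ext a
    rw [← lintegral_indicator_one hB, lintegral_of_image (hφa a) (hDa a) (hinj a) (hT a)
      (measurable_one.indicator hB)]
    rfl
  rw [this]
  exact measurable_lintegral hX (F := fun a p => D.indicator
    (fun q => B.indicator 1 (φ q.1 q.2)) (a, p)) (((measurable_one.indicator hB).comp hφ).indicator hD)

lemma measurable_translate {α : Type*} [MeasurableSpace α] {X : α → Config d 𝕄} {y : α → E d}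
    (hX : Measurable X) (hy : Measurable y) : Measurable fun a => (X a).translate (y a) := by
  refine measurable_of_image hX (φ := fun a p => (p.1 + y a, p.2)) (D := univ) (by fun_prop)
    MeasurableSet.univ (fun a => (translate_injective _).injOn) (fun a => ?_)
  simp [translate]

lemma measurable_dilate {α : Type*} [MeasurableSpace α] {X : α → Config d 𝕄} {x : α → E d}
    {a : α → ℝ} (hX : Measurable X) (hx : Measurable x) (ha : Measurable a) :
    Measurable fun t => (X t).dilate (x t) (a t) := by
  have hset : MeasurableSet {t | 0 < a t} := measurableSet_lt measurable_const ha
  -- For a nonpositive factor the dilated configuration is empty by definition; the set `D` then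
  -- selects no point at all.
  refine measurable_of_image hX (φ := fun t p => (x t + a t • (p.1 - x t), p.2))
    (D := {q | 0 < a q.1}) (by fun_prop) (hset.preimage measurable_fst) (fun t => ?_) (fun t => ?_)
  · by_cases h : 0 < a t
    · exact (dilate_injective _ h).injOn
    · simp [h]
  · by_cases h : 0 < a t
    · simp [h, dilate_pts]
    · simp [h, dilate]

end Config

end StabScores

end

/-! ### Laws of random configurations: cell counts and the Mecke equation -/

noncomputable section

namespace StabScores

variable {d : ℕ} {𝕄 : Type*}

namespace Config

lemma count_ne_top (S : Config d 𝕄) {B : Set (E d × 𝕄)} {r : ℝ}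
    (hB : B ⊆ Metric.closedBall 0 r ×ˢ univ) : S.count B ≠ ⊤ := by
  rw [count, Set.encard_ne_top_iff]
  exact (S.locFin _ Metric.isBounded_closedBall).subset (inter_subset_inter_right _ hB)

variable [MeasurableSpace 𝕄]

/-- A finite disjoint family of bounded measurable sets. -/
structure IsGrid {ι : Type*} (B : ι → Set (E d × 𝕄)) : Prop where
  meas : ∀ i, MeasurableSet (B i)
  bdd : ∀ i, ∃ r : ℝ, B i ⊆ Metric.closedBall 0 r ×ˢ univ
  disj : Pairwise fun i j => Disjoint (B i) (B j)

/-- Configurations with prescribed numbers of points in the sets of a family. -/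
def cellEvent {ι : Type*} (B : ι → Set (E d × 𝕄)) (k : ι → ℕ) : Set (Config d 𝕄) :=
  {S | ∀ l, S.count (B l) = k l}

lemma measurableSet_cellEvent {ι : Type*} [Countable ι] {B : ι → Set (E d × 𝕄)} (hB : IsGrid B)
    (k : ι → ℕ) : MeasurableSet (cellEvent B k) := by
  have : cellEvent B k = ⋂ l, {S : Config d 𝕄 | S.count (B l) = k l} := by
    ext S; simp [cellEvent]
  rw [this]
  exact MeasurableSet.iInter fun l => measurableSet_count_eq (hB.meas l) _

lemma count_biUnion (S : Config d 𝕄) {ι : Type*} {B : ι → Set (E d × 𝕄)} (hB : IsGrid B)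
    (I : Finset ι) : S.count (⋃ i ∈ I, B i) = ∑ i ∈ I, S.count (B i) := by
  have h := measure_biUnion_finset (μ := S.toMeasure) (s := I) (f := B)
    (fun i _ j _ hij => hB.disj hij) (fun i _ => hB.meas i)
  rw [toMeasure_apply _ (Finset.measurableSet_biUnion _ fun i _ => hB.meas i)] at h
  simp_rw [toMeasure_apply _ (hB.meas _)] at h
  apply ENat.toENNReal_inj.1
  rw [h]
  exact (map_sum ENat.toENNRealRingHom _ _).symm

/-- The cells are the intersections and the two kinds of differences; the index `none` stands for
the part outside all sets of the respective family. The cell outside both families is replaced by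
the empty set, which keeps all cells bounded. -/
lemma IsGrid.refine {ι ι' : Type} [Fintype ι] [Fintype ι'] {B : ι → Set (E d × 𝕄)}
    {B' : ι' → Set (E d × 𝕄)} (hB : IsGrid B) (hB' : IsGrid B') :
    ∃ (κ : Type) (_ : Fintype κ) (C : κ → Set (E d × 𝕄)) (I : ι → Finset κ) (I' : ι' → Finset κ),
      IsGrid C ∧ (∀ i, B i = ⋃ k ∈ I i, C k) ∧ ∀ i, B' i = ⋃ k ∈ I' i, C k := by
  classical
  let C : Option ι × Option ι' → Set (E d × 𝕄)
    | (some i, some j) => B i ∩ B' j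
    | (some i, none) => B i \ ⋃ j, B' j
    | (none, some j) => B' j \ ⋃ i, B i
    | (none, none) => ∅
  have hd := fun i j (h : i ≠ j) x (h1 : x ∈ B i) (h2 : x ∈ B j) =>
    Set.disjoint_left.1 (hB.disj h) h1 h2
  have hd' := fun i j (h : i ≠ j) x (h1 : x ∈ B' i) (h2 : x ∈ B' j) =>
    Set.disjoint_left.1 (hB'.disj h) h1 h2
  refine ⟨Option ι × Option ι', inferInstance, C,
    fun i => Finset.univ.filter (fun k => k.1 = some i),
    fun j => Finset.univ.filter (fun k => k.2 = some j), ⟨?_, ?_, ?_⟩, ?_, ?_⟩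
  · rintro ⟨_ | i, _ | j⟩
    · exact MeasurableSet.empty
    · exact (hB'.meas j).diff (MeasurableSet.iUnion hB.meas)
    · exact (hB.meas i).diff (MeasurableSet.iUnion hB'.meas)
    · exact (hB.meas i).inter (hB'.meas j)
  · rintro ⟨_ | i, _ | j⟩
    · exact ⟨0, empty_subset _⟩
    · exact (hB'.bdd j).imp fun r hr => sdiff_subset.trans hr
    · exact (hB.bdd i).imp fun r hr => sdiff_subset.trans hr
    · exact (hB.bdd i).imp fun r hr => inter_subset_left.trans hr
  · rintro ⟨_ | i, _ | j⟩ ⟨_ | i', _ | j'⟩ h <;> rw [Set.disjoint_left] <;> intro x hx hx' <;>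
      simp only [C, mem_inter_iff, Set.mem_sdiff, mem_iUnion, not_exists, mem_empty_iff_false] at hx hx'
    all_goals grind
  · intro i
    ext x
    simp only [Finset.mem_filter, Finset.mem_univ, true_and, mem_iUnion, exists_prop, Prod.exists]
    constructor
    · intro hx
      by_cases hj : ∃ j, x ∈ B' j
      · obtain ⟨j, hj⟩ := hj
        exact ⟨some i, some j, rfl, hx, hj⟩
      · exact ⟨some i, none, rfl, hx, by simpa using hj⟩
    · rintro ⟨_, _ | j, rfl, hx⟩
      · exact hx.1
      · exact hx.1
  · intro j
    ext x
    simp only [Finset.mem_filter, Finset.mem_univ, true_and, mem_iUnion, exists_prop, Prod.exists]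
    constructor
    · intro hx
      by_cases hj : ∃ j, x ∈ B j
      · obtain ⟨i, hj⟩ := hj
        exact ⟨some i, some j, rfl, hj, hx⟩
      · exact ⟨none, some j, rfl, hx, by simpa using hj⟩
    · rintro ⟨_ | i, _, rfl, hx⟩
      · exact hx.1
      · exact hx.2

lemma measurable_of_count_bdd {α : Type*} [MeasurableSpace α] {X : α → Config d 𝕄}
    (h : ∀ B, MeasurableSet B → (∃ r : ℝ, B ⊆ Metric.closedBall 0 r ×ˢ univ) →
      Measurable fun a => (X a).count B) : Measurable X := by
  refine measurable_of_toMeasure fun B hB => ?_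
  have : (fun a => (X a).toMeasure B) =
      fun a => ∑' n, (((X a).count (B ∩ shell d 𝕄 n) : ℕ∞) : ℝ≥0∞) := by
    ext a
    simp_rw [← toMeasure_apply _ (hB.inter (measurableSet_shell _))]
    rw [← measure_iUnion _ (fun n => hB.inter (measurableSet_shell n)),
      ← inter_iUnion, iUnion_shell, inter_univ]
    intro k l hkl
    exact (pairwise_disjoint_shell hkl).mono inter_subset_right inter_subset_right
  rw [this]
  refine Measurable.tsum fun n => ?_
  exact (measurable_of_countable (fun n : ℕ∞ => (n : ℝ≥0∞))).comp
    (h _ (hB.inter (measurableSet_shell n)) ⟨_, inter_subset_right.trans (shell_bounded n)⟩)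

/-- Events determined by the numbers of points in the sets of a grid. -/
def cylinders (d : ℕ) (𝕄 : Type*) [MeasurableSpace 𝕄] : Set (Set (Config d 𝕄)) :=
  {C | ∃ (ι : Type) (_ : Fintype ι) (B : ι → Set (E d × 𝕄)) (T : Set (ι → ℕ∞)),
    IsGrid B ∧ C = {S | (fun i => S.count (B i)) ∈ T}}

/-- Over a common refinement both events depend on the counts of a single grid. -/
lemma isPiSystem_cylinders : IsPiSystem (cylinders d 𝕄) := by
  rintro _ ⟨ι, _, B, T, hB, rfl⟩ _ ⟨ι', _, B', T', hB', rfl⟩ -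
  obtain ⟨κ, _, C, I, I', hC, hI, hI'⟩ := hB.refine hB'
  refine ⟨κ, inferInstance, C, {v | (fun i => ∑ k ∈ I i, v k) ∈ T ∧
    (fun i => ∑ k ∈ I' i, v k) ∈ T'}, hC, ?_⟩
  ext S
  simp only [mem_inter_iff, mem_ofPred_eq, hI, hI', count_biUnion S hC]

lemma generateFrom_cylinders :
    (instMeasurableSpace : MeasurableSpace (Config d 𝕄)) =
      MeasurableSpace.generateFrom (cylinders d 𝕄) := by
  apply le_antisymm
  · have h := @measurable_of_count_bdd d 𝕄 _ (Config d 𝕄)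
      (MeasurableSpace.generateFrom (cylinders d 𝕄)) id ?_
    · intro s hs
      exact h hs
    · intro B hB hr
      refine @ENat.measurable_iff _ (MeasurableSpace.generateFrom (cylinders d 𝕄)) _ |>.2 fun n => ?_
      apply MeasurableSpace.measurableSet_generateFrom
      refine ⟨Unit, inferInstance, fun _ => B, {v | v () = n}, ⟨fun _ => hB, fun _ => hr, ?_⟩, rfl⟩
      intro i j hij
      exact absurd (Subsingleton.elim i j) hij
  · refine MeasurableSpace.generateFrom_le ?_
    rintro _ ⟨ι, _, B, T, hB, rfl⟩
    have : Measurable fun S : Config d 𝕄 => fun i => S.count (B i) :=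
      measurable_pi_lambda _ fun i => measurable_count (hB.meas i)
    exact this (Set.to_countable T).measurableSet

/-- Every cylinder is a countable disjoint union of cell events, since counts in bounded sets are
finite. It suffices to test grids in which `B₀` is a union of cells; this freedom is needed for
measures weighted by the number of points in `B₀`, which is then constant on each cell event. -/
lemma measure_ext_of_cellEvent {ν₁ ν₂ : Measure (Config d 𝕄)} [IsFiniteMeasure ν₁]
    {B₀ : Set (E d × 𝕄)} (hB₀ : MeasurableSet B₀)
    (hr : ∃ r : ℝ, B₀ ⊆ Metric.closedBall 0 r ×ˢ univ)
    (h : ∀ (κ : Type) (_ : Fintype κ) (C : κ → Set (E d × 𝕄)) (I : Finset κ), IsGrid C →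
      B₀ = ⋃ k ∈ I, C k → ∀ k, ν₁ (cellEvent C k) = ν₂ (cellEvent C k)) : ν₁ = ν₂ := by
  have key : ∀ s ∈ cylinders d 𝕄, ν₁ s = ν₂ s := by
    rintro _ ⟨ι, _, B, T, hB, rfl⟩
    have hg : IsGrid (fun _ : Unit => B₀) := ⟨fun _ => hB₀, fun _ => hr, fun i j hij =>
      absurd (Subsingleton.elim i j) hij⟩
    obtain ⟨κ, _, C, I, I', hC, hI, hI'⟩ := hB.refine hg
    have hset : {S : Config d 𝕄 | (fun i => S.count (B i)) ∈ T} =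
        ⋃ k ∈ {k : κ → ℕ | (fun i => ∑ l ∈ I i, (k l : ℕ∞)) ∈ T}, cellEvent C k := by
      ext S
      simp only [mem_ofPred_eq, mem_iUnion, exists_prop, hI, count_biUnion S hC, cellEvent]
      constructor
      · intro hS
        refine ⟨fun l => (S.count (C l)).toNat, ?_, fun l => ?_⟩
        · convert hS using 3 with i l
          obtain ⟨r, hr⟩ := hC.bdd l
          exact ENat.natCast_toNat (S.count_ne_top hr)
        · obtain ⟨r, hr⟩ := hC.bdd l
          exact (ENat.natCast_toNat (S.count_ne_top hr)).symm
      · rintro ⟨k, hk, hS⟩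
        simpa only [hS] using hk
    have hdis : ({k : κ → ℕ | (fun i => ∑ l ∈ I i, (k l : ℕ∞)) ∈ T}).PairwiseDisjoint
        (cellEvent C) := by
      intro k _ k' _ hkk
      refine Set.disjoint_left.2 fun S hS hS' => hkk ?_
      ext l
      have := (hS l).symm.trans (hS' l)
      exact_mod_cast this
    rw [hset, measure_biUnion (Set.to_countable _) hdis
        (fun k _ => measurableSet_cellEvent hC k),
      measure_biUnion (Set.to_countable _) hdis (fun k _ => measurableSet_cellEvent hC k)]
    exact tsum_congr fun k => h κ inferInstance C (I' ()) hC (hI' ()) k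
  refine ext_of_generate_finite _ generateFrom_cylinders isPiSystem_cylinders key ?_
  -- The whole space is the cylinder over the empty family, so the total masses agree as well.
  apply key
  refine ⟨Empty, inferInstance, fun i => i.elim, univ, ⟨fun i => i.elim, fun i => i.elim,
    fun i => i.elim⟩, ?_⟩
  simp

end Config

variable [MeasurableSpace 𝕄]

/-- `Λ` is finite on bounded sets. -/
def LocallyFinite (Λ : Measure (E d × 𝕄)) : Prop :=
  ∀ r : ℝ, Λ (Metric.closedBall 0 r ×ˢ univ) ≠ ∞

variable {Ω : Type*} [MeasurableSpace Ω]

/-- The Mecke equation for a random configuration without fixed points. -/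
structure IsMecke (μ : Measure Ω) (X : Ω → Config d 𝕄) (Λ : Measure (E d × 𝕄)) : Prop where
  measurable : Measurable X
  noAtom : ∀ x : E d, ∀ᵐ ω ∂μ, x ∉ (X ω).proj
  mecke : ∀ F : (E d × 𝕄) × Config d 𝕄 → ℝ≥0∞, Measurable F →
    ∫⁻ ω, ∫⁻ p, F (p, X ω) ∂(X ω).toMeasure ∂μ = ∫⁻ p, ∫⁻ ω, F (p, (X ω).ins p) ∂μ ∂Λ

/-- The recursion satisfied by the joint distribution of the numbers of points. -/
def CellRecursion (μ : Measure Ω) (X : Ω → Config d 𝕄) (Λ : Measure (E d × 𝕄)) : Prop :=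
  ∀ (κ : Type) (_ : Fintype κ) (_ : DecidableEq κ) (C : κ → Set (E d × 𝕄)), Config.IsGrid C →
    ∀ (l : κ) (k : κ → ℕ),
      ((k l + 1 : ℕ) : ℝ≥0∞) * μ (X ⁻¹' Config.cellEvent C (Function.update k l (k l + 1))) =
        Λ (C l) * μ (X ⁻¹' Config.cellEvent C k)

open Config

lemma count_add_mem {S : Config d 𝕄} {p : E d × 𝕄} {B : Set (E d × 𝕄)} (hB : MeasurableSet B)
    (hp : p ∉ S.pts) : (S.add p).count B = S.count B + B.indicator 1 p := by
  apply ENat.toENNReal_inj.1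
  rw [← toMeasure_apply _ hB, ← lintegral_indicator_one hB,
    lintegral_add hp (measurable_one.indicator hB), lintegral_indicator_one hB, add_comm,
    toMeasure_apply _ hB]
  by_cases h : p ∈ B <;> simp [h]

lemma add_mem_cellEvent {κ : Type*} [DecidableEq κ] {C : κ → Set (E d × 𝕄)} (hC : IsGrid C)
    {l : κ} {p : E d × 𝕄} (hp : p ∈ C l) {S : Config d 𝕄} (hS : p ∉ S.pts) (k : κ → ℕ) :
    S.add p ∈ cellEvent C (Function.update k l (k l + 1)) ↔ S ∈ cellEvent C k := by
  simp only [cellEvent, mem_ofPred_eq]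
  refine forall_congr' fun j => ?_
  rw [count_add_mem (hC.meas j) hS]
  by_cases hj : j = l
  · subst hj
    simp only [hp, indicator_of_mem, Pi.one_apply, Function.update_self, Nat.cast_add, Nat.cast_one]
    exact ENat.add_left_injective_of_ne_top (by simp) |>.eq_iff
  · have : p ∉ C j := fun h => Set.disjoint_left.1 (hC.disj hj) h hp
    simp [this, hj]

lemma add_notMem_cellEvent {κ : Type*} {C : κ → Set (E d × 𝕄)} (hC : IsGrid C)
    {l : κ} {p : E d × 𝕄} (hp : p ∈ C l) {S : Config d 𝕄} (hS : p ∉ S.pts) {k : κ → ℕ}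
    (hk : k l = 0) : S.add p ∉ cellEvent C k := by
  intro h
  have := h l
  rw [count_add_mem (hC.meas l) hS, hk] at this
  simp [hp] at this

/-- The Mecke equation is applied to the indicator that the point lies in the cell `C l` and the
counts are `k` raised by one at `l`. Summing over the points produces the factor `k l + 1`;
inserting a point of `C l` brings the count vector from `k` to the raised one. -/
lemma IsMecke.cellRecursion {μ : Measure Ω} {X : Ω → Config d 𝕄} {Λ : Measure (E d × 𝕄)}
    (hX : IsMecke μ X Λ) : CellRecursion μ X Λ := by
  intro κ _ _ C hC l k
  set k' := Function.update k l (k l + 1) with hk'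
  have hm := measurableSet_cellEvent hC k'
  have h := hX.mecke (fun q => (C l).indicator 1 q.1 * (cellEvent C k').indicator 1 q.2)
    (((measurable_one.indicator (hC.meas l)).comp measurable_fst).mul
      ((measurable_one.indicator hm).comp measurable_snd))
  have h1 : ∀ ω, ∫⁻ p, (C l).indicator 1 p * (cellEvent C k').indicator 1 (X ω) ∂(X ω).toMeasure =
      (X ⁻¹' cellEvent C k').indicator (fun _ => ((k l + 1 : ℕ) : ℝ≥0∞)) ω := by
    intro ω
    rw [lintegral_mul_const _ (measurable_one.indicator (hC.meas l)),
      lintegral_indicator_one (hC.meas l), toMeasure_apply _ (hC.meas l)]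
    by_cases hω : X ω ∈ cellEvent C k'
    · rw [hω l, indicator_of_mem hω, indicator_of_mem (mem_preimage.2 hω)]
      simp [hk']
    · simp [hω]
  have h2 : ∀ p, ∫⁻ ω, (C l).indicator 1 p * (cellEvent C k').indicator 1 ((X ω).ins p) ∂μ =
      (C l).indicator (fun _ => μ (X ⁻¹' cellEvent C k)) p := by
    intro p
    by_cases hp : p ∈ C l
    · simp only [hp, indicator_of_mem, Pi.one_apply, one_mul]
      rw [← lintegral_indicator_one (hX.measurable (measurableSet_cellEvent hC k))]
      refine lintegral_congr_ae ?_
      filter_upwards [hX.noAtom p.1] with ω hω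
      rw [ins_of_notMem hω]
      by_cases hS : X ω ∈ cellEvent C k
      · rw [indicator_of_mem ((add_mem_cellEvent hC hp (notMem_of_notMem_proj hω) k).2 hS),
          indicator_of_mem (by exact hS)]
        rfl
      · rw [indicator_of_notMem (fun h => hS
          ((add_mem_cellEvent hC hp (notMem_of_notMem_proj hω) k).1 h)),
          indicator_of_notMem (by exact hS)]
    · simp [hp]
  simp only [h1, h2] at h
  rw [lintegral_indicator_const (hX.measurable hm), lintegral_indicator_const (hC.meas l)] at h
  rw [h, mul_comm]

/-- Lowering one count at a time leads to the event that all cells are empty. The distribution of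
the counts is thereby a product of Poisson weights up to one unknown constant, the void probability.
-/
lemma CellRecursion.mul_prod {μ : Measure Ω} {X : Ω → Config d 𝕄} {Λ : Measure (E d × 𝕄)}
    (h : CellRecursion μ X Λ) {κ : Type} [Fintype κ] {C : κ → Set (E d × 𝕄)} (hC : IsGrid C)
    (k : κ → ℕ) : μ (X ⁻¹' cellEvent C k) =
      μ (X ⁻¹' cellEvent C 0) * ∏ l, (Λ (C l) ^ k l * ((k l).factorial : ℝ≥0∞)⁻¹) := by
  classical
  induction hn : ∑ l, k l generalizing k with
  | zero =>
    have : k = 0 := by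
      ext l
      exact (Finset.sum_eq_zero_iff.1 hn) l (Finset.mem_univ l)
    simp [this]
  | succ n ih =>
    obtain ⟨l, hl⟩ : ∃ l, k l ≠ 0 := by
      by_contra! hcon
      simp [hcon] at hn
    obtain ⟨a, ha⟩ := Nat.exists_eq_succ_of_ne_zero hl
    set k' := Function.update k l a with hk'
    have hkk : k = Function.update k' l (k' l + 1) := by
      simp [hk', ← Nat.succ_eq_add_one, ← ha]
    have hsum : ∑ l, k' l = n := by
      rw [hkk, Finset.sum_update_of_mem (Finset.mem_univ l)] at hn
      rw [← Finset.add_sum_erase _ _ (Finset.mem_univ l), Finset.erase_eq]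
      lia
    have hrec := h κ inferInstance inferInstance C hC l k'
    rw [← hkk, ih k' hsum] at hrec
    have h0 : ((k' l + 1 : ℕ) : ℝ≥0∞) ≠ 0 := by simp
    have ht : ((k' l + 1 : ℕ) : ℝ≥0∞) ≠ ∞ := ENNReal.natCast_ne_top _
    have := congrArg (fun t => ((k' l + 1 : ℕ) : ℝ≥0∞)⁻¹ * t) hrec
    rw [← mul_assoc, ENNReal.inv_mul_cancel h0 ht, one_mul] at this
    rw [this]
    have hprod : ∏ j, (Λ (C j) ^ k j * ((k j).factorial : ℝ≥0∞)⁻¹) =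
        (Λ (C l) * ((k' l + 1 : ℕ) : ℝ≥0∞)⁻¹) *
          ∏ j, (Λ (C j) ^ k' j * ((k' j).factorial : ℝ≥0∞)⁻¹) := by
      rw [← Finset.mul_prod_erase _ _ (Finset.mem_univ l),
        ← Finset.mul_prod_erase (a := l) _ (fun j => (Λ (C j) ^ k' j *
          ((k' j).factorial : ℝ≥0∞)⁻¹)) (Finset.mem_univ l), ← mul_assoc]
      congr 1
      · have : k l = k' l + 1 := by simp [hk', ha]
        rw [this, Nat.factorial_succ, pow_succ, Nat.cast_mul,
          ENNReal.mul_inv (Or.inl h0) (Or.inl ht)]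
        ring
      · refine Finset.prod_congr rfl fun j hj => ?_
        have : k' j = k j := by simp [hk', Finset.ne_of_mem_erase hj]
        rw [this]
    rw [hprod]
    ring

lemma sum_cellEvent {μ : Measure Ω} [IsProbabilityMeasure μ] {X : Ω → Config d 𝕄}
    (hX : Measurable X) {κ : Type} [Fintype κ] {C : κ → Set (E d × 𝕄)} (hC : IsGrid C) :
    ∑' k : κ → ℕ, μ (X ⁻¹' cellEvent C k) = 1 := by
  rw [← measure_iUnion]
  · rw [← measure_univ (μ := μ)]
    congr 1
    refine eq_univ_of_forall fun ω => ?_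
    simp only [mem_iUnion, mem_preimage, mem_ofPred_eq, cellEvent]
    refine ⟨fun l => ((X ω).count (C l)).toNat, fun l => ?_⟩
    obtain ⟨r, hr⟩ := hC.bdd l
    exact (ENat.natCast_toNat ((X ω).count_ne_top hr)).symm
  · intro k k' hkk
    refine Set.disjoint_left.2 fun S hS hS' => hkk ?_
    ext l
    have := (hS l).symm.trans (hS' l)
    exact_mod_cast this
  · exact fun k => hX (measurableSet_cellEvent hC k)

/-- The law of a random configuration is determined by the cell recursion. -/
lemma CellRecursion.map_eq {Ω' : Type*} [MeasurableSpace Ω'] {μ : Measure Ω}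
    [IsProbabilityMeasure μ] {μ' : Measure Ω'} [IsProbabilityMeasure μ'] {X : Ω → Config d 𝕄}
    {X' : Ω' → Config d 𝕄} {Λ : Measure (E d × 𝕄)} (h : CellRecursion μ X Λ)
    (h' : CellRecursion μ' X' Λ) (hX : Measurable X) (hX' : Measurable X') :
    μ.map X = μ'.map X' := by
  have := Measure.isProbabilityMeasure_map (μ := μ) hX.aemeasurable
  refine measure_ext_of_cellEvent (B₀ := ∅) MeasurableSet.empty ⟨0, empty_subset _⟩ ?_
  intro κ _ C I hC _ k
  rw [Measure.map_apply hX (measurableSet_cellEvent hC k),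
    Measure.map_apply hX' (measurableSet_cellEvent hC k)]
  change μ (X ⁻¹' cellEvent C k) = μ' (X' ⁻¹' cellEvent C k)
  -- The probabilities of all count vectors add up to one, so the two void probabilities are
  -- inverses of the same series.
  have s := sum_cellEvent (μ := μ) hX hC
  have s' := sum_cellEvent (μ := μ') hX' hC
  rw [tsum_congr (h.mul_prod hC), ENNReal.tsum_mul_left] at s
  rw [tsum_congr (h'.mul_prod hC), ENNReal.tsum_mul_left] at s'
  rw [h.mul_prod hC, h'.mul_prod hC, ENNReal.eq_inv_of_mul_eq_one_left s,
    ENNReal.eq_inv_of_mul_eq_one_left s']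

/-- This is how identities in law are proved throughout: a transformed process is shown to satisfy
the Mecke equation with the desired intensity, and no distribution has to be computed. -/
lemma IsMecke.map_eq {Ω' : Type*} [MeasurableSpace Ω'] {μ : Measure Ω}
    [IsProbabilityMeasure μ] {μ' : Measure Ω'} [IsProbabilityMeasure μ'] {X : Ω → Config d 𝕄}
    {X' : Ω' → Config d 𝕄} {Λ : Measure (E d × 𝕄)} (h : IsMecke μ X Λ)
    (h' : IsMecke μ' X' Λ) : μ.map X = μ'.map X' :=
  h.cellRecursion.map_eq h'.cellRecursion h.measurable h'.measurable

end StabScores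

end

/-! ### The Mecke equation for Poisson processes -/

noncomputable section

namespace StabScores

variable {d : ℕ} {𝕄 : Type*} [MeasurableSpace 𝕄] {Ω : Type*} [MeasurableSpace Ω]

open Config

lemma LocallyFinite.ne_top {Λ : Measure (E d × 𝕄)} (hΛ : LocallyFinite Λ) {B : Set (E d × 𝕄)}
    (hr : ∃ r : ℝ, B ⊆ Metric.closedBall 0 r ×ˢ univ) : Λ B ≠ ∞ := by
  obtain ⟨r, hr⟩ := hr
  exact measure_ne_top_of_subset hr (hΛ r)

/-- The argument of `IsMecke.cellRecursion` read backwards. Inserting a point of the cell is almost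
surely a genuine addition: it can produce the counts `k` only from `k` lowered by one at `l`, and
never if `k l = 0`. -/
lemma CellRecursion.measure_ins {μ : Measure Ω} {X : Ω → Config d 𝕄} {Λ : Measure (E d × 𝕄)}
    (h : CellRecursion μ X Λ) (hX : Measurable X) (hat : ∀ x : E d, ∀ᵐ ω ∂μ, x ∉ (X ω).proj)
    {κ : Type} [Fintype κ] {C : κ → Set (E d × 𝕄)} (hC : IsGrid C) (l : κ) (k : κ → ℕ) :
    ∫⁻ p in C l, μ {ω | (X ω).ins p ∈ cellEvent C k} ∂Λ =
      (k l : ℝ≥0∞) * μ (X ⁻¹' cellEvent C k) := by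
  classical
  rcases Nat.eq_zero_or_eq_succ_pred (k l) with h0 | h1
  · rw [h0, Nat.cast_zero, zero_mul, setLIntegral_congr_fun (g := fun _ => 0) (hC.meas l)]
    · simp
    · intro p hp
      change μ {ω | (X ω).ins p ∈ cellEvent C k} = 0
      rw [← nonpos_iff_eq_zero, ← measure_empty (μ := μ)]
      refine measure_mono_ae ?_
      filter_upwards [hat p.1] with ω hω hmem
      change (X ω).ins p ∈ cellEvent C k at hmem
      rw [ins_of_notMem hω] at hmem
      exact add_notMem_cellEvent hC hp (notMem_of_notMem_proj hω) h0 hmem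
  · set k' := Function.update k l ((k l).pred) with hk'
    have hkk : k = Function.update k' l (k' l + 1) := by
      have : (k l).pred + 1 = k l := by rw [← Nat.succ_eq_add_one]; exact h1.symm
      simp only [hk', Function.update_self, Function.update_idem, this, Function.update_eq_self]
    have hl : k l = k' l + 1 := by rw [hkk]; simp
    rw [setLIntegral_congr_fun (g := fun _ => μ (X ⁻¹' cellEvent C k')) (hC.meas l),
      setLIntegral_const, mul_comm, ← h κ inferInstance inferInstance C hC l k', ← hkk, hl]
    intro p hp
    refine measure_congr ?_
    filter_upwards [hat p.1] with ω hω
    have := add_mem_cellEvent hC hp (notMem_of_notMem_proj hω) k'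
    rw [← hkk] at this
    change ((X ω).ins p ∈ cellEvent C k) = (X ω ∈ cellEvent C k')
    rw [ins_of_notMem hω]
    exact propext this

/-- On a grid whose cells make up `B`, the number of points in `B` is the sum of the prescribed
counts, so both sides split into the one-cell identities of `CellRecursion.measure_ins`. Boundedness
of `B` makes the measures finite, as `measure_ext_of_cellEvent` requires. -/
lemma CellRecursion.campbell {μ : Measure Ω} [IsProbabilityMeasure μ] {X : Ω → Config d 𝕄}
    {Λ : Measure (E d × 𝕄)} [SFinite Λ]
    (h : CellRecursion μ X Λ) (hΛ : LocallyFinite Λ) (hX : Measurable X)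
    (hat : ∀ x : E d, ∀ᵐ ω ∂μ, x ∉ (X ω).proj) {B : Set (E d × 𝕄)} (hB : MeasurableSet B)
    (hr : ∃ r : ℝ, B ⊆ Metric.closedBall 0 r ×ˢ univ) :
    ((Λ.restrict B).prod μ).map (fun q => (X q.2).ins q.1) =
      (μ.withDensity fun ω => (X ω).toMeasure B).map X := by
  have hins : Measurable fun q : (E d × 𝕄) × Ω => (X q.2).ins q.1 :=
    measurable_ins (hX.comp measurable_snd) measurable_fst
  have : IsFiniteMeasure (Λ.restrict B) :=
    ⟨by rw [Measure.restrict_apply_univ]; exact (hΛ.ne_top hr).lt_top⟩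
  refine measure_ext_of_cellEvent hB hr ?_
  intro κ _ C I hC hI k
  have hm := measurableSet_cellEvent hC k
  rw [Measure.map_apply hins hm, Measure.map_apply hX hm, withDensity_apply _ (hX hm),
    Measure.prod_apply (hins hm)]
  have h2 : ∫⁻ ω in X ⁻¹' cellEvent C k, (X ω).toMeasure B ∂μ =
      (∑ l ∈ I, (k l : ℝ≥0∞)) * μ (X ⁻¹' cellEvent C k) := by
    rw [← setLIntegral_const]
    refine setLIntegral_congr_fun (hX hm) fun ω hω => ?_
    change (X ω).toMeasure B = _
    rw [toMeasure_apply _ hB, hI, count_biUnion _ hC, Finset.sum_congr rfl fun l _ => hω l]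
    exact map_sum ENat.toENNRealRingHom _ _
  rw [h2, Finset.sum_mul, hI, lintegral_biUnion_finset (fun i _ j _ hij => hC.disj hij)
    (fun i _ => hC.meas i)]
  exact Finset.sum_congr rfl fun l _ => h.measure_ins hX hat hC l k

/-- The Mecke equation is an equality of two measures on configurations times points. Restricted to
a shell they are finite, hence determined by rectangles, and on rectangles the equality is
`CellRecursion.campbell`. -/
lemma CellRecursion.isMecke {μ : Measure Ω} [IsProbabilityMeasure μ] {X : Ω → Config d 𝕄}
    {Λ : Measure (E d × 𝕄)} [SFinite Λ]
    (h : CellRecursion μ X Λ) (hΛ : LocallyFinite Λ) (hX : Measurable X)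
    (hat : ∀ x : E d, ∀ᵐ ω ∂μ, x ∉ (X ω).proj) : IsMecke μ X Λ := by
  refine ⟨hX, hat, fun F hF => ?_⟩
  have hins : Measurable fun q : (E d × 𝕄) × Ω => (X q.2).ins q.1 :=
    measurable_ins (hX.comp measurable_snd) measurable_fst
  have hins' : Measurable fun q : (E d × 𝕄) × Ω => ((X q.2).ins q.1, q.1) :=
    hins.prodMk measurable_fst
  have := Measure.isProbabilityMeasure_map (μ := μ) hX.aemeasurable
  have key : (Λ.prod μ).map (fun q => ((X q.2).ins q.1, q.1)) = (μ.map X) ⊗ₘ kern d 𝕄 := by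
    rw [← Measure.restrict_univ (μ := (Λ.prod μ).map _), ← Measure.restrict_univ (μ := _ ⊗ₘ _)]
    have hu : (univ : Set (Config d 𝕄 × E d × 𝕄)) = ⋃ n, univ ×ˢ shell d 𝕄 n := by
      rw [← prod_iUnion, iUnion_shell, univ_prod_univ]
    rw [hu, Measure.restrict_iUnion_congr]
    intro n
    have hsh := measurableSet_shell (d := d) (𝕄 := 𝕄) n
    have hrect : ∀ s : Set (Config d 𝕄), ∀ t : Set (E d × 𝕄), MeasurableSet s → MeasurableSet t →
        (((Λ.prod μ).map (fun q => ((X q.2).ins q.1, q.1))).restrict (univ ×ˢ shell d 𝕄 n))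
          (s ×ˢ t) = ((Λ.restrict (t ∩ shell d 𝕄 n)).prod μ).map (fun q => (X q.2).ins q.1) s := by
      intro s t hs ht
      rw [Measure.restrict_apply (hs.prod ht), prod_inter_prod, inter_univ,
        Measure.map_apply hins' (hs.prod (ht.inter hsh)), Measure.map_apply hins hs,
        ← Measure.restrict_univ (μ := μ), Measure.prod_restrict, Measure.restrict_apply (hins hs),
        Measure.restrict_univ]
      congr 1
      ext q
      simp
    have : IsFiniteMeasure
        (((Λ.prod μ).map (fun q => ((X q.2).ins q.1, q.1))).restrict (univ ×ˢ shell d 𝕄 n)) := by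
      refine ⟨?_⟩
      rw [← univ_prod_univ, hrect univ univ MeasurableSet.univ MeasurableSet.univ,
        Measure.map_apply hins MeasurableSet.univ, preimage_univ,
        ← univ_prod_univ (α := E d × 𝕄) (β := Ω),
        Measure.prod_prod, measure_univ (μ := μ), mul_one, Measure.restrict_apply_univ, univ_inter]
      exact (hΛ.ne_top ⟨_, shell_bounded n⟩).lt_top
    refine Measure.ext_prod fun {s t} hs ht => ?_
    rw [hrect s t hs ht, h.campbell hΛ hX hat (ht.inter hsh)
      ⟨_, inter_subset_right.trans (shell_bounded n)⟩, Measure.map_apply hX hs,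
      withDensity_apply _ (hX hs), Measure.restrict_apply (hs.prod ht), prod_inter_prod, inter_univ,
      Measure.compProd_apply_prod hs (ht.inter hsh), setLIntegral_map hs
        ((kern d 𝕄).measurable_coe (ht.inter hsh)) hX]
    rfl
  have hF' : Measurable fun q : Config d 𝕄 × E d × 𝕄 => F (q.2, q.1) := by fun_prop
  have h1 := congrArg (fun ν => ∫⁻ q, F (q.2, q.1) ∂ν) key
  rw [lintegral_map hF' hins', Measure.lintegral_compProd hF',
    lintegral_map (Measurable.lintegral_kernel_prod_right' hF') hX,
    lintegral_prod (fun q => F (q.1, (X q.2).ins q.1)) (hF'.comp hins').aemeasurable] at h1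
  exact h1.symm

lemma IsPoissonProcess.measure_cellEvent {μ : Measure Ω} {X : Ω → Config d 𝕄}
    {Λ : Measure (E d × 𝕄)} (hX : IsPoissonProcess μ X Λ) (hΛ : LocallyFinite Λ)
    {κ : Type} [Fintype κ] {C : κ → Set (E d × 𝕄)} (hC : IsGrid C) (k : κ → ℕ) :
    μ (X ⁻¹' cellEvent C k) = ∏ l, poissonMeasure (Λ (C l)).toNNReal {k l} := by
  let e := Fintype.equivFin κ
  have hind := hX.indep (Fintype.card κ) (fun j => C (e.symm j)) (fun j => hC.meas _)
    (fun i j hij => hC.disj (fun h => hij (e.symm.injective h)))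
  have h := hind.measure_inter_preimage_eq_mul Finset.univ
    (sets := fun j => {(k (e.symm j) : ℕ∞)}) (fun j _ => measurableSet_singleton _)
  have h1 : (⋂ i ∈ (Finset.univ : Finset (Fin (Fintype.card κ))),
      (fun ω => (X ω).count (C (e.symm i))) ⁻¹' {(k (e.symm i) : ℕ∞)}) = X ⁻¹' cellEvent C k := by
    ext ω
    simp only [Finset.mem_univ, iInter_true, mem_iInter, mem_preimage, mem_singleton_iff,
      cellEvent, mem_ofPred_eq]
    exact ⟨fun h l => by simpa using h (e l), fun h i => h _⟩
  rw [h1] at h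
  rw [h, ← e.symm.prod_comp]
  refine Finset.prod_congr rfl fun j _ => ?_
  exact hX.count_law _ (hC.meas _) (hΛ.ne_top (hC.bdd _)) _

lemma poissonMeasure_succ (r : ℝ≥0) (n : ℕ) :
    ((n + 1 : ℕ) : ℝ≥0∞) * poissonMeasure r {n + 1} = r * poissonMeasure r {n} := by
  rw [poissonMeasure_singleton, poissonMeasure_singleton, ← ENNReal.ofReal_natCast,
    ← ENNReal.ofReal_coe_nnreal, ← ENNReal.ofReal_mul (by positivity),
    ← ENNReal.ofReal_mul (by positivity)]
  congr 1
  rw [Nat.factorial_succ, pow_succ, Nat.cast_mul]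
  have : (n.factorial : ℝ) ≠ 0 := by positivity
  have : ((n + 1 : ℕ) : ℝ) ≠ 0 := by positivity
  field_simp

lemma IsPoissonProcess.cellRecursion {μ : Measure Ω} {X : Ω → Config d 𝕄}
    {Λ : Measure (E d × 𝕄)} (hX : IsPoissonProcess μ X Λ) (hΛ : LocallyFinite Λ) :
    CellRecursion μ X Λ := by
  intro κ _ _ C hC l k
  rw [hX.measure_cellEvent hΛ hC, hX.measure_cellEvent hΛ hC,
    ← Finset.mul_prod_erase _ _ (Finset.mem_univ l),
    ← Finset.mul_prod_erase (a := l) _ (fun j => poissonMeasure (Λ (C j)).toNNReal {k j})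
      (Finset.mem_univ l), ← mul_assoc, ← mul_assoc, Function.update_self, poissonMeasure_succ,
    ENNReal.coe_toNNReal (hΛ.ne_top (hC.bdd l))]
  congr 1
  refine Finset.prod_congr rfl fun j hj => ?_
  rw [Function.update_of_ne (Finset.ne_of_mem_erase hj)]

/-- The number of points over the position `x` is Poisson with parameter zero. -/
lemma IsPoissonProcess.noAtom {μ : Measure Ω} [IsProbabilityMeasure μ] {X : Ω → Config d 𝕄}
    {Λ : Measure (E d × 𝕄)} (hX : IsPoissonProcess μ X Λ)
    (h0 : ∀ x : E d, Λ ({x} ×ˢ univ) = 0) (x : E d) : ∀ᵐ ω ∂μ, x ∉ (X ω).proj := by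
  have hm : MeasurableSet (({x} : Set (E d)) ×ˢ (univ : Set 𝕄)) :=
    (measurableSet_singleton x).prod MeasurableSet.univ
  have h := hX.count_law _ hm (by simp [h0]) 0
  rw [h0, poissonMeasure_singleton] at h
  simp only [Nat.cast_zero, ENNReal.toNNReal_zero, NNReal.coe_zero, neg_zero, Real.exp_zero,
    pow_zero, mul_one, Nat.factorial_zero, Nat.cast_one, div_one, ENNReal.ofReal_one] at h
  have h' := (prob_compl_eq_zero_iff (hX.measurable (measurableSet_count_eq hm 0))).2 h
  filter_upwards [compl_mem_ae_iff.2 h'] with ω hω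
  simp only [compl_compl, mem_preimage, mem_ofPred_eq, count, Set.encard_eq_zero] at hω
  rintro ⟨p, hp, hpx⟩
  exact (Set.eq_empty_iff_forall_notMem.1 hω p) ⟨hp, hpx, mem_univ _⟩

/-- Beyond this point the Poisson property is used only in the form of the Mecke equation and of the
absence of fixed points. -/
lemma IsPoissonProcess.isMecke {μ : Measure Ω} [IsProbabilityMeasure μ] {X : Ω → Config d 𝕄}
    {Λ : Measure (E d × 𝕄)} [SFinite Λ] (hX : IsPoissonProcess μ X Λ) (hΛ : LocallyFinite Λ)
    (h0 : ∀ x : E d, Λ ({x} ×ˢ univ) = 0) : IsMecke μ X Λ :=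
  (hX.cellRecursion hΛ).isMecke hΛ hX.measurable (hX.noAtom h0)

end StabScores

end

/-! ### Images, resampling and independence over disjoint sets -/

noncomputable section

namespace StabScores

variable {d : ℕ} {𝕄 𝕄' : Type*}

namespace Config

lemma mem_proj_add {S : Config d 𝕄} {p : E d × 𝕄} {x : E d} :
    x ∈ (S.add p).proj ↔ x = p.1 ∨ x ∈ S.proj := by
  rw [proj, add_pts, image_insert_eq, mem_insert_iff]; rfl

/-- The points of `S` with position in `D`. -/
def restr (S : Config d 𝕄) (D : Set (E d)) : Config d 𝕄 where
  pts := S.pts ∩ D ×ˢ univ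
  locFin B hB := (S.locFin B hB).subset fun _ h => ⟨h.1.1, h.2⟩

lemma restr_pts (S : Config d 𝕄) (D : Set (E d)) : (S.restr D).pts = S.pts ∩ D ×ˢ univ := rfl

lemma restr_closedBall (S : Config d 𝕄) (x : E d) (r : ℝ) :
    S.restr (Metric.closedBall x r) = S.inBall x r := rfl

/-- The points of `S` with position in `D` and the points of `S'` with position outside. -/
def glue (D : Set (E d)) (S S' : Config d 𝕄) : Config d 𝕄 where
  pts := S.pts ∩ D ×ˢ univ ∪ S'.pts ∩ Dᶜ ×ˢ univ
  locFin B hB := ((S.locFin B hB).union (S'.locFin B hB)).subset (by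
    rintro p ⟨h | h, hB⟩
    · exact Or.inl ⟨h.1, hB⟩
    · exact Or.inr ⟨h.1, hB⟩)

lemma mem_glue_pts {D : Set (E d)} {S S' : Config d 𝕄} {p : E d × 𝕄} :
    p ∈ (glue D S S').pts ↔ (p ∈ S.pts ∧ p.1 ∈ D) ∨ (p ∈ S'.pts ∧ p.1 ∉ D) := by
  simp [glue]

lemma mem_glue_proj {D : Set (E d)} {S S' : Config d 𝕄} {x : E d} :
    x ∈ (glue D S S').proj ↔ (x ∈ S.proj ∧ x ∈ D) ∨ (x ∈ S'.proj ∧ x ∉ D) := by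
  simp only [proj, mem_image, mem_glue_pts]
  constructor
  · rintro ⟨p, h | h, rfl⟩
    · exact Or.inl ⟨⟨p, h.1, rfl⟩, h.2⟩
    · exact Or.inr ⟨⟨p, h.1, rfl⟩, h.2⟩
  · rintro (⟨⟨p, hp, rfl⟩, h⟩ | ⟨⟨p, hp, rfl⟩, h⟩)
    · exact ⟨p, Or.inl ⟨hp, h⟩, rfl⟩
    · exact ⟨p, Or.inr ⟨hp, h⟩, rfl⟩

lemma glue_ins_left {D : Set (E d)} {S S' : Config d 𝕄} {p : E d × 𝕄} (hp : p.1 ∈ D) :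
    glue D (S.ins p) S' = (glue D S S').ins p := by
  by_cases h : p.1 ∈ S.proj
  · rw [ins_of_mem h, ins_of_mem (mem_glue_proj.2 (Or.inl ⟨h, hp⟩))]
  · rw [ins_of_notMem h, ins_of_notMem]
    · ext1
      ext q
      simp only [mem_glue_pts, add_pts, mem_insert_iff]
      by_cases hq : q = p
      · simp [hq, hp]
      · simp [hq]
    · rw [mem_glue_proj]; tauto

lemma glue_ins_right {D : Set (E d)} {S S' : Config d 𝕄} {p : E d × 𝕄} (hp : p.1 ∉ D) :
    glue D S (S'.ins p) = (glue D S S').ins p := by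
  by_cases h : p.1 ∈ S'.proj
  · rw [ins_of_mem h, ins_of_mem (mem_glue_proj.2 (Or.inr ⟨h, hp⟩))]
  · rw [ins_of_notMem h, ins_of_notMem]
    · ext1
      ext q
      simp only [mem_glue_pts, add_pts, mem_insert_iff]
      by_cases hq : q = p
      · simp [hq, hp]
      · simp [hq]
    · rw [mem_glue_proj]; tauto

lemma glue_restr_left {D D₁ : Set (E d)} (h : D₁ ⊆ D) (S S' : Config d 𝕄) :
    (glue D S S').restr D₁ = S.restr D₁ := by
  ext1
  ext p
  simp only [restr_pts, mem_inter_iff, mem_glue_pts, mem_prod, mem_univ, and_true]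
  have := @h p.1
  tauto

lemma glue_restr_right {D D₁ : Set (E d)} (h : D₁ ⊆ Dᶜ) (S S' : Config d 𝕄) :
    (glue D S S').restr D₁ = S'.restr D₁ := by
  ext1
  ext p
  simp only [restr_pts, mem_inter_iff, mem_glue_pts, mem_prod, mem_univ, and_true]
  have := @h p.1
  simp only [mem_compl_iff] at this
  tauto

variable [MeasurableSpace 𝕄] [MeasurableSpace 𝕄']

lemma lintegral_glue {D : Set (E d)} (hD : MeasurableSet D) (S S' : Config d 𝕄)
    {F : E d × 𝕄 → ℝ≥0∞} (hF : Measurable F) :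
    ∫⁻ p, F p ∂(glue D S S').toMeasure =
      ∫⁻ p, (D ×ˢ univ).indicator F p ∂S.toMeasure +
        ∫⁻ p, (Dᶜ ×ˢ univ).indicator F p ∂S'.toMeasure := by
  have hD1 : MeasurableSet (D ×ˢ (univ : Set 𝕄)) := hD.prod MeasurableSet.univ
  have hD2 : MeasurableSet (Dᶜ ×ˢ (univ : Set 𝕄)) := hD.compl.prod MeasurableSet.univ
  rw [lintegral_toMeasure _ hF, lintegral_toMeasure _ (hF.indicator hD1),
    lintegral_toMeasure _ (hF.indicator hD2), glue, Summable.tsum_union_disjoint _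
      ENNReal.summable ENNReal.summable, tsum_subtype (S.pts ∩ D ×ˢ univ) F,
      tsum_subtype (S'.pts ∩ Dᶜ ×ˢ univ) F, tsum_subtype S.pts, tsum_subtype S'.pts]
  · simp_rw [indicator_indicator]
  · rw [Set.disjoint_left]
    rintro p ⟨_, hp, _⟩ ⟨_, hp', _⟩
    exact hp' hp

lemma measurable_glue {α : Type*} [MeasurableSpace α] {D : Set (E d)} (hD : MeasurableSet D)
    {X Y : α → Config d 𝕄} (hX : Measurable X) (hY : Measurable Y) :
    Measurable fun a => glue D (X a) (Y a) := by
  refine measurable_of_toMeasure fun B hB => ?_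
  have hD1 : MeasurableSet (D ×ˢ (univ : Set 𝕄)) := hD.prod MeasurableSet.univ
  have hD2 : MeasurableSet (Dᶜ ×ˢ (univ : Set 𝕄)) := hD.compl.prod MeasurableSet.univ
  have : (fun a => (glue D (X a) (Y a)).toMeasure B) = fun a =>
      (X a).toMeasure (D ×ˢ univ ∩ B) + (Y a).toMeasure (Dᶜ ×ˢ univ ∩ B) := by
    ext a
    rw [← lintegral_indicator_one hB, lintegral_glue hD _ _ (measurable_one.indicator hB),
      indicator_indicator, indicator_indicator, lintegral_indicator_one (hD1.inter hB),
      lintegral_indicator_one (hD2.inter hB)]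
  rw [this]
  exact (((kern d 𝕄).measurable_coe (hD1.inter hB)).comp hX).add
    (((kern d 𝕄).measurable_coe (hD2.inter hB)).comp hY)

lemma measurable_restr {α : Type*} [MeasurableSpace α] {X : α → Config d 𝕄} {D : Set (E d)}
    (hX : Measurable X) (hD : MeasurableSet D) : Measurable fun t => (X t).restr D := by
  refine measurable_of_image hX (φ := fun t p => p)
    (D := {q | q.2.1 ∈ D}) (by fun_prop)
    (measurable_snd.fst hD) (fun t => injOn_id _) (fun t => ?_)
  ext p
  simp [restr]

end Config

open Config

variable [MeasurableSpace 𝕄] [MeasurableSpace 𝕄'] {Ω : Type*} [MeasurableSpace Ω]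

/-- Images of random configurations under maps acting injectively on positions. -/
lemma IsMecke.image {μ : Measure Ω} [SFinite μ] {X : Ω → Config d 𝕄} {Λ : Measure (E d × 𝕄)}
    (hX : IsMecke μ X Λ) {φ : E d × 𝕄 → E d × 𝕄'} (hφ : Measurable φ)
    {ψ : E d → E d} (hψ : Function.Injective ψ) (hφψ : ∀ p, (φ p).1 = ψ p.1)
    {D : Set (E d × 𝕄)} (hD : MeasurableSet D) {T : Config d 𝕄 → Config d 𝕄'} (hT : Measurable T)
    {P : Config d 𝕄 → Prop} (hP : ∀ ω, P (X ω))
    (hPins : ∀ S p, P S → p.1 ∉ S.proj → P (S.add p))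
    (hpts : ∀ S, P S → (T S).pts = φ '' (S.pts ∩ D)) (hinj : ∀ S, P S → InjOn φ (S.pts ∩ D)) :
    IsMecke μ (fun ω => T (X ω)) ((Λ.restrict D).map φ) := by
  have hproj : ∀ S, P S → ∀ x, ψ x ∈ (T S).proj → x ∈ S.proj := by
    rintro S hS x ⟨q, hq, hqx⟩
    rw [hpts S hS] at hq
    obtain ⟨p, hp, rfl⟩ := hq
    rw [hφψ] at hqx
    exact ⟨p, hp.1, hψ hqx⟩
  refine ⟨hT.comp hX.measurable, fun x => ?_, fun F hF => ?_⟩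
  · by_cases hx : ∃ y, ψ y = x
    · obtain ⟨y, rfl⟩ := hx
      filter_upwards [hX.noAtom y] with ω hω hmem
      exact hω (hproj _ (hP ω) y hmem)
    · refine Eventually.of_forall fun ω hmem => hx ?_
      obtain ⟨q, hq, hqx⟩ := hmem
      rw [hpts _ (hP ω)] at hq
      obtain ⟨p, hp, rfl⟩ := hq
      exact ⟨p.1, (hφψ p).symm.trans hqx⟩
  · let G : (E d × 𝕄) × Config d 𝕄 → ℝ≥0∞ :=
      fun q => (D ×ˢ univ).indicator (fun q => F (φ q.1, T q.2)) q
    have hG : Measurable G :=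
      (hF.comp ((hφ.comp measurable_fst).prodMk (hT.comp measurable_snd))).indicator
        (hD.prod MeasurableSet.univ)
    have h := hX.mecke G hG
    have h1 : ∀ ω, ∫⁻ q, F (q, T (X ω)) ∂(T (X ω)).toMeasure =
        ∫⁻ p, G (p, X ω) ∂(X ω).toMeasure := by
      intro ω
      rw [lintegral_of_image hφ hD (hinj _ (hP ω)) (hpts _ (hP ω))
        (F := fun q => F (q, T (X ω))) (hF.comp (measurable_id.prodMk measurable_const))]
      refine lintegral_congr fun p => ?_
      by_cases hp : p ∈ D <;> simp [G, hp]
    have hmeas : Measurable fun q : E d × 𝕄' => ∫⁻ ω, F (q, (T (X ω)).ins q) ∂μ := by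
      refine Measurable.lintegral_prod_right' (f := fun q : (E d × 𝕄') × Ω =>
        F (q.1, (T (X q.2)).ins q.1)) ?_
      exact hF.comp (measurable_fst.prodMk
        (measurable_ins (hT.comp (hX.measurable.comp measurable_snd)) measurable_fst))
    simp only [h1]
    rw [h, lintegral_map hmeas hφ, ← lintegral_indicator hD]
    refine lintegral_congr fun p => ?_
    by_cases hp : p ∈ D
    · simp only [hp, indicator_of_mem]
      refine lintegral_congr_ae ?_
      filter_upwards [hX.noAtom p.1] with ω hω
      have hn : (φ p).1 ∉ (T (X ω)).proj := by
        rw [hφψ]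
        exact fun hmem => hω (hproj _ (hP ω) _ hmem)
      simp only [G, mem_prod, hp, mem_univ, and_true, indicator_of_mem]
      rw [ins_of_notMem hω, ins_of_notMem hn]
      congr 2
      ext1
      -- The invariant `P` survives the addition of a point at a free position, so the description
      -- of `T` is available after the addition too. In the application to thinning `P` is
      -- simplicity.
      rw [hpts _ (hPins _ _ (hP ω) hω), add_pts, add_pts, hpts _ (hP ω), ← image_insert_eq]
      congr 1
      ext q
      simp only [mem_inter_iff, mem_insert_iff]
      constructor
      · rintro ⟨h | h, hq⟩
        · exact Or.inl h
        · exact Or.inr ⟨h, hq⟩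
      · rintro (rfl | h)
        · exact ⟨Or.inl rfl, hp⟩
        · exact ⟨Or.inr h.1, h.2⟩
    · simp [hp, G]

lemma IsMecke.restr {μ : Measure Ω} [SFinite μ] {X : Ω → Config d 𝕄} {Λ : Measure (E d × 𝕄)}
    (hX : IsMecke μ X Λ) {D : Set (E d)} (hD : MeasurableSet D) :
    IsMecke μ (fun ω => (X ω).restr D) (Λ.restrict (D ×ˢ univ)) := by
  have := hX.image (φ := id) (ψ := id) measurable_id Function.injective_id (fun _ => rfl)
    (hD.prod MeasurableSet.univ) (T := fun S => S.restr D) (measurable_restr measurable_id hD)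
    (P := fun _ => True) (fun _ => trivial) (fun _ _ _ _ => trivial)
    (fun S _ => by simp [restr_pts]) (fun _ _ => injOn_id _)
  rwa [Measure.map_id] at this

lemma IsMecke.translate {μ : Measure Ω} [SFinite μ] {X : Ω → Config d 𝕄} {Λ : Measure (E d × 𝕄)}
    (hX : IsMecke μ X Λ) (y : E d) :
    IsMecke μ (fun ω => (X ω).translate y) (Λ.map fun p => (p.1 + y, p.2)) := by
  have := hX.image (φ := fun p => (p.1 + y, p.2)) (ψ := fun x => x + y) (by fun_prop)
    (add_left_injective y) (fun _ => rfl) MeasurableSet.univ (T := fun S => S.translate y)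
    (measurable_translate measurable_id measurable_const)
    (P := fun _ => True) (fun _ => trivial) (fun _ _ _ _ => trivial)
    (fun S _ => by simp [Config.translate]) (fun _ _ => (translate_injective y).injOn)
  rwa [Measure.restrict_univ] at this

lemma IsMecke.dilate {μ : Measure Ω} [SFinite μ] {X : Ω → Config d 𝕄} {Λ : Measure (E d × 𝕄)}
    (hX : IsMecke μ X Λ) (x : E d) {a : ℝ} (ha : 0 < a) :
    IsMecke μ (fun ω => (X ω).dilate x a) (Λ.map fun p => (x + a • (p.1 - x), p.2)) := by
  have := hX.image (φ := fun p => (x + a • (p.1 - x), p.2)) (ψ := fun z => x + a • (z - x))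
    (by fun_prop) (fun u v h => sub_left_injective
      (smul_right_injective _ ha.ne' (add_right_injective x h)))
    (fun _ => rfl) MeasurableSet.univ (T := fun S => S.dilate x a)
    (measurable_dilate measurable_id measurable_const measurable_const)
    (P := fun _ => True) (fun _ => trivial) (fun _ _ _ _ => trivial)
    (fun S _ => by simp [dilate_pts S x ha]) (fun _ _ => (dilate_injective x ha).injOn)
  rwa [Measure.restrict_univ] at this

/-- Resampling outside `D` does not change the law; this replaces any explicit statement on complete
independence. The test function is split according to whether the point lies in `D`. With the copy
that does not contain the point held fixed, each part is the Mecke equation of the other copy. -/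
lemma IsMecke.glue {μ : Measure Ω} [IsProbabilityMeasure μ] {X : Ω → Config d 𝕄}
    {Λ : Measure (E d × 𝕄)} [SFinite Λ] (hX : IsMecke μ X Λ) {D : Set (E d)}
    (hD : MeasurableSet D) :
    IsMecke (μ.prod μ) (fun ω => Config.glue D (X ω.1) (X ω.2)) Λ := by
  have hm : Measurable fun ω : Ω × Ω => Config.glue D (X ω.1) (X ω.2) :=
    measurable_glue hD (hX.measurable.comp measurable_fst) (hX.measurable.comp measurable_snd)
  refine ⟨hm, fun x => ?_, fun F hF => ?_⟩
  · have h1 : ∀ᵐ ω : Ω × Ω ∂(μ.prod μ), x ∉ (X ω.1).proj :=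
      Measure.quasiMeasurePreserving_fst.ae (hX.noAtom x)
    have h2 : ∀ᵐ ω : Ω × Ω ∂(μ.prod μ), x ∉ (X ω.2).proj :=
      Measure.quasiMeasurePreserving_snd.ae (hX.noAtom x)
    filter_upwards [h1, h2] with ω h1 h2
    rw [mem_glue_proj]; tauto
  · have hD1 : MeasurableSet (D ×ˢ (univ : Set 𝕄)) := hD.prod MeasurableSet.univ
    have hD2 : MeasurableSet (Dᶜ ×ˢ (univ : Set 𝕄)) := hD.compl.prod MeasurableSet.univ
    let G₁ : (E d × 𝕄) × Config d 𝕄 → ℝ≥0∞ := fun q => ((D ×ˢ univ) ×ˢ univ).indicator F q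
    let G₂ : (E d × 𝕄) × Config d 𝕄 → ℝ≥0∞ := fun q => ((Dᶜ ×ˢ univ) ×ˢ univ).indicator F q
    have hG₁ : Measurable G₁ := hF.indicator (hD1.prod MeasurableSet.univ)
    have hG₂ : Measurable G₂ := hF.indicator (hD2.prod MeasurableSet.univ)
    have hsplit : ∀ q, F q = G₁ q + G₂ q := by
      intro q
      by_cases hq : q.1.1 ∈ D <;> simp [G₁, G₂, hq]
    have hlhs : ∀ ω : Ω × Ω, ∫⁻ p, F (p, Config.glue D (X ω.1) (X ω.2))
        ∂(Config.glue D (X ω.1) (X ω.2)).toMeasure =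
        ∫⁻ p, G₁ (p, Config.glue D (X ω.1) (X ω.2)) ∂(X ω.1).toMeasure +
        ∫⁻ p, G₂ (p, Config.glue D (X ω.1) (X ω.2)) ∂(X ω.2).toMeasure := by
      intro ω
      rw [lintegral_glue hD _ _ (F := fun p => F (p, Config.glue D (X ω.1) (X ω.2)))
        (hF.comp (measurable_id.prodMk measurable_const))]
      congr 1 <;> refine lintegral_congr fun p => ?_
      · by_cases hq : p.1 ∈ D <;> simp [G₁, hq]
      · by_cases hq : p.1 ∈ D <;> simp [G₂, hq]
    have hm1 : Measurable fun ω : Ω × Ω =>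
        ∫⁻ p, G₁ (p, Config.glue D (X ω.1) (X ω.2)) ∂(X ω.1).toMeasure :=
      measurable_lintegral (hX.measurable.comp measurable_fst)
        (F := fun ω p => G₁ (p, Config.glue D (X ω.1) (X ω.2)))
        (hG₁.comp (measurable_snd.prodMk (hm.comp measurable_fst)))
    have hm2 : Measurable fun ω : Ω × Ω =>
        ∫⁻ p, G₂ (p, Config.glue D (X ω.1) (X ω.2)) ∂(X ω.2).toMeasure :=
      measurable_lintegral (hX.measurable.comp measurable_snd)
        (F := fun ω p => G₂ (p, Config.glue D (X ω.1) (X ω.2)))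
        (hG₂.comp (measurable_snd.prodMk (hm.comp measurable_fst)))
    have hins : Measurable fun q : (E d × 𝕄) × Ω × Ω =>
        (q.1, (Config.glue D (X q.2.1) (X q.2.2)).ins q.1) :=
      measurable_fst.prodMk (measurable_ins (hm.comp measurable_snd) measurable_fst)
    simp only [hlhs]
    rw [MeasureTheory.lintegral_add_left hm1]
    simp only [hsplit]
    have hr : ∀ p, ∫⁻ ω : Ω × Ω, (G₁ (p, (Config.glue D (X ω.1) (X ω.2)).ins p) +
        G₂ (p, (Config.glue D (X ω.1) (X ω.2)).ins p)) ∂(μ.prod μ) =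
        ∫⁻ ω : Ω × Ω, G₁ (p, (Config.glue D (X ω.1) (X ω.2)).ins p) ∂(μ.prod μ) +
        ∫⁻ ω : Ω × Ω, G₂ (p, (Config.glue D (X ω.1) (X ω.2)).ins p) ∂(μ.prod μ) := fun p =>
      MeasureTheory.lintegral_add_left ((hG₁.comp hins).comp measurable_prodMk_left) _
    simp only [hr]
    rw [MeasureTheory.lintegral_add_left]
    swap
    · exact Measurable.lintegral_prod_right' (f := fun q : (E d × 𝕄) × Ω × Ω =>
        G₁ (q.1, (Config.glue D (X q.2.1) (X q.2.2)).ins q.1)) (hG₁.comp hins)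
    congr 1
    -- The points inside `D` come from the first copy, so the second coordinate is fixed and the
    -- first one integrated.
    · rw [lintegral_prod_symm _ hm1.aemeasurable]
      have hin : ∀ ω', ∫⁻ ω, ∫⁻ p, G₁ (p, Config.glue D (X ω) (X ω')) ∂(X ω).toMeasure ∂μ =
          ∫⁻ p, ∫⁻ ω, G₁ (p, (Config.glue D (X ω) (X ω')).ins p) ∂μ ∂Λ := by
        intro ω'
        have := hX.mecke (fun q => G₁ (q.1, Config.glue D q.2 (X ω')))
          (hG₁.comp (measurable_fst.prodMk (measurable_glue hD measurable_snd measurable_const)))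
        rw [this]
        refine lintegral_congr fun p => lintegral_congr fun ω => ?_
        by_cases hp : p.1 ∈ D
        · rw [glue_ins_left hp]
        · simp [G₁, hp]
      simp only [hin]
      rw [lintegral_lintegral_swap]
      · refine lintegral_congr fun p => ?_
        exact (lintegral_prod_symm (fun ω : Ω × Ω => G₁ (p, (Config.glue D (X ω.1) (X ω.2)).ins p))
          ((hG₁.comp hins).comp measurable_prodMk_left).aemeasurable).symm
      · have h3 : Measurable fun q : (Ω × E d × 𝕄) × Ω =>
            G₁ (q.1.2, (Config.glue D (X q.2) (X q.1.1)).ins q.1.2) :=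
          (hG₁.comp hins).comp ((measurable_fst.snd).prodMk
            (measurable_snd.prodMk measurable_fst.fst))
        exact (Measurable.lintegral_prod_right' h3).aemeasurable
    · rw [lintegral_prod _ hm2.aemeasurable]
      have hin : ∀ ω, ∫⁻ ω', ∫⁻ p, G₂ (p, Config.glue D (X ω) (X ω')) ∂(X ω').toMeasure ∂μ =
          ∫⁻ p, ∫⁻ ω', G₂ (p, (Config.glue D (X ω) (X ω')).ins p) ∂μ ∂Λ := by
        intro ω
        have := hX.mecke (fun q => G₂ (q.1, Config.glue D (X ω) q.2))
          (hG₂.comp (measurable_fst.prodMk (measurable_glue hD measurable_const measurable_snd)))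
        rw [this]
        refine lintegral_congr fun p => lintegral_congr fun ω' => ?_
        by_cases hp : p.1 ∈ D
        · simp [G₂, hp]
        · rw [glue_ins_right hp]
      simp only [hin]
      rw [lintegral_lintegral_swap]
      · refine lintegral_congr fun p => ?_
        exact (lintegral_prod (fun ω : Ω × Ω => G₂ (p, (Config.glue D (X ω.1) (X ω.2)).ins p))
          ((hG₂.comp hins).comp measurable_prodMk_left).aemeasurable).symm
      · have h3 : Measurable fun q : (Ω × E d × 𝕄) × Ω =>
            G₂ (q.1.2, (Config.glue D (X q.1.1) (X q.2)).ins q.1.2) :=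
          (hG₂.comp hins).comp ((measurable_fst.snd).prodMk
            (measurable_fst.fst.prodMk measurable_snd))
        exact (Measurable.lintegral_prod_right' h3).aemeasurable

/-- Functionals of the restrictions to disjoint sets are uncorrelated. -/
lemma IsMecke.integral_mul_of_disjoint {μ : Measure Ω} [IsProbabilityMeasure μ]
    {X : Ω → Config d 𝕄} {Λ : Measure (E d × 𝕄)} [SFinite Λ] (hX : IsMecke μ X Λ)
    {D₁ D₂ : Set (E d)} (hD : MeasurableSet D₁) (hdisj : Disjoint D₁ D₂)
    {h₁ h₂ : Config d 𝕄 → ℝ} (hm₁ : Measurable h₁) (hm₂ : Measurable h₂)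
    (hh₁ : ∀ S, h₁ S = h₁ (S.restr D₁)) (hh₂ : ∀ S, h₂ S = h₂ (S.restr D₂)) :
    ∫ ω, h₁ (X ω) * h₂ (X ω) ∂μ = (∫ ω, h₁ (X ω) ∂μ) * ∫ ω, h₂ (X ω) ∂μ := by
  have hg := hX.glue hD
  -- The process may be replaced by the glued process of two independent copies, of which `h₁` sees
  -- only the first and `h₂` only the second.
  have hlaw := hX.map_eq hg
  have hmul : StronglyMeasurable fun S => h₁ S * h₂ S := (hm₁.mul hm₂).stronglyMeasurable
  have e1 := integral_map (μ := μ) hX.measurable.aemeasurable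
    (f := fun S => h₁ S * h₂ S) hmul.aestronglyMeasurable
  have e2 := integral_map (μ := μ.prod μ) hg.measurable.aemeasurable
    (f := fun S => h₁ S * h₂ S) hmul.aestronglyMeasurable
  rw [← e1, hlaw, e2, ← integral_prod_mul]
  refine integral_congr_ae (Eventually.of_forall fun ω => ?_)
  simp only
  rw [hh₁, hh₂, glue_restr_left subset_rfl, glue_restr_right, ← hh₁, ← hh₂]
  exact fun x hx hx' => Set.disjoint_left.1 hdisj hx' hx

end StabScores

end

/-! ### Existence: Poisson processes of finite intensity as random tuples -/

noncomputable section

namespace StabScores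

variable {d : ℕ} {𝕄 : Type*}

namespace Config

/-- Distinct points have distinct positions. -/
def Simple (S : Config d 𝕄) : Prop := ∀ p ∈ S.pts, ∀ q ∈ S.pts, p.1 = q.1 → p = q

/-- The empty configuration. -/
def void (d : ℕ) (𝕄 : Type*) : Config d 𝕄 := ⟨∅, fun _ _ => by simp⟩

lemma Simple.add {S : Config d 𝕄} (hS : S.Simple) {p : E d × 𝕄} (hp : p.1 ∉ S.proj) :
    (S.add p).Simple := by
  intro q hq q' hq' h
  rw [add_pts] at hq hq'
  rcases hq with rfl | hq <;> rcases hq' with rfl | hq'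
  · rfl
  · exact absurd ⟨q', hq', h.symm⟩ hp
  · exact absurd ⟨q, hq, h⟩ hp
  · exact hS q hq q' hq' h

open Classical in
/-- The configuration of the points of a tuple with distinct positions. -/
def ofTuple {n : ℕ} (x : Fin n → E d × 𝕄) : Config d 𝕄 :=
  if Function.Injective (fun i => (x i).1) then
    ⟨range x, fun _ _ => (finite_range x).inter_of_left _⟩ else void d 𝕄

lemma ofTuple_pts {n : ℕ} {x : Fin n → E d × 𝕄} (hx : Function.Injective (fun i => (x i).1)) :
    (ofTuple x).pts = range x := by rw [ofTuple, if_pos hx]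

lemma ofTuple_of_not {n : ℕ} {x : Fin n → E d × 𝕄}
    (hx : ¬ Function.Injective (fun i => (x i).1)) : ofTuple x = void d 𝕄 := by
  rw [ofTuple, if_neg hx]

lemma simple_ofTuple {n : ℕ} (x : Fin n → E d × 𝕄) : (ofTuple x).Simple := by
  by_cases hx : Function.Injective (fun i => (x i).1)
  · intro p hp q hq h
    rw [ofTuple_pts hx] at hp hq
    obtain ⟨i, rfl⟩ := hp
    obtain ⟨j, rfl⟩ := hq
    rw [hx h]
  · rw [ofTuple_of_not hx]
    intro p hp
    exact absurd hp (notMem_empty p)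

lemma ofTuple_insertNth {n : ℕ} {w : Fin n → E d × 𝕄}
    (hw : Function.Injective (fun i => (w i).1)) {z : E d × 𝕄}
    (hz : ∀ i, (w i).1 ≠ z.1) (i : Fin (n + 1)) :
    Function.Injective (fun j => (Fin.insertNth (α := fun _ => E d × 𝕄) i z w j).1) ∧
      ofTuple (Fin.insertNth (α := fun _ => E d × 𝕄) i z w) = (ofTuple w).ins z := by
  have hinj : Function.Injective
      (fun j => (Fin.insertNth (α := fun _ => E d × 𝕄) i z w j).1) := by
    intro j j' h
    induction j using Fin.succAboveCases i with
    | x =>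
      induction j' using Fin.succAboveCases i with
      | x => rfl
      | p j' => simp only [Fin.insertNth_apply_same, Fin.insertNth_apply_succAbove] at h
                exact absurd h.symm (hz _)
    | p j =>
      induction j' using Fin.succAboveCases i with
      | x => simp only [Fin.insertNth_apply_same, Fin.insertNth_apply_succAbove] at h
             exact absurd h (hz _)
      | p j' => simp only [Fin.insertNth_apply_succAbove] at h
                rw [hw h]
  refine ⟨hinj, ?_⟩
  have hn : z.1 ∉ (ofTuple w).proj := by
    rw [proj, ofTuple_pts hw]
    rintro ⟨_, ⟨j, rfl⟩, h⟩
    exact hz j h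
  rw [ins_of_notMem hn]
  ext1
  rw [ofTuple_pts hinj, add_pts, ofTuple_pts hw, Fin.range_insertNth]
  rfl

variable [MeasurableSpace 𝕄]

lemma lintegral_ofTuple {n : ℕ} {x : Fin n → E d × 𝕄}
    (hx : Function.Injective (fun i => (x i).1)) {F : E d × 𝕄 → ℝ≥0∞} (hF : Measurable F) :
    ∫⁻ p, F p ∂(ofTuple x).toMeasure = ∑ i, F (x i) := by
  have hinj : Function.Injective x := fun i j h => hx (by simp [h])
  rw [lintegral_toMeasure _ hF, ofTuple_pts hx, ← image_univ, tsum_image F hinj.injOn,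
    tsum_univ (fun i => F (x i)), tsum_fintype]

lemma lintegral_void (F : E d × 𝕄 → ℝ≥0∞) : ∫⁻ p, F p ∂(void d 𝕄).toMeasure = 0 := by
  have : (void d 𝕄).toMeasure = 0 := by
    rw [toMeasure]
    haveI : IsEmpty (void d 𝕄).pts := by simp [void]
    exact Measure.sum_of_isEmpty _
  rw [this, lintegral_zero_measure]

lemma measurableSet_injective_fst (n : ℕ) :
    MeasurableSet {x : Fin n → E d × 𝕄 | Function.Injective (fun i => (x i).1)} := by
  have : {x : Fin n → E d × 𝕄 | Function.Injective (fun i => (x i).1)} =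
      ⋂ i, ⋂ j, {x | i = j} ∪ {x : Fin n → E d × 𝕄 | (x i).1 = (x j).1}ᶜ := by
    ext x
    simp only [Function.Injective, mem_ofPred_eq, mem_iInter, mem_union, mem_compl_iff]
    exact forall₂_congr fun i j => by tauto
  rw [this]
  refine MeasurableSet.iInter fun i => MeasurableSet.iInter fun j => MeasurableSet.union ?_ ?_
  · exact MeasurableSet.const _
  · exact (measurableSet_eq_fun (by fun_prop) (by fun_prop)).compl

lemma measurable_ofTuple (n : ℕ) : Measurable (ofTuple : (Fin n → E d × 𝕄) → Config d 𝕄) := by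
  refine measurable_of_toMeasure fun B hB => ?_
  have : (fun x : Fin n → E d × 𝕄 => (ofTuple x).toMeasure B) =
      {x : Fin n → E d × 𝕄 | Function.Injective (fun i => (x i).1)}.indicator
        (fun x => ∑ i, B.indicator 1 (x i)) := by
    ext x
    by_cases hx : Function.Injective (fun i => (x i).1)
    · rw [indicator_of_mem (by exact hx), ← lintegral_indicator_one hB,
        lintegral_ofTuple hx (measurable_one.indicator hB)]
    · rw [indicator_of_notMem (by exact hx), ofTuple_of_not hx, ← lintegral_indicator_one hB,
        lintegral_void]
  rw [this]
  refine Measurable.indicator ?_ (measurableSet_injective_fst n)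
  exact Finset.measurable_sum _ fun i _ =>
    (measurable_one.indicator hB).comp (measurable_pi_apply i)

end Config

open Config

variable [MeasurableSpace 𝕄]

lemma measurable_sigma_of {ι α : Type*} {β : ι → Type*} [∀ i, MeasurableSpace (β i)]
    [MeasurableSpace α] {f : Sigma β → α} (h : ∀ i, Measurable fun b => f ⟨i, b⟩) :
    Measurable f := fun s hs => by
  refine (MeasurableSpace.measurableSet_iInf).2 fun i => ?_
  exact h i hs

lemma measurable_sigmaMk {ι : Type*} {β : ι → Type*} [∀ i, MeasurableSpace (β i)] (i : ι) :
    Measurable (Sigma.mk i : β i → Sigma β) := fun _ hs =>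
  (MeasurableSpace.measurableSet_iInf).1 hs i

/-- The law of the tuple of points of a Poisson process with finite intensity `Λ`. -/
def tupleLaw (Λ : Measure (E d × 𝕄)) : Measure (Σ n : ℕ, Fin n → E d × 𝕄) :=
  Measure.sum fun n : ℕ =>
    (ENNReal.ofReal (Real.exp (-(Λ univ).toReal)) * (n.factorial : ℝ≥0∞)⁻¹) •
      (Measure.pi fun _ : Fin n => Λ).map (Sigma.mk n)

lemma lintegral_tupleLaw (Λ : Measure (E d × 𝕄)) {F : (Σ n : ℕ, Fin n → E d × 𝕄) → ℝ≥0∞}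
    (hF : Measurable F) : ∫⁻ x, F x ∂(tupleLaw Λ) =
      ∑' n : ℕ, (ENNReal.ofReal (Real.exp (-(Λ univ).toReal)) * (n.factorial : ℝ≥0∞)⁻¹) *
        ∫⁻ x, F ⟨n, x⟩ ∂(Measure.pi fun _ : Fin n => Λ) := by
  rw [tupleLaw, lintegral_sum_measure]
  refine tsum_congr fun n => ?_
  rw [lintegral_smul_measure, lintegral_map hF (measurable_sigmaMk n), smul_eq_mul]

instance (Λ : Measure (E d × 𝕄)) [IsFiniteMeasure Λ] : IsProbabilityMeasure (tupleLaw Λ) := by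
  refine ⟨?_⟩
  rw [← lintegral_one, lintegral_tupleLaw Λ measurable_const]
  have h : ∀ n : ℕ, (ENNReal.ofReal (Real.exp (-(Λ univ).toReal)) * (n.factorial : ℝ≥0∞)⁻¹) *
      ∫⁻ _, 1 ∂(Measure.pi fun _ : Fin n => Λ) =
      ENNReal.ofReal (Real.exp (-((Λ univ).toNNReal : ℝ)) * ((Λ univ).toNNReal : ℝ) ^ n /
        (n.factorial : ℝ)) := by
    intro n
    rw [lintegral_one, Measure.pi_univ, Finset.prod_const, Finset.card_univ, Fintype.card_fin,
      ENNReal.ofReal_div_of_pos (by positivity), ENNReal.ofReal_mul (by positivity),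
      ENNReal.ofReal_pow (by positivity), ENNReal.ofReal_natCast, ENNReal.ofReal_coe_nnreal,
      ENNReal.coe_toNNReal (measure_ne_top _ _), div_eq_mul_inv]
    change ENNReal.ofReal (Real.exp (-(Λ univ).toReal)) * _ * _ = _
    rw [mul_right_comm]
    rfl
  rw [tsum_congr h, ← ENNReal.ofReal_tsum_of_nonneg (fun n => by positivity)
    (hasSum_one_poissonMeasure _).summable, (hasSum_one_poissonMeasure _).tsum_eq,
    ENNReal.ofReal_one]

/-- With the tuple fixed, the exceptional points lie in a fibre over a single position, which has
measure zero. -/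
lemma ae_prod_pi_ne (Λ : Measure (E d × 𝕄)) [IsFiniteMeasure Λ]
    (h0 : ∀ x : E d, Λ ({x} ×ˢ univ) = 0) (n : ℕ) :
    ∀ᵐ q ∂(Λ.prod (Measure.pi fun _ : Fin n => Λ)), ∀ i, (q.2 i).1 ≠ q.1.1 := by
  rw [ae_all_iff]
  intro i
  have hm : MeasurableSet {q : (E d × 𝕄) × (Fin n → E d × 𝕄) | (q.2 i).1 = q.1.1} :=
    measurableSet_eq_fun (by fun_prop) (by fun_prop)
  rw [ae_iff]
  simp only [ne_eq, not_not]
  rw [Measure.prod_apply_symm hm]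
  simp only [lintegral_eq_zero_iff' (measurable_measure_prodMk_right hm).aemeasurable]
  refine Eventually.of_forall fun w => ?_
  refine measure_mono_null ?_ (h0 (w i).1)
  intro z hz
  exact ⟨Eq.symm hz, mem_univ _⟩

lemma lintegral_pi_succ (Λ : Measure (E d × 𝕄)) [IsFiniteMeasure Λ] (n : ℕ) (i : Fin (n + 1))
    {F : (Fin (n + 1) → E d × 𝕄) → ℝ≥0∞} (hF : Measurable F) :
    ∫⁻ x, F x ∂(Measure.pi fun _ : Fin (n + 1) => Λ) =
      ∫⁻ q, F (Fin.insertNth (α := fun _ => E d × 𝕄) i q.1 q.2)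
        ∂(Λ.prod (Measure.pi fun _ : Fin n => Λ)) := by
  have h := (measurePreserving_piFinSuccAbove (fun _ : Fin (n + 1) => Λ) i).symm
  rw [← h.lintegral_comp hF]
  rfl

lemma ae_pi_injective (Λ : Measure (E d × 𝕄)) [IsFiniteMeasure Λ]
    (h0 : ∀ x : E d, Λ ({x} ×ˢ univ) = 0) (n : ℕ) :
    ∀ᵐ w ∂(Measure.pi fun _ : Fin n => Λ), Function.Injective (fun i => (w i).1) := by
  induction n with
  | zero => exact Eventually.of_forall fun w i => i.elim0
  | succ n ih =>
    have hm := (measurableSet_injective_fst (d := d) (𝕄 := 𝕄) (n + 1)).compl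
    rw [ae_iff]
    change (Measure.pi fun _ : Fin (n + 1) => Λ)
      ({x : Fin (n + 1) → E d × 𝕄 | Function.Injective (fun i => (x i).1)}ᶜ) = 0
    rw [← lintegral_indicator_one hm, lintegral_pi_succ Λ n 0 (measurable_one.indicator hm)]
    rw [lintegral_congr_ae (g := fun _ => 0), lintegral_zero]
    have h2 : ∀ᵐ q ∂(Λ.prod (Measure.pi fun _ : Fin n => Λ)),
        Function.Injective (fun i => (q.2 i).1) := Measure.quasiMeasurePreserving_snd.ae ih
    filter_upwards [ae_prod_pi_ne Λ h0 n, h2] with q hq hinj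
    rw [indicator_of_notMem]
    simp only [mem_compl_iff, not_not]
    exact (ofTuple_insertNth hinj hq 0).1

/-- The coupling needs a process with an additional height coordinate, which the given processes do
not provide; it is built here as a Poisson number of independent points. In the Mecke equation the
term with $n+1$ points contains $n+1$ equal integrals, one for each distinguished coordinate, and
$(n+1)/(n+1)!=1/n!$ matches the term with $n$ points on the other side. -/
lemma isMecke_tupleLaw (Λ : Measure (E d × 𝕄)) [IsFiniteMeasure Λ]
    (h0 : ∀ x : E d, Λ ({x} ×ˢ univ) = 0) :
    IsMecke (tupleLaw Λ) (fun x => ofTuple x.2) Λ := by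
  have hm : Measurable fun x : (Σ n : ℕ, Fin n → E d × 𝕄) => ofTuple x.2 :=
    measurable_sigma_of fun n => measurable_ofTuple n
  refine ⟨hm, fun x => ?_, fun F hF => ?_⟩
  · have hms : MeasurableSet {y : (Σ n : ℕ, Fin n → E d × 𝕄) | x ∈ (ofTuple y.2).proj} :=
      measurableSet_mem_proj hm measurable_const
    rw [ae_iff]
    simp only [not_not]
    rw [← lintegral_indicator_one hms, lintegral_tupleLaw Λ (measurable_one.indicator hms),
      ENNReal.tsum_eq_zero]
    intro n
    rw [lintegral_congr_ae (g := fun _ => 0), lintegral_zero, mul_zero]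
    have h1 : ∀ i : Fin n, ∀ᵐ w ∂(Measure.pi fun _ : Fin n => Λ), (w i).1 ≠ x := by
      intro i
      rw [ae_iff]
      refine measure_mono_null ?_ (Measure.pi_eval_preimage_null _ (i := i) (h0 x))
      intro w hw
      simp only [ne_eq, not_not, mem_ofPred_eq] at hw
      exact ⟨hw, mem_univ _⟩
    filter_upwards [ae_all_iff.2 h1] with w hw
    rw [indicator_of_notMem]
    rintro ⟨p, hp, hpx⟩
    by_cases hinj : Function.Injective (fun i => (w i).1)
    · rw [ofTuple_pts hinj] at hp
      obtain ⟨i, rfl⟩ := hp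
      exact hw i hpx
    · change p ∈ (ofTuple w).pts at hp
      rw [ofTuple_of_not hinj] at hp
      exact hp
  · have hmL : Measurable fun x : (Σ n : ℕ, Fin n → E d × 𝕄) =>
        ∫⁻ p, F (p, ofTuple x.2) ∂(ofTuple x.2).toMeasure :=
      measurable_lintegral hm (F := fun x p => F (p, ofTuple x.2))
        (hF.comp (measurable_snd.prodMk (hm.comp measurable_fst)))
    have hins : ∀ n, Measurable fun q : (E d × 𝕄) × (Fin n → E d × 𝕄) =>
        F (q.1, (ofTuple q.2).ins q.1) := fun n => hF.comp (measurable_fst.prodMk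
      (measurable_ins ((measurable_ofTuple n).comp measurable_snd) measurable_fst))
    set c : ℕ → ℝ≥0∞ := fun n =>
      ENNReal.ofReal (Real.exp (-(Λ univ).toReal)) * (n.factorial : ℝ≥0∞)⁻¹ with hc
    have hR : ∀ p, ∫⁻ x, F (p, (ofTuple x.2).ins p) ∂(tupleLaw Λ) =
        ∑' n, c n * ∫⁻ w, F (p, (ofTuple w).ins p) ∂(Measure.pi fun _ : Fin n => Λ) := by
      intro p
      exact lintegral_tupleLaw Λ (F := fun x => F (p, (ofTuple x.2).ins p)) (hF.comp
        (measurable_const.prodMk (measurable_ins hm measurable_const)))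
    simp only [hR]
    have hin : ∀ n, Measurable fun p : E d × 𝕄 =>
        ∫⁻ w, F (p, (ofTuple w).ins p) ∂(Measure.pi fun _ : Fin n => Λ) :=
      fun n => Measurable.lintegral_prod_right' (hins n)
    rw [lintegral_tupleLaw Λ hmL, lintegral_tsum fun n => ((hin n).const_mul _).aemeasurable,
      tsum_eq_zero_add' ENNReal.summable]
    -- The empty tuple has no point to sum over, so the series starts at one and can be shifted.
    have hz : ∫⁻ x : Fin 0 → E d × 𝕄, ∫⁻ p, F (p, ofTuple x) ∂(ofTuple x).toMeasure
        ∂(Measure.pi fun _ : Fin 0 => Λ) = 0 := by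
      rw [lintegral_congr (g := fun _ => 0), lintegral_zero]
      intro x
      rw [lintegral_ofTuple (F := fun p => F (p, ofTuple x)) (fun i => i.elim0)
        (hF.comp (measurable_id.prodMk measurable_const))]
      simp
    rw [hz, mul_zero, zero_add]
    refine tsum_congr fun n => ?_
    rw [lintegral_const_mul _ (hin n), ← lintegral_prod (fun q => F (q.1, (ofTuple q.2).ins q.1))
      (hins n).aemeasurable]
    have h1 : ∫⁻ x, ∫⁻ p, F (p, ofTuple x) ∂(ofTuple x).toMeasure
        ∂(Measure.pi fun _ : Fin (n + 1) => Λ) =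
        ∫⁻ x, ∑ i, F (x i, ofTuple x) ∂(Measure.pi fun _ : Fin (n + 1) => Λ) := by
      refine lintegral_congr_ae ?_
      filter_upwards [ae_pi_injective Λ h0 (n + 1)] with x hx
      exact lintegral_ofTuple hx (F := fun p => F (p, ofTuple x))
        (hF.comp (measurable_id.prodMk measurable_const))
    have hFi : ∀ i : Fin (n + 1), Measurable fun x : Fin (n + 1) → E d × 𝕄 =>
        F (x i, ofTuple x) := fun i =>
      hF.comp ((measurable_pi_apply i).prodMk (measurable_ofTuple (n + 1)))
    -- The configuration forgets the order of the tuple, so the integral does not depend on which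
    -- coordinate is singled out as the inserted point.
    have h2 : ∀ i : Fin (n + 1), ∫⁻ x, F (x i, ofTuple x) ∂(Measure.pi fun _ : Fin (n + 1) => Λ) =
        ∫⁻ q, F (q.1, (ofTuple q.2).ins q.1) ∂(Λ.prod (Measure.pi fun _ : Fin n => Λ)) := by
      intro i
      rw [lintegral_pi_succ Λ n i (hFi i)]
      refine lintegral_congr_ae ?_
      have h2 : ∀ᵐ q ∂(Λ.prod (Measure.pi fun _ : Fin n => Λ)),
          Function.Injective (fun i => (q.2 i).1) :=
        Measure.quasiMeasurePreserving_snd.ae (ae_pi_injective Λ h0 n)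
      filter_upwards [ae_prod_pi_ne Λ h0 n, h2] with q hq hinj
      rw [(ofTuple_insertNth hinj hq i).2, Fin.insertNth_apply_same]
    change c (n + 1) * ∫⁻ x, ∫⁻ p, F (p, ofTuple x) ∂(ofTuple x).toMeasure
        ∂(Measure.pi fun _ : Fin (n + 1) => Λ) = _
    rw [h1, lintegral_finsetSum _ fun i _ => hFi i, Finset.sum_congr rfl fun i _ => h2 i,
      Finset.sum_const, Finset.card_univ, Fintype.card_fin, nsmul_eq_mul, ← mul_assoc]
    congr 1
    simp only [hc]
    rw [mul_assoc]
    congr 1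
    rw [Nat.factorial_succ, Nat.cast_mul, ENNReal.mul_inv (Or.inl (by simp))
      (Or.inl (ENNReal.natCast_ne_top _)), mul_right_comm, ENNReal.inv_mul_cancel (by simp)
      (ENNReal.natCast_ne_top _), one_mul]

end StabScores

end

/-! ### Thinning by heights: coupling of processes with different densities -/

noncomputable section

namespace StabScores

variable {d : ℕ} {𝕄 : Type*}

namespace Config

open Classical in
/-- The points whose extra mark lies below `ρ`, the extra mark being forgotten. -/
def thin (ρ : E d → ℝ) (S : Config d (ℝ × 𝕄)) : Config d 𝕄 :=
  if S.Simple then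
    { pts := (fun p : E d × ℝ × 𝕄 => (p.1, p.2.2)) '' (S.pts ∩ {p | p.2.1 ≤ ρ p.1})
      locFin := fun B hB => by
        refine ((S.locFin B hB).image (fun p : E d × ℝ × 𝕄 => (p.1, p.2.2))).subset ?_
        rintro _ ⟨⟨p, hp, rfl⟩, hpB⟩
        exact ⟨p, ⟨hp.1, hpB⟩, rfl⟩ }
  else void d 𝕄

lemma thin_pts {ρ : E d → ℝ} {S : Config d (ℝ × 𝕄)} (hS : S.Simple) :
    (thin ρ S).pts =
      (fun p : E d × ℝ × 𝕄 => (p.1, p.2.2)) '' (S.pts ∩ {p | p.2.1 ≤ ρ p.1}) := by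
  rw [thin, if_pos hS]

/-- Two points that differ only in their heights would be merged when heights are forgotten. For
this reason thinning is set to the empty configuration on non-simple input; the tuple construction
yields only simple configurations. -/
lemma Simple.injOn {S : Config d (ℝ × 𝕄)} (hS : S.Simple) :
    InjOn (fun p : E d × ℝ × 𝕄 => (p.1, p.2.2)) S.pts := by
  intro p hp q hq h
  exact hS p hp q hq (Prod.ext_iff.1 h).1

lemma thin_add_le {ρ : E d → ℝ} {S : Config d (ℝ × 𝕄)} (hS : S.Simple) {p : E d × ℝ × 𝕄}
    (hp : p.1 ∉ S.proj) (h : p.2.1 ≤ ρ p.1) :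
    thin ρ (S.add p) = (thin ρ S).add (p.1, p.2.2) := by
  ext1
  rw [thin_pts (hS.add hp), add_pts, add_pts, thin_pts hS, insert_inter_of_mem (by exact h),
    image_insert_eq]

lemma thin_add_gt {ρ : E d → ℝ} {S : Config d (ℝ × 𝕄)} (hS : S.Simple) {p : E d × ℝ × 𝕄}
    (hp : p.1 ∉ S.proj) (h : ¬ p.2.1 ≤ ρ p.1) : thin ρ (S.add p) = thin ρ S := by
  ext1
  rw [thin_pts (hS.add hp), add_pts, thin_pts hS, insert_inter_of_notMem (by exact h)]

variable [MeasurableSpace 𝕄]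

/-- Simplicity means that every point shares its position with at most one point, namely itself.
This is expressed by the vanishing of an iterated sum of truncated differences, which is measurable.
-/
lemma measurableSet_simple : MeasurableSet {S : Config d 𝕄 | S.Simple} := by
  have hset : MeasurableSet {r : (Config d 𝕄 × E d × 𝕄) × E d × 𝕄 | r.2.1 = r.1.2.1} :=
    measurableSet_eq_fun (by fun_prop) (by fun_prop)
  have h1 : Measurable fun q : Config d 𝕄 × E d × 𝕄 =>
      ∫⁻ p, {r : (Config d 𝕄 × E d × 𝕄) × E d × 𝕄 | r.2.1 = r.1.2.1}.indicator 1 (q, p)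
        ∂q.1.toMeasure :=
    measurable_lintegral measurable_fst (F := fun q p =>
      {r : (Config d 𝕄 × E d × 𝕄) × E d × 𝕄 | r.2.1 = r.1.2.1}.indicator 1 (q, p))
      (measurable_one.indicator hset)
  have h2 : Measurable fun S : Config d 𝕄 => ∫⁻ q,
      (∫⁻ p, {r : (Config d 𝕄 × E d × 𝕄) × E d × 𝕄 | r.2.1 = r.1.2.1}.indicator 1 ((S, q), p)
        ∂S.toMeasure) - 1 ∂S.toMeasure :=
    measurable_lintegral measurable_id (F := fun S q =>
      (∫⁻ p, {r : (Config d 𝕄 × E d × 𝕄) × E d × 𝕄 | r.2.1 = r.1.2.1}.indicator 1 ((S, q), p)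
        ∂S.toMeasure) - 1) (h1.sub measurable_const)
  have : {S : Config d 𝕄 | S.Simple} = {S | (∫⁻ q,
      (∫⁻ p, {r : (Config d 𝕄 × E d × 𝕄) × E d × 𝕄 | r.2.1 = r.1.2.1}.indicator 1 ((S, q), p)
        ∂S.toMeasure) - 1 ∂S.toMeasure) = 0} := by
    ext S
    have hin : ∀ q : E d × 𝕄,
        ∫⁻ p, {r : (Config d 𝕄 × E d × 𝕄) × E d × 𝕄 | r.2.1 = r.1.2.1}.indicator 1 ((S, q), p)
          ∂S.toMeasure = (S.count {p | p.1 = q.1} : ℝ≥0∞) := by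
      intro q
      have hm : MeasurableSet {p : E d × 𝕄 | p.1 = q.1} :=
        measurableSet_eq_fun (by fun_prop) (by fun_prop)
      rw [← toMeasure_apply _ hm, ← lintegral_indicator_one hm]
      rfl
    have hmq : Measurable fun q : E d × 𝕄 => (S.count {p | p.1 = q.1} : ℝ≥0∞) - 1 := by
      simp only [← hin]
      exact (h1.comp (measurable_prodMk_left (x := S))).sub measurable_const
    simp only [mem_ofPred_eq, hin]
    rw [lintegral_toMeasure _ hmq, ENNReal.tsum_eq_zero]
    simp only [tsub_eq_zero_iff_le, Subtype.forall]
    refine forall₂_congr fun p hp => ?_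
    rw [← ENat.toENNReal_one, ENat.toENNReal_le, count, Set.encard_le_one_iff]
    constructor
    · intro h a b ha hb
      exact (h a ha.1 (Eq.symm ha.2)).symm.trans (h b hb.1 (Eq.symm hb.2))
    · intro h q hq hpq
      exact h p q ⟨hp, rfl⟩ ⟨hq, hpq.symm⟩
  rw [this]
  exact h2 (measurableSet_singleton 0)

lemma measurable_thin {ρ : E d → ℝ} (hρ : Measurable ρ) :
    Measurable (thin ρ : Config d (ℝ × 𝕄) → Config d 𝕄) := by
  refine measurable_of_image (X := id) measurable_id (φ := fun _ p => (p.1, p.2.2))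
    (D := {q | q.1.Simple} ∩ {q | q.2.2.1 ≤ ρ q.2.1}) (by fun_prop)
    ((measurable_fst measurableSet_simple).inter
      (measurableSet_le (by fun_prop) (by fun_prop))) (fun S => ?_) (fun S => ?_)
  · intro p hp q hq h
    exact Simple.injOn hp.2.1 hp.1 hq.1 h
  · by_cases hS : S.Simple
    · rw [thin_pts hS]
      congr 1
      ext p
      simp [hS]
    · simp [thin, hS, void]

end Config

open Config

variable [MeasurableSpace 𝕄] {Ω : Type*} [MeasurableSpace Ω]

/-- The intensity of a marked Poisson process on `K` with extra marks in `(0, H]`. -/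
def heightMeasure (K : Set (E d)) (H : ℝ) (Q : Measure 𝕄) : Measure (E d × ℝ × 𝕄) :=
  (volume.restrict K).prod ((volume.restrict (Ioc 0 H)).prod Q)

/-- The intensity measure with spatial density `ρ` and mark distribution `Q`. -/
def intensity (ρ : E d → ℝ) (Q : Measure 𝕄) : Measure (E d × 𝕄) :=
  (volume.withDensity fun x => ENNReal.ofReal (ρ x)).prod Q

instance (ρ : E d → ℝ) (Q : Measure 𝕄) [SFinite Q] : SFinite (intensity ρ Q) := by
  unfold intensity; infer_instance

lemma lintegral_heightMeasure {K : Set (E d)} {H : ℝ} {Q : Measure 𝕄} [SFinite Q]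
    {F : E d × ℝ × 𝕄 → ℝ≥0∞} (hF : Measurable F) :
    ∫⁻ p, F p ∂(heightMeasure K H Q) =
      ∫⁻ z in K, ∫⁻ m, (∫⁻ t in Ioc 0 H, F (z, t, m)) ∂Q := by
  rw [heightMeasure, lintegral_prod _ hF.aemeasurable]
  refine lintegral_congr fun z => ?_
  exact lintegral_prod_symm (fun q => F (z, q)) (hF.comp measurable_prodMk_left).aemeasurable

lemma lintegral_intensity {ρ : E d → ℝ} (hρ : Measurable ρ) {Q : Measure 𝕄} [SFinite Q]
    {F : E d × 𝕄 → ℝ≥0∞} (hF : Measurable F) :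
    ∫⁻ p, F p ∂(intensity ρ Q) = ∫⁻ z, ENNReal.ofReal (ρ z) * ∫⁻ m, F (z, m) ∂Q := by
  rw [intensity, lintegral_prod _ hF.aemeasurable, lintegral_withDensity_eq_lintegral_mul _
    hρ.ennreal_ofReal (Measurable.lintegral_prod_right' hF)]
  rfl

lemma restrict_intensity {ρ : E d → ℝ} {Q : Measure 𝕄} [SFinite Q] {K : Set (E d)}
    (hK : MeasurableSet K) : (intensity ρ Q).restrict (K ×ˢ univ) =
      intensity (K.indicator ρ) Q := by
  have : (fun x => ENNReal.ofReal (K.indicator ρ x)) =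
      K.indicator fun x => ENNReal.ofReal (ρ x) := by
    ext x
    by_cases hx : x ∈ K <;> simp [hx]
  rw [intensity, intensity, this, withDensity_indicator hK, ← restrict_withDensity hK,
    ← Measure.prod_restrict, Measure.restrict_univ]

/-- Over a position `z` the heights in `(0, H]` below `ρ z` fill an interval whose length is the
positive part of `ρ z`. -/
lemma map_restrict_heightMeasure {K : Set (E d)} (hK : MeasurableSet K) {H : ℝ} {Q : Measure 𝕄}
    [SFinite Q] {ρ : E d → ℝ} (hρ : Measurable ρ) (hH : ∀ z, ρ z ≤ H) :
    ((heightMeasure K H Q).restrict {p | p.2.1 ≤ ρ p.1}).map (fun p => (p.1, p.2.2)) =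
      intensity (K.indicator ρ) Q := by
  have hD : MeasurableSet {p : E d × ℝ × 𝕄 | p.2.1 ≤ ρ p.1} :=
    measurableSet_le (by fun_prop) (by fun_prop)
  refine Measure.ext_of_lintegral _ fun F hF => ?_
  have hφ : Measurable fun p : E d × ℝ × 𝕄 => (p.1, p.2.2) := by fun_prop
  rw [lintegral_map hF hφ, ← lintegral_indicator hD,
    lintegral_heightMeasure (Measurable.indicator (f := fun p : E d × ℝ × 𝕄 => F (p.1, p.2.2))
      (hF.comp hφ) hD),
    lintegral_intensity (hρ.indicator hK) hF, ← lintegral_indicator hK]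
  refine lintegral_congr fun z => ?_
  by_cases hz : z ∈ K
  · simp only [hz, indicator_of_mem]
    have hFz : Measurable fun m => F (z, m) := hF.comp measurable_prodMk_left
    rw [← lintegral_const_mul _ hFz]
    refine lintegral_congr fun m => ?_
    have : ∀ t : ℝ, {p : E d × ℝ × 𝕄 | p.2.1 ≤ ρ p.1}.indicator
        (fun p => F (p.1, p.2.2)) (z, t, m) = (Iic (ρ z)).indicator (fun _ => F (z, m)) t := by
      intro t
      by_cases ht : t ≤ ρ z <;> simp [ht]
    simp only [this]
    rw [lintegral_indicator_const measurableSet_Iic, Measure.restrict_apply measurableSet_Iic,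
      Iic_inter_Ioc_of_le (hH z), Real.volume_Ioc, sub_zero, mul_comm]
  · simp [hz]

/-- All densities bounded by `H` are realized by one process. Applied to two densities this is the
coupling. -/
lemma IsMecke.thin {μ : Measure Ω} [SFinite μ] {Y : Ω → Config d (ℝ × 𝕄)} {K : Set (E d)}
    (hK : MeasurableSet K) {H : ℝ} {Q : Measure 𝕄} [SFinite Q]
    (hY : IsMecke μ Y (heightMeasure K H Q)) (hs : ∀ ω, (Y ω).Simple) {ρ : E d → ℝ}
    (hρ : Measurable ρ) (hH : ∀ z, ρ z ≤ H) :
    IsMecke μ (fun ω => Config.thin ρ (Y ω)) (intensity (K.indicator ρ) Q) := by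
  have := hY.image (φ := fun p => (p.1, p.2.2)) (ψ := id) (by fun_prop) Function.injective_id
    (fun _ => rfl) (D := {p | p.2.1 ≤ ρ p.1}) (measurableSet_le (by fun_prop) (by fun_prop))
    (measurable_thin hρ) (P := Simple) hs (fun S p hS hp => hS.add hp)
    (fun S hS => thin_pts hS) (fun S hS => hS.injOn.mono inter_subset_left)
  rwa [map_restrict_heightMeasure hK hρ hH] at this

/-- `h` depends on the configuration only through the points in the ball around `x` whose
radius `R` is itself determined by these points. -/
def LocalAt (x : E d) (R : Config d 𝕄 → ℝ) {β : Type*} (h : Config d 𝕄 → β) : Prop :=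
  ∀ S S' : Config d 𝕄, S.inBall x (R S) = S'.inBall x (R S) → R S' = R S ∧ h S' = h S

/-- The contribution of a perturbation at `z` to the functional `h` with radius `R` at `x`. -/
@[irreducible] def influence (x : E d) (R h : Config d 𝕄 → ℝ) (S : Config d 𝕄) (z : E d) : ℝ≥0∞ :=
  {z | dist z x ≤ R S}.indicator (fun _ => ‖h S‖ₑ) z

lemma measurable_influence (x : E d) {R h : Config d 𝕄 → ℝ} (hR : Measurable R)
    (hh : Measurable h) : Measurable fun q : Config d 𝕄 × E d => influence x R h q.1 q.2 := by
  have hs : MeasurableSet {q : Config d 𝕄 × E d | dist q.2 x ≤ R q.1} :=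
    measurableSet_le (by fun_prop) (by fun_prop)
  have hm : Measurable fun q : Config d 𝕄 × E d => ‖h q.1‖ₑ := by fun_prop
  simp only [influence]
  exact hm.indicator hs

/-- If the two values differ, the thinnings cannot agree in the ball determined by either of them.
Each of these balls hence contains a point kept by exactly one thinning. The difference is at most
the sum of the two absolute values, and each absolute value is charged to such a point. -/
lemma enorm_sub_le_of_localAt {x : E d} {R h : Config d 𝕄 → ℝ}
    (hloc : LocalAt x R h) {ρ₁ ρ₂ : E d → ℝ} (hρ₁ : Measurable ρ₁) (hρ₂ : Measurable ρ₂)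
    {S : Config d (ℝ × 𝕄)} (hS : S.Simple) :
    ‖h (thin ρ₁ S) - h (thin ρ₂ S)‖ₑ ≤ ∫⁻ p, {p : E d × ℝ × 𝕄 |
        (p.2.1 ≤ ρ₁ p.1 ↔ ¬ p.2.1 ≤ ρ₂ p.1)}.indicator (fun p =>
        influence x R h (thin ρ₁ S) p.1 + influence x R h (thin ρ₂ S) p.1) p ∂S.toMeasure := by
  simp only [influence]
  by_cases heq : h (thin ρ₁ S) = h (thin ρ₂ S)
  · simp [heq]
  have key : ∀ ρ ρ' : E d → ℝ, h (thin ρ S) ≠ h (thin ρ' S) → ∃ p ∈ S.pts,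
      (p.2.1 ≤ ρ p.1 ↔ ¬ p.2.1 ≤ ρ' p.1) ∧ dist p.1 x ≤ R (thin ρ S) := by
    intro ρ ρ' hne
    by_contra! hcon
    refine hne (hloc _ _ ?_).2.symm
    ext1
    ext q
    simp only [inBall_pts, thin_pts hS, mem_inter_iff, mem_image, mem_ofPred_eq, mem_prod, mem_univ,
      and_true, Metric.mem_closedBall]
    constructor
    · rintro ⟨⟨p, ⟨hp, hpρ⟩, rfl⟩, hq⟩
      refine ⟨⟨p, ⟨hp, ?_⟩, rfl⟩, hq⟩
      by_contra hp'
      exact absurd hq (not_le.2 (hcon p hp ⟨fun _ => not_le.1 hp', fun _ => hpρ⟩))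
    · rintro ⟨⟨p, ⟨hp, hpρ⟩, rfl⟩, hq⟩
      refine ⟨⟨p, ⟨hp, ?_⟩, rfl⟩, hq⟩
      by_contra hp'
      exact absurd hq (not_le.2 (hcon p hp
        ⟨fun a => absurd a hp', fun a => absurd hpρ (not_le.2 a)⟩))
  have hD : MeasurableSet {p : E d × ℝ × 𝕄 | (p.2.1 ≤ ρ₁ p.1 ↔ ¬ p.2.1 ≤ ρ₂ p.1)} := by
    have h1 : MeasurableSet {p : E d × ℝ × 𝕄 | p.2.1 ≤ ρ₁ p.1} :=
      measurableSet_le (by fun_prop) (by fun_prop)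
    have h2 : MeasurableSet {p : E d × ℝ × 𝕄 | p.2.1 ≤ ρ₂ p.1} :=
      measurableSet_le (by fun_prop) (by fun_prop)
    exact h1.iff h2.compl
  have hB : ∀ r : ℝ, ∀ c : ℝ≥0∞, Measurable fun p : E d × ℝ × 𝕄 =>
      {z | dist z x ≤ r}.indicator (fun _ => c) p.1 := fun r c =>
    (measurable_const.indicator (measurableSet_le (by fun_prop) (by fun_prop))).comp measurable_fst
  have hm : ∀ ρ : E d → ℝ, Measurable fun p : E d × ℝ × 𝕄 => {p : E d × ℝ × 𝕄 |
      (p.2.1 ≤ ρ₁ p.1 ↔ ¬ p.2.1 ≤ ρ₂ p.1)}.indicator (fun p =>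
      {z | dist z x ≤ R (thin ρ S)}.indicator (fun _ => ‖h (thin ρ S)‖ₑ) p.1) p :=
    fun ρ => (hB _ _).indicator hD
  have hsing : ∀ {F : E d × ℝ × 𝕄 → ℝ≥0∞}, Measurable F → ∀ p ∈ S.pts,
      F p ≤ ∫⁻ p, F p ∂S.toMeasure := by
    intro F hF p hp
    rw [lintegral_toMeasure _ hF]
    exact ENNReal.le_tsum (f := fun q : S.pts => F q) ⟨p, hp⟩
  simp only [indicator_add]
  rw [MeasureTheory.lintegral_add_left (hm ρ₁)]
  -- The point `p` lies within the radius of the first thinning, `p'` within that of the second; the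
  -- two need not coincide.
  obtain ⟨p, hp, hpb, hpx⟩ := key ρ₁ ρ₂ heq
  obtain ⟨p', hp', hpb', hpx'⟩ := key ρ₂ ρ₁ (Ne.symm heq)
  have e1 := hsing (hm ρ₁) p hp
  have e2 := hsing (hm ρ₂) p' hp'
  rw [indicator_of_mem (by exact hpb), indicator_of_mem (by exact hpx)] at e1
  rw [indicator_of_mem (show p' ∈ {p : E d × ℝ × 𝕄 | (p.2.1 ≤ ρ₁ p.1 ↔ ¬ p.2.1 ≤ ρ₂ p.1)} by
      change _ ↔ _; tauto), indicator_of_mem (by exact hpx')] at e2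
  exact enorm_sub_le.trans (add_le_add e1 e2)

end StabScores

end

/-! ### Comparison of the means of a localized functional under two intensities -/

noncomputable section

namespace StabScores

variable {d : ℕ} {𝕄 : Type*} [MeasurableSpace 𝕄] {Ω : Type*} [MeasurableSpace Ω]

open Config

lemma thin_ins_ae {μ : Measure Ω} {Y : Ω → Config d (ℝ × 𝕄)} {Λ : Measure (E d × ℝ × 𝕄)}
    (hY : IsMecke μ Y Λ) (hs : ∀ ω, (Y ω).Simple) (ρ : E d → ℝ) (p : E d × ℝ × 𝕄) :
    ∀ᵐ ω ∂μ, Config.thin ρ ((Y ω).ins p) = if p.2.1 ≤ ρ p.1 then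
      (Config.thin ρ (Y ω)).ins (p.1, p.2.2) else Config.thin ρ (Y ω) := by
  filter_upwards [hY.noAtom p.1] with ω hω
  rw [ins_of_notMem hω]
  split_ifs with h
  · rw [thin_add_le (hs ω) hω h, ins_of_notMem]
    rintro ⟨q, hq, hqp⟩
    rw [thin_pts (hs ω)] at hq
    obtain ⟨r, hr, rfl⟩ := hq
    exact hω ⟨r, hr.1, hqp⟩
  · exact thin_add_gt (hs ω) hω h

/-- Mean influence of a perturbation at `z` with mark `m` on `h`. -/
@[irreducible] def meanInfluence (μ : Measure Ω) (x : E d) (R h : Config d 𝕄 → ℝ) (ρ : E d → ℝ)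
    (X : Ω → Config d 𝕄) (z : E d) (m : 𝕄) : ℝ≥0∞ :=
  {z | 0 < ρ z}.indicator (fun z => ∫⁻ ω, influence x R h ((X ω).ins (z, m)) z ∂μ) z +
    ∫⁻ ω, influence x R h (X ω) z ∂μ

lemma measurable_meanInfluence (μ : Measure Ω) [SFinite μ] (x : E d) {R h : Config d 𝕄 → ℝ}
    (hR : Measurable R) (hh : Measurable h) {ρ : E d → ℝ} (hρ : Measurable ρ)
    {X : Ω → Config d 𝕄} (hX : Measurable X) :
    Measurable fun q : E d × 𝕄 => meanInfluence μ x R h ρ X q.1 q.2 := by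
  have hinf := measurable_influence x hR hh
  have h1 : Measurable fun q : E d × 𝕄 => ∫⁻ ω, influence x R h ((X ω).ins (q.1, q.2)) q.1 ∂μ := by
    have hg : Measurable fun r : (E d × 𝕄) × Ω => ((X r.2).ins (r.1.1, r.1.2), r.1.1) :=
      (measurable_ins (hX.comp measurable_snd) (by fun_prop)).prodMk measurable_fst.fst
    have hc := hinf.comp hg
    exact Measurable.lintegral_prod_right' hc
  have h2 : Measurable fun q : E d × 𝕄 => ∫⁻ ω, influence x R h (X ω) q.1 ∂μ := by
    have hg : Measurable fun r : (E d × 𝕄) × Ω => (X r.2, r.1.1) :=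
      (hX.comp measurable_snd).prodMk measurable_fst.fst
    have hc := hinf.comp hg
    exact Measurable.lintegral_prod_right' hc
  have hs : MeasurableSet {q : E d × 𝕄 | 0 < ρ q.1} :=
    measurableSet_lt (by fun_prop) (by fun_prop)
  simp only [meanInfluence]
  exact (h1.indicator hs).add h2

/-- The Mecke equation turns the sum over distinguishing points into an integral over positions,
marks and heights. A height that distinguishes the thinnings at `z` lies between the two densities,
whence the factor $|\rho_1(z)-\rho_2(z)|$. -/
lemma lintegral_enorm_sub_thin_le {μ : Measure Ω} [SFinite μ] {Y : Ω → Config d (ℝ × 𝕄)}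
    {K : Set (E d)} {H : ℝ} {Q : Measure 𝕄} [SFinite Q]
    (hY : IsMecke μ Y (heightMeasure K H Q)) (hs : ∀ ω, (Y ω).Simple) {ρ₁ ρ₂ : E d → ℝ}
    (hρ₁ : Measurable ρ₁) (hρ₂ : Measurable ρ₂) {x : E d} {R h : Config d 𝕄 → ℝ}
    (hR : Measurable R) (hh : Measurable h) (hloc : LocalAt x R h) :
    ∫⁻ ω, ‖h (Config.thin ρ₁ (Y ω)) - h (Config.thin ρ₂ (Y ω))‖ₑ ∂μ ≤
      ∫⁻ z in K, ∫⁻ m, ENNReal.ofReal |ρ₁ z - ρ₂ z| *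
        (meanInfluence μ x R h ρ₁ (fun ω => Config.thin ρ₁ (Y ω)) z m +
          meanInfluence μ x R h ρ₂ (fun ω => Config.thin ρ₂ (Y ω)) z m) ∂Q := by
  set D := {p : E d × ℝ × 𝕄 | (p.2.1 ≤ ρ₁ p.1 ↔ ¬ p.2.1 ≤ ρ₂ p.1)} with hDdef
  have hD : MeasurableSet D := by
    have h1 : MeasurableSet {p : E d × ℝ × 𝕄 | p.2.1 ≤ ρ₁ p.1} :=
      measurableSet_le (by fun_prop) (by fun_prop)
    have h2 : MeasurableSet {p : E d × ℝ × 𝕄 | p.2.1 ≤ ρ₂ p.1} :=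
      measurableSet_le (by fun_prop) (by fun_prop)
    exact h1.iff h2.compl
  have hinf := measurable_influence x hR hh
  have hIi : ∀ {ρ : E d → ℝ}, Measurable ρ → Measurable
      fun q : (E d × ℝ × 𝕄) × Config d (ℝ × 𝕄) => influence x R h (thin ρ q.2) q.1.1 :=
    fun {ρ} hρ => by
      have hg : Measurable fun q : (E d × ℝ × 𝕄) × Config d (ℝ × 𝕄) => (thin ρ q.2, q.1.1) :=
        ((measurable_thin hρ).comp measurable_snd).prodMk measurable_fst.fst
      exact hinf.comp hg
  let F : (E d × ℝ × 𝕄) × Config d (ℝ × 𝕄) → ℝ≥0∞ := fun q => (D ×ˢ univ).indicator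
    (fun q => influence x R h (thin ρ₁ q.2) q.1.1 + influence x R h (thin ρ₂ q.2) q.1.1) q
  have hF : Measurable F :=
    ((hIi hρ₁).add (hIi hρ₂)).indicator (hD.prod MeasurableSet.univ)
  have hthin : ∀ {ρ : E d → ℝ}, Measurable ρ → Measurable fun ω => Config.thin ρ (Y ω) :=
    fun hρ => (measurable_thin hρ).comp hY.measurable
  set X₁ := fun ω => Config.thin ρ₁ (Y ω)
  set X₂ := fun ω => Config.thin ρ₂ (Y ω)
  have hM₁ := measurable_meanInfluence μ x hR hh hρ₁ (hthin hρ₁)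
  have hM₂ := measurable_meanInfluence μ x hR hh hρ₂ (hthin hρ₂)
  -- A point above the graph of the density leaves the thinning unchanged; a point below it is
  -- inserted. As heights are positive, an insertion takes place only where the density is positive.
  -- This matters because the moment condition for the process on `W` permits insertions only at
  -- positions in `W`.
  have hone : ∀ (ρ : E d → ℝ), ∀ p : E d × ℝ × 𝕄, 0 < p.2.1 →
      ∫⁻ ω, influence x R h (Config.thin ρ ((Y ω).ins p)) p.1 ∂μ ≤
        meanInfluence μ x R h ρ (fun ω => Config.thin ρ (Y ω)) p.1 p.2.2 := by
    intro ρ p hp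
    by_cases hle : p.2.1 ≤ ρ p.1
    · rw [meanInfluence, indicator_of_mem (show p.1 ∈ {z | 0 < ρ z} from hp.trans_le hle)]
      refine le_trans (le_of_eq (lintegral_congr_ae ?_)) le_self_add
      filter_upwards [thin_ins_ae hY hs ρ p] with ω hω
      rw [hω, if_pos hle]
    · rw [meanInfluence]
      refine le_trans (le_of_eq (lintegral_congr_ae ?_)) le_add_self
      filter_upwards [thin_ins_ae hY hs ρ p] with ω hω
      rw [hω, if_neg hle]
  have hpos : ∀ᵐ p ∂(heightMeasure K H Q), 0 < p.2.1 := by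
    have h1 : ∀ᵐ t : ℝ ∂(volume.restrict (Ioc 0 H)), 0 < t :=
      (ae_restrict_mem measurableSet_Ioc).mono fun t ht => ht.1
    have h2 : ∀ᵐ q : ℝ × 𝕄 ∂((volume.restrict (Ioc 0 H)).prod Q), 0 < q.1 :=
      Measure.quasiMeasurePreserving_fst.ae h1
    exact Measure.quasiMeasurePreserving_snd.ae h2
  calc ∫⁻ ω, ‖h (X₁ ω) - h (X₂ ω)‖ₑ ∂μ
      ≤ ∫⁻ ω, ∫⁻ p, F (p, Y ω) ∂(Y ω).toMeasure ∂μ := by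
        refine lintegral_mono fun ω => ?_
        refine (enorm_sub_le_of_localAt hloc hρ₁ hρ₂ (hs ω)).trans (le_of_eq ?_)
        refine lintegral_congr fun p => ?_
        by_cases hp : p ∈ D
        · rw [indicator_of_mem (by exact hp)]
          simp only [F]
          rw [indicator_of_mem (by exact ⟨hp, mem_univ _⟩)]
        · rw [indicator_of_notMem (by exact hp)]
          simp only [F]
          rw [indicator_of_notMem (fun h => hp h.1)]
    _ = ∫⁻ p, ∫⁻ ω, F (p, (Y ω).ins p) ∂μ ∂(heightMeasure K H Q) := hY.mecke F hF
    _ ≤ ∫⁻ p, D.indicator (fun p => meanInfluence μ x R h ρ₁ X₁ p.1 p.2.2 +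
          meanInfluence μ x R h ρ₂ X₂ p.1 p.2.2) p ∂(heightMeasure K H Q) := by
        refine lintegral_mono_ae ?_
        filter_upwards [hpos] with p hp
        by_cases hpD : p ∈ D
        · simp only [F, mem_prod, hpD, mem_univ, and_true, indicator_of_mem]
          rw [MeasureTheory.lintegral_add_left]
          · exact add_le_add (hone ρ₁ p hp) (hone ρ₂ p hp)
          · have hg : Measurable fun ω => (p, (Y ω).ins p) :=
              measurable_const.prodMk (measurable_ins hY.measurable measurable_const)
            exact (hIi hρ₁).comp hg
        · simp [F, hpD]
    _ ≤ _ := by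
        rw [lintegral_heightMeasure]
        swap
        · have hg : Measurable fun p : E d × ℝ × 𝕄 => (p.1, p.2.2) := by fun_prop
          have hc₁ := hM₁.comp hg
          have hc₂ := hM₂.comp hg
          exact (hc₁.add hc₂).indicator hD
        refine lintegral_mono fun z => lintegral_mono fun m => ?_
        set c := meanInfluence μ x R h ρ₁ X₁ z m + meanInfluence μ x R h ρ₂ X₂ z m
        have e : ∀ t : ℝ, D.indicator (fun p => meanInfluence μ x R h ρ₁ X₁ p.1 p.2.2 +
            meanInfluence μ x R h ρ₂ X₂ p.1 p.2.2) (z, t, m) ≤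
            (Ioc (min (ρ₁ z) (ρ₂ z)) (max (ρ₁ z) (ρ₂ z))).indicator (fun _ => c) t := by
          intro t
          by_cases ht : (z, t, m) ∈ D
          · rw [indicator_of_mem ht, indicator_of_mem]
            change (t ≤ ρ₁ z ↔ ¬ t ≤ ρ₂ z) at ht
            simp only [mem_Ioc, min_lt_iff, le_max_iff]
            grind
          · rw [indicator_of_notMem ht]
            exact zero_le
        calc ∫⁻ t in Ioc 0 H, _ ≤ ∫⁻ t, _ := setLIntegral_le_lintegral _ _
          _ ≤ ∫⁻ t, (Ioc (min (ρ₁ z) (ρ₂ z)) (max (ρ₁ z) (ρ₂ z))).indicator (fun _ => c) t :=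
            lintegral_mono e
          _ = _ := by
            rw [lintegral_indicator_const measurableSet_Ioc, Real.volume_Ioc, max_sub_min_eq_abs,
              mul_comm, abs_sub_comm]

lemma meanInfluence_congr_law {Ω' : Type*} [MeasurableSpace Ω'] {μ : Measure Ω}
    {μ' : Measure Ω'} (x : E d) {R h : Config d 𝕄 → ℝ} (hR : Measurable R) (hh : Measurable h)
    (ρ : E d → ℝ) {X : Ω → Config d 𝕄} {X' : Ω' → Config d 𝕄} (hX : Measurable X)
    (hX' : Measurable X') (hlaw : μ.map X = μ'.map X') (z : E d) (m : 𝕄) :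
    meanInfluence μ x R h ρ X z m = meanInfluence μ' x R h ρ X' z m := by
  have hinf := measurable_influence x hR hh
  have h1 : Measurable fun S : Config d 𝕄 => influence x R h S z :=
    hinf.comp (measurable_id.prodMk measurable_const)
  have h2 : Measurable fun S : Config d 𝕄 => influence x R h (S.ins (z, m)) z :=
    h1.comp (measurable_ins measurable_id measurable_const)
  simp only [meanInfluence]
  rw [← lintegral_map h1 hX, ← lintegral_map h1 hX', hlaw]
  by_cases hz : z ∈ {z | 0 < ρ z}
  · rw [indicator_of_mem hz, indicator_of_mem hz, ← lintegral_map h2 hX, ← lintegral_map h2 hX',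
      hlaw]
  · rw [indicator_of_notMem hz, indicator_of_notMem hz]

/-- The functional `h` cut off where the radius exceeds `r`. -/
def cutoff (R h : Config d 𝕄 → ℝ) (r : ℝ) (S : Config d 𝕄) : ℝ := {S | R S ≤ r}.indicator h S

lemma measurable_cutoff {R h : Config d 𝕄 → ℝ} (hR : Measurable R) (hh : Measurable h) (r : ℝ) :
    Measurable (cutoff R h r) := hh.indicator (measurableSet_le hR measurable_const)

lemma LocalAt.cutoff {x : E d} {R h : Config d 𝕄 → ℝ} (hloc : LocalAt x R h) (r : ℝ) :
    LocalAt x R (cutoff R h r) := by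
  intro S S' hS
  obtain ⟨h1, h2⟩ := hloc S S' hS
  refine ⟨h1, ?_⟩
  simp only [StabScores.cutoff, indicator, mem_ofPred_eq, h1, h2]

lemma inBall_inBall_of_le (S : Config d 𝕄) (x : E d) {r r' : ℝ} (h : r ≤ r') :
    (S.inBall x r').inBall x r = S.inBall x r := by
  ext1
  simp only [inBall_pts, inter_assoc]
  rw [prod_inter_prod, univ_inter, inter_eq_right.2 (Metric.closedBall_subset_closedBall h)]

lemma LocalAt.inBall {x : E d} {R h : Config d 𝕄 → ℝ} (hloc : LocalAt x R h) (r : ℝ)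
    (S : Config d 𝕄) : (R (S.inBall x r) ≤ r ↔ R S ≤ r) ∧
      (R S ≤ r → R (S.inBall x r) = R S ∧ h (S.inBall x r) = h S) := by
  have h1 : R S ≤ r → R (S.inBall x r) = R S ∧ h (S.inBall x r) = h S := fun hS =>
    hloc S (S.inBall x r) (inBall_inBall_of_le S x hS).symm
  refine ⟨⟨fun hS => ?_, fun hS => ?_⟩, h1⟩
  · rw [(hloc (S.inBall x r) S (inBall_inBall_of_le S x hS)).1]
    exact hS
  · rw [(h1 hS).1]
    exact hS

/-- After the cutoff only the points in a fixed ball matter. In that ball the intensity is finite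
and the coupling exists. -/
lemma LocalAt.cutoff_inBall {x : E d} {R h : Config d 𝕄 → ℝ} (hloc : LocalAt x R h) (r : ℝ)
    (S : Config d 𝕄) : StabScores.cutoff R h r (S.inBall x r) = StabScores.cutoff R h r S := by
  by_cases hS : R S ≤ r
  · simp [StabScores.cutoff, hS, (hloc.inBall r S).2 hS]
  · simp [StabScores.cutoff, hS, (hloc.inBall r S).1]

lemma LocalAt.influence_cutoff_inBall {x : E d} {R h : Config d 𝕄 → ℝ} (hloc : LocalAt x R h)
    (r : ℝ) (S : Config d 𝕄) (z : E d) : influence x R (StabScores.cutoff R h r) (S.inBall x r) z =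
      influence x R (StabScores.cutoff R h r) S z := by
  simp only [influence]
  rw [hloc.cutoff_inBall]
  by_cases hS : R S ≤ r
  · rw [((hloc.inBall r S).2 hS).1]
  · simp [StabScores.cutoff, hS]

lemma influence_cutoff_le (x : E d) (R h : Config d 𝕄 → ℝ) (r : ℝ) (S : Config d 𝕄) (z : E d) :
    influence x R (cutoff R h r) S z ≤ influence x R h S z := by
  simp only [influence]
  refine indicator_le_indicator ?_
  by_cases hS : R S ≤ r <;> simp [cutoff, hS]

lemma inBall_ins {S : Config d 𝕄} {x : E d} {r : ℝ} {p : E d × 𝕄}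
    (hp : p.1 ∈ Metric.closedBall x r) : (S.inBall x r).ins p = (S.ins p).inBall x r := by
  have hiff : p.1 ∈ (S.inBall x r).proj ↔ p.1 ∈ S.proj := by
    constructor
    · rintro ⟨q, hq, h⟩
      exact ⟨q, hq.1, h⟩
    · rintro ⟨q, hq, h⟩
      exact ⟨q, ⟨hq, by rw [h]; exact hp, mem_univ _⟩, h⟩
  by_cases h : p.1 ∈ S.proj
  · rw [ins_of_mem h, ins_of_mem (hiff.2 h)]
  · rw [ins_of_notMem h, ins_of_notMem (fun h' => h (hiff.1 h'))]
    ext1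
    rw [add_pts, inBall_pts, inBall_pts, add_pts, insert_inter_of_mem (by exact ⟨hp, mem_univ _⟩)]

/-- The bound for the truncated problem is thereby estimated by quantities that do not involve the
ball, so that the ball can be exhausted. -/
lemma LocalAt.meanInfluence_cutoff_le {μ : Measure Ω} {x : E d} {R h : Config d 𝕄 → ℝ}
    (hloc : LocalAt x R h) (ρ : E d → ℝ) (X : Ω → Config d 𝕄) {r : ℝ} {z : E d}
    (hz : z ∈ Metric.closedBall x r) (m : 𝕄) :
    meanInfluence μ x R (StabScores.cutoff R h r) ρ (fun ω => (X ω).inBall x r) z m ≤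
      meanInfluence μ x R h ρ X z m := by
  simp only [meanInfluence]
  refine add_le_add ?_ (lintegral_mono fun ω => ?_)
  · refine indicator_le_indicator (lintegral_mono fun ω => ?_)
    rw [inBall_ins (p := (z, m)) hz, hloc.influence_cutoff_inBall]
    exact influence_cutoff_le _ _ _ _ _ _
  · rw [hloc.influence_cutoff_inBall]
    exact influence_cutoff_le _ _ _ _ _ _

lemma tendsto_integral_cutoff {μ : Measure Ω} {R h : Config d 𝕄 → ℝ} (hR : Measurable R)
    (hh : Measurable h) {X : Ω → Config d 𝕄} (hX : Measurable X)
    (hi : Integrable (fun ω => h (X ω)) μ) :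
    Tendsto (fun n : ℕ => ∫ ω, cutoff R h n (X ω) ∂μ) atTop (𝓝 (∫ ω, h (X ω) ∂μ)) := by
  refine tendsto_integral_of_dominated_convergence (fun ω => ‖h (X ω)‖) (fun n => ?_) hi.norm
    (fun n => Eventually.of_forall fun ω => ?_) (Eventually.of_forall fun ω => ?_)
  · exact ((measurable_cutoff hR hh n).comp hX).aestronglyMeasurable
  · exact norm_indicator_le_norm_self _ _
  · refine tendsto_const_nhds.congr' ?_
    obtain ⟨N, hN⟩ := exists_nat_ge (R (X ω))
    filter_upwards [eventually_ge_atTop N] with n hn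
    have : R (X ω) ≤ (n : ℝ) := hN.trans (by exact_mod_cast hn)
    simp [cutoff, this]

/-- Comparison of the means of a localized functional under two Poisson processes. -/
theorem enorm_integral_sub_le [NullSingletonClass (volume : Measure (E d))] {μ : Measure Ω}
    [IsProbabilityMeasure μ] {Q : Measure 𝕄} [IsProbabilityMeasure Q] {ρ₁ ρ₂ : E d → ℝ}
    (hρ₁ : Measurable ρ₁) (hρ₂ : Measurable ρ₂) {H : ℝ} (hH₁ : ∀ z, ρ₁ z ≤ H)
    (hH₂ : ∀ z, ρ₂ z ≤ H) {P₁ P₂ : Ω → Config d 𝕄} (hP₁ : IsMecke μ P₁ (intensity ρ₁ Q))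
    (hP₂ : IsMecke μ P₂ (intensity ρ₂ Q)) {x : E d} {R h : Config d 𝕄 → ℝ}
    (hR : Measurable R) (hh : Measurable h) (hloc : LocalAt x R h)
    (hi₁ : Integrable (fun ω => h (P₁ ω)) μ) (hi₂ : Integrable (fun ω => h (P₂ ω)) μ) :
    ‖∫ ω, h (P₁ ω) ∂μ - ∫ ω, h (P₂ ω) ∂μ‖ₑ ≤
      ∫⁻ z, ∫⁻ m, ENNReal.ofReal |ρ₁ z - ρ₂ z| *
        (meanInfluence μ x R h ρ₁ P₁ z m + meanInfluence μ x R h ρ₂ P₂ z m) ∂Q := by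
  -- Dominated convergence reduces the claim to the functional cut off at radius `n`, with a bound
  -- independent of `n`.
  have hlim : Tendsto (fun n : ℕ => ‖∫ ω, cutoff R h n (P₁ ω) ∂μ - ∫ ω, cutoff R h n (P₂ ω) ∂μ‖ₑ)
      atTop (𝓝 ‖∫ ω, h (P₁ ω) ∂μ - ∫ ω, h (P₂ ω) ∂μ‖ₑ) :=
    ((tendsto_integral_cutoff hR hh hP₁.measurable hi₁).sub
      (tendsto_integral_cutoff hR hh hP₂.measurable hi₂)).enorm
  refine le_of_tendsto hlim (Eventually.of_forall fun n => ?_)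
  set K := Metric.closedBall x (n : ℝ) with hKdef
  have hK : MeasurableSet K := Metric.isClosed_closedBall.measurableSet
  have : IsFiniteMeasure (volume.restrict K) := ⟨by
    rw [Measure.restrict_apply_univ]; exact measure_closedBall_lt_top⟩
  have : IsFiniteMeasure (heightMeasure K H Q) := by unfold heightMeasure; infer_instance
  have h0 : ∀ z : E d, heightMeasure K H Q ({z} ×ˢ univ) = 0 := by
    intro z
    rw [heightMeasure, Measure.prod_prod, measure_singleton, zero_mul]
  -- The coupling lives on the space of tuples; no relation between `P₁` and `P₂` on the original
  -- space is used.
  have hY := isMecke_tupleLaw (heightMeasure K H Q) h0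
  have hs : ∀ y : (Σ n : ℕ, Fin n → E d × ℝ × 𝕄), (ofTuple y.2).Simple :=
    fun y => simple_ofTuple y.2
  have hT₁ := hY.thin hK hs hρ₁ hH₁
  have hT₂ := hY.thin hK hs hρ₂ hH₂
  have hB₁ := hP₁.restr hK
  have hB₂ := hP₂.restr hK
  rw [restrict_intensity hK] at hB₁ hB₂
  -- Both the thinning and the restriction of the given process satisfy the Mecke equation with the
  -- same intensity, hence have the same law.
  have hl₁ := hT₁.map_eq hB₁
  have hl₂ := hT₂.map_eq hB₂
  have hcm := measurable_cutoff hR hh n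
  have hint : ∀ {ρ : E d → ℝ} {P : Ω → Config d 𝕄}, Measurable P →
      Measurable (fun y : (Σ n : ℕ, Fin n → E d × ℝ × 𝕄) => Config.thin ρ (ofTuple y.2)) →
      (tupleLaw (heightMeasure K H Q)).map (fun y => Config.thin ρ (ofTuple y.2)) =
        μ.map (fun ω => (P ω).restr K) → Measurable (fun ω => (P ω).restr K) →
      ∫ ω, cutoff R h n (P ω) ∂μ =
        ∫ y, cutoff R h n (Config.thin ρ (ofTuple y.2)) ∂(tupleLaw (heightMeasure K H Q)) ∧
      (Integrable (fun ω => h (P ω)) μ → Integrable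
        (fun y => cutoff R h n (Config.thin ρ (ofTuple y.2))) (tupleLaw (heightMeasure K H Q))) := by
    intro ρ P hP hTm hl hPm
    have e : ∀ ω, cutoff R h n (P ω) = cutoff R h n ((P ω).restr K) := fun ω =>
      (hloc.cutoff_inBall n (P ω)).symm
    constructor
    · simp only [e]
      rw [← integral_map (φ := fun ω => (P ω).restr K) hPm.aemeasurable
        hcm.aestronglyMeasurable, ← hl, integral_map hTm.aemeasurable hcm.aestronglyMeasurable]
    · intro hi
      have h1 : Integrable (fun ω => cutoff R h n ((P ω).restr K)) μ := by
        simp only [← e]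
        refine hi.mono (hcm.comp hP).aestronglyMeasurable (Eventually.of_forall fun ω => ?_)
        exact norm_indicator_le_norm_self _ _
      have h2 : Integrable (cutoff R h n) (μ.map fun ω => (P ω).restr K) :=
        (integrable_map_measure hcm.aestronglyMeasurable hPm.aemeasurable).2 h1
      rw [← hl] at h2
      exact (integrable_map_measure hcm.aestronglyMeasurable hTm.aemeasurable).1 h2
  obtain ⟨a₁, b₁⟩ := hint hP₁.measurable hT₁.measurable hl₁ hB₁.measurable
  obtain ⟨a₂, b₂⟩ := hint hP₂.measurable hT₂.measurable hl₂ hB₂.measurable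
  rw [a₁, a₂, ← integral_sub (b₁ hi₁) (b₂ hi₂)]
  refine (enorm_integral_le_lintegral_enorm _).trans ?_
  refine (lintegral_enorm_sub_thin_le hY hs hρ₁ hρ₂ hR hcm (hloc.cutoff n)).trans ?_
  refine le_trans ?_ (setLIntegral_le_lintegral K _)
  refine setLIntegral_mono' hK fun z hz => lintegral_mono fun m => ?_
  rw [meanInfluence_congr_law x hR hcm ρ₁ hT₁.measurable hB₁.measurable hl₁,
    meanInfluence_congr_law x hR hcm ρ₂ hT₂.measurable hB₂.measurable hl₂]
  gcongr
  · exact hloc.meanInfluence_cutoff_le ρ₁ P₁ hz m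
  · exact hloc.meanInfluence_cutoff_le ρ₂ P₂ hz m

end StabScores

end

/-! ### Stabilizing sites, and comparison in the presence of independent marks -/

noncomputable section

namespace StabScores

variable {d : ℕ} {𝕄 : Type*}

open Config

namespace Config

lemma mem_proj_of_inBall_eq {S S' : Config d 𝕄} {x y : E d} {r : ℝ}
    (h : S.inBall x r = S'.inBall x r) (hy : dist y x ≤ r) : y ∈ S.proj → y ∈ S'.proj := by
  rintro ⟨p, hp, rfl⟩
  have : p ∈ (S.inBall x r).pts := ⟨hp, hy, mem_univ _⟩
  rw [h] at this
  exact ⟨p, this.1, rfl⟩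

lemma inBall_eq_of_subset {S S' : Config d 𝕄} {x y : E d} {r t : ℝ}
    (h : S.inBall x r = S'.inBall x r) (hsub : Metric.closedBall y t ⊆ Metric.closedBall x r) :
    S.inBall y t = S'.inBall y t := by
  have key : ∀ S : Config d 𝕄, S.inBall y t = (S.inBall x r).inBall y t := by
    intro S
    ext1
    simp only [inBall_pts, inter_assoc]
    rw [prod_inter_prod, univ_inter, inter_eq_right.2 hsub]
  rw [key S, key S', h]

lemma addFinset_inBall_congr {S S' : Config d 𝕄} {x : E d} {r : ℝ}
    (h : S.inBall x r = S'.inBall x r) (F : Finset (E d × 𝕄)) :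
    (S.addFinset F).inBall x r = (S'.addFinset F).inBall x r := by
  ext1
  have := congrArg Config.pts h
  simp only [inBall_pts, addFinset_pts, union_inter_distrib_right] at this ⊢
  rw [this]

lemma subset_ins (S : Config d 𝕄) (p : E d × 𝕄) : S.pts ⊆ (S.ins p).pts := by
  by_cases h : p.1 ∈ S.proj
  · rw [ins_of_mem h]
  · rw [ins_of_notMem h, add_pts]
    exact subset_insert _ _

end Config

variable [MeasurableSpace 𝕄]

/-- A functional `η` of a mark and a configuration that stabilizes within the ball of radius `r`
around `a`. -/
structure IsSite (a : E d) (η r : 𝕄 → Config d 𝕄 → ℝ) : Prop where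
  measurable_score : Measurable (Function.uncurry η)
  measurable_radius : Measurable (Function.uncurry r)
  nonneg : ∀ m (S : Config d 𝕄), 0 ≤ r m S
  stab : ∀ m (S : Config d 𝕄) (F : Finset (E d × 𝕄)), F.card ≤ 9 →
    η m ((S.addFinset F).inBall a (r m S)) = η m (S.addFinset F)
  mono : ∀ m (S T : Config d 𝕄), S.pts ⊆ T.pts → r m T ≤ r m S
  loc : ∀ m (S : Config d 𝕄) (t : ℝ), 0 ≤ t → (r m S ≤ t ↔ r m (S.inBall a t) ≤ t)

namespace IsSite

variable {a : E d} {η r : 𝕄 → Config d 𝕄 → ℝ}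

/-- Local determination of the event that the radius of `S` is at most its own value gives one
inequality. Since the ball of `S'` is then the smaller one, the configurations agree there too, and
the argument can be reversed. -/
lemma radius_eq (hs : IsSite a η r) {m : 𝕄} {S S' : Config d 𝕄}
    (h : S.inBall a (r m S) = S'.inBall a (r m S)) : r m S' = r m S := by
  have h1 : r m S' ≤ r m S := by
    rw [hs.loc m S' _ (hs.nonneg m S), ← h, ← hs.loc m S _ (hs.nonneg m S)]
  refine le_antisymm h1 ?_
  have h' := inBall_eq_of_subset h (Metric.closedBall_subset_closedBall (x := a) h1)
  rw [hs.loc m S _ (hs.nonneg m S'), h', ← hs.loc m S' _ (hs.nonneg m S')]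

lemma score_addFinset_eq (hs : IsSite a η r) {m : 𝕄} {S S' : Config d 𝕄}
    (h : S.inBall a (r m S) = S'.inBall a (r m S)) {F : Finset (E d × 𝕄)} (hF : F.card ≤ 9) :
    η m (S'.addFinset F) = η m (S.addFinset F) := by
  rw [← hs.stab m S F hF, ← hs.stab m S' F hF, hs.radius_eq h, addFinset_inBall_congr h]

lemma score_eq (hs : IsSite a η r) {m : 𝕄} {S S' : Config d 𝕄}
    (h : S.inBall a (r m S) = S'.inBall a (r m S)) : η m S' = η m S := by
  have := hs.score_addFinset_eq h (F := ∅) (by simp)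
  rwa [addFinset_empty, addFinset_empty] at this

/-- The value of `ins` depends on whether the position is occupied, possibly far outside the ball;
this has to be assumed to agree. -/
lemma score_ins_eq (hs : IsSite a η r) {m : 𝕄} {S S' : Config d 𝕄}
    (h : S.inBall a (r m S) = S'.inBall a (r m S)) {p : E d × 𝕄}
    (hp : p.1 ∈ S.proj ↔ p.1 ∈ S'.proj) : η m (S'.ins p) = η m (S.ins p) := by
  by_cases hpS : p.1 ∈ S.proj
  · rw [ins_of_mem hpS, ins_of_mem (hp.1 hpS), hs.score_eq h]
  · rw [ins_of_notMem hpS, ins_of_notMem (fun h' => hpS (hp.2 h'))]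
    exact hs.score_addFinset_eq h (F := {p}) (by simp)

lemma localAt (hs : IsSite a η r) (m : 𝕄) : LocalAt a (r m) (η m) :=
  fun _ _ h => ⟨hs.radius_eq h, hs.score_eq h⟩

/-- Points farther away than the radius of stabilization do not matter. -/
lemma score_ins_of_lt (hs : IsSite a η r) {m : 𝕄} {S : Config d 𝕄} {p : E d × 𝕄}
    (hp : r m S < dist p.1 a) : η m (S.ins p) = η m S := by
  by_cases hpS : p.1 ∈ S.proj
  · rw [ins_of_mem hpS]
  · rw [ins_of_notMem hpS, Config.add, ← hs.stab m S {p} (by simp)]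
    have h0 := hs.stab m S ∅ (by simp)
    rw [addFinset_empty] at h0
    rw [← h0]
    congr 1
    ext1
    rw [inBall_pts, inBall_pts, addFinset_pts, union_inter_distrib_right]
    have : (({p} : Finset (E d × 𝕄)) : Set (E d × 𝕄)) ∩ Metric.closedBall a (r m S) ×ˢ univ = ∅ := by
      rw [Finset.coe_singleton, singleton_inter_eq_empty]
      rintro ⟨h, -⟩
      exact absurd (Metric.mem_closedBall.1 h) (not_le.2 hp)
    rw [this, union_empty]

end IsSite

/-- Cauchy-Schwarz separates the indicator from the product, and a second application separates the
two squares. Hence fourth moments suffice. -/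
lemma lintegral_mul_indicator_le {α : Type*} [MeasurableSpace α] {ν : Measure α}
    [IsProbabilityMeasure ν] {u v : α → ℝ≥0∞} (hu : AEMeasurable u ν) (hv : AEMeasurable v ν)
    {K₁ K₂ : ℝ≥0∞} (hK₁ : ∫⁻ t, u t ^ 4 ∂ν ≤ K₁ ^ 4) (hK₂ : ∫⁻ t, v t ^ 4 ∂ν ≤ K₂ ^ 4)
    {A : Set α} (hA : MeasurableSet A) :
    ∫⁻ t, A.indicator (fun t => u t * v t) t ∂ν ≤ K₁ * K₂ * ν A ^ (1 / 2 : ℝ) := by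
  have hpq : (2 : ℝ).HolderConjugate 2 := Real.HolderConjugate.two_two
  have key : ∀ {f g : α → ℝ≥0∞}, AEMeasurable f ν → AEMeasurable g ν →
      ∫⁻ t, f t * g t ∂ν ≤
        (∫⁻ t, f t ^ 2 ∂ν) ^ (1 / 2 : ℝ) * (∫⁻ t, g t ^ 2 ∂ν) ^ (1 / 2 : ℝ) := by
    intro f g hf hg
    have := ENNReal.lintegral_mul_le_Lp_mul_Lq ν hpq hf hg
    simpa only [Pi.mul_apply, ENNReal.rpow_two] using this
  have hroot : ∀ {b c : ℝ≥0∞}, b ≤ c ^ 2 → b ^ (1 / 2 : ℝ) ≤ c := by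
    intro b c h
    calc b ^ (1 / 2 : ℝ) ≤ (c ^ 2) ^ (1 / 2 : ℝ) := ENNReal.rpow_le_rpow h (by norm_num)
      _ = c := by rw [← ENNReal.rpow_natCast, ← ENNReal.rpow_mul]; norm_num
  have h1 : ∫⁻ t, (u t * v t) ^ 2 ∂ν ≤ (K₁ * K₂) ^ 2 := by
    have e : ∀ t, (u t * v t) ^ 2 = u t ^ 2 * v t ^ 2 := fun t => mul_pow _ _ _
    simp only [e]
    refine (key (hu.pow_const 2) (hv.pow_const 2)).trans ?_
    rw [mul_pow]
    refine mul_le_mul' (hroot ?_) (hroot ?_)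
    · simpa [← pow_mul] using hK₁
    · simpa [← pow_mul] using hK₂
  have h2 : ∀ t, A.indicator (fun t => u t * v t) t = (u t * v t) * A.indicator 1 t := by
    intro t
    by_cases ht : t ∈ A <;> simp [ht]
  simp only [h2]
  refine (key (hu.mul hv) ((measurable_one.indicator hA).aemeasurable)).trans ?_
  refine mul_le_mul' (hroot h1) (le_of_eq ?_)
  congr 1
  rw [← lintegral_indicator_one hA]
  refine lintegral_congr fun t => ?_
  by_cases ht : t ∈ A <;> simp [ht]

/-- Splitting the exponent 1/2 into two quarters retains smallness from both events at once. In the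
applications one event says that a radius exceeds a third of the distance of the two sites, the
other that a radius reaches the perturbed point. -/
lemma lintegral_mul_indicator_inter_le {α : Type*} [MeasurableSpace α] {ν : Measure α}
    [IsProbabilityMeasure ν] {u v : α → ℝ≥0∞} (hu : AEMeasurable u ν) (hv : AEMeasurable v ν)
    {K₁ K₂ : ℝ≥0∞} (hK₁ : ∫⁻ t, u t ^ 4 ∂ν ≤ K₁ ^ 4) (hK₂ : ∫⁻ t, v t ^ 4 ∂ν ≤ K₂ ^ 4)
    {A B : Set α} (hA : MeasurableSet A) (hB : MeasurableSet B) {ε δ : ℝ≥0∞} (hε : ν A ≤ ε)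
    (hδ : ν B ≤ δ) :
    ∫⁻ t, (A ∩ B).indicator (fun t => u t * v t) t ∂ν ≤
      K₁ * K₂ * (ε ^ (1 / 4 : ℝ) * δ ^ (1 / 4 : ℝ)) := by
  refine (lintegral_mul_indicator_le hu hv hK₁ hK₂ (hA.inter hB)).trans ?_
  gcongr
  have hsplit : ν (A ∩ B) ^ (1 / 2 : ℝ) =
      ν (A ∩ B) ^ (1 / 4 : ℝ) * ν (A ∩ B) ^ (1 / 4 : ℝ) := by
    rw [← ENNReal.rpow_add_of_nonneg _ _ (by norm_num) (by norm_num)]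
    norm_num
  rw [hsplit]
  gcongr
  · exact (measure_mono inter_subset_left).trans hε
  · exact (measure_mono inter_subset_right).trans hδ

variable {Ω : Type*} [MeasurableSpace Ω]

lemma measurable_influence_param {α : Type*} [MeasurableSpace α] (x : E d)
    {R h : α → Config d 𝕄 → ℝ} (hR : Measurable (Function.uncurry R))
    (hh : Measurable (Function.uncurry h)) :
    Measurable fun q : α × Config d 𝕄 × E d => influence x (R q.1) (h q.1) q.2.1 q.2.2 := by
  have hR' : Measurable fun q : α × Config d 𝕄 × E d => R q.1 q.2.1 :=
    hR.comp (measurable_fst.prodMk measurable_snd.fst)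
  have hh' : Measurable fun q : α × Config d 𝕄 × E d => h q.1 q.2.1 :=
    hh.comp (measurable_fst.prodMk measurable_snd.fst)
  have hs : MeasurableSet {q : α × Config d 𝕄 × E d | dist q.2.2 x ≤ R q.1 q.2.1} :=
    measurableSet_le (by fun_prop) hR'
  have hm : Measurable fun q : α × Config d 𝕄 × E d => ‖h q.1 q.2.1‖ₑ := hh'.enorm
  simp only [influence]
  exact hm.indicator hs

/-- Comparison of the means of a localized functional with additional independent marks. -/
lemma enorm_integral_sub_le_param [NullSingletonClass (volume : Measure (E d))] {𝕃 : Type*}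
    [MeasurableSpace 𝕃] {L : Measure 𝕃} [IsProbabilityMeasure L] {μ : Measure Ω}
    [IsProbabilityMeasure μ] {Q : Measure 𝕄} [IsProbabilityMeasure Q] {ρ₁ ρ₂ : E d → ℝ}
    (hρ₁ : Measurable ρ₁) (hρ₂ : Measurable ρ₂) {b : ℝ} (hb₁ : ∀ z, ρ₁ z ≤ b)
    (hb₂ : ∀ z, ρ₂ z ≤ b) {P₁ P₂ : Ω → Config d 𝕄} (hP₁ : IsMecke μ P₁ (intensity ρ₁ Q))
    (hP₂ : IsMecke μ P₂ (intensity ρ₂ Q)) {x : E d} {R H : 𝕃 → Config d 𝕄 → ℝ}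
    (hR : Measurable (Function.uncurry R)) (hH : Measurable (Function.uncurry H))
    (hloc : ∀ l, LocalAt x (R l) (H l))
    (hi₁ : Integrable (fun q : Ω × 𝕃 => H q.2 (P₁ q.1)) (μ.prod L))
    (hi₂ : Integrable (fun q : Ω × 𝕃 => H q.2 (P₂ q.1)) (μ.prod L)) {U : E d → ℝ≥0∞}
    (hU₁ : ∀ᵐ z, 0 < ρ₁ z → ∫⁻ q : Ω × 𝕃 × 𝕄,
      influence x (R q.2.1) (H q.2.1) ((P₁ q.1).ins (z, q.2.2)) z ∂(μ.prod (L.prod Q)) ≤ U z)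
    (hU₁' : ∀ᵐ z, ∫⁻ q : Ω × 𝕃, influence x (R q.2) (H q.2) (P₁ q.1) z ∂(μ.prod L) ≤ U z)
    (hU₂ : ∀ᵐ z, 0 < ρ₂ z → ∫⁻ q : Ω × 𝕃 × 𝕄,
      influence x (R q.2.1) (H q.2.1) ((P₂ q.1).ins (z, q.2.2)) z ∂(μ.prod (L.prod Q)) ≤ U z)
    (hU₂' : ∀ᵐ z, ∫⁻ q : Ω × 𝕃, influence x (R q.2) (H q.2) (P₂ q.1) z ∂(μ.prod L) ≤ U z) :
    ‖∫ q : Ω × 𝕃, H q.2 (P₁ q.1) ∂(μ.prod L) - ∫ q : Ω × 𝕃, H q.2 (P₂ q.1) ∂(μ.prod L)‖ₑ ≤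
      ∫⁻ z, ENNReal.ofReal |ρ₁ z - ρ₂ z| * (4 * U z) := by
  have hinf := measurable_influence_param x hR hH
  have hMI : ∀ {P : Ω → Config d 𝕄} {ρ : E d → ℝ}, Measurable P → Measurable ρ →
      Measurable fun q : 𝕃 × E d × 𝕄 => meanInfluence μ x (R q.1) (H q.1) ρ P q.2.1 q.2.2 := by
    intro P ρ hP hρ
    have hg1 : Measurable fun r : (𝕃 × E d × 𝕄) × Ω =>
        (r.1.1, (P r.2).ins (r.1.2.1, r.1.2.2), r.1.2.1) :=
      measurable_fst.fst.prodMk ((measurable_ins (hP.comp measurable_snd) (by fun_prop)).prodMk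
        measurable_fst.snd.fst)
    have hg2 : Measurable fun r : (𝕃 × E d × 𝕄) × Ω => (r.1.1, P r.2, r.1.2.1) :=
      measurable_fst.fst.prodMk ((hP.comp measurable_snd).prodMk measurable_fst.snd.fst)
    have hc1 := (hinf.comp hg1).lintegral_prod_right' (ν := μ)
    have hc2 := (hinf.comp hg2).lintegral_prod_right' (ν := μ)
    have hs : MeasurableSet {q : 𝕃 × E d × 𝕄 | 0 < ρ q.2.1} :=
      measurableSet_lt (by fun_prop) (by fun_prop)
    simp only [meanInfluence]
    exact (hc1.indicator hs).add hc2
  -- The terms with and without insertion contribute `U z` each; with two inputs this makes the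
  -- factor 4.
  have hbound : ∀ {P : Ω → Config d 𝕄} {ρ : E d → ℝ}, Measurable P → Measurable ρ → ∀ z,
      (0 < ρ z → ∫⁻ q : Ω × 𝕃 × 𝕄,
        influence x (R q.2.1) (H q.2.1) ((P q.1).ins (z, q.2.2)) z ∂(μ.prod (L.prod Q)) ≤ U z) →
      (∫⁻ q : Ω × 𝕃, influence x (R q.2) (H q.2) (P q.1) z ∂(μ.prod L) ≤ U z) →
      ∫⁻ l, ∫⁻ m, meanInfluence μ x (R l) (H l) ρ P z m ∂Q ∂L ≤ 2 * U z := by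
    intro P ρ hP hρ z h1 h2
    have hg1 : Measurable fun r : (𝕃 × 𝕄) × Ω => (r.1.1, (P r.2).ins (z, r.1.2), z) :=
      measurable_fst.fst.prodMk ((measurable_ins (hP.comp measurable_snd) (by fun_prop)).prodMk
        measurable_const)
    have hg2 : Measurable fun r : 𝕃 × Ω => (r.1, P r.2, z) :=
      measurable_fst.prodMk ((hP.comp measurable_snd).prodMk measurable_const)
    have hc1 := hinf.comp hg1
    have hc2 := hinf.comp hg2
    have e2 : ∫⁻ l, ∫⁻ ω, influence x (R l) (H l) (P ω) z ∂μ ∂L ≤ U z := by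
      refine le_trans (le_of_eq ?_) h2
      rw [lintegral_prod_symm (fun q : Ω × 𝕃 => influence x (R q.2) (H q.2) (P q.1) z)
        (hc2.comp measurable_swap).aemeasurable]
    simp only [meanInfluence]
    have hsplit : ∀ l, ∫⁻ m, ({z | 0 < ρ z}.indicator
        (fun z => ∫⁻ ω, influence x (R l) (H l) ((P ω).ins (z, m)) z ∂μ) z +
        ∫⁻ ω, influence x (R l) (H l) (P ω) z ∂μ) ∂Q =
        ∫⁻ m, {z | 0 < ρ z}.indicator
          (fun z => ∫⁻ ω, influence x (R l) (H l) ((P ω).ins (z, m)) z ∂μ) z ∂Q +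
        ∫⁻ ω, influence x (R l) (H l) (P ω) z ∂μ := by
      intro l
      rw [lintegral_add_right _ measurable_const]
      simp
    simp only [hsplit]
    have hc2' : Measurable fun l => ∫⁻ ω, influence x (R l) (H l) (P ω) z ∂μ :=
      hc2.lintegral_prod_right'
    rw [lintegral_add_right _ hc2', two_mul]
    refine add_le_add ?_ e2
    by_cases hz : 0 < ρ z
    · refine le_trans (le_of_eq ?_) (h1 hz)
      simp only [indicator_of_mem (show z ∈ {z | 0 < ρ z} from hz)]
      rw [lintegral_prod_symm (fun q : Ω × 𝕃 × 𝕄 =>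
        influence x (R q.2.1) (H q.2.1) ((P q.1).ins (z, q.2.2)) z)
        (hc1.comp measurable_swap).aemeasurable]
      exact (lintegral_prod (fun q : 𝕃 × 𝕄 =>
        ∫⁻ ω, influence x (R q.1) (H q.1) ((P ω).ins (z, q.2)) z ∂μ)
        hc1.lintegral_prod_right'.aemeasurable).symm
    · simp only [indicator_of_notMem (show z ∉ {z | 0 < ρ z} from hz)]
      simp
  have hswap : ∀ {P : Ω → Config d 𝕄}, Integrable (fun q : Ω × 𝕃 => H q.2 (P q.1)) (μ.prod L) →
      ∫ q : Ω × 𝕃, H q.2 (P q.1) ∂(μ.prod L) = ∫ l, ∫ ω, H l (P ω) ∂μ ∂L := fun hi =>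
    integral_prod_symm _ hi
  -- The marks are integrated last: for a fixed mark the functional is localized and
  -- `enorm_integral_sub_le` applies.
  rw [hswap hi₁, hswap hi₂, ← integral_sub hi₁.integral_prod_right hi₂.integral_prod_right]
  refine (enorm_integral_le_lintegral_enorm _).trans ?_
  have hM₁ := hMI hP₁.measurable hρ₁
  have hM₂ := hMI hP₂.measurable hρ₂
  calc ∫⁻ l, ‖∫ ω, H l (P₁ ω) ∂μ - ∫ ω, H l (P₂ ω) ∂μ‖ₑ ∂L
      ≤ ∫⁻ l, ∫⁻ z, ∫⁻ m, ENNReal.ofReal |ρ₁ z - ρ₂ z| *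
        (meanInfluence μ x (R l) (H l) ρ₁ P₁ z m + meanInfluence μ x (R l) (H l) ρ₂ P₂ z m) ∂Q
        ∂volume ∂L := by
        refine lintegral_mono_ae ?_
        filter_upwards [hi₁.prod_left_ae, hi₂.prod_left_ae] with l h1 h2
        exact enorm_integral_sub_le hρ₁ hρ₂ hb₁ hb₂ hP₁ hP₂ (hR.comp measurable_prodMk_left)
          (hH.comp measurable_prodMk_left) (hloc l) h1 h2
    _ = ∫⁻ z, ∫⁻ l, ∫⁻ m, ENNReal.ofReal |ρ₁ z - ρ₂ z| *
        (meanInfluence μ x (R l) (H l) ρ₁ P₁ z m + meanInfluence μ x (R l) (H l) ρ₂ P₂ z m) ∂Q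
        ∂L := by
        refine lintegral_lintegral_swap ?_
        have h3 : Measurable fun r : (𝕃 × E d) × 𝕄 => ENNReal.ofReal |ρ₁ r.1.2 - ρ₂ r.1.2| *
            (meanInfluence μ x (R r.1.1) (H r.1.1) ρ₁ P₁ r.1.2 r.2 +
              meanInfluence μ x (R r.1.1) (H r.1.1) ρ₂ P₂ r.1.2 r.2) := by
          have hg : Measurable fun r : (𝕃 × E d) × 𝕄 => (r.1.1, r.1.2, r.2) := by fun_prop
          have k1 := hM₁.comp hg
          have k2 := hM₂.comp hg
          have k0 : Measurable fun r : (𝕃 × E d) × 𝕄 => ENNReal.ofReal |ρ₁ r.1.2 - ρ₂ r.1.2| := by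
            fun_prop
          exact k0.mul (k1.add k2)
        exact h3.lintegral_prod_right'.aemeasurable
    _ ≤ ∫⁻ z, ENNReal.ofReal |ρ₁ z - ρ₂ z| * (4 * U z) := by
        refine lintegral_mono_ae ?_
        filter_upwards [hU₁, hU₁', hU₂, hU₂'] with z h1 h1' h2 h2'
        have m1 : Measurable fun q : 𝕃 × 𝕄 => meanInfluence μ x (R q.1) (H q.1) ρ₁ P₁ z q.2 := by
          have hg : Measurable fun r : 𝕃 × 𝕄 => (r.1, z, r.2) := by fun_prop
          exact hM₁.comp hg
        have m2 : Measurable fun q : 𝕃 × 𝕄 => meanInfluence μ x (R q.1) (H q.1) ρ₂ P₂ z q.2 := by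
          have hg : Measurable fun r : 𝕃 × 𝕄 => (r.1, z, r.2) := by fun_prop
          exact hM₂.comp hg
        have m1' : ∀ l, Measurable fun m => meanInfluence μ x (R l) (H l) ρ₁ P₁ z m :=
          fun l => m1.comp (measurable_prodMk_left (x := l))
        have m2' : ∀ l, Measurable fun m => meanInfluence μ x (R l) (H l) ρ₂ P₂ z m :=
          fun l => m2.comp (measurable_prodMk_left (x := l))
        have m1'' : Measurable fun l => ∫⁻ m, meanInfluence μ x (R l) (H l) ρ₁ P₁ z m ∂Q :=
          m1.lintegral_prod_right'
        have m2'' : Measurable fun l => ∫⁻ m, meanInfluence μ x (R l) (H l) ρ₂ P₂ z m ∂Q :=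
          m2.lintegral_prod_right'
        have e : ∀ l, ∫⁻ m, ENNReal.ofReal |ρ₁ z - ρ₂ z| *
            (meanInfluence μ x (R l) (H l) ρ₁ P₁ z m + meanInfluence μ x (R l) (H l) ρ₂ P₂ z m) ∂Q =
            ENNReal.ofReal |ρ₁ z - ρ₂ z| * (∫⁻ m, meanInfluence μ x (R l) (H l) ρ₁ P₁ z m ∂Q +
              ∫⁻ m, meanInfluence μ x (R l) (H l) ρ₂ P₂ z m ∂Q) := by
          intro l
          rw [lintegral_const_mul _ ((m1' l).fun_add (m2' l))]
          congr 1
          exact MeasureTheory.lintegral_add_left (m1' l) _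
        simp only [e]
        rw [lintegral_const_mul _ (m1''.fun_add m2'')]
        gcongr
        rw [MeasureTheory.lintegral_add_left m1'']
        calc _ ≤ 2 * U z + 2 * U z := add_le_add (hbound hP₁.measurable hρ₁ z h1 h1')
              (hbound hP₂.measurable hρ₂ z h2 h2')
          _ = 4 * U z := by ring

end StabScores

end

/-! ### Comparison of means in terms of fourth moments and tails -/

noncomputable section

namespace StabScores

variable {d : ℕ} {𝕄 Ω : Type*} [MeasurableSpace 𝕄] [MeasurableSpace Ω]

open Config

section Compare

variable {𝕃 : Type*} [MeasurableSpace 𝕃]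

/-- Here `T` is the input `T₀`, possibly with a point inserted. Tails are assumed only for inputs
without inserted points, moments also with them. Monotonicity of the radius and of `G` moves the
events from `T` to `T₀`, while the moments stay at `T`. -/
lemma lintegral_influence_le {α : Type*} [MeasurableSpace α] {ν : Measure α}
    [IsProbabilityMeasure ν] {x : E d} {R H u v : 𝕃 → Config d 𝕄 → ℝ} {G : Set (𝕃 × Config d 𝕄)}
    (hR : Measurable (Function.uncurry R)) (hu : Measurable (Function.uncurry u))
    (hv : Measurable (Function.uncurry v)) (hG : MeasurableSet G)
    (hH : ∀ l S, ‖H l S‖ₑ ≤ G.indicator (fun q => ‖u q.1 q.2‖ₑ * ‖v q.1 q.2‖ₑ) (l, S))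
    {l : α → 𝕃} {T T₀ : α → Config d 𝕄} (hl : Measurable l) (hT : Measurable T)
    (hT₀ : Measurable T₀) (hRT : ∀ t, R (l t) (T t) ≤ R (l t) (T₀ t))
    (hGT : ∀ t, (l t, T t) ∈ G → (l t, T₀ t) ∈ G) {K₁ K₂ ε δ : ℝ≥0∞}
    (hK₁ : ∫⁻ t, ‖u (l t) (T t)‖ₑ ^ 4 ∂ν ≤ K₁ ^ 4)
    (hK₂ : ∫⁻ t, ‖v (l t) (T t)‖ₑ ^ 4 ∂ν ≤ K₂ ^ 4)
    (hε : ν {t | (l t, T₀ t) ∈ G} ≤ ε) (z : E d) (hδ : ν {t | dist z x ≤ R (l t) (T₀ t)} ≤ δ) :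
    ∫⁻ t, influence x (R (l t)) (H (l t)) (T t) z ∂ν ≤
      K₁ * K₂ * (ε ^ (1 / 4 : ℝ) * δ ^ (1 / 4 : ℝ)) := by
  have hlT : Measurable fun t => (l t, T t) := hl.prodMk hT
  have hlT₀ : Measurable fun t => (l t, T₀ t) := hl.prodMk hT₀
  have hu' : Measurable fun t => ‖u (l t) (T t)‖ₑ := (hu.comp hlT).enorm
  have hv' : Measurable fun t => ‖v (l t) (T t)‖ₑ := (hv.comp hlT).enorm
  have hR' : Measurable fun t => R (l t) (T₀ t) := hR.comp hlT₀
  have hB : MeasurableSet {t | dist z x ≤ R (l t) (T₀ t)} := measurableSet_le measurable_const hR'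
  refine le_trans (lintegral_mono fun t => ?_) (lintegral_mul_indicator_inter_le hu'.aemeasurable
    hv'.aemeasurable hK₁ hK₂ (hlT₀ hG) hB hε hδ)
  simp only [influence]
  by_cases h1 : dist z x ≤ R (l t) (T t)
  · rw [indicator_of_mem (by exact h1)]
    refine (hH _ _).trans ?_
    by_cases h2 : (l t, T t) ∈ G
    · rw [indicator_of_mem h2, indicator_of_mem]
      exact ⟨hGT t h2, h1.trans (hRT t)⟩
    · rw [indicator_of_notMem h2]
      exact zero_le
  · rw [indicator_of_notMem (by exact h1)]
    exact zero_le

/-- The functional `u` has a fourth moment on the input `X`, also after insertion of an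
independently marked point. -/
def FourthMoment (μ : Measure Ω) (L : Measure 𝕃) (Q : Measure 𝕄) (X : Ω → Config d 𝕄)
    (ρ : E d → ℝ) (u : 𝕃 → Config d 𝕄 → ℝ) (K : ℝ≥0∞) : Prop :=
  ∫⁻ q : Ω × 𝕃, ‖u q.2 (X q.1)‖ₑ ^ 4 ∂(μ.prod L) ≤ K ^ 4 ∧
    ∀ᵐ z, 0 < ρ z → ∫⁻ q : Ω × 𝕃 × 𝕄, ‖u q.2.1 ((X q.1).ins (z, q.2.2))‖ₑ ^ 4
      ∂(μ.prod (L.prod Q)) ≤ K ^ 4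

lemma FourthMoment.const_one (μ : Measure Ω) [IsProbabilityMeasure μ] (L : Measure 𝕃)
    [IsProbabilityMeasure L] (Q : Measure 𝕄) [IsProbabilityMeasure Q] (X : Ω → Config d 𝕄)
    (ρ : E d → ℝ) : FourthMoment μ L Q X ρ (fun _ _ => 1) 1 := by
  refine ⟨?_, Eventually.of_forall fun z _ => ?_⟩ <;> simp

lemma integral_mul_of_fourthMoment {α : Type*} [MeasurableSpace α] {ν : Measure α}
    [IsProbabilityMeasure ν] {u v : α → ℝ} (hu : Measurable u) (hv : Measurable v)
    {K₁ K₂ : ℝ≥0∞} (hK₁' : K₁ ≠ ∞) (hK₂' : K₂ ≠ ∞) (hK₁ : ∫⁻ t, ‖u t‖ₑ ^ 4 ∂ν ≤ K₁ ^ 4)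
    (hK₂ : ∫⁻ t, ‖v t‖ₑ ^ 4 ∂ν ≤ K₂ ^ 4) {A : Set α} (hA : MeasurableSet A) {ε : ℝ≥0∞}
    (hε : ν A ≤ ε) :
    Integrable (A.indicator fun t => u t * v t) ν ∧
      ‖∫ t, A.indicator (fun t => u t * v t) t ∂ν‖ₑ ≤ K₁ * K₂ * ε ^ (1 / 4 : ℝ) := by
  have key : ∀ {A : Set α} {ε : ℝ≥0∞}, MeasurableSet A → ν A ≤ ε →
      ∫⁻ t, ‖A.indicator (fun t => u t * v t) t‖ₑ ∂ν ≤ K₁ * K₂ * ε ^ (1 / 4 : ℝ) := by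
    intro A ε hA hε
    have := lintegral_mul_indicator_inter_le hu.enorm.aemeasurable hv.enorm.aemeasurable hK₁ hK₂
      hA MeasurableSet.univ hε (δ := 1) (by simp)
    simp only [inter_univ, ENNReal.one_rpow, mul_one] at this
    refine le_trans (lintegral_mono fun t => ?_) this
    by_cases ht : t ∈ A <;> simp [ht]
  refine ⟨⟨((hu.mul hv).indicator hA).aestronglyMeasurable, ?_⟩,
    (enorm_integral_le_lintegral_enorm _).trans (key hA hε)⟩
  refine (key hA (ε := 1) prob_le_one).trans_lt ?_
  rw [ENNReal.one_rpow, mul_one]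
  exact ENNReal.mul_lt_top hK₁'.lt_top hK₂'.lt_top

/-- Comparison of the means of a localized functional on two inputs. -/
lemma enorm_integral_sub_le_of_fourthMoment [NullSingletonClass (volume : Measure (E d))]
    {L : Measure 𝕃} [IsProbabilityMeasure L] {μ : Measure Ω}
    [IsProbabilityMeasure μ] {Q : Measure 𝕄} [IsProbabilityMeasure Q] {ρ₁ ρ₂ : E d → ℝ}
    (hρ₁ : Measurable ρ₁) (hρ₂ : Measurable ρ₂) {b : ℝ} (hb₁ : ∀ z, ρ₁ z ≤ b)
    (hb₂ : ∀ z, ρ₂ z ≤ b) {P₁ P₂ : Ω → Config d 𝕄} (hP₁ : IsMecke μ P₁ (intensity ρ₁ Q))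
    (hP₂ : IsMecke μ P₂ (intensity ρ₂ Q)) {x : E d} {R H u v : 𝕃 → Config d 𝕄 → ℝ}
    {G : Set (𝕃 × Config d 𝕄)}
    (hR : Measurable (Function.uncurry R)) (hHm : Measurable (Function.uncurry H))
    (hu : Measurable (Function.uncurry u))
    (hv : Measurable (Function.uncurry v)) (hG : MeasurableSet G)
    (hH : ∀ l S, ‖H l S‖ₑ ≤ G.indicator (fun q => ‖u q.1 q.2‖ₑ * ‖v q.1 q.2‖ₑ) (l, S))
    (hloc : ∀ l, LocalAt x (R l) (H l))
    (hRmono : ∀ l (S T : Config d 𝕄), S.pts ⊆ T.pts → R l T ≤ R l S)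
    (hGmono : ∀ l (S T : Config d 𝕄), S.pts ⊆ T.pts → (l, T) ∈ G → (l, S) ∈ G)
    {K₁ K₂ ε : ℝ≥0∞} {δ : ℝ → ℝ≥0∞} (hδm : Measurable δ) (hK₁ : K₁ ≠ ∞) (hK₂ : K₂ ≠ ∞)
    (hu₁ : FourthMoment μ L Q P₁ ρ₁ u K₁) (hv₁ : FourthMoment μ L Q P₁ ρ₁ v K₂)
    (hu₂ : FourthMoment μ L Q P₂ ρ₂ u K₁) (hv₂ : FourthMoment μ L Q P₂ ρ₂ v K₂)
    (hε₁ : (μ.prod L) {q | (q.2, P₁ q.1) ∈ G} ≤ ε) (hε₂ : (μ.prod L) {q | (q.2, P₂ q.1) ∈ G} ≤ ε)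
    (hδ₁ : ∀ t, 0 ≤ t → (μ.prod L) {q | t ≤ R q.2 (P₁ q.1)} ≤ δ t)
    (hδ₂ : ∀ t, 0 ≤ t → (μ.prod L) {q | t ≤ R q.2 (P₂ q.1)} ≤ δ t) :
    ‖∫ q : Ω × 𝕃, H q.2 (P₁ q.1) ∂(μ.prod L) - ∫ q : Ω × 𝕃, H q.2 (P₂ q.1) ∂(μ.prod L)‖ₑ ≤
      K₁ * K₂ * ε ^ (1 / 4 : ℝ) *
        ∫⁻ z, ENNReal.ofReal |ρ₁ z - ρ₂ z| * (4 * δ (dist z x) ^ (1 / 4 : ℝ)) := by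
  have hint : ∀ {P : Ω → Config d 𝕄} {ρ : E d → ℝ}, Measurable P → FourthMoment μ L Q P ρ u K₁ →
      FourthMoment μ L Q P ρ v K₂ →
      Integrable (fun q : Ω × 𝕃 => H q.2 (P q.1)) (μ.prod L) := by
    intro P ρ hP h1 h2
    have hlT : Measurable fun q : Ω × 𝕃 => (q.2, P q.1) :=
      measurable_snd.prodMk (hP.comp measurable_fst)
    have := (integral_mul_of_fourthMoment (hu.comp hlT) (hv.comp hlT) hK₁ hK₂ h1.1 h2.1
      (MeasurableSet.univ) le_rfl).1
    refine this.mono (hHm.comp hlT).aestronglyMeasurable (Eventually.of_forall fun q => ?_)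
    have h3 := (hH q.2 (P q.1)).trans (indicator_le_self _ _ _)
    rw [← enorm_mul, enorm_le_iff_norm_le] at h3
    simpa using h3
  -- The events, once transferred to the input without the inserted point, do not involve the mark
  -- of that point.
  have hmp : MeasurePreserving (fun q : Ω × 𝕃 × 𝕄 => (q.1, q.2.1)) (μ.prod (L.prod Q))
      (μ.prod L) := (MeasurePreserving.id μ).prod measurePreserving_fst
  have hU' : ∀ {P : Ω → Config d 𝕄} {ρ : E d → ℝ}, Measurable P → FourthMoment μ L Q P ρ u K₁ →
      FourthMoment μ L Q P ρ v K₂ → (μ.prod L) {q | (q.2, P q.1) ∈ G} ≤ ε →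
      (∀ t, 0 ≤ t → (μ.prod L) {q | t ≤ R q.2 (P q.1)} ≤ δ t) →
      ∀ᵐ z, ∫⁻ q : Ω × 𝕃, influence x (R q.2) (H q.2) (P q.1) z ∂(μ.prod L) ≤
        K₁ * K₂ * (ε ^ (1 / 4 : ℝ) * δ (dist z x) ^ (1 / 4 : ℝ)) := by
    intro P ρ hP h1 h2 h3 h4
    refine Eventually.of_forall fun z => ?_
    exact lintegral_influence_le hR hu hv hG hH measurable_snd (hP.comp measurable_fst)
      (hP.comp measurable_fst) (fun _ => le_rfl) (fun _ => id) h1.1 h2.1 h3 z (h4 _ dist_nonneg)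
  have hU : ∀ {P : Ω → Config d 𝕄} {ρ : E d → ℝ}, Measurable P → FourthMoment μ L Q P ρ u K₁ →
      FourthMoment μ L Q P ρ v K₂ → (μ.prod L) {q | (q.2, P q.1) ∈ G} ≤ ε →
      (∀ t, 0 ≤ t → (μ.prod L) {q | t ≤ R q.2 (P q.1)} ≤ δ t) →
      ∀ᵐ z, 0 < ρ z → ∫⁻ q : Ω × 𝕃 × 𝕄,
        influence x (R q.2.1) (H q.2.1) ((P q.1).ins (z, q.2.2)) z ∂(μ.prod (L.prod Q)) ≤
        K₁ * K₂ * (ε ^ (1 / 4 : ℝ) * δ (dist z x) ^ (1 / 4 : ℝ)) := by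
    intro P ρ hP h1 h2 h3 h4
    filter_upwards [h1.2, h2.2] with z k1 k2 hz
    have hlT : Measurable fun q : Ω × 𝕃 => (q.2, P q.1) :=
      measurable_snd.prodMk (hP.comp measurable_fst)
    refine lintegral_influence_le hR hu hv hG hH measurable_snd.fst
      (measurable_ins (hP.comp measurable_fst) (by fun_prop)) (hP.comp measurable_fst)
      (fun q => hRmono _ _ _ (subset_ins _ _)) (fun q => hGmono _ _ _ (subset_ins _ _))
      (k1 hz) (k2 hz) ?_ z ?_
    · have hA : MeasurableSet {q : Ω × 𝕃 | (q.2, P q.1) ∈ G} := hlT hG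
      rw [← hmp.measure_preimage hA.nullMeasurableSet] at h3
      exact h3
    · have h5 := h4 (dist z x) dist_nonneg
      have hB : MeasurableSet {q : Ω × 𝕃 | dist z x ≤ R q.2 (P q.1)} :=
        measurableSet_le measurable_const (hR.comp hlT)
      rw [← hmp.measure_preimage hB.nullMeasurableSet] at h5
      exact h5
  refine (enorm_integral_sub_le_param hρ₁ hρ₂ hb₁ hb₂ hP₁ hP₂ hR hHm hloc
    (hint hP₁.measurable hu₁ hv₁) (hint hP₂.measurable hu₂ hv₂)
    (hU hP₁.measurable hu₁ hv₁ hε₁ hδ₁) (hU' hP₁.measurable hu₁ hv₁ hε₁ hδ₁)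
    (hU hP₂.measurable hu₂ hv₂ hε₂ hδ₂) (hU' hP₂.measurable hu₂ hv₂ hε₂ hδ₂)).trans_eq ?_
  rw [← lintegral_const_mul _ (by fun_prop)]
  refine lintegral_congr fun z => ?_
  ring

end Compare

end StabScores

end

/-! ### Covariances of two sites: decorrelation and dependence on the input -/

noncomputable section

namespace StabScores

variable {d : ℕ} {𝕄 Ω : Type*} [MeasurableSpace 𝕄] [MeasurableSpace Ω]

open Config

/-- The covariance of two functionals sitting at the points `a` and `b`, in the first expectation
the marked points being added to the input. -/
def covar (μ : Measure Ω) (Q : Measure 𝕄) (X : Ω → Config d 𝕄) (a b : E d)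
    (η₁ η₂ : 𝕄 → Config d 𝕄 → ℝ) : ℝ :=
  ∫ q : Ω × 𝕄 × 𝕄, η₁ q.2.1 ((X q.1).ins (b, q.2.2)) * η₂ q.2.2 ((X q.1).ins (a, q.2.1))
      ∂(μ.prod (Q.prod Q)) -
    (∫ q : Ω × 𝕄, η₁ q.2 (X q.1) ∂(μ.prod Q)) * ∫ q : Ω × 𝕄, η₂ q.2 (X q.1) ∂(μ.prod Q)

/-- Moments and tails of two functionals sitting at `a` and `b` on the input `X`. -/
structure PairInput (μ : Measure Ω) (Q : Measure 𝕄) (X : Ω → Config d 𝕄) (ρ : E d → ℝ)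
    (a b : E d) (η₁ r₁ η₂ r₂ : 𝕄 → Config d 𝕄 → ℝ) (K₁ K₂ : ℝ≥0∞) (τ : ℝ → ℝ≥0∞) : Prop where
  mecke : IsMecke μ X (intensity ρ Q)
  moment₁ : FourthMoment μ (Q.prod Q) Q X ρ (fun l S => η₁ l.1 S) K₁
  moment₁_ins : FourthMoment μ (Q.prod Q) Q X ρ (fun l S => η₁ l.1 (S.ins (b, l.2))) K₁
  moment₂ : FourthMoment μ (Q.prod Q) Q X ρ (fun l S => η₂ l.2 S) K₂
  moment₂_ins : FourthMoment μ (Q.prod Q) Q X ρ (fun l S => η₂ l.2 (S.ins (a, l.1))) K₂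
  tail₁ : ∀ t, 0 ≤ t → (μ.prod Q) {q | t ≤ r₁ q.2 (X q.1)} ≤ τ t
  tail₂ : ∀ t, 0 ≤ t → (μ.prod Q) {q | t ≤ r₂ q.2 (X q.1)} ≤ τ t

section Marks

variable (μ : Measure Ω) [IsProbabilityMeasure μ] (Q : Measure 𝕄) [IsProbabilityMeasure Q]

lemma measurePreserving_markFst :
    MeasurePreserving (fun q : Ω × 𝕄 × 𝕄 => (q.1, q.2.1)) (μ.prod (Q.prod Q)) (μ.prod Q) :=
  (MeasurePreserving.id μ).prod measurePreserving_fst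

lemma measurePreserving_markSnd :
    MeasurePreserving (fun q : Ω × 𝕄 × 𝕄 => (q.1, q.2.2)) (μ.prod (Q.prod Q)) (μ.prod Q) :=
  (MeasurePreserving.id μ).prod measurePreserving_snd

variable {μ Q}

lemma integral_markFst {F : Ω × 𝕄 → ℝ} (hF : Measurable F) :
    ∫ q : Ω × 𝕄 × 𝕄, F (q.1, q.2.1) ∂(μ.prod (Q.prod Q)) = ∫ q, F q ∂(μ.prod Q) := by
  rw [← (measurePreserving_markFst μ Q).map_eq, integral_map
    (measurePreserving_markFst μ Q).measurable.aemeasurable hF.aestronglyMeasurable]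

lemma integral_markSnd {F : Ω × 𝕄 → ℝ} (hF : Measurable F) :
    ∫ q : Ω × 𝕄 × 𝕄, F (q.1, q.2.2) ∂(μ.prod (Q.prod Q)) = ∫ q, F q ∂(μ.prod Q) := by
  rw [← (measurePreserving_markSnd μ Q).map_eq, integral_map
    (measurePreserving_markSnd μ Q).measurable.aemeasurable hF.aestronglyMeasurable]

end Marks

/-- The radius around `a` within which both of two functionals at `a` and `b` are determined. -/
def pairRadius (a b : E d) (r₁ r₂ : 𝕄 → Config d 𝕄 → ℝ) (l : 𝕄 × 𝕄) (S : Config d 𝕄) : ℝ :=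
  max (r₁ l.1 S) (r₂ l.2 S + dist a b)

/-- The event that one of the two radii is larger than `t`. -/
def farEvent (r₁ r₂ : 𝕄 → Config d 𝕄 → ℝ) (t : ℝ) : Set ((𝕄 × 𝕄) × Config d 𝕄) :=
  {q | t < r₁ q.1.1 q.2 ∨ t < r₂ q.1.2 q.2}

section Pair

variable {a b : E d} {η₁ r₁ η₂ r₂ : 𝕄 → Config d 𝕄 → ℝ}

lemma IsSite.inBall_of_pairRadius {l : 𝕄 × 𝕄} {S S' : Config d 𝕄}
    (h : S.inBall a (pairRadius a b r₁ r₂ l S) = S'.inBall a (pairRadius a b r₁ r₂ l S)) :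
    S.inBall a (r₁ l.1 S) = S'.inBall a (r₁ l.1 S) ∧
      S.inBall b (r₂ l.2 S) = S'.inBall b (r₂ l.2 S) := by
  refine ⟨inBall_eq_of_subset h (Metric.closedBall_subset_closedBall (le_max_left _ _)),
    inBall_eq_of_subset h (Metric.closedBall_subset_closedBall' ?_)⟩
  rw [dist_comm b a]
  exact le_max_right _ _

lemma dist_le_pairRadius (h₂ : IsSite b η₂ r₂) (l : 𝕄 × 𝕄) (S : Config d 𝕄) :
    dist a b ≤ pairRadius a b r₁ r₂ l S :=
  le_max_of_le_right (by linarith [h₂.nonneg l.2 S])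

/-- The pair radius is at least the distance of the sites, so both sites lie in its ball. This
settles the occupancy question raised by `ins` and makes the functionals with inserted points local
as well. -/
lemma mem_proj_iff_of_pairRadius (h₂ : IsSite b η₂ r₂) {l : 𝕄 × 𝕄} {S S' : Config d 𝕄}
    (h : S.inBall a (pairRadius a b r₁ r₂ l S) = S'.inBall a (pairRadius a b r₁ r₂ l S))
    {y : E d} (hy : y = a ∨ y = b) : y ∈ S.proj ↔ y ∈ S'.proj := by
  have hd : dist y a ≤ pairRadius a b r₁ r₂ l S := by
    have h1 := dist_le_pairRadius (a := a) (r₁ := r₁) h₂ l S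
    rcases hy with rfl | rfl
    · rw [dist_self]
      exact dist_nonneg.trans h1
    · rwa [dist_comm]
  exact ⟨mem_proj_of_inBall_eq h hd, mem_proj_of_inBall_eq h.symm hd⟩

lemma localAt_pairRadius (h₁ : IsSite a η₁ r₁) (h₂ : IsSite b η₂ r₂) (l : 𝕄 × 𝕄)
    {S S' : Config d 𝕄}
    (h : S.inBall a (pairRadius a b r₁ r₂ l S) = S'.inBall a (pairRadius a b r₁ r₂ l S)) :
    r₁ l.1 S' = r₁ l.1 S ∧ r₂ l.2 S' = r₂ l.2 S ∧ η₁ l.1 S' = η₁ l.1 S ∧ η₂ l.2 S' = η₂ l.2 S ∧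
      η₁ l.1 (S'.ins (b, l.2)) = η₁ l.1 (S.ins (b, l.2)) ∧
      η₂ l.2 (S'.ins (a, l.1)) = η₂ l.2 (S.ins (a, l.1)) ∧
      pairRadius a b r₁ r₂ l S' = pairRadius a b r₁ r₂ l S := by
  obtain ⟨k1, k2⟩ := IsSite.inBall_of_pairRadius h
  have e1 := h₁.radius_eq k1
  have e2 := h₂.radius_eq k2
  refine ⟨e1, e2, h₁.score_eq k1, h₂.score_eq k2,
    h₁.score_ins_eq k1 (mem_proj_iff_of_pairRadius h₂ h (Or.inr rfl)),
    h₂.score_ins_eq k2 (mem_proj_iff_of_pairRadius h₂ h (Or.inl rfl)), ?_⟩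
  simp only [pairRadius, e1, e2]

lemma IsSite.measurable_along {α : Type*} [MeasurableSpace α] (h₁ : IsSite a η₁ r₁) {l : α → 𝕄}
    {T : α → Config d 𝕄} (hl : Measurable l) (hT : Measurable T) :
    (Measurable fun t => η₁ (l t) (T t)) ∧ Measurable fun t => r₁ (l t) (T t) :=
  ⟨h₁.measurable_score.comp (hl.prodMk hT), h₁.measurable_radius.comp (hl.prodMk hT)⟩

lemma measurableSet_farEvent (h₁ : IsSite a η₁ r₁) (h₂ : IsSite b η₂ r₂) (t : ℝ) :
    MeasurableSet (farEvent r₁ r₂ t) := by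
  have k1 := (h₁.measurable_along (l := fun q : (𝕄 × 𝕄) × Config d 𝕄 => q.1.1) (by fun_prop)
    measurable_snd).2
  have k2 := (h₂.measurable_along (l := fun q : (𝕄 × 𝕄) × Config d 𝕄 => q.1.2) (by fun_prop)
    measurable_snd).2
  exact (measurableSet_lt measurable_const k1).union (measurableSet_lt measurable_const k2)

lemma measurable_pairRadius (h₁ : IsSite a η₁ r₁) (h₂ : IsSite b η₂ r₂) :
    Measurable (Function.uncurry (pairRadius a b r₁ r₂)) := by
  have k1 := (h₁.measurable_along (l := fun q : (𝕄 × 𝕄) × Config d 𝕄 => q.1.1) (by fun_prop)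
    measurable_snd).2
  have k2 := (h₂.measurable_along (l := fun q : (𝕄 × 𝕄) × Config d 𝕄 => q.1.2) (by fun_prop)
    measurable_snd).2
  exact k1.max (k2.add_const _)

variable {μ : Measure Ω} [IsProbabilityMeasure μ] {Q : Measure 𝕄} [IsProbabilityMeasure Q]
  {X : Ω → Config d 𝕄} {ρ : E d → ℝ} {K₁ K₂ : ℝ≥0∞} {τ : ℝ → ℝ≥0∞}

lemma PairInput.measure_far_le (hX : PairInput μ Q X ρ a b η₁ r₁ η₂ r₂ K₁ K₂ τ)
    (h₁ : IsSite a η₁ r₁) (h₂ : IsSite b η₂ r₂) {t : ℝ} (ht : 0 ≤ t) :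
    (μ.prod (Q.prod Q)) {q | (q.2, X q.1) ∈ farEvent r₁ r₂ t} ≤ 2 * τ t := by
  have hXm := hX.mecke.measurable
  have k1 := (h₁.measurable_along (l := fun q : Ω × 𝕄 => q.2) (by fun_prop)
    (hXm.comp measurable_fst)).2
  have k2 := (h₂.measurable_along (l := fun q : Ω × 𝕄 => q.2) (by fun_prop)
    (hXm.comp measurable_fst)).2
  have e1 := (measurePreserving_markFst μ Q).measure_preimage
    (measurableSet_le (measurable_const (a := t)) k1).nullMeasurableSet
  have e2 := (measurePreserving_markSnd μ Q).measure_preimage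
    (measurableSet_le (measurable_const (a := t)) k2).nullMeasurableSet
  rw [two_mul]
  refine le_trans (le_trans (measure_mono ?_) (measure_union_le _ _))
    (add_le_add (e1.trans_le (hX.tail₁ t ht)) (e2.trans_le (hX.tail₂ t ht)))
  rintro q (hq | hq)
  · exact Or.inl hq.le
  · exact Or.inr hq.le

/-- The second radius has to reach only the remaining distance after moving from `a` to `b`. The
truncation at zero is needed because tails are bounded for nonnegative arguments only. -/
lemma PairInput.measure_pairRadius_le (hX : PairInput μ Q X ρ a b η₁ r₁ η₂ r₂ K₁ K₂ τ)
    (h₁ : IsSite a η₁ r₁) (h₂ : IsSite b η₂ r₂) {t : ℝ} (ht : 0 ≤ t) :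
    (μ.prod (Q.prod Q)) {q | t ≤ pairRadius a b r₁ r₂ q.2 (X q.1)} ≤
      τ t + τ (max (t - dist a b) 0) := by
  have hXm := hX.mecke.measurable
  have k1 := (h₁.measurable_along (l := fun q : Ω × 𝕄 => q.2) (by fun_prop)
    (hXm.comp measurable_fst)).2
  have k2 := (h₂.measurable_along (l := fun q : Ω × 𝕄 => q.2) (by fun_prop)
    (hXm.comp measurable_fst)).2
  have e1 := (measurePreserving_markFst μ Q).measure_preimage
    (measurableSet_le (measurable_const (a := t)) k1).nullMeasurableSet
  have e2 := (measurePreserving_markSnd μ Q).measure_preimage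
    (measurableSet_le (measurable_const (a := max (t - dist a b) 0)) k2).nullMeasurableSet
  refine le_trans (le_trans (measure_mono ?_) (measure_union_le _ _))
    (add_le_add (e1.trans_le (hX.tail₁ t ht)) (e2.trans_le (hX.tail₂ _ (le_max_right _ _))))
  intro q hq
  rcases le_max_iff.1 (mem_ofPred_eq ▸ hq) with hq | hq
  · exact Or.inl hq
  · refine Or.inr ?_
    have h0 := h₂.nonneg q.2.2 (X q.1)
    exact max_le (by linarith) h0

/-- The part of the product on which one of the radii is large. -/
def farProd (a b : E d) (η₁ r₁ η₂ r₂ : 𝕄 → Config d 𝕄 → ℝ) (t : ℝ) (l : 𝕄 × 𝕄)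
    (S : Config d 𝕄) : ℝ :=
  (farEvent r₁ r₂ t).indicator
    (fun q => η₁ q.1.1 (q.2.ins (b, q.1.2)) * η₂ q.1.2 (q.2.ins (a, q.1.1))) (l, S)

/-- The part of a functional on which its radius is large. -/
def farPart (r η : 𝕄 → Config d 𝕄 → ℝ) (t : ℝ) (m : 𝕄) (S : Config d 𝕄) : ℝ :=
  {S | t < r m S}.indicator (η m) S

lemma IsSite.measurable_farPart (h₁ : IsSite a η₁ r₁) (t : ℝ) :
    Measurable (Function.uncurry (farPart r₁ η₁ t)) :=
  h₁.measurable_score.indicator (measurableSet_lt measurable_const h₁.measurable_radius)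

lemma IsSite.measurable_cutoff (h₁ : IsSite a η₁ r₁) (t : ℝ) :
    Measurable (Function.uncurry fun m => cutoff (r₁ m) (η₁ m) t) :=
  h₁.measurable_score.indicator (measurableSet_le h₁.measurable_radius measurable_const)

lemma farPart_add_cutoff (t : ℝ) (m : 𝕄) (S : Config d 𝕄) :
    farPart r₁ η₁ t m S + cutoff (r₁ m) (η₁ m) t S = η₁ m S := by
  by_cases h : t < r₁ m S
  · simp [farPart, cutoff, h]
  · simp [farPart, cutoff, h, not_lt.1 h]

lemma IsSite.measurable_ins (h₁ : IsSite a η₁ r₁) (y : E d) :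
    Measurable fun q : (𝕄 × 𝕄) × Config d 𝕄 => η₁ q.1.1 (q.2.ins (y, q.1.2)) :=
  (h₁.measurable_along (by fun_prop) (Config.measurable_ins measurable_snd (by fun_prop))).1

lemma IsSite.measurable_ins' (h₁ : IsSite a η₁ r₁) (y : E d) :
    Measurable fun q : (𝕄 × 𝕄) × Config d 𝕄 => η₁ q.1.2 (q.2.ins (y, q.1.1)) :=
  (h₁.measurable_along (by fun_prop) (Config.measurable_ins measurable_snd (by fun_prop))).1

lemma measurable_farProd (h₁ : IsSite a η₁ r₁) (h₂ : IsSite b η₂ r₂) (t : ℝ) :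
    Measurable (Function.uncurry (farProd a b η₁ r₁ η₂ r₂ t)) :=
  ((h₁.measurable_ins b).mul (h₂.measurable_ins' a)).indicator (measurableSet_farEvent h₁ h₂ t)

section Bounds

variable (hX : PairInput μ Q X ρ a b η₁ r₁ η₂ r₂ K₁ K₂ τ) (h₁ : IsSite a η₁ r₁)
  (h₂ : IsSite b η₂ r₂) (hK₁ : K₁ ≠ ∞) (hK₂ : K₂ ≠ ∞) {t : ℝ} (ht : 0 ≤ t)

include hX h₁ h₂ hK₁ hK₂

lemma PairInput.farProd_le (ht : 0 ≤ t) :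
    Integrable (fun q : Ω × 𝕄 × 𝕄 => farProd a b η₁ r₁ η₂ r₂ t q.2 (X q.1)) (μ.prod (Q.prod Q)) ∧
      ‖∫ q : Ω × 𝕄 × 𝕄, farProd a b η₁ r₁ η₂ r₂ t q.2 (X q.1) ∂(μ.prod (Q.prod Q))‖ₑ ≤
        K₁ * K₂ * (2 * τ t) ^ (1 / 4 : ℝ) := by
  have hg : Measurable fun q : Ω × 𝕄 × 𝕄 => (q.2, X q.1) :=
    measurable_snd.prodMk (hX.mecke.measurable.comp measurable_fst)
  exact integral_mul_of_fourthMoment ((h₁.measurable_ins b).comp hg) ((h₂.measurable_ins' a).comp hg)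
    hK₁ hK₂ hX.moment₁_ins.1 hX.moment₂_ins.1 (hg (measurableSet_farEvent h₁ h₂ t))
    (hX.measure_far_le h₁ h₂ ht)

lemma PairInput.integrable_prod :
    Integrable (fun q : Ω × 𝕄 × 𝕄 => η₁ q.2.1 ((X q.1).ins (b, q.2.2)) *
      η₂ q.2.2 ((X q.1).ins (a, q.2.1))) (μ.prod (Q.prod Q)) := by
  have hg : Measurable fun q : Ω × 𝕄 × 𝕄 => (q.2, X q.1) :=
    measurable_snd.prodMk (hX.mecke.measurable.comp measurable_fst)
  have := (integral_mul_of_fourthMoment ((h₁.measurable_ins b).comp hg)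
    ((h₂.measurable_ins' a).comp hg)
    hK₁ hK₂ hX.moment₁_ins.1 hX.moment₂_ins.1 MeasurableSet.univ le_rfl).1
  simpa using this

omit h₂ hK₂ in
lemma PairInput.part₁_le {A : Set (Ω × 𝕄 × 𝕄)} (hA : MeasurableSet A) {ε : ℝ≥0∞}
    (hε : (μ.prod (Q.prod Q)) A ≤ ε) :
    Integrable (A.indicator fun q => η₁ q.2.1 (X q.1)) (μ.prod (Q.prod Q)) ∧
      ‖∫ q, A.indicator (fun q => η₁ q.2.1 (X q.1)) q ∂(μ.prod (Q.prod Q))‖ₑ ≤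
        K₁ * ε ^ (1 / 4 : ℝ) := by
  have k1 := (h₁.measurable_along (l := fun q : Ω × 𝕄 × 𝕄 => q.2.1) (by fun_prop)
    (hX.mecke.measurable.comp measurable_fst)).1
  simpa using integral_mul_of_fourthMoment k1 (measurable_const (a := (1 : ℝ))) hK₁
    ENNReal.one_ne_top hX.moment₁.1 (by simp) hA hε

omit h₁ hK₁ in
lemma PairInput.part₂_le {A : Set (Ω × 𝕄 × 𝕄)} (hA : MeasurableSet A) {ε : ℝ≥0∞}
    (hε : (μ.prod (Q.prod Q)) A ≤ ε) :
    Integrable (A.indicator fun q => η₂ q.2.2 (X q.1)) (μ.prod (Q.prod Q)) ∧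
      ‖∫ q, A.indicator (fun q => η₂ q.2.2 (X q.1)) q ∂(μ.prod (Q.prod Q))‖ₑ ≤
        K₂ * ε ^ (1 / 4 : ℝ) := by
  have k1 := (h₂.measurable_along (l := fun q : Ω × 𝕄 × 𝕄 => q.2.2) (by fun_prop)
    (hX.mecke.measurable.comp measurable_fst)).1
  simpa using integral_mul_of_fourthMoment k1 (measurable_const (a := (1 : ℝ))) hK₂
    ENNReal.one_ne_top hX.moment₂.1 (by simp) hA hε

/-- Bounds for the means of a functional, of its near and of its far part. -/
lemma PairInput.means_le (ht : 0 ≤ t) :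
    (Integrable (fun q : Ω × 𝕄 × 𝕄 => η₂ q.2.2 (X q.1)) (μ.prod (Q.prod Q)) ∧
      ‖∫ q : Ω × 𝕄 × 𝕄, η₂ q.2.2 (X q.1) ∂(μ.prod (Q.prod Q))‖ₑ ≤ K₂) ∧
    (Integrable (fun q : Ω × 𝕄 × 𝕄 => farPart r₁ η₁ t q.2.1 (X q.1)) (μ.prod (Q.prod Q)) ∧
      ‖∫ q : Ω × 𝕄 × 𝕄, farPart r₁ η₁ t q.2.1 (X q.1) ∂(μ.prod (Q.prod Q))‖ₑ ≤
        K₁ * (2 * τ t) ^ (1 / 4 : ℝ)) ∧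
    (Integrable (fun q : Ω × 𝕄 × 𝕄 => cutoff (r₁ q.2.1) (η₁ q.2.1) t (X q.1)) (μ.prod (Q.prod Q)) ∧
      ‖∫ q : Ω × 𝕄 × 𝕄, cutoff (r₁ q.2.1) (η₁ q.2.1) t (X q.1) ∂(μ.prod (Q.prod Q))‖ₑ ≤ K₁) ∧
    (Integrable (fun q : Ω × 𝕄 × 𝕄 => farPart r₂ η₂ t q.2.2 (X q.1)) (μ.prod (Q.prod Q)) ∧
      ‖∫ q : Ω × 𝕄 × 𝕄, farPart r₂ η₂ t q.2.2 (X q.1) ∂(μ.prod (Q.prod Q))‖ₑ ≤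
        K₂ * (2 * τ t) ^ (1 / 4 : ℝ)) ∧
    Integrable (fun q : Ω × 𝕄 × 𝕄 => cutoff (r₂ q.2.2) (η₂ q.2.2) t (X q.1))
      (μ.prod (Q.prod Q)) := by
  have hXm := hX.mecke.measurable
  have k1 := (h₁.measurable_along (l := fun q : Ω × 𝕄 × 𝕄 => q.2.1) (by fun_prop)
    (hXm.comp measurable_fst)).2
  have k2 := (h₂.measurable_along (l := fun q : Ω × 𝕄 × 𝕄 => q.2.2) (by fun_prop)
    (hXm.comp measurable_fst)).2
  have hfar := hX.measure_far_le h₁ h₂ ht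
  refine ⟨?_, ?_, ?_, ?_, ?_⟩
  · simpa using hX.part₂_le h₂ hK₂ MeasurableSet.univ (ε := 1) (by simp)
  · exact hX.part₁_le h₁ hK₁ (measurableSet_lt (measurable_const (a := t)) k1)
      ((measure_mono fun q hq => Or.inl hq).trans hfar)
  · have := hX.part₁_le h₁ hK₁ (measurableSet_le k1 (measurable_const (a := t)))
      (ε := 1) prob_le_one
    rw [ENNReal.one_rpow, mul_one] at this
    exact this
  · exact hX.part₂_le h₂ hK₂ (measurableSet_lt (measurable_const (a := t)) k2)
      ((measure_mono fun q hq => Or.inr hq).trans hfar)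
  · exact (hX.part₂_le h₂ hK₂ (measurableSet_le k2 (measurable_const (a := t)))
      (ε := 1) prob_le_one).1

/-- Decoupling of the two functionals on the event that both radii are small. -/
lemma PairInput.covar_eq (hab : a ≠ b) :
    covar μ Q X a b η₁ η₂ =
      ∫ q : Ω × 𝕄 × 𝕄, farProd a b η₁ r₁ η₂ r₂ (dist a b / 3) q.2 (X q.1) ∂(μ.prod (Q.prod Q)) -
      (∫ q : Ω × 𝕄 × 𝕄, farPart r₁ η₁ (dist a b / 3) q.2.1 (X q.1) ∂(μ.prod (Q.prod Q))) *
        (∫ q : Ω × 𝕄 × 𝕄, η₂ q.2.2 (X q.1) ∂(μ.prod (Q.prod Q))) -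
      (∫ q : Ω × 𝕄 × 𝕄, cutoff (r₁ q.2.1) (η₁ q.2.1) (dist a b / 3) (X q.1)
          ∂(μ.prod (Q.prod Q))) *
        ∫ q : Ω × 𝕄 × 𝕄, farPart r₂ η₂ (dist a b / 3) q.2.2 (X q.1) ∂(μ.prod (Q.prod Q)) := by
  have hXm := hX.mecke.measurable
  have hD : 0 < dist a b := dist_pos.2 hab
  -- With a third of the distance the closed balls around the two sites are disjoint, and neither
  -- contains the other site.
  set t := dist a b / 3 with ht_def
  have ht : 0 ≤ t := by positivity
  obtain ⟨⟨i2, -⟩, ⟨if1, -⟩, ⟨ic1, -⟩, ⟨if2, -⟩, ic2⟩ := hX.means_le h₁ h₂ hK₁ hK₂ ht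
  have iP := (hX.farProd_le h₁ h₂ hK₁ hK₂ ht).1
  have iall := hX.integrable_prod h₁ h₂ hK₁ hK₂
  -- Outside the far event the inserted points lie beyond the radii and can be dropped; on the far
  -- event one of the cutoffs vanishes.
  have key : ∀ q : Ω × 𝕄 × 𝕄, η₁ q.2.1 ((X q.1).ins (b, q.2.2)) *
      η₂ q.2.2 ((X q.1).ins (a, q.2.1)) - farProd a b η₁ r₁ η₂ r₂ t q.2 (X q.1) =
      cutoff (r₁ q.2.1) (η₁ q.2.1) t (X q.1) * cutoff (r₂ q.2.2) (η₂ q.2.2) t (X q.1) := by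
    intro q
    by_cases hq : (q.2, X q.1) ∈ farEvent r₁ r₂ t
    · rw [farProd, indicator_of_mem hq]
      simp only [sub_self, cutoff]
      rcases hq with hq | hq
      · rw [indicator_of_notMem (s := {S | r₁ q.2.1 S ≤ t}) (by exact not_le.2 hq), zero_mul]
      · rw [indicator_of_notMem (s := {S | r₂ q.2.2 S ≤ t}) (by exact not_le.2 hq), mul_zero]
    · rw [farProd, indicator_of_notMem hq, sub_zero]
      have hq1 : r₁ q.2.1 (X q.1) ≤ t := not_lt.1 fun h => hq (Or.inl h)
      have hq2 : r₂ q.2.2 (X q.1) ≤ t := not_lt.1 fun h => hq (Or.inr h)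
      rw [cutoff, cutoff, indicator_of_mem (by exact hq1), indicator_of_mem (by exact hq2),
        h₁.score_ins_of_lt, h₂.score_ins_of_lt]
      · refine hq2.trans_lt ?_
        simp only
        linarith
      · refine hq1.trans_lt ?_
        simp only
        rw [dist_comm]
        linarith
  have hm1 := h₁.measurable_cutoff t
  have hm2 := h₂.measurable_cutoff t
  have hc : Integrable (fun q : Ω × 𝕄 × 𝕄 => cutoff (r₁ q.2.1) (η₁ q.2.1) t (X q.1) *
      cutoff (r₂ q.2.2) (η₂ q.2.2) t (X q.1)) (μ.prod (Q.prod Q)) := by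
    refine (iall.sub iP).congr (Eventually.of_forall fun q => ?_)
    exact key q
  have hdisj : Disjoint (Metric.closedBall a t) (Metric.closedBall b t) := by
    apply Metric.closedBall_disjoint_closedBall
    rw [ht_def]
    linarith
  -- For fixed marks the cut off functionals see the process only in disjoint balls.
  have hindep : ∀ l : 𝕄 × 𝕄, ∫ ω, cutoff (r₁ l.1) (η₁ l.1) t (X ω) *
      cutoff (r₂ l.2) (η₂ l.2) t (X ω) ∂μ =
      (∫ ω, cutoff (r₁ l.1) (η₁ l.1) t (X ω) ∂μ) * ∫ ω, cutoff (r₂ l.2) (η₂ l.2) t (X ω) ∂μ := by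
    intro l
    refine hX.mecke.integral_mul_of_disjoint measurableSet_closedBall hdisj
      (hm1.comp measurable_prodMk_left) (hm2.comp measurable_prodMk_left) ?_ ?_
    · intro S
      rw [restr_closedBall]
      exact ((h₁.localAt l.1).cutoff_inBall t S).symm
    · intro S
      rw [restr_closedBall]
      exact ((h₂.localAt l.2).cutoff_inBall t S).symm
  have hg : Measurable fun q : Ω × 𝕄 => (q.2, X q.1) :=
    measurable_snd.prodMk (hXm.comp measurable_fst)
  have mk1 := integral_markFst (μ := μ) (Q := Q) (h₁.measurable_score.comp hg)
  have mk2 := integral_markSnd (μ := μ) (Q := Q) (h₂.measurable_score.comp hg)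
  have mc1 := integral_markFst (μ := μ) (Q := Q) (hm1.comp hg)
  have mc2 := integral_markSnd (μ := μ) (Q := Q) (hm2.comp hg)
  simp only [Function.comp_def, Function.uncurry] at mk1 mk2 mc1 mc2
  have ic1' : Integrable (fun q : Ω × 𝕄 => cutoff (r₁ q.2) (η₁ q.2) t (X q.1)) (μ.prod Q) :=
    ((measurePreserving_markFst μ Q).integrable_comp
      (hm1.comp hg).aestronglyMeasurable).1 ic1
  have ic2' : Integrable (fun q : Ω × 𝕄 => cutoff (r₂ q.2) (η₂ q.2) t (X q.1)) (μ.prod Q) :=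
    ((measurePreserving_markSnd μ Q).integrable_comp
      (hm2.comp hg).aestronglyMeasurable).1 ic2
  have hprod : ∫ q : Ω × 𝕄 × 𝕄, cutoff (r₁ q.2.1) (η₁ q.2.1) t (X q.1) *
      cutoff (r₂ q.2.2) (η₂ q.2.2) t (X q.1) ∂(μ.prod (Q.prod Q)) =
      (∫ q : Ω × 𝕄 × 𝕄, cutoff (r₁ q.2.1) (η₁ q.2.1) t (X q.1) ∂(μ.prod (Q.prod Q))) *
      ∫ q : Ω × 𝕄 × 𝕄, cutoff (r₂ q.2.2) (η₂ q.2.2) t (X q.1) ∂(μ.prod (Q.prod Q)) := by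
    rw [mc1, mc2, integral_prod_symm _ hc, integral_prod_symm _ ic1', integral_prod_symm _ ic2']
    simp only [hindep]
    exact integral_prod_mul (fun m => ∫ ω, cutoff (r₁ m) (η₁ m) t (X ω) ∂μ)
      (fun m => ∫ ω, cutoff (r₂ m) (η₂ m) t (X ω) ∂μ)
  have hA : ∫ q : Ω × 𝕄 × 𝕄, η₁ q.2.1 ((X q.1).ins (b, q.2.2)) *
      η₂ q.2.2 ((X q.1).ins (a, q.2.1)) ∂(μ.prod (Q.prod Q)) =
      ∫ q : Ω × 𝕄 × 𝕄, farProd a b η₁ r₁ η₂ r₂ t q.2 (X q.1) ∂(μ.prod (Q.prod Q)) +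
      ∫ q : Ω × 𝕄 × 𝕄, cutoff (r₁ q.2.1) (η₁ q.2.1) t (X q.1) *
        cutoff (r₂ q.2.2) (η₂ q.2.2) t (X q.1) ∂(μ.prod (Q.prod Q)) := by
    rw [← integral_add iP hc]
    refine integral_congr_ae (Eventually.of_forall fun q => ?_)
    simp only [← key q]
    ring
  have hs1 : ∫ q : Ω × 𝕄, η₁ q.2 (X q.1) ∂(μ.prod Q) =
      ∫ q : Ω × 𝕄 × 𝕄, farPart r₁ η₁ t q.2.1 (X q.1) ∂(μ.prod (Q.prod Q)) +
      ∫ q : Ω × 𝕄 × 𝕄, cutoff (r₁ q.2.1) (η₁ q.2.1) t (X q.1) ∂(μ.prod (Q.prod Q)) := by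
    rw [← mk1, ← integral_add if1 ic1]
    exact integral_congr_ae (Eventually.of_forall fun q => (farPart_add_cutoff t _ _).symm)
  have hs2 : ∫ q : Ω × 𝕄 × 𝕄, η₂ q.2.2 (X q.1) ∂(μ.prod (Q.prod Q)) =
      ∫ q : Ω × 𝕄 × 𝕄, farPart r₂ η₂ t q.2.2 (X q.1) ∂(μ.prod (Q.prod Q)) +
      ∫ q : Ω × 𝕄 × 𝕄, cutoff (r₂ q.2.2) (η₂ q.2.2) t (X q.1) ∂(μ.prod (Q.prod Q)) := by
    rw [← integral_add if2 ic2]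
    exact integral_congr_ae (Eventually.of_forall fun q => (farPart_add_cutoff t _ _).symm)
  rw [covar, hA, hprod, hs1, ← mk2, hs2]
  ring

/-- Exponential decorrelation. -/
theorem PairInput.enorm_covar_le (hab : a ≠ b) :
    ‖covar μ Q X a b η₁ η₂‖ₑ ≤ 3 * (K₁ * K₂ * (2 * τ (dist a b / 3)) ^ (1 / 4 : ℝ)) := by
  have ht : 0 ≤ dist a b / 3 := by positivity
  rw [hX.covar_eq h₁ h₂ hK₁ hK₂ hab]
  obtain ⟨⟨-, i2⟩, ⟨-, if1⟩, ⟨-, ic1⟩, ⟨-, if2⟩, -⟩ := hX.means_le h₁ h₂ hK₁ hK₂ ht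
  have iP := (hX.farProd_le h₁ h₂ hK₁ hK₂ ht).2
  refine (enorm_sub_le.trans (add_le_add_left enorm_sub_le _)).trans ?_
  rw [enorm_mul, enorm_mul]
  refine (add_le_add (add_le_add iP (mul_le_mul' if1 i2)) (mul_le_mul' ic1 if2)).trans_eq ?_
  ring

end Bounds

section Compare

variable [NullSingletonClass (volume : Measure (E d))] {ρ₁ ρ₂ : E d → ℝ}
  {P₁ P₂ : Ω → Config d 𝕄}

/-- Comparison of the covariances on two inputs. -/
theorem PairInput.enorm_covar_sub_le
    (hX₁ : PairInput μ Q P₁ ρ₁ a b η₁ r₁ η₂ r₂ K₁ K₂ τ)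
    (hX₂ : PairInput μ Q P₂ ρ₂ a b η₁ r₁ η₂ r₂ K₁ K₂ τ) (h₁ : IsSite a η₁ r₁)
    (h₂ : IsSite b η₂ r₂) (hK₁ : K₁ ≠ ∞) (hK₂ : K₂ ≠ ∞) (hρ₁ : Measurable ρ₁)
    (hρ₂ : Measurable ρ₂) {B : ℝ} (hb₁ : ∀ z, ρ₁ z ≤ B) (hb₂ : ∀ z, ρ₂ z ≤ B)
    (hτ : Measurable τ) (hab : a ≠ b) :
    ‖covar μ Q P₁ a b η₁ η₂ - covar μ Q P₂ a b η₁ η₂‖ₑ ≤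
      5 * (K₁ * K₂ * (2 * τ (dist a b / 3)) ^ (1 / 4 : ℝ) *
        ∫⁻ z, ENNReal.ofReal |ρ₁ z - ρ₂ z| *
          (4 * (τ (dist z a) + τ (max (dist z a - dist a b) 0)) ^ (1 / 4 : ℝ))) := by
  have ht : 0 ≤ dist a b / 3 := by positivity
  set t := dist a b / 3 with ht_def
  -- The tail of the pair radius, the common radius of all functionals compared below.
  set δ : ℝ → ℝ≥0∞ := fun w => τ w + τ (max (w - dist a b) 0) with hδ
  have hδm : Measurable δ := by
    have : Measurable fun w : ℝ => max (w - dist a b) 0 := by fun_prop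
    exact hτ.add (hτ.comp this)
  have hRm := measurable_pairRadius h₁ h₂
  have hGm := measurableSet_farEvent h₁ h₂ t
  have hRmono : ∀ l (S T : Config d 𝕄), S.pts ⊆ T.pts →
      pairRadius a b r₁ r₂ l T ≤ pairRadius a b r₁ r₂ l S := by
    intro l S T h
    have k1 := h₁.mono l.1 S T h
    have k2 := h₂.mono l.2 S T h
    exact max_le_max k1 (by linarith)
  have hGmono : ∀ l (S T : Config d 𝕄), S.pts ⊆ T.pts → (l, T) ∈ farEvent r₁ r₂ t →
      (l, S) ∈ farEvent r₁ r₂ t := by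
    intro l S T h hT
    exact hT.imp (fun k => k.trans_le (h₁.mono l.1 S T h)) (fun k => k.trans_le (h₂.mono l.2 S T h))
  have hf1 := hX₁.measure_far_le h₁ h₂ ht
  have hf2 := hX₂.measure_far_le h₁ h₂ ht
  have hr1 : ∀ w, 0 ≤ w → _ ≤ δ w := fun w hw => hX₁.measure_pairRadius_le h₁ h₂ hw
  have hr2 : ∀ w, 0 ≤ w → _ ≤ δ w := fun w hw => hX₂.measure_pairRadius_le h₁ h₂ hw
  have c1 := FourthMoment.const_one μ (Q.prod Q) Q P₁ ρ₁
  have c2 := FourthMoment.const_one μ (Q.prod Q) Q P₂ ρ₂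
  have hg1 : Measurable fun q : (𝕄 × 𝕄) × Config d 𝕄 => (q.1.1, q.2) := by fun_prop
  have hg2 : Measurable fun q : (𝕄 × 𝕄) × Config d 𝕄 => (q.1.2, q.2) := by fun_prop
  have hone : Measurable (Function.uncurry fun (_ : 𝕄 × 𝕄) (_ : Config d 𝕄) => (1 : ℝ)) :=
    measurable_const
  -- The means in `covar_eq` are compared one by one. The three far terms use the far event as `G`,
  -- which supplies a factor that is small when the sites are far apart.
  have compA := enorm_integral_sub_le_of_fourthMoment hρ₁ hρ₂ hb₁ hb₂ hX₁.mecke hX₂.mecke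
    (x := a) (G := farEvent r₁ r₂ t) (H := farProd a b η₁ r₁ η₂ r₂ t)
    (u := fun l S => η₁ l.1 (S.ins (b, l.2))) (v := fun l S => η₂ l.2 (S.ins (a, l.1))) hRm
    (measurable_farProd h₁ h₂ t)
    (h₁.measurable_ins b) (h₂.measurable_ins' a) hGm
    (fun l S => by
      rw [farProd]
      by_cases h : (l, S) ∈ farEvent r₁ r₂ t
      · rw [indicator_of_mem h, indicator_of_mem h, enorm_mul]
      · rw [indicator_of_notMem h, indicator_of_notMem h, enorm_zero])
    (fun l S S' h => by
      obtain ⟨e1, e2, -, -, e3, e4, e5⟩ := localAt_pairRadius h₁ h₂ l h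
      refine ⟨e5, ?_⟩
      simp only [farProd, indicator, farEvent, mem_ofPred_eq, e1, e2, e3, e4]
      congr)
    hRmono hGmono hδm hK₁ hK₂ hX₁.moment₁_ins hX₁.moment₂_ins hX₂.moment₁_ins hX₂.moment₂_ins
    hf1 hf2 hr1 hr2
  have compB1 := enorm_integral_sub_le_of_fourthMoment hρ₁ hρ₂ hb₁ hb₂ hX₁.mecke hX₂.mecke
    (x := a) (G := farEvent r₁ r₂ t) (H := fun l : 𝕄 × 𝕄 => farPart r₁ η₁ t l.1)
    (u := fun l S => η₁ l.1 S) (v := fun _ _ => 1) hRm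
    ((h₁.measurable_farPart t).comp hg1) (h₁.measurable_score.comp hg1) hone hGm
    (fun l S => by
      by_cases h : t < r₁ l.1 S <;> simp [farPart, farEvent, h, Function.uncurry])
    (fun l S S' h => by
      obtain ⟨e1, -, e3, -, -, -, e5⟩ := localAt_pairRadius h₁ h₂ l h
      refine ⟨e5, ?_⟩
      simp only [farPart, indicator, mem_ofPred_eq, e1, e3])
    hRmono hGmono hδm hK₁ ENNReal.one_ne_top hX₁.moment₁ c1 hX₂.moment₁ c2 hf1 hf2 hr1 hr2
  have compB2 := enorm_integral_sub_le_of_fourthMoment hρ₁ hρ₂ hb₁ hb₂ hX₁.mecke hX₂.mecke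
    (x := a) (G := farEvent r₁ r₂ t) (H := fun l : 𝕄 × 𝕄 => farPart r₂ η₂ t l.2)
    (u := fun l S => η₂ l.2 S) (v := fun _ _ => 1) hRm
    ((h₂.measurable_farPart t).comp hg2) (h₂.measurable_score.comp hg2) hone hGm
    (fun l S => by
      by_cases h : t < r₂ l.2 S <;> simp [farPart, farEvent, h, Function.uncurry])
    (fun l S S' h => by
      obtain ⟨-, e2, -, e4, -, -, e5⟩ := localAt_pairRadius h₁ h₂ l h
      refine ⟨e5, ?_⟩
      simp only [farPart, indicator, mem_ofPred_eq, e2, e4])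
    hRmono hGmono hδm hK₂ ENNReal.one_ne_top hX₁.moment₂ c1 hX₂.moment₂ c2 hf1 hf2 hr1 hr2
  -- The near part and the full mean carry no such factor, so `G` is everything; they will be
  -- multiplied by the mean of a far part.
  have compC1 := enorm_integral_sub_le_of_fourthMoment hρ₁ hρ₂ hb₁ hb₂ hX₁.mecke hX₂.mecke
    (x := a) (G := univ) (ε := 1) (H := fun l : 𝕄 × 𝕄 => cutoff (r₁ l.1) (η₁ l.1) t)
    (u := fun l S => η₁ l.1 S) (v := fun _ _ => 1) hRm
    ((h₁.measurable_cutoff t).comp hg1) (h₁.measurable_score.comp hg1) hone MeasurableSet.univ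
    (fun l S => by
      by_cases h : r₁ l.1 S ≤ t <;> simp [cutoff, h, Function.uncurry])
    (fun l S S' h => by
      obtain ⟨e1, -, e3, -, -, -, e5⟩ := localAt_pairRadius h₁ h₂ l h
      refine ⟨e5, ?_⟩
      simp only [cutoff, indicator, mem_ofPred_eq, e1, e3])
    hRmono (fun _ _ _ _ _ => mem_univ _) hδm hK₁ ENNReal.one_ne_top hX₁.moment₁ c1 hX₂.moment₁ c2
    prob_le_one prob_le_one hr1 hr2
  have compE2 := enorm_integral_sub_le_of_fourthMoment hρ₁ hρ₂ hb₁ hb₂ hX₁.mecke hX₂.mecke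
    (x := a) (G := univ) (ε := 1) (H := fun l : 𝕄 × 𝕄 => η₂ l.2)
    (u := fun l S => η₂ l.2 S) (v := fun _ _ => 1) hRm
    (h₂.measurable_score.comp hg2) (h₂.measurable_score.comp hg2) hone MeasurableSet.univ
    (fun l S => by simp [Function.uncurry])
    (fun l S S' h => by
      obtain ⟨-, -, -, e4, -, -, e5⟩ := localAt_pairRadius h₁ h₂ l h
      exact ⟨e5, e4⟩)
    hRmono (fun _ _ _ _ _ => mem_univ _) hδm hK₂ ENNReal.one_ne_top hX₁.moment₂ c1 hX₂.moment₂ c2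
    prob_le_one prob_le_one hr1 hr2
  rw [hX₁.covar_eq h₁ h₂ hK₁ hK₂ hab, hX₂.covar_eq h₁ h₂ hK₁ hK₂ hab]
  obtain ⟨⟨-, i2⟩, -, -, ⟨-, if2⟩, -⟩ := hX₁.means_le h₁ h₂ hK₁ hK₂ ht
  obtain ⟨-, ⟨-, if1'⟩, ⟨-, ic1'⟩, -, -⟩ := hX₂.means_le h₁ h₂ hK₁ hK₂ ht
  set J := ∫⁻ z, ENNReal.ofReal |ρ₁ z - ρ₂ z| * (4 * δ (dist z a) ^ (1 / 4 : ℝ))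
  set ε := (2 * τ t) ^ (1 / 4 : ℝ)
  simp only [ENNReal.one_rpow, mul_one] at compB1 compB2 compC1 compE2
  -- Telescoping such that each of the five summands contains exactly one difference of means and
  -- one far factor. All five have the same bound, which gives the constant 5.
  have split : ∀ x y z w u v x' y' z' w' u' v' : ℝ,
      (x - u * v - z * w) - (x' - u' * v' - z' * w') =
        (x - x') - (u - u') * v - u' * (v - v') - (z - z') * w - z' * (w - w') := by
    intros; ring
  rw [split _ 0 _ _ _ _ _ 0]
  refine (enorm_sub_le.trans (add_le_add_left (enorm_sub_le.trans (add_le_add_left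
    (enorm_sub_le.trans (add_le_add_left enorm_sub_le _)) _)) _)).trans ?_
  simp only [enorm_mul]
  refine (add_le_add (add_le_add (add_le_add (add_le_add compA (mul_le_mul' compB1 i2))
    (mul_le_mul' if1' compE2)) (mul_le_mul' compC1 if2)) (mul_le_mul' ic1' compB2)).trans_eq ?_
  ring

end Compare

end Pair

end StabScores

end

/-! ### Exponential tails and explicit constants -/

noncomputable section

namespace StabScores

variable {d : ℕ} {𝕄 Ω : Type*} [MeasurableSpace 𝕄] [MeasurableSpace Ω]

open Config

/-- An exponential tail of order `d`. -/
def expTail (d : ℕ) (C κ : ℝ) (t : ℝ) : ℝ≥0∞ := ENNReal.ofReal (C * Real.exp (-κ * t ^ d))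

lemma measurable_expTail (d : ℕ) (C κ : ℝ) : Measurable (expTail d C κ) := by
  unfold expTail
  fun_prop

lemma two_mul_expTail (d : ℕ) (C κ : ℝ) (t : ℝ) : 2 * expTail d C κ t = expTail d (2 * C) κ t := by
  rw [expTail, expTail, mul_assoc, ENNReal.ofReal_mul (p := 2) (by norm_num), ENNReal.ofReal_ofNat]

lemma expTail_rpow {C κ t : ℝ} (hC : 0 ≤ C) :
    expTail d C κ t ^ (1 / 4 : ℝ) =
      ENNReal.ofReal (C ^ (1 / 4 : ℝ) * Real.exp (-(κ * t ^ d / 4))) := by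
  rw [expTail, ENNReal.ofReal_rpow_of_nonneg (by positivity) (by norm_num),
    Real.mul_rpow hC (Real.exp_pos _).le, ← Real.exp_mul]
  congr 3
  ring

/-- The reduced rate. -/
def slowRate (d : ℕ) (κ : ℝ) : ℝ := κ / (8 * 6 ^ d)

lemma slowRate_le {κ t : ℝ} (hκ : 0 ≤ κ) (ht : 0 ≤ t) : slowRate d κ * t ^ d ≤ κ * t ^ d / 4 := by
  have h6 : (1 : ℝ) ≤ 6 ^ d := one_le_pow₀ (by norm_num)
  have : slowRate d κ ≤ κ / 4 := by
    rw [slowRate]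
    gcongr
    linarith
  calc slowRate d κ * t ^ d ≤ κ / 4 * t ^ d := by gcongr
    _ = κ * t ^ d / 4 := by ring

/-- Here `D` is the distance of the sites and `w` that of the perturbation. If `w ≤ 2 * D`, then `D
/ 3` dominates `w / 6`; otherwise `w - D` does. In the constant `8 * 6 ^ d` of `slowRate`, the 8
consists of 4 for the fourth root of the tail and 2 for sharing the decay between `D` and `w`. -/
lemma slowRate_split_le {κ D w : ℝ} (hκ : 0 ≤ κ) (hD : 0 ≤ D) (hw : 0 ≤ w) :
    slowRate d κ * D ^ d + slowRate d κ * w ^ d ≤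
      κ * (D / 3) ^ d / 4 + κ * (max (w - D) 0) ^ d / 4 := by
  have key : (D / 6) ^ d / 2 + (w / 6) ^ d / 2 ≤ (D / 3) ^ d + (max (w - D) 0) ^ d := by
    rcases le_total w (2 * D) with h | h
    · have h1 : (D / 6) ^ d ≤ (D / 3) ^ d := by gcongr; norm_num
      have h2 : (w / 6) ^ d ≤ (D / 3) ^ d := pow_le_pow_left₀ (by positivity) (by linarith) d
      have h3 : 0 ≤ (max (w - D) 0) ^ d := by positivity
      linarith
    · have h1 : (D / 6) ^ d ≤ (D / 3) ^ d := by gcongr; norm_num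
      have h2 : (w / 6) ^ d ≤ (max (w - D) 0) ^ d :=
        pow_le_pow_left₀ (by positivity) (le_max_of_le_left (by linarith)) d
      have h3 : 0 ≤ (D / 6) ^ d := by positivity
      have h4 : 0 ≤ (w / 6) ^ d := by positivity
      linarith
  calc slowRate d κ * D ^ d + slowRate d κ * w ^ d
      = κ / 4 * ((D / 6) ^ d / 2 + (w / 6) ^ d / 2) := by
        rw [slowRate, div_pow, div_pow]
        field_simp
        ring
    _ ≤ κ / 4 * ((D / 3) ^ d + (max (w - D) 0) ^ d) := by gcongr
    _ = _ := by ring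

lemma slowRate_third_le {κ D : ℝ} (hκ : 0 ≤ κ) (hD : 0 ≤ D) :
    slowRate d κ * D ^ d ≤ κ * (D / 3) ^ d / 4 := by
  have h6 : (D / 6) ^ d ≤ (D / 3) ^ d := by gcongr; norm_num
  have h0 : 0 ≤ (D / 6) ^ d := by positivity
  calc slowRate d κ * D ^ d = κ / 4 * ((D / 6) ^ d / 2) := by
        rw [slowRate, div_pow]
        field_simp
        ring
    _ ≤ κ / 4 * (D / 3) ^ d := by gcongr; linarith
    _ = _ := by ring

lemma expTail_third_rpow_le {C κ D : ℝ} (hC : 0 ≤ C) (hκ : 0 ≤ κ) (hD : 0 ≤ D) :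
    (2 * expTail d C κ (D / 3)) ^ (1 / 4 : ℝ) ≤
      ENNReal.ofReal ((2 * C) ^ (1 / 4 : ℝ) * Real.exp (-(slowRate d κ * D ^ d))) := by
  rw [two_mul_expTail, expTail_rpow (by positivity)]
  gcongr
  exact slowRate_third_le hκ hD

/-- The pair radius alone decays in `w` only beyond the distance `D`. The decay in `D` of the far
factor makes up for the range `w ≤ 2 * D`, and what results is a product of decay in `D` and decay
in `w`. -/
lemma expTail_add_rpow_le {C κ D w : ℝ} (hC : 0 ≤ C) (hκ : 0 ≤ κ) (hD : 0 ≤ D) (hw : 0 ≤ w) :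
    (2 * expTail d C κ (D / 3)) ^ (1 / 4 : ℝ) *
      (expTail d C κ w + expTail d C κ (max (w - D) 0)) ^ (1 / 4 : ℝ) ≤
      ENNReal.ofReal ((2 * C) ^ (1 / 2 : ℝ) * Real.exp (-(slowRate d κ * D ^ d))) *
        ENNReal.ofReal (Real.exp (-(slowRate d κ * w ^ d))) := by
  have h1 : expTail d C κ w + expTail d C κ (max (w - D) 0) ≤
      expTail d (2 * C) κ (max (w - D) 0) := by
    rw [← two_mul_expTail, two_mul]
    refine add_le_add_left ?_ _
    unfold expTail
    have : (max (w - D) 0) ^ d ≤ w ^ d :=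
      pow_le_pow_left₀ (le_max_right _ _) (max_le (by linarith) hw) d
    gcongr ENNReal.ofReal (C * Real.exp ?_)
    nlinarith
  refine (mul_le_mul' le_rfl (ENNReal.rpow_le_rpow h1 (by norm_num))).trans ?_
  rw [two_mul_expTail, expTail_rpow (by positivity), expTail_rpow (by positivity),
    ← ENNReal.ofReal_mul (by positivity), ← ENNReal.ofReal_mul (by positivity)]
  refine ENNReal.ofReal_le_ofReal ?_
  have e : (2 * C) ^ (1 / 2 : ℝ) = (2 * C) ^ (1 / 4 : ℝ) * (2 * C) ^ (1 / 4 : ℝ) := by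
    rw [← Real.rpow_add_of_nonneg (by positivity) (by norm_num) (by norm_num)]
    norm_num
  calc (2 * C) ^ (1 / 4 : ℝ) * Real.exp (-(κ * (D / 3) ^ d / 4)) *
        ((2 * C) ^ (1 / 4 : ℝ) * Real.exp (-(κ * max (w - D) 0 ^ d / 4)))
      = (2 * C) ^ (1 / 2 : ℝ) *
        Real.exp (-(κ * (D / 3) ^ d / 4 + κ * max (w - D) 0 ^ d / 4)) := by
        rw [e, neg_add, Real.exp_add]
        ring
    _ ≤ (2 * C) ^ (1 / 2 : ℝ) *
        Real.exp (-(slowRate d κ * D ^ d + slowRate d κ * w ^ d)) := by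
        gcongr ?_ * Real.exp (-?_)
        exact slowRate_split_le hκ hD hw
    _ = _ := by
        rw [neg_add, Real.exp_add]
        ring

section Pair

variable {a b : E d} {η₁ r₁ η₂ r₂ η₂' r₂' : 𝕄 → Config d 𝕄 → ℝ}
  {μ : Measure Ω} [IsProbabilityMeasure μ] {Q : Measure 𝕄} [IsProbabilityMeasure Q]
  {X : Ω → Config d 𝕄} {ρ : E d → ℝ} {K₁ K₂ C κ : ℝ}

/-- Exponential decorrelation. -/
theorem PairInput.abs_covar_le
    (hX : PairInput μ Q X ρ a b η₁ r₁ η₂ r₂ (ENNReal.ofReal K₁) (ENNReal.ofReal K₂)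
      (expTail d C κ)) (h₁ : IsSite a η₁ r₁) (h₂ : IsSite b η₂ r₂) (hK₁ : 0 ≤ K₁) (hK₂ : 0 ≤ K₂)
    (hC : 0 ≤ C) (hκ : 0 ≤ κ) (hab : a ≠ b) :
    |covar μ Q X a b η₁ η₂| ≤
      3 * K₁ * K₂ * (2 * C) ^ (1 / 4 : ℝ) * Real.exp (-(slowRate d κ * dist a b ^ d)) := by
  have h := hX.enorm_covar_le h₁ h₂ ENNReal.ofReal_ne_top ENNReal.ofReal_ne_top hab
  rw [← ENNReal.ofReal_le_ofReal_iff (by positivity), ← Real.enorm_eq_ofReal_abs]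
  refine h.trans ((mul_le_mul' le_rfl (mul_le_mul' le_rfl
    (expTail_third_rpow_le hC hκ dist_nonneg))).trans_eq ?_)
  rw [show (3 : ℝ≥0∞) = ENNReal.ofReal 3 by norm_num, ← ENNReal.ofReal_mul hK₁,
    ← ENNReal.ofReal_mul (by positivity), ← ENNReal.ofReal_mul (by positivity)]
  congr 1
  ring

/-- Comparison of the covariances on two inputs. -/
theorem PairInput.ofReal_abs_covar_sub_le [NullSingletonClass (volume : Measure (E d))]
    {ρ₁ ρ₂ : E d → ℝ} {P₁ P₂ : Ω → Config d 𝕄}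
    (hX₁ : PairInput μ Q P₁ ρ₁ a b η₁ r₁ η₂ r₂ (ENNReal.ofReal K₁) (ENNReal.ofReal K₂)
      (expTail d C κ))
    (hX₂ : PairInput μ Q P₂ ρ₂ a b η₁ r₁ η₂ r₂ (ENNReal.ofReal K₁) (ENNReal.ofReal K₂)
      (expTail d C κ)) (h₁ : IsSite a η₁ r₁)
    (h₂ : IsSite b η₂ r₂) (hK₁ : 0 ≤ K₁) (hK₂ : 0 ≤ K₂) (hC : 0 ≤ C) (hκ : 0 ≤ κ)
    (hρ₁ : Measurable ρ₁) (hρ₂ : Measurable ρ₂) {B : ℝ} (hb₁ : ∀ z, ρ₁ z ≤ B)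
    (hb₂ : ∀ z, ρ₂ z ≤ B) (hab : a ≠ b) :
    ENNReal.ofReal |covar μ Q P₁ a b η₁ η₂ - covar μ Q P₂ a b η₁ η₂| ≤
      ENNReal.ofReal (20 * K₁ * K₂ * (2 * C) ^ (1 / 2 : ℝ) *
        Real.exp (-(slowRate d κ * dist a b ^ d))) *
        ∫⁻ z, ENNReal.ofReal |ρ₁ z - ρ₂ z| *
          ENNReal.ofReal (Real.exp (-(slowRate d κ * dist z a ^ d))) := by
  have h := hX₁.enorm_covar_sub_le hX₂ h₁ h₂ ENNReal.ofReal_ne_top ENNReal.ofReal_ne_top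
    hρ₁ hρ₂ hb₁ hb₂ (measurable_expTail d C κ) hab
  rw [← Real.enorm_eq_ofReal_abs]
  refine h.trans ?_
  have hτ := measurable_expTail d C κ
  rw [← lintegral_const_mul _ (by fun_prop), ← lintegral_const_mul _ (by fun_prop),
    ← lintegral_const_mul _ (by fun_prop)]
  refine lintegral_mono fun z => ?_
  have hz := expTail_add_rpow_le (d := d) hC hκ (dist_nonneg (x := a) (y := b))
    (dist_nonneg (x := z) (y := a))
  set x₁ := (2 * expTail d C κ (dist a b / 3)) ^ (1 / 4 : ℝ)
  set x₂ := (expTail d C κ (dist z a) + expTail d C κ (max (dist z a - dist a b) 0)) ^ (1 / 4 : ℝ)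
  calc 5 * (ENNReal.ofReal K₁ * ENNReal.ofReal K₂ * x₁ *
        (ENNReal.ofReal |ρ₁ z - ρ₂ z| * (4 * x₂)))
      = 20 * ENNReal.ofReal K₁ * ENNReal.ofReal K₂ * ENNReal.ofReal |ρ₁ z - ρ₂ z| * (x₁ * x₂) := by
        ring
    _ ≤ 20 * ENNReal.ofReal K₁ * ENNReal.ofReal K₂ * ENNReal.ofReal |ρ₁ z - ρ₂ z| * _ :=
        mul_le_mul' le_rfl hz
    _ = _ := by
        rw [show (20 : ℝ≥0∞) = ENNReal.ofReal 20 by norm_num, mul_assoc (20 * K₁ * K₂),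
          ENNReal.ofReal_mul (p := 20 * K₁ * K₂) (by positivity),
          ENNReal.ofReal_mul (p := 20 * K₁) (by positivity), ENNReal.ofReal_mul (p := 20)
          (by positivity)]
        ring

/-- Comparison of the mixed second moments at a point on two inputs. -/
theorem ofReal_abs_integral_mul_sub_le [NullSingletonClass (volume : Measure (E d))]
    {η₁ η₂ r : 𝕄 → Config d 𝕄 → ℝ}
    {ρ₁ ρ₂ : E d → ℝ} {P₁ P₂ : Ω → Config d 𝕄} (hP₁ : IsMecke μ P₁ (intensity ρ₁ Q))
    (hP₂ : IsMecke μ P₂ (intensity ρ₂ Q))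
    (hu₁ : FourthMoment μ Q Q P₁ ρ₁ η₁ (ENNReal.ofReal K₁))
    (hv₁ : FourthMoment μ Q Q P₁ ρ₁ η₂ (ENNReal.ofReal K₂))
    (hu₂ : FourthMoment μ Q Q P₂ ρ₂ η₁ (ENNReal.ofReal K₁))
    (hv₂ : FourthMoment μ Q Q P₂ ρ₂ η₂ (ENNReal.ofReal K₂))
    (ht₁ : ∀ t, 0 ≤ t → (μ.prod Q) {q | t ≤ r q.2 (P₁ q.1)} ≤ expTail d C κ t)
    (ht₂ : ∀ t, 0 ≤ t → (μ.prod Q) {q | t ≤ r q.2 (P₂ q.1)} ≤ expTail d C κ t)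
    (h₁ : IsSite a η₁ r)
    (h₂ : IsSite a η₂ r) (hK₁ : 0 ≤ K₁) (hC : 0 ≤ C) (hκ : 0 ≤ κ) (hK₂ : 0 ≤ K₂)
    (hρ₁ : Measurable ρ₁) (hρ₂ : Measurable ρ₂) {B : ℝ} (hb₁ : ∀ z, ρ₁ z ≤ B)
    (hb₂ : ∀ z, ρ₂ z ≤ B) :
    ENNReal.ofReal |∫ q : Ω × 𝕄, η₁ q.2 (P₁ q.1) * η₂ q.2 (P₁ q.1) ∂(μ.prod Q) -
        ∫ q : Ω × 𝕄, η₁ q.2 (P₂ q.1) * η₂ q.2 (P₂ q.1) ∂(μ.prod Q)| ≤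
      ENNReal.ofReal (4 * K₁ * K₂ * C ^ (1 / 4 : ℝ)) *
        ∫⁻ z, ENNReal.ofReal |ρ₁ z - ρ₂ z| *
          ENNReal.ofReal (Real.exp (-(slowRate d κ * dist z a ^ d))) := by
  have h := enorm_integral_sub_le_of_fourthMoment hρ₁ hρ₂ hb₁ hb₂ hP₁ hP₂
    (x := a) (G := univ) (ε := 1) (R := r) (H := fun m S => η₁ m S * η₂ m S)
    (u := η₁) (v := η₂) h₁.measurable_radius (h₁.measurable_score.mul h₂.measurable_score)
    h₁.measurable_score h₂.measurable_score MeasurableSet.univ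
    (fun l S => by simp [enorm_mul])
    (fun l S S' h => ⟨h₁.radius_eq h, by simp only [h₁.score_eq h, h₂.score_eq h]⟩)
    h₁.mono (fun _ _ _ _ _ => mem_univ _) (measurable_expTail d C κ) ENNReal.ofReal_ne_top
    ENNReal.ofReal_ne_top hu₁ hv₁ hu₂ hv₂ prob_le_one prob_le_one ht₁ ht₂
  rw [← Real.enorm_eq_ofReal_abs]
  refine h.trans ?_
  have hτ := measurable_expTail d C κ
  rw [← lintegral_const_mul _ (by fun_prop), ← lintegral_const_mul _ (by fun_prop)]
  refine lintegral_mono fun z => ?_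
  have hz : expTail d C κ (dist z a) ^ (1 / 4 : ℝ) ≤ ENNReal.ofReal (C ^ (1 / 4 : ℝ)) *
      ENNReal.ofReal (Real.exp (-(slowRate d κ * dist z a ^ d))) := by
    rw [expTail_rpow hC, ← ENNReal.ofReal_mul (by positivity)]
    gcongr
    exact slowRate_le hκ dist_nonneg
  rw [ENNReal.one_rpow, mul_one]
  calc ENNReal.ofReal K₁ * ENNReal.ofReal K₂ *
        (ENNReal.ofReal |ρ₁ z - ρ₂ z| * (4 * expTail d C κ (dist z a) ^ (1 / 4 : ℝ)))
      ≤ ENNReal.ofReal K₁ * ENNReal.ofReal K₂ * (ENNReal.ofReal |ρ₁ z - ρ₂ z| *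
        (4 * (ENNReal.ofReal (C ^ (1 / 4 : ℝ)) *
          ENNReal.ofReal (Real.exp (-(slowRate d κ * dist z a ^ d)))))) := by
        gcongr
    _ = _ := by
        rw [show (4 : ℝ≥0∞) = ENNReal.ofReal 4 by norm_num,
          ENNReal.ofReal_mul (p := 4 * K₁ * K₂) (by positivity),
          ENNReal.ofReal_mul (p := 4 * K₁) (by positivity), ENNReal.ofReal_mul (p := 4)
          (by positivity)]
        ring

lemma FourthMoment.of_bound {𝕃 : Type*} [MeasurableSpace 𝕃] {L : Measure 𝕃}
    [IsProbabilityMeasure L] {u : 𝕃 → Config d 𝕄 → ℝ} {δ : ℝ} (h : ∀ l S, |u l S| ≤ δ) :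
    FourthMoment μ L Q X ρ u (ENNReal.ofReal δ) := by
  have h' : ∀ l S, ‖u l S‖ₑ ^ 4 ≤ ENNReal.ofReal δ ^ 4 := fun l S => by
    gcongr
    rw [Real.enorm_eq_ofReal_abs]
    exact ENNReal.ofReal_le_ofReal (h l S)
  refine ⟨?_, Eventually.of_forall fun z _ => ?_⟩
  · exact (lintegral_mono fun q => h' _ _).trans (by simp)
  · exact (lintegral_mono fun q => h' _ _).trans (by simp)

open Classical in
/-- A larger radius works as well. -/
lemma IsSite.stab_of_le (h₁ : IsSite a η₁ r₁) (m : 𝕄) (S : Config d 𝕄) {t : ℝ} (ht : r₁ m S ≤ t)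
    {F : Finset (E d × 𝕄)} (hF : F.card ≤ 9) :
    η₁ m ((S.addFinset F).inBall a t) = η₁ m (S.addFinset F) := by
  -- Restriction to the larger ball commutes with adding points once those outside it are discarded;
  -- the restricted configuration has the same radius, so stabilization can be applied to it.
  set F' := F.filter fun p => p.1 ∈ Metric.closedBall a t with hF'
  have e : (S.addFinset F).inBall a t = (S.inBall a t).addFinset F' := by
    ext1
    rw [inBall_pts, addFinset_pts, addFinset_pts, inBall_pts, union_inter_distrib_right]
    congr 1
    ext p
    simp [hF']
  have hS : S.inBall a (r₁ m S) = (S.inBall a t).inBall a (r₁ m S) :=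
    (inBall_inBall_of_le S a ht).symm
  have h1 := h₁.stab m (S.inBall a t) F' ((Finset.card_filter_le _ _).trans hF)
  rw [h₁.radius_eq hS, ← e, inBall_inBall_of_le _ _ ht, h₁.stab m S F hF] at h1
  rw [← h1.symm]

/-- Differences of sites are sites. Hence continuity of the covariance in its second functional is
decorrelation for a functional that is uniformly small. -/
lemma IsSite.sub (h₂ : IsSite b η₂ r₂) (h₂' : IsSite b η₂' r₂') :
    IsSite b (fun m S => η₂ m S - η₂' m S) (fun m S => max (r₂ m S) (r₂' m S)) where
  measurable_score := h₂.measurable_score.sub h₂'.measurable_score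
  measurable_radius := h₂.measurable_radius.max h₂'.measurable_radius
  nonneg m S := (h₂.nonneg m S).trans (le_max_left _ _)
  stab m S F hF := by
    rw [h₂.stab_of_le m S (le_max_left _ _) hF, h₂'.stab_of_le m S (le_max_right _ _) hF]
  mono m S T h := max_le_max (h₂.mono m S T h) (h₂'.mono m S T h)
  loc m S t ht := by
    rw [max_le_iff, max_le_iff, h₂.loc m S t ht, h₂'.loc m S t ht]

/-- The covariance depends continuously on its second functional. -/
theorem PairInput.abs_covar_sub_right_le
    (hX : PairInput μ Q X ρ a b η₁ r₁ η₂ r₂ (ENNReal.ofReal K₁) (ENNReal.ofReal K₂)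
      (expTail d C κ))
    (hX' : PairInput μ Q X ρ a b η₁ r₁ η₂' r₂' (ENNReal.ofReal K₁) (ENNReal.ofReal K₂)
      (expTail d C κ)) (h₁ : IsSite a η₁ r₁) (h₂ : IsSite b η₂ r₂) (h₂' : IsSite b η₂' r₂')
    (hK₁ : 0 ≤ K₁) {δ : ℝ} (hδ : 0 ≤ δ) (hdiff : ∀ m S, |η₂ m S - η₂' m S| ≤ δ)
    (hC : 0 ≤ C) (hκ : 0 ≤ κ) (hab : a ≠ b) :
    |covar μ Q X a b η₁ η₂ - covar μ Q X a b η₁ η₂'| ≤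
      3 * K₁ * δ * (2 * (2 * C)) ^ (1 / 4 : ℝ) *
        Real.exp (-(slowRate d κ * dist a b ^ d)) := by
  have hXm := hX.mecke.measurable
  have hs := h₂.sub h₂'
  -- The uniform bound `δ` serves as the moment constant of the difference; the maximum of two radii
  -- doubles the constant of the tail.
  have hdX : PairInput μ Q X ρ a b η₁ r₁ (fun m S => η₂ m S - η₂' m S)
      (fun m S => max (r₂ m S) (r₂' m S)) (ENNReal.ofReal K₁) (ENNReal.ofReal δ)
      (expTail d (2 * C) κ) := by
    refine ⟨hX.mecke, hX.moment₁, hX.moment₁_ins, FourthMoment.of_bound fun l S => hdiff _ _,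
      FourthMoment.of_bound fun l S => hdiff _ _, fun t ht => ?_, fun t ht => ?_⟩
    · refine (hX.tail₁ t ht).trans ?_
      rw [← two_mul_expTail, two_mul]
      exact le_self_add
    · rw [← two_mul_expTail, two_mul]
      refine le_trans ?_ (add_le_add (hX.tail₂ t ht) (hX'.tail₂ t ht))
      refine le_trans (measure_mono ?_) (measure_union_le _ _)
      intro q hq
      exact le_max_iff.1 (mem_ofPred_eq ▸ hq)
  have e : covar μ Q X a b η₁ η₂ - covar μ Q X a b η₁ η₂' =
      covar μ Q X a b η₁ (fun m S => η₂ m S - η₂' m S) := by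
    have i1 := hX.integrable_prod h₁ h₂ ENNReal.ofReal_ne_top ENNReal.ofReal_ne_top
    have i2 := hX'.integrable_prod h₁ h₂' ENNReal.ofReal_ne_top ENNReal.ofReal_ne_top
    have hg : Measurable fun q : Ω × 𝕄 => (q.2, X q.1) :=
      measurable_snd.prodMk (hXm.comp measurable_fst)
    have j1 : Integrable (fun q : Ω × 𝕄 => η₂ q.2 (X q.1)) (μ.prod Q) :=
      ((measurePreserving_markSnd μ Q).integrable_comp
        (h₂.measurable_score.comp hg).aestronglyMeasurable).1
        (hX.means_le h₁ h₂ ENNReal.ofReal_ne_top ENNReal.ofReal_ne_top le_rfl).1.1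
    have j2 : Integrable (fun q : Ω × 𝕄 => η₂' q.2 (X q.1)) (μ.prod Q) :=
      ((measurePreserving_markSnd μ Q).integrable_comp
        (h₂'.measurable_score.comp hg).aestronglyMeasurable).1
        (hX'.means_le h₁ h₂' ENNReal.ofReal_ne_top ENNReal.ofReal_ne_top le_rfl).1.1
    simp only [covar, mul_sub]
    rw [integral_sub i1 i2, integral_sub j1 j2]
    ring
  rw [e]
  exact hdX.abs_covar_le h₁ hs hK₁ hδ (by positivity) hκ hab

end Pair

end StabScores

end

/-! ### Translation and dilation; moments on inputs with inserted points -/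

noncomputable section

namespace StabScores

variable {d : ℕ} {𝕄 : Type*}

namespace Config

lemma translate_pts (S : Config d 𝕄) (v : E d) :
    (S.translate v).pts = (fun p : E d × 𝕄 => (p.1 + v, p.2)) '' S.pts := rfl

lemma addFinset_translate (S : Config d 𝕄) (F : Finset (E d × 𝕄)) (v : E d) :
    (S.addFinset F).translate v =
      (S.translate v).addFinset (F.map ⟨_, translate_injective v⟩) := by
  ext1
  simp only [translate_pts, addFinset_pts, image_union, Finset.coe_map,
    Function.Embedding.coeFn_mk]

lemma inBall_translate (S : Config d 𝕄) (a v : E d) (t : ℝ) :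
    (S.inBall a t).translate v = (S.translate v).inBall (a + v) t := by
  ext1
  rw [translate_pts, inBall_pts, inBall_pts, translate_pts]
  ext q
  constructor
  · rintro ⟨p, ⟨hp, hpa, -⟩, rfl⟩
    exact ⟨⟨p, hp, rfl⟩, by simpa using hpa, mem_univ _⟩
  · rintro ⟨⟨p, hp, rfl⟩, hpa, -⟩
    exact ⟨p, ⟨hp, by simpa using hpa, mem_univ _⟩, rfl⟩

lemma mem_proj_translate {S : Config d 𝕄} {x v : E d} :
    x + v ∈ (S.translate v).proj ↔ x ∈ S.proj := by
  simp [proj, translate_pts]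

lemma add_translate (S : Config d 𝕄) (p : E d × 𝕄) (v : E d) :
    (S.add p).translate v = (S.translate v).add (p.1 + v, p.2) := by
  ext1
  rw [translate_pts, add_pts, add_pts, image_insert_eq, translate_pts]

lemma ins_translate (S : Config d 𝕄) (p : E d × 𝕄) (v : E d) :
    (S.ins p).translate v = (S.translate v).ins (p.1 + v, p.2) := by
  by_cases h : p.1 ∈ S.proj
  · rw [ins_of_mem h, ins_of_mem (mem_proj_translate.2 h)]
  · rw [ins_of_notMem h, ins_of_notMem (fun h' => h (mem_proj_translate.1 h')), add_translate]

lemma dilate_translate (S : Config d 𝕄) (b v : E d) {α : ℝ} (hα : 0 < α) :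
    (S.dilate b α).translate v = (S.translate v).dilate (b + v) α := by
  ext1
  rw [translate_pts, dilate_pts _ _ hα, dilate_pts _ _ hα, translate_pts, image_image, image_image]
  congr 1
  ext p <;> simp
  ring

lemma dilate_translate_neg (S : Config d 𝕄) (b v : E d) {α : ℝ} (hα : 0 < α) :
    (S.dilate b α).translate (-(α • v)) = (S.translate (-v)).dilate b α := by
  ext1
  rw [translate_pts, dilate_pts _ _ hα, dilate_pts _ _ hα, translate_pts, image_image, image_image]
  congr 1
  ext p <;> simp
  ring

lemma mem_proj_dilate {S : Config d 𝕄} {x b : E d} {α : ℝ} (hα : 0 < α) :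
    b + α • (x - b) ∈ (S.dilate b α).proj ↔ x ∈ S.proj := by
  rw [proj, dilate_pts _ _ hα]
  constructor
  · rintro ⟨_, ⟨p, hp, rfl⟩, h⟩
    have h1 : p.1 = x :=
      sub_left_injective (smul_right_injective _ hα.ne' (add_right_injective b h))
    exact ⟨p, hp, h1⟩
  · rintro ⟨p, hp, rfl⟩
    exact ⟨_, ⟨p, hp, rfl⟩, rfl⟩

lemma add_dilate (S : Config d 𝕄) (p : E d × 𝕄) (b : E d) {α : ℝ} (hα : 0 < α) :
    (S.add p).dilate b α = (S.dilate b α).add (b + α • (p.1 - b), p.2) := by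
  ext1
  rw [dilate_pts _ _ hα, add_pts, add_pts, image_insert_eq, dilate_pts _ _ hα]

lemma ins_dilate (S : Config d 𝕄) (p : E d × 𝕄) (b : E d) {α : ℝ} (hα : 0 < α) :
    (S.ins p).dilate b α = (S.dilate b α).ins (b + α • (p.1 - b), p.2) := by
  by_cases h : p.1 ∈ S.proj
  · rw [ins_of_mem h, ins_of_mem ((mem_proj_dilate hα).2 h)]
  · rw [ins_of_notMem h, ins_of_notMem (fun h' => h ((mem_proj_dilate hα).1 h')), add_dilate _ _ _ hα]

lemma mem_proj_ins {S : Config d 𝕄} {p : E d × 𝕄} {x : E d} :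
    x ∈ (S.ins p).proj ↔ x = p.1 ∨ x ∈ S.proj := by
  by_cases h : p.1 ∈ S.proj
  · rw [ins_of_mem h]
    exact ⟨Or.inr, fun h' => h'.elim (fun e => e ▸ h) id⟩
  · rw [ins_of_notMem h]
    exact mem_proj_add

end Config

open Config

variable [MeasurableSpace 𝕄]

/-- The score at `a`, read off after translating the configuration by `-v`, is a functional centred
at `a + v`. This puts the translated score of the limiting covariance into the framework of two
sites. -/
lemma IsSite.translate {a : E d} {η r : 𝕄 → Config d 𝕄 → ℝ} (hs : IsSite a η r) (v : E d) :
    IsSite (a + v) (fun m S => η m (S.translate (-v))) (fun m S => r m (S.translate (-v))) := by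
  have hg : Measurable fun q : 𝕄 × Config d 𝕄 => (q.1, q.2.translate (-v)) :=
    measurable_fst.prodMk (measurable_translate measurable_snd measurable_const)
  have hb : ∀ (S : Config d 𝕄) (t : ℝ), (S.inBall (a + v) t).translate (-v) =
      (S.translate (-v)).inBall a t := by
    intro S t
    rw [inBall_translate, add_neg_cancel_right]
  refine ⟨hs.measurable_score.comp hg, hs.measurable_radius.comp hg, fun m S => hs.nonneg m _,
    fun m S F hF => ?_, fun m S T h => hs.mono m _ _ (image_mono h), fun m S t ht => ?_⟩
  · rw [hb, addFinset_translate]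
    exact hs.stab m _ _ (by rwa [Finset.card_map])
  · rw [hb, ← hs.loc m _ t ht]

lemma measurable_scaledScore {ξ : Score d 𝕄} (hξ : Measurable (Function.uncurry ξ)) (s : ℝ) :
    Measurable (Function.uncurry (scaledScore ξ s)) := by
  have hg : Measurable fun q : (E d × 𝕄) × Config d 𝕄 =>
      (q.1, q.2.dilate q.1.1 (s ^ (1 / (d : ℝ)))) :=
    measurable_fst.prodMk (measurable_dilate measurable_snd measurable_fst.fst measurable_const)
  exact hξ.comp hg

lemma isSite_of_stabilizing {m : ℕ} {W : Set (E d)} {ζ : Fin m → Score d 𝕄}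
    {R : E d × 𝕄 → Config d 𝕄 → ℝ≥0} (hR : Measurable (Function.uncurry R))
    (hstab : IsStabilizationRadius W ζ R) (hmono : IsMonotoneRadius W R)
    (hloc : IsLocallyDetermined W R) (i : Fin m) (hζ : Measurable (Function.uncurry (ζ i)))
    {x : E d} (hx : x ∈ W) :
    IsSite x (fun m S => ζ i (x, m) S) (fun m S => (R (x, m) S : ℝ)) := by
  have hg : Measurable fun q : 𝕄 × Config d 𝕄 => ((x, q.1), q.2) := by fun_prop
  refine ⟨hζ.comp hg, (hR.comp hg).coe_nnreal_real, fun m S => NNReal.coe_nonneg _,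
    fun m S F hF => hstab i x m S F hx hF,
    fun m S T h => NNReal.coe_le_coe.2 (hmono x m S T hx h), fun m S t ht => ?_⟩
  have := hloc x m S ⟨t, ht⟩ hx
  exact this

variable {Ω : Type*} [MeasurableSpace Ω]

/-- Fourth moments of a functional at `a`, on the input `X` with at most two independently marked
points of `V` inserted. -/
structure SiteMoments (μ : Measure Ω) (Q : Measure 𝕄) (X : Ω → Config d 𝕄) (V : Set (E d))
    (a : E d) (η : 𝕄 → Config d 𝕄 → ℝ) (K : ℝ≥0∞) : Prop where
  zero : ∫⁻ q : Ω × 𝕄, ‖η q.2 (X q.1)‖ₑ ^ 4 ∂(μ.prod Q) ≤ K ^ 4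
  one : ∀ y ∈ V, y ≠ a → ∫⁻ q : Ω × 𝕄 × 𝕄, ‖η q.2.1 ((X q.1).ins (y, q.2.2))‖ₑ ^ 4
    ∂(μ.prod (Q.prod Q)) ≤ K ^ 4
  two : ∀ y ∈ V, ∀ z ∈ V, y ≠ a → z ≠ a → y ≠ z → ∫⁻ q : Ω × 𝕄 × 𝕄 × 𝕄,
    ‖η q.2.1 (((X q.1).ins (z, q.2.2.2)).ins (y, q.2.2.1))‖ₑ ^ 4
    ∂(μ.prod (Q.prod (Q.prod Q))) ≤ K ^ 4

section Moments

variable {μ : Measure Ω} [IsProbabilityMeasure μ] {Q : Measure 𝕄} [IsProbabilityMeasure Q]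
  {X : Ω → Config d 𝕄} {V : Set (E d)} {a b : E d} {η r : 𝕄 → Config d 𝕄 → ℝ} {K : ℝ≥0∞}
  {ρ : E d → ℝ}

/-- The moment conditions concern inserted points distinct from the site and from each other; for
almost every position of a further point this is automatic. -/
lemma ae_pos_imp [NullSingletonClass (volume : Measure (E d))] (hρ : ∀ z, 0 < ρ z → z ∈ V)
    (a b : E d) : ∀ᵐ z, 0 < ρ z → z ∈ V ∧ z ≠ a ∧ z ≠ b := by
  have h1 : ∀ a : E d, ∀ᵐ z : E d, z ≠ a := fun a =>
    (measure_eq_zero_iff_ae_notMem.1 (measure_singleton (μ := (volume : Measure (E d))) a)).mono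
      fun z hz => hz
  filter_upwards [h1 a, h1 b] with z h2 h3 h4
  exact ⟨hρ z h4, h2, h3⟩

lemma SiteMoments.fourthMoment [NullSingletonClass (volume : Measure (E d))]
    (h : SiteMoments μ Q X V a η K) (hρ : ∀ z, 0 < ρ z → z ∈ V) :
    FourthMoment μ Q Q X ρ η K := by
  refine ⟨h.zero, ?_⟩
  filter_upwards [ae_pos_imp hρ a a] with z hz hz0
  exact h.one z (hz hz0).1 (hz hz0).2.1

variable (hX : Measurable X) (hη : Measurable (Function.uncurry η))

include hX hη

omit [IsProbabilityMeasure μ] [IsProbabilityMeasure Q] in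
lemma measurable_enorm_score_ins (y z : E d) :
    (Measurable fun q : Ω × 𝕄 => ‖η q.2 (X q.1)‖ₑ ^ 4) ∧
    (Measurable fun q : Ω × 𝕄 × 𝕄 => ‖η q.2.1 ((X q.1).ins (y, q.2.2))‖ₑ ^ 4) ∧
    (Measurable fun q : Ω × 𝕄 × 𝕄 × 𝕄 =>
      ‖η q.2.1 (((X q.1).ins (z, q.2.2.2)).ins (y, q.2.2.1))‖ₑ ^ 4) := by
  have g1 : Measurable fun q : Ω × 𝕄 => (q.2, X q.1) :=
    measurable_snd.prodMk (hX.comp measurable_fst)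
  have g2 : Measurable fun q : Ω × 𝕄 × 𝕄 => (q.2.1, (X q.1).ins (y, q.2.2)) :=
    measurable_snd.fst.prodMk (measurable_ins (hX.comp measurable_fst) (by fun_prop))
  have g3 : Measurable fun q : Ω × 𝕄 × 𝕄 × 𝕄 =>
      (q.2.1, ((X q.1).ins (z, q.2.2.2)).ins (y, q.2.2.1)) :=
    measurable_snd.fst.prodMk (measurable_ins (measurable_ins (hX.comp measurable_fst)
      (by fun_prop)) (by fun_prop))
  exact ⟨(hη.comp g1).enorm.pow_const 4, (hη.comp g2).enorm.pow_const 4,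
    (hη.comp g3).enorm.pow_const 4⟩

/-- A bookkeeping of marks. The second inserted point comes from the Mecke equation inside the
comparison of means, the first from the covariance itself; this is why moments with two insertions
are needed. -/
lemma SiteMoments.pair_fst [NullSingletonClass (volume : Measure (E d))]
    (h : SiteMoments μ Q X V a η K) (hρ : ∀ z, 0 < ρ z → z ∈ V) (hb : b ∈ V) (hab : b ≠ a) :
    FourthMoment μ (Q.prod Q) Q X ρ (fun l S => η l.1 S) K ∧
      FourthMoment μ (Q.prod Q) Q X ρ (fun l S => η l.1 (S.ins (b, l.2))) K := by
  have mp1 : MeasurePreserving (fun q : Ω × (𝕄 × 𝕄) × 𝕄 => (q.1, q.2.1.1, q.2.2))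
      (μ.prod ((Q.prod Q).prod Q)) (μ.prod (Q.prod Q)) :=
    (MeasurePreserving.id μ).prod (measurePreserving_fst.prod (MeasurePreserving.id Q))
  have mp2 : MeasurePreserving (fun q : Ω × (𝕄 × 𝕄) × 𝕄 => (q.1, q.2.1.1, q.2.1.2, q.2.2))
      (μ.prod ((Q.prod Q).prod Q)) (μ.prod (Q.prod (Q.prod Q))) :=
    (MeasurePreserving.id μ).prod (measurePreserving_prodAssoc Q Q Q)
  refine ⟨⟨?_, ?_⟩, ⟨h.one b hb hab, ?_⟩⟩
  · exact ((measurePreserving_markFst μ Q).lintegral_comp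
      (measurable_enorm_score_ins hX hη b b).1).trans_le h.zero
  · filter_upwards [ae_pos_imp hρ a a] with z hz hz0
    exact (mp1.lintegral_comp (measurable_enorm_score_ins hX hη z b).2.1).trans_le
      (h.one z (hz hz0).1 (hz hz0).2.1)
  · filter_upwards [ae_pos_imp hρ a b] with z hz hz0
    exact (mp2.lintegral_comp (measurable_enorm_score_ins hX hη b z).2.2).trans_le
      (h.two b hb z (hz hz0).1 hab (hz hz0).2.1 (hz hz0).2.2.symm)

lemma SiteMoments.pair_snd [NullSingletonClass (volume : Measure (E d))]
    (h : SiteMoments μ Q X V a η K) (hρ : ∀ z, 0 < ρ z → z ∈ V) (hb : b ∈ V) (hab : b ≠ a) :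
    FourthMoment μ (Q.prod Q) Q X ρ (fun l S => η l.2 S) K ∧
      FourthMoment μ (Q.prod Q) Q X ρ (fun l S => η l.2 (S.ins (b, l.1))) K := by
  have hswap : MeasurePreserving (Prod.swap : 𝕄 × 𝕄 → 𝕄 × 𝕄) (Q.prod Q) (Q.prod Q) :=
    Measure.measurePreserving_swap
  have mp0 : MeasurePreserving (fun q : Ω × 𝕄 × 𝕄 => (q.1, q.2.2, q.2.1))
      (μ.prod (Q.prod Q)) (μ.prod (Q.prod Q)) := (MeasurePreserving.id μ).prod hswap
  have mp1 : MeasurePreserving (fun q : Ω × (𝕄 × 𝕄) × 𝕄 => (q.1, q.2.1.2, q.2.2))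
      (μ.prod ((Q.prod Q).prod Q)) (μ.prod (Q.prod Q)) :=
    (MeasurePreserving.id μ).prod (measurePreserving_snd.prod (MeasurePreserving.id Q))
  have mp2 : MeasurePreserving (fun q : Ω × (𝕄 × 𝕄) × 𝕄 => (q.1, q.2.1.2, q.2.1.1, q.2.2))
      (μ.prod ((Q.prod Q).prod Q)) (μ.prod (Q.prod (Q.prod Q))) :=
    (MeasurePreserving.id μ).prod
      ((measurePreserving_prodAssoc Q Q Q).comp (hswap.prod (MeasurePreserving.id Q)))
  refine ⟨⟨?_, ?_⟩, ⟨?_, ?_⟩⟩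
  · exact ((measurePreserving_markSnd μ Q).lintegral_comp
      (measurable_enorm_score_ins hX hη b b).1).trans_le h.zero
  · filter_upwards [ae_pos_imp hρ a a] with z hz hz0
    exact (mp1.lintegral_comp (measurable_enorm_score_ins hX hη z b).2.1).trans_le
      (h.one z (hz hz0).1 (hz hz0).2.1)
  · exact (mp0.lintegral_comp (measurable_enorm_score_ins hX hη b b).2.1).trans_le (h.one b hb hab)
  · filter_upwards [ae_pos_imp hρ a b] with z hz hz0
    exact (mp2.lintegral_comp (measurable_enorm_score_ins hX hη b z).2.2).trans_le
      (h.two b hb z (hz hz0).1 hab (hz hz0).2.1 (hz hz0).2.2.symm)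

end Moments

/-- Assembling the hypotheses on a pair of sites. -/
lemma SiteMoments.pairInput [NullSingletonClass (volume : Measure (E d))]
    {μ : Measure Ω} [IsProbabilityMeasure μ] {Q : Measure 𝕄} [IsProbabilityMeasure Q]
    {X : Ω → Config d 𝕄} {V : Set (E d)} {a b : E d} {η₁ r₁ η₂ r₂ : 𝕄 → Config d 𝕄 → ℝ}
    {K₁ K₂ : ℝ≥0∞} {ρ : E d → ℝ} {τ : ℝ → ℝ≥0∞} (hX : IsMecke μ X (intensity ρ Q))
    (hm₁ : SiteMoments μ Q X V a η₁ K₁)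
    (hm₂ : SiteMoments μ Q X V b η₂ K₂) (h₁ : IsSite a η₁ r₁) (h₂ : IsSite b η₂ r₂)
    (hρ : ∀ z, 0 < ρ z → z ∈ V) (ha : a ∈ V) (hb : b ∈ V) (hab : a ≠ b)
    (t₁ : ∀ t, 0 ≤ t → (μ.prod Q) {q | t ≤ r₁ q.2 (X q.1)} ≤ τ t)
    (t₂ : ∀ t, 0 ≤ t → (μ.prod Q) {q | t ≤ r₂ q.2 (X q.1)} ≤ τ t) :
    PairInput μ Q X ρ a b η₁ r₁ η₂ r₂ K₁ K₂ τ := by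
  obtain ⟨k1, k2⟩ := hm₁.pair_fst hX.measurable h₁.measurable_score hρ hb hab.symm
  obtain ⟨k3, k4⟩ := hm₂.pair_snd hX.measurable h₂.measurable_score hρ ha hab
  exact ⟨hX, k1, k2, k3, k4, t₁, t₂⟩

section Law

variable {Ω' : Type*} [MeasurableSpace Ω'] {μ : Measure Ω} [IsProbabilityMeasure μ]
  {μ' : Measure Ω'} [IsProbabilityMeasure μ'] {X : Ω → Config d 𝕄} {X' : Ω' → Config d 𝕄}
  {N : Type*} [MeasurableSpace N] {ν : Measure N} [SFinite ν]

/-- Equality in law of the inputs extends to the inputs together with independent marks; in this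
form it transfers moments, tails and covariances. -/
lemma map_prodMap_of_map_eq (hX : Measurable X) (hX' : Measurable X')
    (h : μ.map X = μ'.map X') :
    (μ.prod ν).map (fun q => (X q.1, q.2)) = (μ'.prod ν).map (fun q => (X' q.1, q.2)) := by
  have e1 := Measure.map_prod_map (f := X) (g := (id : N → N)) μ ν hX measurable_id
  have e2 := Measure.map_prod_map (f := X') (g := (id : N → N)) μ' ν hX' measurable_id
  rw [Measure.map_id] at e1 e2
  rw [h] at e1
  exact e1.symm.trans e2

lemma lintegral_of_map_eq (hX : Measurable X) (hX' : Measurable X') (h : μ.map X = μ'.map X')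
    {F : Config d 𝕄 × N → ℝ≥0∞} (hF : Measurable F) :
    ∫⁻ q, F (X q.1, q.2) ∂(μ.prod ν) = ∫⁻ q, F (X' q.1, q.2) ∂(μ'.prod ν) := by
  have h1 : Measurable fun q : Ω × N => (X q.1, q.2) := (hX.comp measurable_fst).prodMk measurable_snd
  have h2 : Measurable fun q : Ω' × N => (X' q.1, q.2) :=
    (hX'.comp measurable_fst).prodMk measurable_snd
  rw [← lintegral_map hF h1, ← lintegral_map hF h2, map_prodMap_of_map_eq hX hX' h]

lemma integral_of_map_eq (hX : Measurable X) (hX' : Measurable X') (h : μ.map X = μ'.map X')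
    {F : Config d 𝕄 × N → ℝ} (hF : Measurable F) :
    ∫ q, F (X q.1, q.2) ∂(μ.prod ν) = ∫ q, F (X' q.1, q.2) ∂(μ'.prod ν) := by
  have h1 : Measurable fun q : Ω × N => (X q.1, q.2) := (hX.comp measurable_fst).prodMk measurable_snd
  have h2 : Measurable fun q : Ω' × N => (X' q.1, q.2) :=
    (hX'.comp measurable_fst).prodMk measurable_snd
  rw [← integral_map h1.aemeasurable hF.aestronglyMeasurable,
    ← integral_map h2.aemeasurable hF.aestronglyMeasurable, map_prodMap_of_map_eq hX hX' h]

lemma measure_of_map_eq (hX : Measurable X) (hX' : Measurable X') (h : μ.map X = μ'.map X')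
    {A : Set (Config d 𝕄 × N)} (hA : MeasurableSet A) :
    (μ.prod ν) {q | (X q.1, q.2) ∈ A} = (μ'.prod ν) {q | (X' q.1, q.2) ∈ A} := by
  have h1 : Measurable fun q : Ω × N => (X q.1, q.2) := (hX.comp measurable_fst).prodMk measurable_snd
  have h2 : Measurable fun q : Ω' × N => (X' q.1, q.2) :=
    (hX'.comp measurable_fst).prodMk measurable_snd
  have := congrArg (fun ν => ν A) (map_prodMap_of_map_eq (ν := ν) hX hX' h)
  simp only [Measure.map_apply h1 hA, Measure.map_apply h2 hA] at this
  exact this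

end Law

section Stationary

variable {μ : Measure Ω} [IsProbabilityMeasure μ] {Q : Measure 𝕄} [IsProbabilityMeasure Q]
  {X : Ω → Config d 𝕄} {u : ℝ}

lemma intensity_const (u : ℝ) (Q : Measure 𝕄) [SFinite Q] : intensity (fun _ : E d => u) Q =
    ENNReal.ofReal u • (volume : Measure (E d)).prod Q := by
  rw [intensity, withDensity_const, Measure.prod_smul_left]

lemma IsMecke.translate_const (hX : IsMecke μ X (intensity (fun _ => u) Q)) (v : E d) :
    IsMecke μ (fun ω => (X ω).translate v) (intensity (fun _ => u) Q) := by
  have h := hX.translate v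
  have e : (intensity (fun _ : E d => u) Q).map (fun p => (p.1 + v, p.2)) =
      intensity (fun _ => u) Q := by
    have := Measure.map_prod_map (f := fun x : E d => x + v) (g := (id : 𝕄 → 𝕄)) volume Q
      (by fun_prop) measurable_id
    rw [Measure.map_id, map_add_right_eq_self] at this
    rw [intensity_const, Measure.map_smul]
    congr 1
    exact this.symm
  rwa [e] at h

/-- The dilation is a linear scaling between two translations, and only the scaling changes Lebesgue
measure, by the factor $\alpha^{-d}$. -/
lemma IsMecke.dilate_const (hX : IsMecke μ X (intensity (fun _ => u) Q)) (x : E d) {α : ℝ}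
    (hα : 0 < α) :
    IsMecke μ (fun ω => (X ω).dilate x α) (intensity (fun _ => u / α ^ d) Q) := by
  have h := hX.dilate x hα
  have e : (intensity (fun _ : E d => u) Q).map (fun p => (x + α • (p.1 - x), p.2)) =
      intensity (fun _ => u / α ^ d) Q := by
    have := Measure.map_prod_map (f := fun z : E d => x + α • (z - x)) (g := (id : 𝕄 → 𝕄)) volume Q
      (by fun_prop) measurable_id
    have hv : (volume : Measure (E d)).map (fun z : E d => x + α • (z - x)) =
        ENNReal.ofReal ((α ^ d)⁻¹) • volume := by
      have e1 : (fun z : E d => x + α • (z - x)) =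
          (fun z => x + z) ∘ (fun z => α • z) ∘ fun z => z + (-x) := by
        ext z
        simp [sub_eq_add_neg]
      rw [e1, ← Measure.map_map (by fun_prop) (by fun_prop), ← Measure.map_map (by fun_prop)
        (by fun_prop), map_add_right_eq_self, Measure.map_addHaar_smul _ hα.ne', Measure.map_smul,
        map_add_left_eq_self]
      simp [abs_of_pos hα]
    rw [Measure.map_id, hv, Measure.prod_smul_left] at this
    rw [intensity_const, Measure.map_smul, intensity_const, div_eq_mul_inv,
      ENNReal.ofReal_mul' (by positivity), mul_smul]
    congr 1
    exact this.symm
  rwa [e] at h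

lemma map_translate_eq (hX : IsMecke μ X (intensity (fun _ => u) Q)) (v : E d) :
    μ.map (fun ω => (X ω).translate v) = μ.map X := (hX.translate_const v).map_eq hX

/-- Moments of a translated functional on a stationary input. -/
lemma SiteMoments.translate (hX : IsMecke μ X (intensity (fun _ => u) Q)) {a : E d}
    {η : 𝕄 → Config d 𝕄 → ℝ} {K : ℝ≥0∞} (hη : Measurable (Function.uncurry η))
    (h : SiteMoments μ Q X univ a η K) (v : E d) :
    SiteMoments μ Q X univ (a + v) (fun m S => η m (S.translate (-v))) K := by
  have hXm := hX.measurable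
  have hXt : Measurable fun ω => (X ω).translate (-v) := (hX.translate_const (-v)).measurable
  have hlaw := map_translate_eq hX (-v)
  refine ⟨?_, fun y _ hy => ?_, fun y _ z _ hy hz hyz => ?_⟩
  · have hF : Measurable fun q : Config d 𝕄 × 𝕄 => ‖η q.2 q.1‖ₑ ^ 4 :=
      (hη.comp measurable_swap).enorm.pow_const 4
    exact (lintegral_of_map_eq hXt hXm hlaw hF).trans_le h.zero
  · have hF : Measurable fun q : Config d 𝕄 × 𝕄 × 𝕄 =>
        ‖η q.2.1 (q.1.ins (y + -v, q.2.2))‖ₑ ^ 4 := by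
      have hg : Measurable fun q : Config d 𝕄 × 𝕄 × 𝕄 => (q.2.1, q.1.ins (y + -v, q.2.2)) :=
        measurable_snd.fst.prodMk (measurable_ins measurable_fst (by fun_prop))
      exact (hη.comp hg).enorm.pow_const 4
    simp only [ins_translate]
    refine (lintegral_of_map_eq hXt hXm hlaw hF).trans_le (h.one _ (mem_univ _) fun e => hy ?_)
    rw [← e]
    simp
  · have hF : Measurable fun q : Config d 𝕄 × 𝕄 × 𝕄 × 𝕄 =>
        ‖η q.2.1 ((q.1.ins (z + -v, q.2.2.2)).ins (y + -v, q.2.2.1))‖ₑ ^ 4 := by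
      have hg : Measurable fun q : Config d 𝕄 × 𝕄 × 𝕄 × 𝕄 =>
          (q.2.1, (q.1.ins (z + -v, q.2.2.2)).ins (y + -v, q.2.2.1)) :=
        measurable_snd.fst.prodMk (measurable_ins (measurable_ins measurable_fst (by fun_prop))
          (by fun_prop))
      exact (hη.comp hg).enorm.pow_const 4
    simp only [ins_translate]
    refine (lintegral_of_map_eq hXt hXm hlaw hF).trans_le (h.two _ (mem_univ _) _ (mem_univ _)
      (fun e => hy ?_) (fun e => hz ?_) (fun e => hyz (add_left_injective (-v) e)))
    · rw [← e]
      simp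
    · rw [← e]
      simp

lemma tail_translate (hX : IsMecke μ X (intensity (fun _ => u) Q))
    {r : 𝕄 → Config d 𝕄 → ℝ} (hr : Measurable (Function.uncurry r)) (v : E d) (t : ℝ) :
    (μ.prod Q) {q | t ≤ r q.2 ((X q.1).translate (-v))} = (μ.prod Q) {q | t ≤ r q.2 (X q.1)} := by
  have hA : MeasurableSet {q : Config d 𝕄 × 𝕄 | t ≤ r q.2 q.1} :=
    measurableSet_le measurable_const (hr.comp measurable_swap)
  exact measure_of_map_eq (hX.translate_const (-v)).measurable hX.measurable
    (map_translate_eq hX (-v)) hA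

end Stationary

end StabScores

end

/-! ### From the moment conditions to fourth moments with inserted points -/

noncomputable section

namespace StabScores

variable {d : ℕ} {𝕄 : Type*}

lemma coe_markedPoints (A : Finset (E d)) (a : A → 𝕄) :
    (markedPoints A a : Set (E d × 𝕄)) = range fun z : A => (z.1, a z) := by
  ext p
  simp [markedPoints]

variable [MeasurableSpace 𝕄] {Ω : Type*} [MeasurableSpace Ω]

open Config

section ScoreMoment

variable {μ : Measure Ω} [IsProbabilityMeasure μ] {Q : Measure 𝕄} [IsProbabilityMeasure Q]
  {X : Ω → Config d 𝕄} {ζ : Score d 𝕄} {k : ℝ}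

lemma ae_notMem_proj {N : Type*} [MeasurableSpace N] {ν : Measure N}
    (hX : ∀ x : E d, ∀ᵐ ω ∂μ, x ∉ (X ω).proj) (y : E d) :
    ∀ᵐ q ∂(μ.prod ν), y ∉ (X q.1).proj :=
  Measure.quasiMeasurePreserving_fst.ae (hX y)

variable (hXm : Measurable X) (hX : ∀ x : E d, ∀ᵐ ω ∂μ, x ∉ (X ω).proj)
  (hζ : Measurable (Function.uncurry ζ))

include hXm hζ

omit [IsProbabilityMeasure μ] in
lemma scoreMoment_empty [SFinite μ] (x : E d) : scoreMoment Q μ ζ X k x ∅ =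
    ∫⁻ q : Ω × 𝕄, ‖ζ (x, q.2) (X q.1)‖ₑ ^ k ∂(μ.prod Q) := by
  have mp : MeasurePreserving (fun q : Ω × 𝕄 × ((∅ : Finset (E d)) → 𝕄) => (q.1, q.2.1))
      (μ.prod (Q.prod (Measure.pi fun _ => Q))) (μ.prod Q) :=
    (MeasurePreserving.id μ).prod measurePreserving_fst
  have hg : Measurable fun q : Ω × 𝕄 => ((x, q.2), X q.1) :=
     (measurable_const.prodMk measurable_snd).prodMk (hXm.comp measurable_fst)
  have hF : Measurable fun q : Ω × 𝕄 => ‖ζ (x, q.2) (X q.1)‖ₑ ^ k :=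
    (hζ.comp hg).enorm.pow_const k
  rw [scoreMoment, ← mp.lintegral_comp hF]
  refine lintegral_congr fun q => ?_
  have : markedPoints (∅ : Finset (E d)) q.2.2 = ∅ := by
    simp [markedPoints]
  rw [this, addFinset_empty]

include hX

lemma scoreMoment_singleton (x y : E d) : scoreMoment Q μ ζ X k x {y} =
    ∫⁻ q : Ω × 𝕄 × 𝕄, ‖ζ (x, q.2.1) ((X q.1).ins (y, q.2.2))‖ₑ ^ k ∂(μ.prod (Q.prod Q)) := by
  have hy : y ∈ ({y} : Finset (E d)) := Finset.mem_singleton_self y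
  have mp : MeasurePreserving
      (fun q : Ω × 𝕄 × (({y} : Finset (E d)) → 𝕄) => (q.1, q.2.1, q.2.2 ⟨y, hy⟩))
      (μ.prod (Q.prod (Measure.pi fun _ => Q))) (μ.prod (Q.prod Q)) :=
    (MeasurePreserving.id μ).prod ((MeasurePreserving.id Q).prod
      (measurePreserving_eval (fun _ : ({y} : Finset (E d)) => Q) ⟨y, hy⟩))
  have hF : Measurable fun q : Ω × 𝕄 × 𝕄 => ‖ζ (x, q.2.1) ((X q.1).ins (y, q.2.2))‖ₑ ^ k := by
    have hg : Measurable fun q : Ω × 𝕄 × 𝕄 => ((x, q.2.1), (X q.1).ins (y, q.2.2)) :=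
      (by fun_prop : Measurable fun q : Ω × 𝕄 × 𝕄 => (x, q.2.1)).prodMk
        (measurable_ins (hXm.comp measurable_fst) (by fun_prop))
    exact (hζ.comp hg).enorm.pow_const k
  rw [scoreMoment, ← mp.lintegral_comp hF]
  refine lintegral_congr_ae ?_
  filter_upwards [ae_notMem_proj hX y] with q hq
  rw [ins_of_notMem hq]
  congr 3

/-- The product measure on marks indexed by the finite set is transported to a product of two copies
of `Q`. Almost surely neither position is occupied, so adding the points and inserting them
successively agree. -/
lemma scoreMoment_pair (x : E d) {y z : E d} (hyz : y ≠ z) : scoreMoment Q μ ζ X k x {y, z} =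
    ∫⁻ q : Ω × 𝕄 × 𝕄 × 𝕄, ‖ζ (x, q.2.1) (((X q.1).ins (z, q.2.2.2)).ins (y, q.2.2.1))‖ₑ ^ k
      ∂(μ.prod (Q.prod (Q.prod Q))) := by
  classical
  have hy : y ∈ ({y, z} : Finset (E d)) := by simp
  have hz : z ∈ ({y, z} : Finset (E d)) := by simp
  have mp0 : MeasurePreserving
      (fun f : ({y, z} : Finset (E d)) → 𝕄 => (f ⟨y, hy⟩, f ⟨z, hz⟩))
      (Measure.pi fun _ => Q) (Q.prod Q) := by
    refine ⟨by fun_prop, (Measure.prod_eq fun s t hs ht => ?_).symm⟩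
    rw [Measure.map_apply (by fun_prop) (hs.prod ht)]
    have e : (fun f : ({y, z} : Finset (E d)) → 𝕄 => (f ⟨y, hy⟩, f ⟨z, hz⟩)) ⁻¹' s ×ˢ t =
        Set.pi univ fun i : ({y, z} : Finset (E d)) => if i.1 = y then s else t := by
      ext f
      simp only [mem_preimage, mem_prod, Set.mem_pi, mem_univ, true_imp_iff]
      constructor
      · rintro ⟨h1, h2⟩ ⟨i, hi⟩
        rcases Finset.mem_insert.1 hi with rfl | h
        · simpa using h1
        · rw [Finset.mem_singleton] at h
          subst h
          simpa [hyz.symm] using h2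
      · intro h
        refine ⟨by simpa using h ⟨y, hy⟩, by simpa [hyz.symm] using h ⟨z, hz⟩⟩
    rw [e, Measure.pi_pi, Fintype.prod_eq_mul (⟨y, hy⟩ : ({y, z} : Finset (E d))) ⟨z, hz⟩]
    · simp [hyz.symm]
    · simpa using hyz
    · rintro ⟨i, hi⟩ ⟨h1, h2⟩
      rcases Finset.mem_insert.1 hi with rfl | h
      · exact absurd rfl h1
      · rw [Finset.mem_singleton] at h
        subst h
        exact absurd rfl h2
  have mp : MeasurePreserving
      (fun q : Ω × 𝕄 × (({y, z} : Finset (E d)) → 𝕄) =>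
        (q.1, q.2.1, q.2.2 ⟨y, hy⟩, q.2.2 ⟨z, hz⟩))
      (μ.prod (Q.prod (Measure.pi fun _ => Q))) (μ.prod (Q.prod (Q.prod Q))) :=
    (MeasurePreserving.id μ).prod ((MeasurePreserving.id Q).prod mp0)
  have hF : Measurable fun q : Ω × 𝕄 × 𝕄 × 𝕄 =>
      ‖ζ (x, q.2.1) (((X q.1).ins (z, q.2.2.2)).ins (y, q.2.2.1))‖ₑ ^ k := by
    have hg : Measurable fun q : Ω × 𝕄 × 𝕄 × 𝕄 =>
        ((x, q.2.1), ((X q.1).ins (z, q.2.2.2)).ins (y, q.2.2.1)) :=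
      (by fun_prop : Measurable fun q : Ω × 𝕄 × 𝕄 × 𝕄 => (x, q.2.1)).prodMk
        (measurable_ins (measurable_ins (hXm.comp measurable_fst) (by fun_prop)) (by fun_prop))
    exact (hζ.comp hg).enorm.pow_const k
  rw [scoreMoment, ← mp.lintegral_comp hF]
  refine lintegral_congr_ae ?_
  filter_upwards [ae_notMem_proj hX y, ae_notMem_proj hX z] with q hqy hqz
  have h2 : y ∉ ((X q.1).ins (z, q.2.2 ⟨z, hz⟩)).proj := by
    rw [mem_proj_ins]
    rintro (h | h)
    · exact hyz h
    · exact hqy h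
  rw [ins_of_notMem h2, ins_of_notMem hqz]
  congr 3
  ext1
  rw [addFinset_pts, coe_markedPoints, add_pts, add_pts, union_comm]
  ext p
  simp only [mem_union, mem_range, Subtype.exists, mem_insert_iff]
  constructor
  · rintro (⟨i, hi, rfl⟩ | h)
    · rcases Finset.mem_insert.1 hi with rfl | h
      · exact Or.inl rfl
      · rw [Finset.mem_singleton] at h
        subst h
        exact Or.inr (Or.inl rfl)
    · exact Or.inr (Or.inr h)
  · rintro (rfl | rfl | h)
    · exact Or.inl ⟨y, hy, rfl⟩
    · exact Or.inl ⟨z, hz, rfl⟩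
    · exact Or.inr h

end ScoreMoment

/-- The bound on the `L⁴` norms of the scores. -/
def momentBound (Cmom : ℝ) : ℝ := (1 + Cmom) ^ (1 / 4 : ℝ)

lemma momentBound_nonneg {Cmom : ℝ} (h : 0 < Cmom) : 0 ≤ momentBound Cmom :=
  Real.rpow_nonneg (by linarith) _

lemma ofReal_momentBound_pow {Cmom : ℝ} (h : 0 < Cmom) :
    ENNReal.ofReal (momentBound Cmom) ^ 4 = 1 + ENNReal.ofReal Cmom := by
  rw [← ENNReal.ofReal_pow (momentBound_nonneg h), momentBound, ← Real.rpow_natCast,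
    ← Real.rpow_mul (by linarith)]
  norm_num
  rw [ENNReal.ofReal_add zero_le_one h.le, ENNReal.ofReal_one]

/-- Only fourth moments are needed. The pointwise bound avoids Hölder's inequality at the price of
the summand 1 in `momentBound`. -/
lemma pow_four_le (x : ℝ≥0∞) {p : ℝ} (hp : 0 < p) : x ^ 4 ≤ 1 + x ^ (6 + p) := by
  rcases le_total x 1 with h | h
  · exact (pow_le_one₀ zero_le h).trans le_self_add
  · refine le_trans ?_ le_add_self
    rw [← ENNReal.rpow_natCast]
    exact ENNReal.rpow_le_rpow_of_exponent_le h (by push_cast; linarith)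

lemma lintegral_pow_four_le {α : Type*} [MeasurableSpace α] {ν : Measure α}
    [IsProbabilityMeasure ν] {u : α → ℝ≥0∞} {p Cmom : ℝ} (hp : 0 < p) (hC : 0 < Cmom)
    (h : ∫⁻ t, u t ^ (6 + p) ∂ν ≤ ENNReal.ofReal Cmom) :
    ∫⁻ t, u t ^ 4 ∂ν ≤ ENNReal.ofReal (momentBound Cmom) ^ 4 := by
  rw [ofReal_momentBound_pow hC]
  calc ∫⁻ t, u t ^ 4 ∂ν ≤ ∫⁻ t, (1 + u t ^ (6 + p)) ∂ν := lintegral_mono fun t => pow_four_le _ hp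
    _ = 1 + ∫⁻ t, u t ^ (6 + p) ∂ν := by
        rw [MeasureTheory.lintegral_add_left measurable_const]
        simp
    _ ≤ _ := by gcongr

/-- Of the nine additional points permitted by the hypothesis, at most two are used. -/
lemma siteMoments_of_scoreMoment {μ : Measure Ω} [IsProbabilityMeasure μ] {Q : Measure 𝕄}
    [IsProbabilityMeasure Q] {X : Ω → Config d 𝕄} {ζ : Score d 𝕄} (hXm : Measurable X)
    (hX : ∀ x : E d, ∀ᵐ ω ∂μ, x ∉ (X ω).proj) (hζ : Measurable (Function.uncurry ζ))
    {p Cmom : ℝ} (hp : 0 < p) (hC : 0 < Cmom) {V : Set (E d)} {x : E d}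
    (hmom : ∀ A : Finset (E d), (A : Set (E d)) ⊆ V → A.card ≤ 9 → x ∉ A →
      scoreMoment Q μ ζ X (6 + p) x A ≤ ENNReal.ofReal Cmom) :
    SiteMoments μ Q X V x (fun m S => ζ (x, m) S) (ENNReal.ofReal (momentBound Cmom)) := by
  refine ⟨?_, fun y hy hyx => ?_, fun y hy z hz hyx hzx hyz => ?_⟩
  · have := hmom ∅ (by simp) (by simp) (by simp)
    rw [scoreMoment_empty hXm hζ] at this
    exact lintegral_pow_four_le hp hC this
  · have := hmom {y} (by simpa using hy) (by simp) (by simpa using hyx.symm)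
    rw [scoreMoment_singleton hXm hX hζ] at this
    exact lintegral_pow_four_le hp hC this
  · have := hmom {y, z} (by
        rw [Finset.coe_insert, Finset.coe_singleton]
        exact insert_subset hy (singleton_subset_iff.2 hz))
      ((Finset.card_le_two).trans (by norm_num)) (by simp [hyx.symm, hzx.symm])
    rw [scoreMoment_pair hXm hX hζ x hyz] at this
    exact lintegral_pow_four_le hp hC this

section Intensity

variable {Q : Measure 𝕄} [IsProbabilityMeasure Q]

lemma measurable_indicator_of_lipschitzOnWith {W : Set (E d)} (hW : MeasurableSet W)
    {g : E d → ℝ} {L : ℝ≥0} (hg : LipschitzOnWith L g W) : Measurable (W.indicator g) := by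
  classical
  rw [← piecewise_eq_indicator]
  exact hg.continuousOn.measurable_piecewise continuousOn_const hW

lemma smul_densityMeasure_prod {W : Set (E d)} (hW : MeasurableSet W) (g : E d → ℝ) {s : ℝ}
    (hs : 0 ≤ s) : ENNReal.ofReal s • (densityMeasure W g).prod Q =
      intensity (fun x => s * W.indicator g x) Q := by
  rw [intensity, densityMeasure, ← withDensity_indicator hW, ← Measure.prod_smul_left,
    ← withDensity_smul' _ _ ENNReal.ofReal_ne_top]
  congr 2
  ext x
  by_cases hx : x ∈ W
  · simp [hx, ENNReal.ofReal_mul hs]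
  · simp [hx]

lemma locallyFinite_intensity {ρ : E d → ℝ} {b : ℝ} (hb : ∀ z, ρ z ≤ b) :
    LocallyFinite (intensity ρ Q) := by
  intro r
  rw [intensity, Measure.prod_prod, measure_univ, mul_one,
    withDensity_apply _ measurableSet_closedBall]
  refine ((lintegral_mono fun z => ENNReal.ofReal_le_ofReal (hb z)).trans_lt ?_).ne
  rw [lintegral_const, Measure.restrict_apply_univ]
  exact ENNReal.mul_lt_top ENNReal.ofReal_lt_top measure_closedBall_lt_top

lemma intensity_fiber [NullSingletonClass (volume : Measure (E d))] (ρ : E d → ℝ) (x : E d) :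
    intensity ρ Q ({x} ×ˢ univ) = 0 := by
  rw [intensity, Measure.prod_prod, withDensity_apply _ (measurableSet_singleton x),
    Measure.restrict_eq_zero.2 (measure_singleton x)]
  simp

lemma IsPoissonProcess.isMecke_intensity [NullSingletonClass (volume : Measure (E d))]
    {μ : Measure Ω} [IsProbabilityMeasure μ] {X : Ω → Config d 𝕄} {ρ : E d → ℝ} {b : ℝ}
    (hb : ∀ z, ρ z ≤ b) (hX : IsPoissonProcess μ X (intensity ρ Q)) :
    IsMecke μ X (intensity ρ Q) :=
  hX.isMecke (locallyFinite_intensity hb) (intensity_fiber ρ)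

end Intensity

end StabScores

end

/-! ### Stabilizing scores at a fixed scale -/

noncomputable section

namespace StabScores

variable {d m : ℕ} {𝕄 : Type*} [MeasurableSpace 𝕄] {Ω : Type*} [MeasurableSpace Ω]

open Config

/-- Stabilizing scores at a fixed scale: `X` is the process with intensity `s g` on `W`, `Z u` the
stationary process of intensity `u`, `R` the radius of stabilization. -/
structure IsModel (W : Set (E d)) (g : E d → ℝ) (B s : ℝ) (Q : Measure 𝕄) (μ : Measure Ω)
    (X : Ω → Config d 𝕄) (Z : ℝ → Ω → Config d 𝕄) (ζ : Fin m → Score d 𝕄)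
    (R : E d × 𝕄 → Config d 𝕄 → ℝ≥0) (Ct : Fin m → ℝ) (K C κ : ℝ) : Prop where
  measurableSet : MeasurableSet W
  measurable_density : Measurable (W.indicator g)
  density_nonneg : ∀ x ∈ W, 0 ≤ g x
  density_le : ∀ x ∈ W, g x ≤ B
  bound_nonneg : 0 ≤ B
  scale_pos : 0 < s
  mecke : IsMecke μ X (intensity (fun z => s * W.indicator g z) Q)
  mecke_stat : ∀ u, 0 < u → IsMecke μ (Z u) (intensity (fun _ => u) Q)
  measurable_score : ∀ i, Measurable (Function.uncurry (ζ i))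
  site : ∀ i, ∀ x ∈ W, IsSite x (fun m S => ζ i (x, m) S) (fun m S => (R (x, m) S : ℝ))
  moments : ∀ i, ∀ x ∈ W,
    SiteMoments μ Q X W x (fun m S => ζ i (x, m) S) (ENNReal.ofReal K)
  moments_stat : ∀ i, ∀ x ∈ W, ∀ y ∈ W, 0 < g y →
    SiteMoments μ Q (Z (s * g y)) univ x (fun m S => ζ i (x, m) S) (ENNReal.ofReal K)
  tail : ∀ x ∈ W, ∀ t, 0 ≤ t →
    (μ.prod Q) {q | t ≤ (R (x, q.2) (X q.1) : ℝ)} ≤ expTail d C κ t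
  tail_stat : ∀ x ∈ W, ∀ y ∈ W, 0 < g y → ∀ t, 0 ≤ t →
    (μ.prod Q) {q | t ≤ (R (x, q.2) (Z (s * g y) q.1) : ℝ)} ≤ expTail d C κ t
  lipschitz : ∀ i, ∀ x ∈ W, ∀ y ∈ W, ∀ a (S : Config d 𝕄),
    |ζ i (y, a) S - ζ i (x, a) (S.translate (-(y - x)))| ≤ Ct i * dist x y
  insert : ∀ i, InsertConvention W (ζ i)
  lipschitz_nonneg : ∀ i, 0 ≤ Ct i
  K_nonneg : 0 ≤ K
  C_nonneg : 0 ≤ C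
  rate_nonneg : 0 ≤ κ

/-- The covariance of the score `ζ₁` at `x` and the score `ζ₂` at `y`. -/
def scoreCov (μ : Measure Ω) (Q : Measure 𝕄) (X : Ω → Config d 𝕄) (ζ₁ ζ₂ : Score d 𝕄)
    (x y : E d) : ℝ :=
  covar μ Q X x y (fun a S => ζ₁ (x, a) S) (fun a S => ζ₂ (y, a) S)

/-- The covariance of the score `ζ₁` at `x` and the score `ζ₂` at `x + v`, the latter being
evaluated after translation to `x`. -/
def shiftCov (μ : Measure Ω) (Q : Measure 𝕄) (X : Ω → Config d 𝕄) (ζ₁ ζ₂ : Score d 𝕄)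
    (x v : E d) : ℝ :=
  covar μ Q X x (x + v) (fun a S => ζ₁ (x, a) S) (fun a S => ζ₂ (x, a) (S.translate (-v)))

/-- The mixed moment of two scores at `x`. -/
def scoreMixed (μ : Measure Ω) (Q : Measure 𝕄) (X : Ω → Config d 𝕄) (ζ₁ ζ₂ : Score d 𝕄)
    (x : E d) : ℝ :=
  ∫ q : Ω × 𝕄, ζ₁ (x, q.2) (X q.1) * ζ₂ (x, q.2) (X q.1) ∂(μ.prod Q)

/-- The weighted `L¹` distance of the intensities. -/
def intensityGap (W : Set (E d)) (g : E d → ℝ) (s κ : ℝ) (x : E d) : ℝ≥0∞ :=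
  ∫⁻ z, ENNReal.ofReal |s * W.indicator g z - s * g x| *
    ENNReal.ofReal (Real.exp (-(slowRate d κ * dist z x ^ d)))

namespace IsModel

variable {W : Set (E d)} {g : E d → ℝ} {B s : ℝ} {Q : Measure 𝕄} [IsProbabilityMeasure Q]
  {μ : Measure Ω} [IsProbabilityMeasure μ] {X : Ω → Config d 𝕄} {Z : ℝ → Ω → Config d 𝕄}
  {ζ : Fin m → Score d 𝕄} {R : E d × 𝕄 → Config d 𝕄 → ℝ≥0} {Ct : Fin m → ℝ} {K C κ : ℝ}
  [NullSingletonClass (volume : Measure (E d))]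

variable (M : IsModel W g B s Q μ X Z ζ R Ct K C κ)

include M

omit [IsProbabilityMeasure Q] [IsProbabilityMeasure μ]
  [NullSingletonClass (volume : Measure (E d))] in
lemma indicator_le (z : E d) : W.indicator g z ≤ B := by
  by_cases h : z ∈ W
  · rw [indicator_of_mem h]
    exact M.density_le z h
  · rw [indicator_of_notMem h]
    exact M.bound_nonneg

omit [IsProbabilityMeasure Q] [IsProbabilityMeasure μ]
  [NullSingletonClass (volume : Measure (E d))] in
lemma indicator_nonneg (z : E d) : 0 ≤ W.indicator g z := by
  by_cases h : z ∈ W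
  · rw [indicator_of_mem h]
    exact M.density_nonneg z h
  · rw [indicator_of_notMem h]

omit [IsProbabilityMeasure Q] [IsProbabilityMeasure μ]
  [NullSingletonClass (volume : Measure (E d))] in
lemma mem_of_pos (z : E d) (hz : 0 < s * W.indicator g z) : z ∈ W := by
  by_contra h
  rw [indicator_of_notMem h, mul_zero] at hz
  exact lt_irrefl _ hz

variable (i j : Fin m) {x y : E d} (hx : x ∈ W)

include hx

lemma pairInput (hy : y ∈ W) (hxy : x ≠ y) :
    PairInput μ Q X (fun z => s * W.indicator g z) x y (fun a S => ζ i (x, a) S)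
      (fun a S => (R (x, a) S : ℝ)) (fun a S => ζ j (y, a) S) (fun a S => (R (y, a) S : ℝ))
      (ENNReal.ofReal K) (ENNReal.ofReal K) (expTail d C κ) :=
  (M.moments i x hx).pairInput M.mecke (M.moments j y hy) (M.site i x hx) (M.site j y hy)
    M.mem_of_pos hx hy hxy (M.tail x hx) (M.tail y hy)

lemma pairInput_stat (hgx : 0 < g x) (hy : y ∈ W) (hxy : x ≠ y) :
    PairInput μ Q (Z (s * g x)) (fun _ => s * g x) x y (fun a S => ζ i (x, a) S)
      (fun a S => (R (x, a) S : ℝ)) (fun a S => ζ j (y, a) S) (fun a S => (R (y, a) S : ℝ))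
      (ENNReal.ofReal K) (ENNReal.ofReal K) (expTail d C κ) :=
  (M.moments_stat i x hx x hx hgx).pairInput (M.mecke_stat _ (mul_pos M.scale_pos hgx))
    (M.moments_stat j y hy x hx hgx) (M.site i x hx) (M.site j y hy)
    (fun _ _ => mem_univ _) (mem_univ _) (mem_univ _) hxy (M.tail_stat x hx x hx hgx)
    (M.tail_stat y hy x hx hgx)

/-- The second functional is the score at `x` after translation, so `x + v` need not belong to `W`.
By stationarity of the input its moments and tails are those of the score at `x`. -/
lemma pairInput_shift (hgx : 0 < g x) {v : E d} (hv : v ≠ 0) :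
    PairInput μ Q (Z (s * g x)) (fun _ => s * g x) x (x + v) (fun a S => ζ i (x, a) S)
      (fun a S => (R (x, a) S : ℝ)) (fun a S => ζ j (x, a) (S.translate (-v)))
      (fun a S => (R (x, a) (S.translate (-v)) : ℝ))
      (ENNReal.ofReal K) (ENNReal.ofReal K) (expTail d C κ) := by
  have hZ := M.mecke_stat _ (mul_pos M.scale_pos hgx)
  refine (M.moments_stat i x hx x hx hgx).pairInput hZ
    ((M.moments_stat j x hx x hx hgx).translate hZ (M.site j x hx).measurable_score v)
    (M.site i x hx) ((M.site j x hx).translate v)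
    (fun _ _ => mem_univ _) (mem_univ _) (mem_univ _) (by simpa using hv)
    (M.tail_stat x hx x hx hgx) fun t ht => ?_
  rw [tail_translate hZ (M.site j x hx).measurable_radius v t]
  exact M.tail_stat x hx x hx hgx t ht

lemma abs_scoreCov_le (hy : y ∈ W) (hxy : x ≠ y) :
    |scoreCov μ Q X (ζ i) (ζ j) x y| ≤
      3 * K * K * (2 * C) ^ (1 / 4 : ℝ) * Real.exp (-(slowRate d κ * dist x y ^ d)) :=
  (M.pairInput i j hx hy hxy).abs_covar_le (M.site i x hx) (M.site j y hy) M.K_nonneg M.K_nonneg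
    M.C_nonneg M.rate_nonneg hxy

lemma abs_shiftCov_le (hgx : 0 < g x) {v : E d} (hv : v ≠ 0) :
    |shiftCov μ Q (Z (s * g x)) (ζ i) (ζ j) x v| ≤
      3 * K * K * (2 * C) ^ (1 / 4 : ℝ) * Real.exp (-(slowRate d κ * ‖v‖ ^ d)) := by
  have := (M.pairInput_shift i j hx hgx hv).abs_covar_le (M.site i x hx)
    ((M.site j x hx).translate v) M.K_nonneg M.K_nonneg M.C_nonneg M.rate_nonneg
    (by simpa using hv)
  rw [dist_self_add_right] at this
  exact this

/-- The cost of making the input homogeneous, for both scores at their true positions. The decay in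
the distance of `x` and `y` is kept, since a factor $s^2$ still has to be integrated against this
bound. -/
lemma scoreCov_sub_stat_le (hgx : 0 < g x) (hy : y ∈ W) (hxy : x ≠ y) :
    ENNReal.ofReal |scoreCov μ Q X (ζ i) (ζ j) x y -
        scoreCov μ Q (Z (s * g x)) (ζ i) (ζ j) x y| ≤
      ENNReal.ofReal (20 * K * K * (2 * C) ^ (1 / 2 : ℝ) *
        Real.exp (-(slowRate d κ * dist x y ^ d))) * intensityGap W g s κ x :=
  (M.pairInput i j hx hy hxy).ofReal_abs_covar_sub_le (M.pairInput_stat i j hx hgx hy hxy)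
    (M.site i x hx) (M.site j y hy) M.K_nonneg M.K_nonneg M.C_nonneg M.rate_nonneg
    (M.measurable_density.const_mul s) measurable_const (B := s * B)
    (fun z => mul_le_mul_of_nonneg_left (M.indicator_le z) M.scale_pos.le)
    (fun z => mul_le_mul_of_nonneg_left (M.density_le x hx) M.scale_pos.le) hxy

lemma scoreMixed_sub_stat_le (hgx : 0 < g x) :
    ENNReal.ofReal |scoreMixed μ Q X (ζ i) (ζ j) x -
        scoreMixed μ Q (Z (s * g x)) (ζ i) (ζ j) x| ≤
      ENNReal.ofReal (4 * K * K * C ^ (1 / 4 : ℝ)) * intensityGap W g s κ x :=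
  ofReal_abs_integral_mul_sub_le M.mecke (M.mecke_stat _ (mul_pos M.scale_pos hgx))
    ((M.moments i x hx).fourthMoment M.mem_of_pos) ((M.moments j x hx).fourthMoment M.mem_of_pos)
    ((M.moments_stat i x hx x hx hgx).fourthMoment fun _ _ => mem_univ _)
    ((M.moments_stat j x hx x hx hgx).fourthMoment fun _ _ => mem_univ _)
    (M.tail x hx) (M.tail_stat x hx x hx hgx) (M.site i x hx) (M.site j x hx)
    M.K_nonneg M.C_nonneg M.rate_nonneg M.K_nonneg
    (M.measurable_density.const_mul s) measurable_const (B := s * B)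
    (fun z => mul_le_mul_of_nonneg_left (M.indicator_le z) M.scale_pos.le)
    (fun z => mul_le_mul_of_nonneg_left (M.density_le x hx) M.scale_pos.le)

/-- The cost of moving the second score from `y` to `x`, on the homogeneous input: the Lipschitz
condition bounds the difference of the scores uniformly, and decorrelation supplies the exponential.
-/
lemma scoreCov_sub_shiftCov_le (hgx : 0 < g x) (hy : y ∈ W) (hxy : x ≠ y) :
    |scoreCov μ Q (Z (s * g x)) (ζ i) (ζ j) x y -
        shiftCov μ Q (Z (s * g x)) (ζ i) (ζ j) x (y - x)| ≤
      3 * K * (Ct j * dist x y) * (2 * (2 * C)) ^ (1 / 4 : ℝ) *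
        Real.exp (-(slowRate d κ * dist x y ^ d)) := by
  have h1 := M.pairInput_shift i j hx hgx (sub_ne_zero.2 hxy.symm)
  have h2 := (M.site j x hx).translate (y - x)
  rw [add_sub_cancel] at h1 h2
  have := (M.pairInput_stat i j hx hgx hy hxy).abs_covar_sub_right_le h1 (M.site i x hx)
    (M.site j y hy) h2 M.K_nonneg (mul_nonneg (M.lipschitz_nonneg j) dist_nonneg)
    (fun a S => M.lipschitz j x hx y hy a S) M.C_nonneg M.rate_nonneg hxy
  rw [scoreCov, shiftCov, add_sub_cancel]
  exact this

omit [NullSingletonClass (volume : Measure (E d))] in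
lemma abs_scoreMixed_le_of_moments {Y : Ω → Config d 𝕄} {V : Set (E d)} (hYm : Measurable Y)
    (h₁ : SiteMoments μ Q Y V x (fun m S => ζ i (x, m) S) (ENNReal.ofReal K))
    (h₂ : SiteMoments μ Q Y V x (fun m S => ζ j (x, m) S) (ENNReal.ofReal K)) :
    |scoreMixed μ Q Y (ζ i) (ζ j) x| ≤ K * K := by
  have hg : Measurable fun q : Ω × 𝕄 => (q.2, Y q.1) :=
    measurable_snd.prodMk (hYm.comp measurable_fst)
  have := (integral_mul_of_fourthMoment ((M.site i x hx).measurable_score.comp hg)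
    ((M.site j x hx).measurable_score.comp hg) ENNReal.ofReal_ne_top ENNReal.ofReal_ne_top
    h₁.zero h₂.zero MeasurableSet.univ (ε := 1) prob_le_one).2
  have hK := M.K_nonneg
  rw [← ENNReal.ofReal_le_ofReal_iff (by positivity), ← Real.enorm_eq_ofReal_abs,
    ENNReal.ofReal_mul hK]
  simpa [scoreMixed] using this

end IsModel

end StabScores

end

/-! ### Campbell formulas of first and second order -/

noncomputable section

namespace StabScores

variable {d : ℕ} {𝕄 : Type*} [MeasurableSpace 𝕄] {Ω : Type*} [MeasurableSpace Ω]

namespace Config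

lemma integrable_toMeasure {S : Config d 𝕄} {A : Set (E d)} (hA : Bornology.IsBounded A)
    {F : E d × 𝕄 → ℝ} (hF : Measurable F) (h0 : ∀ p, p.1 ∉ A → F p = 0) :
    Integrable F S.toMeasure := by
  refine ⟨hF.aestronglyMeasurable, ?_⟩
  have hfin := S.locFin A hA
  rw [HasFiniteIntegral, lintegral_toMeasure _ hF.enorm, tsum_subtype S.pts fun p => ‖F p‖ₑ]
  rw [tsum_eq_sum (s := hfin.toFinset)]
  · exact ENNReal.sum_lt_top.2 fun p _ => (indicator_le_self _ _ _).trans_lt enorm_lt_top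
  · intro p hp
    by_cases hpS : p ∈ S.pts
    · rw [indicator_of_mem hpS, h0 p fun h => hp (by simpa using ⟨hpS, h⟩), enorm_zero]
    · rw [indicator_of_notMem hpS]

lemma integral_toMeasure_eq_finsum {S : Config d 𝕄} {A : Set (E d)} (hA : Bornology.IsBounded A)
    {F : E d × 𝕄 → ℝ} (hF : Measurable F) (h0 : ∀ p, p.1 ∉ A → F p = 0) :
    ∫ p, F p ∂S.toMeasure = ∑ᶠ q ∈ S.pts ∩ A ×ˢ univ, F q := by
  have hfin := S.locFin A hA
  have h1 := hasSum_integral_measure (integrable_toMeasure (S := S) hA hF h0)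
  simp only [integral_dirac' _ _ hF.stronglyMeasurable] at h1
  rw [finsum_mem_eq_finite_toFinset_sum _ hfin]
  refine h1.unique ?_
  have h2 : HasSum (S.pts.indicator F) (∑ p ∈ hfin.toFinset, S.pts.indicator F p) := by
    refine hasSum_sum_of_ne_finset_zero fun p hp => ?_
    by_cases hpS : p ∈ S.pts
    · rw [indicator_of_mem hpS, h0 p fun h => hp (by simpa using ⟨hpS, h⟩)]
    · rw [indicator_of_notMem hpS]
  have h3 : ∑ p ∈ hfin.toFinset, S.pts.indicator F p = ∑ p ∈ hfin.toFinset, F p := by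
    refine Finset.sum_congr rfl fun p hp => indicator_of_mem ?_ _
    exact (by simpa using hp : p ∈ S.pts ∧ p.1 ∈ A).1
  rw [h3] at h2
  exact hasSum_subtype_iff_indicator.2 h2

end Config

open Config

instance (S : Config d 𝕄) : SFinite S.toMeasure := by
  rw [← kern_apply]
  infer_instance

/-- The kernel of the counting measures of a random configuration. -/
def countKernel (X : Ω → Config d 𝕄) (hX : Measurable X) : Kernel Ω (E d × 𝕄) :=
  (kern d 𝕄).comap X hX

lemma countKernel_apply {X : Ω → Config d 𝕄} (hX : Measurable X) (ω : Ω) :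
    countKernel X hX ω = (X ω).toMeasure := by
  rw [countKernel, Kernel.comap_apply, kern_apply]

instance {X : Ω → Config d 𝕄} (hX : Measurable X) : IsSFiniteKernel (countKernel X hX) := by
  unfold countKernel; infer_instance

section Mecke

variable {μ : Measure Ω} [IsProbabilityMeasure μ] {X : Ω → Config d 𝕄} {Λ : Measure (E d × 𝕄)}
  [SFinite Λ] (hX : IsMecke μ X Λ)

include hX

/-- The Mecke equation as an equality of measures; in this form it carries integrability and
integrals of signed functions. -/
lemma IsMecke.map_campbell :
    (μ ⊗ₘ countKernel X hX.measurable).map (fun q => (q.2, X q.1)) =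
      (Λ.prod μ).map fun q => (q.1, (X q.2).ins q.1) := by
  have hXm := hX.measurable
  have g1 : Measurable fun q : Ω × (E d × 𝕄) => (q.2, X q.1) :=
    measurable_snd.prodMk (hXm.comp measurable_fst)
  have g2 : Measurable fun q : (E d × 𝕄) × Ω => (q.1, (X q.2).ins q.1) :=
    measurable_fst.prodMk (measurable_ins (hXm.comp measurable_snd) measurable_fst)
  refine Measure.ext_of_lintegral _ fun F hF => ?_
  have k1 : Measurable fun q : Ω × (E d × 𝕄) => F (q.2, X q.1) := hF.comp g1
  have k2 : Measurable fun q : (E d × 𝕄) × Ω => F (q.1, (X q.2).ins q.1) := hF.comp g2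
  rw [lintegral_map hF g1, lintegral_map hF g2, Measure.lintegral_compProd k1,
    lintegral_prod _ k2.aemeasurable]
  simp only [countKernel_apply]
  exact hX.mecke F hF

/-- Mecke's formula for integrable functions. -/
lemma IsMecke.integral_campbell {F : (E d × 𝕄) × Config d 𝕄 → ℝ} (hF : Measurable F)
    (hi : Integrable (fun q : (E d × 𝕄) × Ω => F (q.1, (X q.2).ins q.1)) (Λ.prod μ)) :
    Integrable (fun ω => ∫ p, F (p, X ω) ∂(X ω).toMeasure) μ ∧
      ∫ ω, ∫ p, F (p, X ω) ∂(X ω).toMeasure ∂μ =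
        ∫ q, F (q.1, (X q.2).ins q.1) ∂(Λ.prod μ) := by
  have hXm := hX.measurable
  have g1 : Measurable fun q : Ω × (E d × 𝕄) => (q.2, X q.1) :=
    measurable_snd.prodMk (hXm.comp measurable_fst)
  have g2 : Measurable fun q : (E d × 𝕄) × Ω => (q.1, (X q.2).ins q.1) :=
    measurable_fst.prodMk (measurable_ins (hXm.comp measurable_snd) measurable_fst)
  have hmap := hX.map_campbell
  have h1 : Integrable F ((Λ.prod μ).map fun q => (q.1, (X q.2).ins q.1)) :=
    (integrable_map_measure hF.aestronglyMeasurable g2.aemeasurable).2 hi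
  rw [← hmap] at h1
  have h2 : Integrable (fun q : Ω × (E d × 𝕄) => F (q.2, X q.1))
      (μ ⊗ₘ countKernel X hXm) :=
    (integrable_map_measure hF.aestronglyMeasurable g1.aemeasurable).1 h1
  have h3 := h2.integral_compProd
  have h4 := Measure.integral_compProd h2
  simp only [countKernel_apply] at h3 h4
  refine ⟨h3, ?_⟩
  rw [← h4, ← integral_map g2.aemeasurable hF.aestronglyMeasurable, ← hmap,
    integral_map g1.aemeasurable hF.aestronglyMeasurable]

/-- The second order Mecke formula. -/
lemma IsMecke.lintegral_campbell_two {G : (E d × 𝕄) × (E d × 𝕄) × Config d 𝕄 → ℝ≥0∞}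
    (hG : Measurable G) :
    ∫⁻ ω, ∫⁻ p, ∫⁻ q, G (p, q, X ω) ∂(X ω).toMeasure ∂(X ω).toMeasure ∂μ =
      ∫⁻ p, ∫⁻ ω, G (p, p, (X ω).ins p) ∂μ ∂Λ +
      ∫⁻ p, ∫⁻ q, ∫⁻ ω, G (p, q, ((X ω).ins q).ins p) ∂μ ∂Λ ∂Λ := by
  have hXm := hX.measurable
  -- The Mecke equation is used for the inner sum, regarded as a function of the outer point and the
  -- configuration.
  have hF : Measurable fun r : (E d × 𝕄) × Config d 𝕄 => ∫⁻ q, G (r.1, q, r.2) ∂r.2.toMeasure := by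
    refine measurable_lintegral measurable_snd (F := fun r q => G (r.1, q, r.2)) ?_
    have hg : Measurable fun r : ((E d × 𝕄) × Config d 𝕄) × (E d × 𝕄) => (r.1.1, r.2, r.1.2) := by
      fun_prop
    exact hG.comp hg
  have h1 := hX.mecke _ hF
  simp only at h1
  rw [h1]
  have hm1 : Measurable fun r : (E d × 𝕄) × Ω => G (r.1, r.1, (X r.2).ins r.1) :=
    hG.comp (measurable_fst.prodMk (measurable_fst.prodMk
      (measurable_ins (hXm.comp measurable_snd) measurable_fst)))
  rw [← MeasureTheory.lintegral_add_left hm1.lintegral_prod_right']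
  refine lintegral_congr fun p => ?_
  have hFp : Measurable fun r : (E d × 𝕄) × Config d 𝕄 => G (p, r.1, r.2.ins p) :=
    hG.comp (measurable_const.prodMk (measurable_fst.prodMk
      (measurable_ins measurable_snd measurable_const)))
  have h2 := hX.mecke _ hFp
  simp only at h2
  have hm2 : Measurable fun ω => G (p, p, (X ω).ins p) := hm1.comp measurable_prodMk_left
  simp only
  -- After insertion of `p` the inner sum consists of the term at `p` itself, which yields the
  -- diagonal part, and the sum over the original points, to which the Mecke equation is applied
  -- again.
  rw [← h2, ← MeasureTheory.lintegral_add_left hm2]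
  refine lintegral_congr_ae ?_
  filter_upwards [hX.noAtom p.1] with ω hω
  simp only [ins_of_notMem hω, Function.comp_apply]
  exact Config.lintegral_add (notMem_of_notMem_proj hω)
    (hG.comp (measurable_const.prodMk (measurable_id.prodMk measurable_const)))

lemma IsMecke.map_campbell_two :
    (μ ⊗ₘ (countKernel X hX.measurable ×ₖ countKernel X hX.measurable)).map
        (fun r => (r.2.1, r.2.2, X r.1)) =
      ((Λ.prod μ).map fun r => (r.1, r.1, (X r.2).ins r.1)) +
      (Λ.prod (Λ.prod μ)).map fun r => (r.1, r.2.1, ((X r.2.2).ins r.2.1).ins r.1) := by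
  have hXm := hX.measurable
  have g1 : Measurable fun r : Ω × (E d × 𝕄) × (E d × 𝕄) => (r.2.1, r.2.2, X r.1) :=
    measurable_snd.fst.prodMk (measurable_snd.snd.prodMk (hXm.comp measurable_fst))
  have g2 : Measurable fun r : (E d × 𝕄) × Ω => (r.1, r.1, (X r.2).ins r.1) :=
    measurable_fst.prodMk (measurable_fst.prodMk
      (measurable_ins (hXm.comp measurable_snd) measurable_fst))
  have g3 : Measurable fun r : (E d × 𝕄) × (E d × 𝕄) × Ω =>
      (r.1, r.2.1, ((X r.2.2).ins r.2.1).ins r.1) :=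
    measurable_fst.prodMk (measurable_snd.fst.prodMk (measurable_ins (measurable_ins
      (hXm.comp measurable_snd.snd) measurable_snd.fst) measurable_fst))
  refine Measure.ext_of_lintegral _ fun G hG => ?_
  have k1 : Measurable fun r : Ω × (E d × 𝕄) × (E d × 𝕄) => G (r.2.1, r.2.2, X r.1) := hG.comp g1
  have k2 : Measurable fun r : (E d × 𝕄) × Ω => G (r.1, r.1, (X r.2).ins r.1) := hG.comp g2
  have k3 : Measurable fun r : (E d × 𝕄) × (E d × 𝕄) × Ω =>
      G (r.1, r.2.1, ((X r.2.2).ins r.2.1).ins r.1) := hG.comp g3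
  rw [lintegral_add_measure, lintegral_map hG g1, lintegral_map hG g2, lintegral_map hG g3,
    Measure.lintegral_compProd k1, lintegral_prod _ k2.aemeasurable,
    lintegral_prod _ k3.aemeasurable]
  have e3 : ∀ p, ∫⁻ r : (E d × 𝕄) × Ω, G (p, r.1, ((X r.2).ins r.1).ins p) ∂(Λ.prod μ) =
      ∫⁻ q, ∫⁻ ω, G (p, q, ((X ω).ins q).ins p) ∂μ ∂Λ := fun p =>
    lintegral_prod _ (k3.comp measurable_prodMk_left).aemeasurable
  have e1 : ∀ ω, ∫⁻ r : (E d × 𝕄) × (E d × 𝕄), G (r.1, r.2, X ω)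
      ∂((X ω).toMeasure.prod (X ω).toMeasure) =
      ∫⁻ p, ∫⁻ q, G (p, q, X ω) ∂(X ω).toMeasure ∂(X ω).toMeasure := fun ω =>
    lintegral_prod _ (k1.comp measurable_prodMk_left).aemeasurable
  simp only [Kernel.prod_apply, countKernel_apply, e1, e3]
  exact hX.lintegral_campbell_two hG

/-- The second order Mecke formula for products of integrable functions. -/
lemma IsMecke.integral_campbell_mul {F₁ F₂ : (E d × 𝕄) × Config d 𝕄 → ℝ} (hF₁ : Measurable F₁)
    (hF₂ : Measurable F₂)
    (hi : Integrable (fun q : (E d × 𝕄) × Ω =>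
      F₁ (q.1, (X q.2).ins q.1) * F₂ (q.1, (X q.2).ins q.1)) (Λ.prod μ))
    (hi' : Integrable (fun r : (E d × 𝕄) × (E d × 𝕄) × Ω =>
      F₁ (r.1, ((X r.2.2).ins r.2.1).ins r.1) * F₂ (r.2.1, ((X r.2.2).ins r.2.1).ins r.1))
      (Λ.prod (Λ.prod μ))) :
    Integrable (fun ω => (∫ p, F₁ (p, X ω) ∂(X ω).toMeasure) *
        ∫ p, F₂ (p, X ω) ∂(X ω).toMeasure) μ ∧
      ∫ ω, (∫ p, F₁ (p, X ω) ∂(X ω).toMeasure) * ∫ p, F₂ (p, X ω) ∂(X ω).toMeasure ∂μ =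
        ∫ q, F₁ (q.1, (X q.2).ins q.1) * F₂ (q.1, (X q.2).ins q.1) ∂(Λ.prod μ) +
        ∫ r : (E d × 𝕄) × (E d × 𝕄) × Ω, F₁ (r.1, ((X r.2.2).ins r.2.1).ins r.1) *
          F₂ (r.2.1, ((X r.2.2).ins r.2.1).ins r.1) ∂(Λ.prod (Λ.prod μ)) := by
  have hXm := hX.measurable
  have g1 : Measurable fun r : Ω × (E d × 𝕄) × (E d × 𝕄) => (r.2.1, r.2.2, X r.1) :=
    measurable_snd.fst.prodMk (measurable_snd.snd.prodMk (hXm.comp measurable_fst))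
  have g2 : Measurable fun r : (E d × 𝕄) × Ω => (r.1, r.1, (X r.2).ins r.1) :=
    measurable_fst.prodMk (measurable_fst.prodMk
      (measurable_ins (hXm.comp measurable_snd) measurable_fst))
  have g3 : Measurable fun r : (E d × 𝕄) × (E d × 𝕄) × Ω =>
      (r.1, r.2.1, ((X r.2.2).ins r.2.1).ins r.1) :=
    measurable_fst.prodMk (measurable_snd.fst.prodMk (measurable_ins (measurable_ins
      (hXm.comp measurable_snd.snd) measurable_snd.fst) measurable_fst))
  have hG : Measurable fun r : (E d × 𝕄) × (E d × 𝕄) × Config d 𝕄 =>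
      F₁ (r.1, r.2.2) * F₂ (r.2.1, r.2.2) :=
    (hF₁.comp (measurable_fst.prodMk measurable_snd.snd)).mul (hF₂.comp measurable_snd)
  have hmap := hX.map_campbell_two
  have i2 := (integrable_map_measure hG.aestronglyMeasurable g2.aemeasurable).2 hi
  have i3 := (integrable_map_measure hG.aestronglyMeasurable g3.aemeasurable).2 hi'
  have i1 := i2.add_measure i3
  rw [← hmap] at i1
  have i1' := (integrable_map_measure hG.aestronglyMeasurable g1.aemeasurable).1 i1
  have h3 := Integrable.integral_compProd i1'
  have h4 := Measure.integral_compProd i1'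
  simp only [Kernel.prodMkLeft_apply, Kernel.const_apply, Kernel.prod_apply, countKernel_apply,
    Function.comp_apply] at h3 h4
  have e : ∀ ω, ∫ r : (E d × 𝕄) × (E d × 𝕄), F₁ (r.1, X ω) * F₂ (r.2, X ω)
      ∂((X ω).toMeasure.prod (X ω).toMeasure) =
      (∫ p, F₁ (p, X ω) ∂(X ω).toMeasure) * ∫ p, F₂ (p, X ω) ∂(X ω).toMeasure := fun ω =>
    integral_prod_mul (fun p => F₁ (p, X ω)) fun p => F₂ (p, X ω)
  simp only [e] at h3 h4
  refine ⟨h3, ?_⟩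
  rw [← h4]
  have h5 := integral_map g1.aemeasurable (f := fun r : (E d × 𝕄) × (E d × 𝕄) × Config d 𝕄 =>
      F₁ (r.1, r.2.2) * F₂ (r.2.1, r.2.2)) hG.aestronglyMeasurable
      (μ := μ ⊗ₘ (countKernel X hX.measurable ×ₖ countKernel X hX.measurable))
  have h6 := integral_map g2.aemeasurable (f := fun r : (E d × 𝕄) × (E d × 𝕄) × Config d 𝕄 =>
      F₁ (r.1, r.2.2) * F₂ (r.2.1, r.2.2)) hG.aestronglyMeasurable (μ := Λ.prod μ)
  have h7 := integral_map g3.aemeasurable (f := fun r : (E d × 𝕄) × (E d × 𝕄) × Config d 𝕄 =>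
      F₁ (r.1, r.2.2) * F₂ (r.2.1, r.2.2)) hG.aestronglyMeasurable (μ := Λ.prod (Λ.prod μ))
  rw [← h6, ← h7, ← integral_add_measure i2 i3, ← hmap, h5]

end Mecke

end StabScores

end

/-! ### The covariance of two statistics as an integral -/

noncomputable section

namespace StabScores

variable {d m : ℕ} {𝕄 : Type*} [MeasurableSpace 𝕄] {Ω : Type*} [MeasurableSpace Ω]

open Config

section Reorder

variable {α β γ : Type*} [MeasurableSpace α] [MeasurableSpace β] [MeasurableSpace γ]
  (a : Measure α) [SFinite a] (b : Measure β) [SFinite b] (c : Measure γ) [SFinite c]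

lemma measurePreserving_swapLeft :
    MeasurePreserving (fun r : α × β × γ => (r.2.1, r.1, r.2.2)) (a.prod (b.prod c))
      (b.prod (a.prod c)) := by
  have h1 : MeasurePreserving (fun r : (α × β) × γ => (r.1.swap, r.2)) ((a.prod b).prod c)
      ((b.prod a).prod c) := Measure.measurePreserving_swap.prod (MeasurePreserving.id c)
  exact (measurePreserving_prodAssoc b a c).comp
    (h1.comp ((measurePreserving_prodAssoc a b c).symm _))

lemma measurePreserving_pointMark :
    MeasurePreserving (fun r : α × β × γ => ((r.1, r.2.2), r.2.1)) (a.prod (b.prod c))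
      ((a.prod c).prod b) := by
  have h1 : MeasurePreserving (fun r : α × β × γ => (r.1, r.2.swap)) (a.prod (b.prod c))
      (a.prod (c.prod b)) := (MeasurePreserving.id a).prod Measure.measurePreserving_swap
  exact ((measurePreserving_prodAssoc a c b).symm _).comp h1

/-- Mecke's formula integrates over marked points, whereas the expectations at given positions
integrate over the process and the marks together. The reordering allows positions to be integrated
last. -/
lemma measurePreserving_pointMark_two :
    MeasurePreserving
      (fun r : (α × α) × β × γ × γ => ((r.1.1, r.2.2.1), (r.1.2, r.2.2.2), r.2.1))
      ((a.prod a).prod (b.prod (c.prod c))) ((a.prod c).prod ((a.prod c).prod b)) := by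
  have h1 := measurePreserving_prodAssoc a a (b.prod (c.prod c))
  have h2 : MeasurePreserving (fun r : α × α × β × γ × γ => (r.1, r.2.1, r.2.2.2.1, r.2.2.1, r.2.2.2.2))
      (a.prod (a.prod (b.prod (c.prod c)))) (a.prod (a.prod (c.prod (b.prod c)))) :=
    (MeasurePreserving.id a).prod ((MeasurePreserving.id a).prod (measurePreserving_swapLeft b c c))
  have h3 : MeasurePreserving (fun r : α × α × γ × β × γ => (r.1, r.2.2.1, r.2.1, r.2.2.2))
      (a.prod (a.prod (c.prod (b.prod c)))) (a.prod (c.prod (a.prod (b.prod c)))) :=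
    (MeasurePreserving.id a).prod (measurePreserving_swapLeft a c (b.prod c))
  have h4 : MeasurePreserving (fun r : α × γ × α × β × γ => (r.1, r.2.1, ((r.2.2.1, r.2.2.2.2), r.2.2.2.1)))
      (a.prod (c.prod (a.prod (b.prod c)))) (a.prod (c.prod ((a.prod c).prod b))) :=
    (MeasurePreserving.id a).prod ((MeasurePreserving.id c).prod (measurePreserving_pointMark a b c))
  have h5 := (measurePreserving_prodAssoc a c ((a.prod c).prod b)).symm _
  exact h5.comp (h4.comp (h3.comp (h2.comp h1)))

end Reorder

/-- All integrands vanish for positions outside a set of finite measure and have uniformly bounded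
inner integrals. -/
lemma integrable_prod_of_ae_le {α N : Type*} [MeasurableSpace α] [MeasurableSpace N]
    {ν : Measure α} [SFinite ν] {n : Measure N} [SFinite n] {u : α × N → ℝ} (hu : Measurable u)
    {A : Set α} (hA : MeasurableSet A) (hνA : ν A ≠ ∞) {c : ℝ≥0∞} (hc : c ≠ ∞)
    (h : ∀ᵐ x ∂ν, ∫⁻ t, ‖u (x, t)‖ₑ ∂n ≤ A.indicator (fun _ => c) x) : Integrable u (ν.prod n) := by
  refine ⟨hu.aestronglyMeasurable, ?_⟩
  rw [HasFiniteIntegral, lintegral_prod _ hu.enorm.aemeasurable]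
  refine (lintegral_mono_ae h).trans_lt ?_
  rw [lintegral_indicator_const hA]
  exact ENNReal.mul_lt_top hc.lt_top hνA.lt_top

lemma lintegral_mul_le_of_fourthMoment {α : Type*} [MeasurableSpace α] {ν : Measure α}
    [IsProbabilityMeasure ν] {u v : α → ℝ} (hu : Measurable u) (hv : Measurable v)
    {K₁ K₂ : ℝ≥0∞} (hK₁ : ∫⁻ t, ‖u t‖ₑ ^ 4 ∂ν ≤ K₁ ^ 4) (hK₂ : ∫⁻ t, ‖v t‖ₑ ^ 4 ∂ν ≤ K₂ ^ 4) :
    ∫⁻ t, ‖u t * v t‖ₑ ∂ν ≤ K₁ * K₂ := by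
  have := lintegral_mul_indicator_le hu.enorm.aemeasurable hv.enorm.aemeasurable hK₁ hK₂
    MeasurableSet.univ
  simpa [enorm_mul] using this

/-- The measure with density `ρ`. -/
abbrev densVol (ρ : E d → ℝ) : Measure (E d) := volume.withDensity fun x => ENNReal.ofReal (ρ x)

lemma integral_densVol {ρ : E d → ℝ} (hρ : Measurable ρ) (h0 : ∀ x, 0 ≤ ρ x) (u : E d → ℝ) :
    ∫ x, u x ∂(densVol ρ) = ∫ x, ρ x * u x := by
  rw [integral_withDensity_eq_integral_toReal_smul hρ.ennreal_ofReal
    (Eventually.of_forall fun x => ENNReal.ofReal_lt_top)]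
  refine integral_congr_ae (Eventually.of_forall fun x => ?_)
  simp [ENNReal.toReal_ofReal (h0 x)]

lemma integral_densVol_prod {ρ : E d → ℝ} (hρ : Measurable ρ) (h0 : ∀ x, 0 ≤ ρ x)
    (u : E d × E d → ℝ) :
    ∫ r, u r ∂((densVol ρ).prod (densVol ρ)) =
      ∫ r : E d × E d, ρ r.1 * ρ r.2 * u r ∂(volume.prod volume) := by
  have hm := hρ.ennreal_ofReal
  rw [prod_withDensity hm hm, integral_withDensity_eq_integral_toReal_smul (by fun_prop)
    (Eventually.of_forall fun x => ENNReal.mul_lt_top ENNReal.ofReal_lt_top ENNReal.ofReal_lt_top)]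
  refine integral_congr_ae (Eventually.of_forall fun x => ?_)
  simp [ENNReal.toReal_mul, ENNReal.toReal_ofReal (h0 x.1), ENNReal.toReal_ofReal (h0 x.2)]

lemma densVol_lt_top {ρ : E d → ℝ} {b : ℝ} (hb : ∀ z, ρ z ≤ b) {A : Set (E d)}
    (hAm : MeasurableSet A) (hA : Bornology.IsBounded A) : densVol ρ A ≠ ∞ := by
  rw [withDensity_apply _ hAm]
  refine ((lintegral_mono fun z => ENNReal.ofReal_le_ofReal (hb z)).trans_lt ?_).ne
  rw [lintegral_const, Measure.restrict_apply_univ]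
  exact ENNReal.mul_lt_top ENNReal.ofReal_lt_top hA.measure_lt_top

/-- The finite sum becomes an integral against the counting measure, to which Campbell formulas
apply. The weight is extended by zero, which turns the restriction to `A` into part of the
integrand. -/
lemma pairing_eq_integral {A : Set (E d)} (hA : Bornology.IsBounded A) {f : E d → ℝ}
    (hf : Measurable (A.indicator f)) {ζ : Score d 𝕄} (hζ : Measurable (Function.uncurry ζ))
    (X : Ω → Config d 𝕄) (ω : Ω) :
    pairing A f ζ X ω = ∫ p, A.indicator f p.1 * ζ p (X ω) ∂(X ω).toMeasure := by
  have hm : Measurable fun p : E d × 𝕄 => A.indicator f p.1 * ζ p (X ω) :=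
    (hf.comp measurable_fst).mul (hζ.comp (measurable_id.prodMk measurable_const))
  rw [integral_toMeasure_eq_finsum hA hm fun p hp => by rw [indicator_of_notMem hp, zero_mul],
    pairing]
  refine finsum_mem_congr rfl fun q hq => ?_
  rw [indicator_of_mem hq.2.1]

/-- A bounded measurable weight supported by a bounded measurable subset of the window. -/
structure IsWeight (W A : Set (E d)) (φ : E d → ℝ) (b : ℝ) : Prop where
  measurable : Measurable φ
  abs_le : ∀ x, |φ x| ≤ b
  support : ∀ x, x ∉ A → φ x = 0
  measurableSet : MeasurableSet A
  bounded : Bornology.IsBounded A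
  subset : A ⊆ W

namespace IsModel

variable {W : Set (E d)} {g : E d → ℝ} {B s : ℝ} {Q : Measure 𝕄} [IsProbabilityMeasure Q]
  {μ : Measure Ω} [IsProbabilityMeasure μ] {X : Ω → Config d 𝕄} {Z : ℝ → Ω → Config d 𝕄}
  {ζ : Fin m → Score d 𝕄} {R : E d × 𝕄 → Config d 𝕄 → ℝ≥0} {Ct : Fin m → ℝ} {K C κ : ℝ}
  [NullSingletonClass (volume : Measure (E d))]
  (M : IsModel W g B s Q μ X Z ζ R Ct K C κ) (i j : Fin m)

include M

lemma ae_prod_notMem_proj {N : Type*} [MeasurableSpace N] {n : Measure N} [SFinite n]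
    {ν : Measure (E d)} [SFinite ν] :
    ∀ᵐ r ∂(ν.prod (μ.prod n)), r.1 ∉ (X r.2.1).proj := by
  rw [Measure.ae_prod_iff_ae_ae]
  · exact Eventually.of_forall fun x => ae_notMem_proj M.mecke.noAtom x
  · exact (measurableSet_mem_proj (M.mecke.measurable.comp measurable_snd.fst) measurable_fst).compl

/-- Mecke's formula inserts the very point at which the score is evaluated; the insertion convention
removes it again. -/
lemma score_ins_self {x : E d} (hx : x ∈ W) (a : 𝕄) {S : Config d 𝕄} (hS : x ∉ S.proj) :
    ζ i (x, a) (S.ins (x, a)) = ζ i (x, a) S := by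
  rw [ins_of_notMem (by exact hS)]
  exact (M.insert i x a S hx (notMem_of_notMem_proj hS)).symm

lemma density_bound (z : E d) : s * W.indicator g z ≤ s * B :=
  mul_le_mul_of_nonneg_left (M.indicator_le z) M.scale_pos.le

lemma density_mul_nonneg (z : E d) : 0 ≤ s * W.indicator g z :=
  mul_nonneg M.scale_pos.le (M.indicator_nonneg z)

lemma measurable_score_comp {α : Type*} [MeasurableSpace α] {p : α → E d × 𝕄}
    {T : α → Config d 𝕄} (hp : Measurable p) (hT : Measurable T) :
    Measurable fun t => ζ i (p t) (T t) := (M.measurable_score i).comp (hp.prodMk hT)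

variable {φ₁ φ₂ : E d → ℝ} {A₁ A₂ : Set (E d)} {b₁ b₂ : ℝ} (h₁ : IsWeight W A₁ φ₁ b₁)
  (h₂ : IsWeight W A₂ φ₂ b₂)

include h₁

lemma integrable_single :
    Integrable (fun r : E d × Ω × 𝕄 => φ₁ r.1 * ζ i (r.1, r.2.2) (X r.2.1))
      ((densVol fun z => s * W.indicator g z).prod (μ.prod Q)) := by
  have hXm := M.mecke.measurable
  have hm : Measurable fun r : E d × Ω × 𝕄 => ζ i (r.1, r.2.2) (X r.2.1) :=
    M.measurable_score_comp i (by fun_prop) (hXm.comp measurable_snd.fst)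
  refine integrable_prod_of_ae_le ((h₁.measurable.comp measurable_fst).mul hm) h₁.measurableSet
    (densVol_lt_top M.density_bound h₁.measurableSet h₁.bounded)
    (c := ENNReal.ofReal b₁ * (ENNReal.ofReal K * 1))
    (by finiteness) (Eventually.of_forall fun x => ?_)
  by_cases hx : x ∈ A₁
  · rw [indicator_of_mem hx]
    have hmx : Measurable fun q : Ω × 𝕄 => ζ i (x, q.2) (X q.1) := hm.comp measurable_prodMk_left
    have k := lintegral_mul_le_of_fourthMoment (ν := μ.prod Q) hmx (measurable_const (a := (1 : ℝ)))
      (M.moments i x (h₁.subset hx)).zero (K₂ := 1) (by simp)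
    simp only [mul_one] at k
    simp only [enorm_mul]
    rw [lintegral_const_mul _ hmx.enorm, mul_one]
    gcongr
    rw [Real.enorm_eq_ofReal_abs]
    exact ENNReal.ofReal_le_ofReal (h₁.abs_le x)
  · simp [h₁.support x hx]

include h₂

lemma integrable_diag :
    Integrable (fun r : E d × Ω × 𝕄 => φ₁ r.1 * φ₂ r.1 *
      (ζ i (r.1, r.2.2) (X r.2.1) * ζ j (r.1, r.2.2) (X r.2.1)))
      ((densVol fun z => s * W.indicator g z).prod (μ.prod Q)) := by
  have hXm := M.mecke.measurable
  have hmi : Measurable fun r : E d × Ω × 𝕄 => ζ i (r.1, r.2.2) (X r.2.1) :=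
    M.measurable_score_comp i (by fun_prop) (hXm.comp measurable_snd.fst)
  have hmj : Measurable fun r : E d × Ω × 𝕄 => ζ j (r.1, r.2.2) (X r.2.1) :=
    M.measurable_score_comp j (by fun_prop) (hXm.comp measurable_snd.fst)
  refine integrable_prod_of_ae_le (((h₁.measurable.comp measurable_fst).mul
    (h₂.measurable.comp measurable_fst)).mul (hmi.mul hmj)) h₁.measurableSet
    (densVol_lt_top M.density_bound h₁.measurableSet h₁.bounded)
    (c := ENNReal.ofReal b₁ * ENNReal.ofReal b₂ * (ENNReal.ofReal K * ENNReal.ofReal K))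
    (by finiteness) (Eventually.of_forall fun x => ?_)
  by_cases hx : x ∈ A₁
  · rw [indicator_of_mem hx]
    have hmix : Measurable fun q : Ω × 𝕄 => ζ i (x, q.2) (X q.1) := hmi.comp measurable_prodMk_left
    have hmjx : Measurable fun q : Ω × 𝕄 => ζ j (x, q.2) (X q.1) := hmj.comp measurable_prodMk_left
    have k := lintegral_mul_le_of_fourthMoment (ν := μ.prod Q) hmix hmjx
      (M.moments i x (h₁.subset hx)).zero (M.moments j x (h₁.subset hx)).zero
    simp only [enorm_mul (φ₁ x * φ₂ x)]
    rw [lintegral_const_mul _ (hmix.fun_mul hmjx).enorm, enorm_mul]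
    refine mul_le_mul' (mul_le_mul' ?_ ?_) k
    · rw [Real.enorm_eq_ofReal_abs]
      exact ENNReal.ofReal_le_ofReal (h₁.abs_le x)
    · rw [Real.enorm_eq_ofReal_abs]
      exact ENNReal.ofReal_le_ofReal (h₂.abs_le x)
  · simp [h₁.support x hx]

omit h₁ h₂ in
lemma ae_ne : ∀ᵐ r ∂((densVol fun z => s * W.indicator g z).prod
    (densVol fun z => s * W.indicator g z)), r.1 ≠ r.2 := by
  refine (Measure.ae_prod_iff_ae_ae (p := fun r : E d × E d => r.1 ≠ r.2)
    (measurableSet_eq_fun measurable_fst measurable_snd).compl).2 ?_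
  refine Eventually.of_forall fun x => (withDensity_absolutelyContinuous _ _).ae_le ?_
  exact (measure_eq_zero_iff_ae_notMem.1 (measure_singleton (μ := (volume : Measure (E d))) x)).mono
      fun z hz h => hz h.symm

/-- Both weights have bounded support and the product of the scores has a bounded mean by fourth
moments with one insertion. No decay in the distance is needed here. -/
lemma integrable_off :
    Integrable (fun r : (E d × E d) × Ω × 𝕄 × 𝕄 => φ₁ r.1.1 * φ₂ r.1.2 *
      (ζ i (r.1.1, r.2.2.1) ((X r.2.1).ins (r.1.2, r.2.2.2)) *
        ζ j (r.1.2, r.2.2.2) ((X r.2.1).ins (r.1.1, r.2.2.1))))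
      (((densVol fun z => s * W.indicator g z).prod (densVol fun z => s * W.indicator g z)).prod
        (μ.prod (Q.prod Q))) := by
  have hXm := M.mecke.measurable
  have hmi : Measurable fun r : (E d × E d) × Ω × 𝕄 × 𝕄 =>
      ζ i (r.1.1, r.2.2.1) ((X r.2.1).ins (r.1.2, r.2.2.2)) :=
    M.measurable_score_comp i (by fun_prop) (measurable_ins (hXm.comp measurable_snd.fst)
      (by fun_prop))
  have hmj : Measurable fun r : (E d × E d) × Ω × 𝕄 × 𝕄 =>
      ζ j (r.1.2, r.2.2.2) ((X r.2.1).ins (r.1.1, r.2.2.1)) :=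
    M.measurable_score_comp j (by fun_prop) (measurable_ins (hXm.comp measurable_snd.fst)
      (by fun_prop))
  have hφ : Measurable fun r : (E d × E d) × Ω × 𝕄 × 𝕄 => φ₁ r.1.1 * φ₂ r.1.2 :=
    (h₁.measurable.comp measurable_fst.fst).mul (h₂.measurable.comp measurable_fst.snd)
  refine integrable_prod_of_ae_le (hφ.mul (hmi.mul hmj)) (h₁.measurableSet.prod h₂.measurableSet)
    ?_ (c := ENNReal.ofReal b₁ * ENNReal.ofReal b₂ * (ENNReal.ofReal K * ENNReal.ofReal K))
    (by finiteness) ?_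
  · rw [Measure.prod_prod]
    exact ENNReal.mul_ne_top (densVol_lt_top M.density_bound h₁.measurableSet h₁.bounded)
      (densVol_lt_top M.density_bound h₂.measurableSet h₂.bounded)
  · filter_upwards [M.ae_ne] with r hr
    obtain ⟨x, y⟩ := r
    by_cases hxy : (x, y) ∈ A₁ ×ˢ A₂
    · rw [indicator_of_mem hxy]
      have hmix : Measurable fun q : Ω × 𝕄 × 𝕄 => ζ i (x, q.2.1) ((X q.1).ins (y, q.2.2)) :=
        hmi.comp (measurable_prodMk_left (x := (x, y)))
      have hmjx : Measurable fun q : Ω × 𝕄 × 𝕄 => ζ j (y, q.2.2) ((X q.1).ins (x, q.2.1)) :=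
        hmj.comp (measurable_prodMk_left (x := (x, y)))
      have P := M.pairInput i j (h₁.subset hxy.1) (h₂.subset hxy.2) hr
      have k := lintegral_mul_le_of_fourthMoment (ν := μ.prod (Q.prod Q)) hmix hmjx
        P.moment₁_ins.1 P.moment₂_ins.1
      simp only [enorm_mul (φ₁ x * φ₂ y)]
      rw [lintegral_const_mul _ (hmix.fun_mul hmjx).enorm, enorm_mul]
      refine mul_le_mul' (mul_le_mul' ?_ ?_) k
      · rw [Real.enorm_eq_ofReal_abs]
        exact ENNReal.ofReal_le_ofReal (h₁.abs_le x)
      · rw [Real.enorm_eq_ofReal_abs]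
        exact ENNReal.ofReal_le_ofReal (h₂.abs_le y)
    · have : φ₁ x * φ₂ y = 0 := by
        by_cases hx : x ∈ A₁
        · rw [h₂.support y fun hy => hxy ⟨hx, hy⟩, mul_zero]
        · rw [h₁.support x hx, zero_mul]
      simp [this]

omit h₂ in
/-- The mean of a statistic. -/
lemma integral_statistic :
    Integrable (fun ω => ∫ p, φ₁ p.1 * ζ i p (X ω) ∂(X ω).toMeasure) μ ∧
    ∫ ω, ∫ p, φ₁ p.1 * ζ i p (X ω) ∂(X ω).toMeasure ∂μ =
      ∫ x, φ₁ x * ∫ q : Ω × 𝕄, ζ i (x, q.2) (X q.1) ∂(μ.prod Q)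
        ∂(densVol fun z => s * W.indicator g z) := by
  have hXm := M.mecke.measurable
  have hF : Measurable fun r : (E d × 𝕄) × Config d 𝕄 => φ₁ r.1.1 * ζ i r.1 r.2 :=
    (h₁.measurable.comp measurable_fst.fst).mul (M.measurable_score_comp i measurable_fst measurable_snd)
  have mp := measurePreserving_pointMark (densVol fun z => s * W.indicator g z) μ Q
  have hF2 : Measurable fun q : (E d × 𝕄) × Ω => φ₁ q.1.1 * ζ i q.1 ((X q.2).ins q.1) :=
    hF.comp (measurable_fst.prodMk (measurable_ins (hXm.comp measurable_snd) measurable_fst))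
  have hae : (fun r : E d × Ω × 𝕄 => φ₁ r.1 * ζ i (r.1, r.2.2) ((X r.2.1).ins (r.1, r.2.2)))
      =ᵐ[(densVol fun z => s * W.indicator g z).prod (μ.prod Q)]
      fun r : E d × Ω × 𝕄 => φ₁ r.1 * ζ i (r.1, r.2.2) (X r.2.1) := by
    filter_upwards [M.ae_prod_notMem_proj] with r hr
    by_cases hx : r.1 ∈ A₁
    · rw [M.score_ins_self i (h₁.subset hx) _ hr]
    · rw [h₁.support _ hx, zero_mul, zero_mul]
  have hi := (M.integrable_single i h₁).congr hae.symm
  have hi2 := (mp.integrable_comp hF2.aestronglyMeasurable).1 hi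
  obtain ⟨k1, k2⟩ := M.mecke.integral_campbell hF hi2
  refine ⟨k1, ?_⟩
  simp only at k2
  rw [k2]
  have e1 := integral_map mp.measurable.aemeasurable (f := fun q : (E d × 𝕄) × Ω =>
    φ₁ q.1.1 * ζ i q.1 ((X q.2).ins q.1)) hF2.aestronglyMeasurable
    (μ := (densVol fun z => s * W.indicator g z).prod (μ.prod Q))
  rw [mp.map_eq] at e1
  refine e1.trans ?_
  rw [integral_congr_ae hae, integral_prod _ (M.integrable_single i h₁)]
  refine integral_congr_ae (Eventually.of_forall fun x => ?_)
  simp only [integral_const_mul]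

/-- The mixed second moment of two statistics. -/
lemma integral_statistic_mul :
    Integrable (fun ω => (∫ p, φ₁ p.1 * ζ i p (X ω) ∂(X ω).toMeasure) *
      ∫ p, φ₂ p.1 * ζ j p (X ω) ∂(X ω).toMeasure) μ ∧
    ∫ ω, (∫ p, φ₁ p.1 * ζ i p (X ω) ∂(X ω).toMeasure) *
      ∫ p, φ₂ p.1 * ζ j p (X ω) ∂(X ω).toMeasure ∂μ =
      ∫ x, φ₁ x * φ₂ x * scoreMixed μ Q X (ζ i) (ζ j) x
        ∂(densVol fun z => s * W.indicator g z) +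
      ∫ r : E d × E d, φ₁ r.1 * φ₂ r.2 * ∫ q : Ω × 𝕄 × 𝕄,
        ζ i (r.1, q.2.1) ((X q.1).ins (r.2, q.2.2)) *
          ζ j (r.2, q.2.2) ((X q.1).ins (r.1, q.2.1)) ∂(μ.prod (Q.prod Q))
        ∂((densVol fun z => s * W.indicator g z).prod (densVol fun z => s * W.indicator g z)) := by
  have hXm := M.mecke.measurable
  have hF₁ : Measurable fun r : (E d × 𝕄) × Config d 𝕄 => φ₁ r.1.1 * ζ i r.1 r.2 :=
    (h₁.measurable.comp measurable_fst.fst).mul (M.measurable_score_comp i measurable_fst measurable_snd)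
  have hF₂ : Measurable fun r : (E d × 𝕄) × Config d 𝕄 => φ₂ r.1.1 * ζ j r.1 r.2 :=
    (h₂.measurable.comp measurable_fst.fst).mul (M.measurable_score_comp j measurable_fst measurable_snd)
  have mp := measurePreserving_pointMark (densVol fun z => s * W.indicator g z) μ Q
  have mp2 := measurePreserving_pointMark_two (densVol fun z => s * W.indicator g z) μ Q
  have g2 : Measurable fun q : (E d × 𝕄) × Ω => (q.1, (X q.2).ins q.1) :=
    measurable_fst.prodMk (measurable_ins (hXm.comp measurable_snd) measurable_fst)
  have g3 : Measurable fun r : (E d × 𝕄) × (E d × 𝕄) × Ω => ((X r.2.2).ins r.2.1).ins r.1 :=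
    measurable_ins (measurable_ins (hXm.comp measurable_snd.snd) measurable_snd.fst) measurable_fst
  have hG2 : Measurable fun q : (E d × 𝕄) × Ω =>
      (φ₁ q.1.1 * ζ i q.1 ((X q.2).ins q.1)) * (φ₂ q.1.1 * ζ j q.1 ((X q.2).ins q.1)) :=
    (hF₁.comp g2).mul (hF₂.comp g2)
  have hG3 : Measurable fun r : (E d × 𝕄) × (E d × 𝕄) × Ω =>
      (φ₁ r.1.1 * ζ i r.1 (((X r.2.2).ins r.2.1).ins r.1)) *
        (φ₂ r.2.1.1 * ζ j r.2.1 (((X r.2.2).ins r.2.1).ins r.1)) :=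
    (hF₁.comp (measurable_fst.prodMk g3)).mul (hF₂.comp (measurable_snd.fst.prodMk g3))
  have hae : (fun r : E d × Ω × 𝕄 => (φ₁ r.1 * ζ i (r.1, r.2.2) ((X r.2.1).ins (r.1, r.2.2))) *
      (φ₂ r.1 * ζ j (r.1, r.2.2) ((X r.2.1).ins (r.1, r.2.2))))
      =ᵐ[(densVol fun z => s * W.indicator g z).prod (μ.prod Q)]
      fun r : E d × Ω × 𝕄 => φ₁ r.1 * φ₂ r.1 *
        (ζ i (r.1, r.2.2) (X r.2.1) * ζ j (r.1, r.2.2) (X r.2.1)) := by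
    filter_upwards [M.ae_prod_notMem_proj] with r hr
    by_cases hx : r.1 ∈ A₁
    · rw [M.score_ins_self i (h₁.subset hx) _ hr, M.score_ins_self j (h₁.subset hx) _ hr]
      ring
    · rw [h₁.support _ hx, zero_mul, zero_mul, zero_mul, zero_mul]
  have hae2 : (fun r : (E d × E d) × Ω × 𝕄 × 𝕄 =>
      (φ₁ r.1.1 * ζ i (r.1.1, r.2.2.1)
        (((X r.2.1).ins (r.1.2, r.2.2.2)).ins (r.1.1, r.2.2.1))) *
      (φ₂ r.1.2 * ζ j (r.1.2, r.2.2.2)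
        (((X r.2.1).ins (r.1.2, r.2.2.2)).ins (r.1.1, r.2.2.1))))
      =ᵐ[((densVol fun z => s * W.indicator g z).prod (densVol fun z => s * W.indicator g z)).prod
        (μ.prod (Q.prod Q))]
      fun r => φ₁ r.1.1 * φ₂ r.1.2 *
      (ζ i (r.1.1, r.2.2.1) ((X r.2.1).ins (r.1.2, r.2.2.2)) *
        ζ j (r.1.2, r.2.2.2) ((X r.2.1).ins (r.1.1, r.2.2.1))) := by
    have n0 : ∀ᵐ r ∂(((densVol fun z => s * W.indicator g z).prod
        (densVol fun z => s * W.indicator g z)).prod (μ.prod (Q.prod Q))),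
        r.1.1 ≠ r.1.2 := Measure.quasiMeasurePreserving_fst.ae M.ae_ne
    have n1 : ∀ᵐ r ∂(((densVol fun z => s * W.indicator g z).prod
        (densVol fun z => s * W.indicator g z)).prod (μ.prod (Q.prod Q))),
        r.1.1 ∉ (X r.2.1).proj := by
      rw [Measure.ae_prod_iff_ae_ae]
      · exact Eventually.of_forall fun x => ae_notMem_proj M.mecke.noAtom x.1
      · exact (measurableSet_mem_proj (hXm.comp measurable_snd.fst) measurable_fst.fst).compl
    have n2 : ∀ᵐ r ∂(((densVol fun z => s * W.indicator g z).prod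
        (densVol fun z => s * W.indicator g z)).prod (μ.prod (Q.prod Q))),
        r.1.2 ∉ (X r.2.1).proj := by
      rw [Measure.ae_prod_iff_ae_ae]
      · exact Eventually.of_forall fun x => ae_notMem_proj M.mecke.noAtom x.2
      · exact (measurableSet_mem_proj (hXm.comp measurable_snd.fst) measurable_fst.snd).compl
    filter_upwards [n0, n1, n2] with r hne hr1 hr2
    by_cases hx : r.1.1 ∈ A₁
    · by_cases hy : r.1.2 ∈ A₂
      · have k1 : r.1.1 ∉ ((X r.2.1).ins (r.1.2, r.2.2.2)).proj := by
          rw [mem_proj_ins]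
          rintro (h | h)
          · exact hne h
          · exact hr1 h
        have k2 : r.1.2 ∉ ((X r.2.1).ins (r.1.1, r.2.2.1)).proj := by
          rw [mem_proj_ins]
          rintro (h | h)
          · exact hne h.symm
          · exact hr2 h
        -- At distinct free positions the insertions commute. Each score can therefore have its own
        -- point inserted last and drop it by the convention, keeping only the point of the other.
        have hcomm : ((X r.2.1).ins (r.1.2, r.2.2.2)).ins (r.1.1, r.2.2.1) =
            ((X r.2.1).ins (r.1.1, r.2.2.1)).ins (r.1.2, r.2.2.2) := by
          rw [ins_of_notMem (p := (r.1.1, r.2.2.1)) k1, ins_of_notMem (p := (r.1.2, r.2.2.2)) k2,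
            ins_of_notMem (p := (r.1.1, r.2.2.1)) hr1, ins_of_notMem (p := (r.1.2, r.2.2.2)) hr2]
          ext1
          simp only [add_pts]
          exact insert_comm _ _ _
        rw [M.score_ins_self i (h₁.subset hx) _ k1, hcomm,
          M.score_ins_self j (h₂.subset hy) _ k2]
        ring
      · rw [h₂.support _ hy]
        simp
    · rw [h₁.support _ hx]
      simp
  have hi := (M.integrable_diag i j h₁ h₂).congr hae.symm
  have hi2 := (mp.integrable_comp hG2.aestronglyMeasurable).1 hi
  have hj := (M.integrable_off i j h₁ h₂).congr hae2.symm
  have hj2 := (mp2.integrable_comp hG3.aestronglyMeasurable).1 hj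
  obtain ⟨k1, k2⟩ := M.mecke.integral_campbell_mul hF₁ hF₂ hi2 hj2
  refine ⟨k1, ?_⟩
  simp only at k2
  rw [k2]
  congr 1
  · have e1 := integral_map mp.measurable.aemeasurable (f := fun q : (E d × 𝕄) × Ω =>
      (φ₁ q.1.1 * ζ i q.1 ((X q.2).ins q.1)) * (φ₂ q.1.1 * ζ j q.1 ((X q.2).ins q.1)))
      hG2.aestronglyMeasurable
      (μ := (densVol fun z => s * W.indicator g z).prod (μ.prod Q))
    rw [mp.map_eq] at e1
    refine e1.trans ?_
    rw [integral_congr_ae hae, integral_prod _ (M.integrable_diag i j h₁ h₂)]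
    refine integral_congr_ae (Eventually.of_forall fun x => ?_)
    simp only [integral_const_mul, scoreMixed]
  · have e1 := integral_map mp2.measurable.aemeasurable
      (f := fun r : (E d × 𝕄) × (E d × 𝕄) × Ω =>
        (φ₁ r.1.1 * ζ i r.1 (((X r.2.2).ins r.2.1).ins r.1)) *
          (φ₂ r.2.1.1 * ζ j r.2.1 (((X r.2.2).ins r.2.1).ins r.1)))
      hG3.aestronglyMeasurable
      (μ := ((densVol fun z => s * W.indicator g z).prod
        (densVol fun z => s * W.indicator g z)).prod (μ.prod (Q.prod Q)))
    rw [mp2.map_eq] at e1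
    refine e1.trans ?_
    rw [integral_congr_ae hae2, integral_prod _ (M.integrable_off i j h₁ h₂)]
    refine integral_congr_ae (Eventually.of_forall fun x => ?_)
    simp only [integral_const_mul]

/-- The covariance of two statistics. -/
theorem covariance_statistic :
    MemLp (fun ω => ∫ p, φ₁ p.1 * ζ i p (X ω) ∂(X ω).toMeasure) 2 μ ∧
    (∫ ω, (∫ p, φ₁ p.1 * ζ i p (X ω) ∂(X ω).toMeasure) *
        ∫ p, φ₂ p.1 * ζ j p (X ω) ∂(X ω).toMeasure ∂μ) -
      (∫ ω, ∫ p, φ₁ p.1 * ζ i p (X ω) ∂(X ω).toMeasure ∂μ) *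
        ∫ ω, ∫ p, φ₂ p.1 * ζ j p (X ω) ∂(X ω).toMeasure ∂μ =
      (∫ x, s * W.indicator g x * (φ₁ x * φ₂ x * scoreMixed μ Q X (ζ i) (ζ j) x)) +
      ∫ r : E d × E d, s * W.indicator g r.1 * (s * W.indicator g r.2) *
        (φ₁ r.1 * φ₂ r.2 * scoreCov μ Q X (ζ i) (ζ j) r.1 r.2) ∂(volume.prod volume) := by
  have hρ : Measurable fun z => s * W.indicator g z := M.measurable_density.const_mul s
  have hρ0 := M.density_mul_nonneg
  constructor
  · rw [memLp_two_iff_integrable_sq (M.integral_statistic i h₁).1.aestronglyMeasurable]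
    simp only [sq]
    exact (M.integral_statistic_mul i i h₁ h₁).1
  · rw [(M.integral_statistic_mul i j h₁ h₂).2, (M.integral_statistic i h₁).2,
      (M.integral_statistic j h₂).2, ← integral_densVol hρ hρ0, ← integral_densVol_prod hρ hρ0,
      add_sub_assoc]
    congr 1
    have i1 := (M.integrable_off i j h₁ h₂).integral_prod_left
    have j1 := (M.integrable_single i h₁).integral_prod_left
    have j2 := (M.integrable_single j h₂).integral_prod_left
    simp only [integral_const_mul] at i1 j1 j2
    -- The product of the two means is a double integral over the same measure as the off-diagonal
    -- moment; their difference has the covariance of the scores as integrand.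
    have e := integral_prod_mul (μ := densVol fun z => s * W.indicator g z)
      (ν := densVol fun z => s * W.indicator g z)
      (fun x => φ₁ x * ∫ q : Ω × 𝕄, ζ i (x, q.2) (X q.1) ∂(μ.prod Q))
      (fun y => φ₂ y * ∫ q : Ω × 𝕄, ζ j (y, q.2) (X q.1) ∂(μ.prod Q))
    rw [← e, ← integral_sub i1 (j1.mul_prod j2)]
    refine integral_congr_ae (Eventually.of_forall fun r => ?_)
    simp only [scoreCov, covar]
    ring

end IsModel

end StabScores

end

/-! ### Boundary neighbourhoods and moments of the exponential kernel -/

noncomputable section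

namespace StabScores

variable {d : ℕ}

section Boundary

/-- The segment between the points is connected, so it cannot be covered by the interiors of `A` and
of its complement; it meets the frontier. -/
lemma infEDist_frontier_le {A : Set (E d)} {x y : E d} (h : x ∈ A ↔ y ∉ A) :
    Metric.infEDist x (frontier A) ≤ ENNReal.ofReal (dist x y) := by
  have hne : (segment ℝ x y ∩ frontier A).Nonempty := by
    by_contra hcon
    rw [not_nonempty_iff_eq_empty, ← disjoint_iff_inter_eq_empty] at hcon
    have hsub : segment ℝ x y ⊆ interior A ∪ interior Aᶜ := by
      rw [← compl_frontier_eq_union_interior]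
      exact hcon.subset_compl_right
    have hdis : Disjoint (interior A) (interior Aᶜ) :=
      disjoint_compl_right.mono interior_subset interior_subset
    have hc := (convex_segment (𝕜 := ℝ) x y).isPreconnected
    have hx := left_mem_segment ℝ x y
    have hy := right_mem_segment ℝ x y
    rcases hsub hx with h1 | h1
    · have := hc.subset_left_of_subset_union isOpen_interior isOpen_interior hdis hsub ⟨x, hx, h1⟩
      exact h.1 (interior_subset h1) (interior_subset (this hy))
    · have := hc.subset_right_of_subset_union isOpen_interior isOpen_interior hdis hsub ⟨x, hx, h1⟩
      have hy' : y ∉ A := interior_subset (this hy)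
      exact interior_subset h1 (h.2 hy')
  obtain ⟨z, hz, hzA⟩ := hne
  refine (Metric.infEDist_le_edist_of_mem hzA).trans ?_
  rw [edist_dist]
  refine ENNReal.ofReal_le_ofReal ?_
  have h1 := dist_add_dist_of_mem_segment hz
  linarith [dist_nonneg (x := z) (y := y)]

/-- Linear growth near zero, for a bounded function, gives a global linear bound. -/
lemma exists_linear_bound {v : ℝ → ℝ≥0∞} {V : ℝ≥0∞} (hV : V ≠ ∞) (hv : ∀ r, v r ≤ V)
    (h : limsup (fun r : ℝ => v r / ENNReal.ofReal r) (𝓝[>] 0) < ∞) :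
    ∃ C : ℝ≥0∞, C ≠ ∞ ∧ ∀ r : ℝ, 0 < r → v r ≤ C * ENNReal.ofReal r := by
  obtain ⟨b, hb, hb'⟩ := exists_between h
  have he := eventually_lt_of_limsup_lt hb
  obtain ⟨r₀, hr₀, hI⟩ := mem_nhdsGT_iff_exists_Ioo_subset.1 he
  have hr₀' : 0 < r₀ := hr₀
  -- The limsup provides the constant `b` below some `r₀`; beyond it the total bound `V` is itself
  -- at most linear.
  refine ⟨max b (V / ENNReal.ofReal r₀), ?_, fun r hr => ?_⟩
  · refine max_ne_top hb'.ne (ENNReal.div_ne_top hV ?_)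
    simpa using hr₀'
  · rcases lt_or_ge r r₀ with hlt | hge
    · have h1 : v r / ENNReal.ofReal r < b := hI ⟨hr, hlt⟩
      have h2 := (ENNReal.div_le_iff (by simpa using hr) ENNReal.ofReal_ne_top).1 h1.le
      exact h2.trans (by gcongr; exact le_max_left _ _)
    · calc v r ≤ V := hv r
        _ = V / ENNReal.ofReal r₀ * ENNReal.ofReal r₀ :=
            (ENNReal.div_mul_cancel (by simpa using hr₀') ENNReal.ofReal_ne_top).symm
        _ ≤ _ := by
            gcongr
            exact le_max_right _ _

/-- The part of `A` near `F` has measure of linear order. -/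
def LinearBoundary (A F : Set (E d)) (Cb : ℝ≥0∞) : Prop :=
  ∀ r : ℝ, 0 < r → volume {x ∈ A | Metric.infEDist x F ≤ ENNReal.ofReal r} ≤ Cb * ENNReal.ofReal r

lemma WindowBoundaryCondition.exists_linearBoundary {W A : Set (E d)}
    (h : WindowBoundaryCondition W) (hA : MeasurableSet A) (hb : Bornology.IsBounded A)
    (hAW : A ⊆ W) : ∃ Cb : ℝ≥0∞, Cb ≠ ∞ ∧ LinearBoundary A (frontier W) Cb :=
  exists_linear_bound hb.measure_lt_top.ne (fun _ => measure_mono (sep_subset _ _)) (h A hA hb hAW)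

lemma BoundaryCondition.exists_linearBoundary {A A' : Set (E d)} (h : BoundaryCondition A')
    (hb : Bornology.IsBounded A) : ∃ Cb : ℝ≥0∞, Cb ≠ ∞ ∧ LinearBoundary A (frontier A') Cb := by
  refine exists_linear_bound hb.measure_lt_top.ne (fun _ => measure_mono (sep_subset _ _))
    (lt_of_le_of_lt (limsup_le_limsup (Eventually.of_forall fun r => ?_)) h)
  simp only
  gcongr
  exact fun hx => hx.2

end Boundary

section Kernel

/-- Moments of the stretched exponential kernel. -/
def kernelMoment (d k : ℕ) (s r : ℝ) : ℝ≥0∞ :=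
  ∫⁻ z : E d, ENNReal.ofReal s * (‖z‖ₑ ^ k * ENNReal.ofReal (Real.exp (-(r * ‖z‖ ^ d))))

lemma lintegral_comp_smul {f : E d → ℝ≥0∞} (hf : Measurable f) {α : ℝ} (hα : 0 < α) :
    ∫⁻ z, f (α • z) = ENNReal.ofReal ((α ^ d)⁻¹) * ∫⁻ z, f z := by
  rw [← lintegral_map hf (measurable_const_smul α), Measure.map_addHaar_smul _ hα.ne',
    lintegral_smul_measure, finrank_euclideanSpace_fin, abs_of_pos (by positivity), smul_eq_mul]

/-- Under $z\mapsto s^{1/d}z$ the factor $s$ is absorbed by the volume element, and each power of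
the norm releases one factor $s^{-1/d}$. The case `k = 1` is the source of the rate, the case `k =
0` is independent of the scale. -/
lemma kernelMoment_scale (hd : d ≠ 0) (k : ℕ) {s : ℝ} (hs : 0 < s) (c : ℝ) :
    kernelMoment d k s (c * s) =
      ENNReal.ofReal (s ^ (-(1 / (d : ℝ)))) ^ k * kernelMoment d k 1 c := by
  set α := s ^ (1 / (d : ℝ)) with hα
  have hα0 : 0 < α := Real.rpow_pos_of_pos hs _
  have hαd : α ^ d = s := by
    rw [hα, one_div, Real.rpow_inv_natCast_pow hs.le hd]
  have hf : Measurable fun z : E d => ‖z‖ₑ ^ k * ENNReal.ofReal (Real.exp (-(c * ‖z‖ ^ d))) := by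
    fun_prop
  have e : ∀ z : E d, ENNReal.ofReal s *
      (‖z‖ₑ ^ k * ENNReal.ofReal (Real.exp (-(c * s * ‖z‖ ^ d)))) =
      ENNReal.ofReal s * ENNReal.ofReal α⁻¹ ^ k *
        (‖α • z‖ₑ ^ k * ENNReal.ofReal (Real.exp (-(c * ‖α • z‖ ^ d)))) := by
    intro z
    have h1 : ‖α • z‖ₑ = ENNReal.ofReal α * ‖z‖ₑ := by
      rw [enorm_smul, Real.enorm_of_nonneg hα0.le]
    have h2 : ENNReal.ofReal α⁻¹ ^ k * ENNReal.ofReal α ^ k = 1 := by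
      rw [← mul_pow, ← ENNReal.ofReal_mul (by positivity), inv_mul_cancel₀ hα0.ne',
        ENNReal.ofReal_one, one_pow]
    rw [h1, norm_smul, Real.norm_of_nonneg hα0.le, mul_pow α, hαd, mul_pow, ← mul_assoc c]
    calc _ = ENNReal.ofReal s * ((ENNReal.ofReal α⁻¹ ^ k * ENNReal.ofReal α ^ k) * ‖z‖ₑ ^ k *
          ENNReal.ofReal (Real.exp (-(c * s * ‖z‖ ^ d)))) := by rw [h2, one_mul]
      _ = _ := by ring
  have hne : Measurable fun z : E d =>
      ‖α • z‖ₑ ^ k * ENNReal.ofReal (Real.exp (-(c * ‖α • z‖ ^ d))) := by fun_prop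
  rw [kernelMoment, lintegral_congr e, lintegral_const_mul _ hne,
    lintegral_comp_smul hf hα0, hαd, kernelMoment]
  simp only [ENNReal.ofReal_one, one_mul]
  rw [Real.rpow_neg hs.le, ← hα, mul_comm (ENNReal.ofReal s), mul_assoc, ← mul_assoc (ENNReal.ofReal s),
    ← ENNReal.ofReal_mul hs.le, mul_inv_cancel₀ hs.ne', ENNReal.ofReal_one, one_mul]

/-- In polar coordinates this is a Gamma-type integral with the power `d - 1 + k` of the radius. -/
lemma kernelMoment_lt_top (hd : 2 ≤ d) (k : ℕ) {c : ℝ} (hc : 0 < c) :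
    kernelMoment d k 1 c ≠ ∞ := by
  haveI : Nonempty (Fin d) := ⟨⟨0, by omega⟩⟩
  have hd0 : (0 : ℝ) < d := by exact_mod_cast (by omega : 0 < d)
  have h := integrableOn_rpow_mul_exp_neg_mul_rpow (p := d) (s := ((d - 1 + k : ℕ) : ℝ)) (b := c)
    (by linarith [Nat.cast_nonneg (α := ℝ) (d - 1 + k)]) hd0 hc
  have h2 : Integrable (fun z : E d => (fun t : ℝ => t ^ k * Real.exp (-(c * t ^ d))) ‖z‖) volume := by
    refine (integrable_fun_norm_addHaar volume
      (f := fun t : ℝ => t ^ k * Real.exp (-(c * t ^ d)))).2 ?_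
    rw [finrank_euclideanSpace_fin]
    refine h.congr (ae_of_all _ fun t => ?_)
    simp only [Real.rpow_natCast, smul_eq_mul]
    rw [pow_add]
    ring_nf
  rw [kernelMoment]
  convert h2.2.ne using 3 with z
  simp only [ENNReal.ofReal_one, one_mul]
  rw [enorm_mul, enorm_pow, enorm_norm, Real.enorm_of_nonneg (Real.exp_pos _).le]

/-- The pairs `(x, z)` with `x` at distance at most `‖z‖` from `F`. -/
def nearPairs (F : Set (E d)) : Set (E d × E d) := {q | Metric.infEDist q.1 F ≤ ‖q.2‖ₑ}

lemma measurableSet_nearPairs (F : Set (E d)) : MeasurableSet (nearPairs F) :=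
  measurableSet_le (Metric.continuous_infEDist.measurable.comp measurable_fst)
    measurable_snd.enorm

/-- The integrand bounding the effect of inhomogeneities near `x`. -/
def gapIntegrand (F : Set (E d)) (s r : ℝ) (a b : ℝ≥0∞) (q : E d × E d) : ℝ≥0∞ :=
  ENNReal.ofReal s * ((a * ‖q.2‖ₑ + b * (nearPairs F).indicator 1 q) *
    ENNReal.ofReal (Real.exp (-(r * ‖q.2‖ ^ d))))

lemma measurable_gapIntegrand (F : Set (E d)) (s r : ℝ) (a b : ℝ≥0∞) :
    Measurable (gapIntegrand F s r a b) := by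
  have h : Measurable ((nearPairs F).indicator (1 : E d × E d → ℝ≥0∞)) :=
    measurable_one.indicator (measurableSet_nearPairs F)
  unfold gapIntegrand
  fun_prop

/-- The indicator of closeness to the boundary is not small pointwise. After exchanging the
integrals, however, the points of `A` within distance `‖z‖` of `F` have measure of order `‖z‖`, so
that both terms lead to the first moment of the kernel. -/
lemma lintegral_gapIntegrand_le [NullSingletonClass (volume : Measure (E d))] {A F : Set (E d)}
    {Cb : ℝ≥0∞} (h : LinearBoundary A F Cb) (hA : MeasurableSet A) (s r : ℝ) (a b : ℝ≥0∞) :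
    ∫⁻ x in A, ∫⁻ z, gapIntegrand F s r a b (x, z) ≤
      (a * volume A + b * Cb) * kernelMoment d 1 s r := by
  rw [lintegral_lintegral_swap (f := fun x z => gapIntegrand F s r a b (x, z))
    (measurable_gapIntegrand F s r a b).aemeasurable, kernelMoment,
    ← lintegral_const_mul _ (by fun_prop)]
  have h0 : ∀ᵐ z : E d, z ≠ 0 :=
    measure_eq_zero_iff_ae_notMem.1 (measure_singleton (μ := (volume : Measure (E d))) 0)
  refine lintegral_mono_ae (h0.mono fun z hz => ?_)
  have hm : MeasurableSet {x : E d | Metric.infEDist x F ≤ ‖z‖ₑ} :=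
    measurableSet_le Metric.continuous_infEDist.measurable measurable_const
  have hind : ∀ x : E d, (nearPairs F).indicator (1 : E d × E d → ℝ≥0∞) (x, z) =
      {x : E d | Metric.infEDist x F ≤ ‖z‖ₑ}.indicator 1 x := fun x => rfl
  have hmi : Measurable ({x : E d | Metric.infEDist x F ≤ ‖z‖ₑ}.indicator (1 : E d → ℝ≥0∞)) :=
    measurable_one.indicator hm
  have hv : volume ({x : E d | Metric.infEDist x F ≤ ‖z‖ₑ} ∩ A) ≤ Cb * ‖z‖ₑ := by
    rw [← ofReal_norm]
    refine le_trans (measure_mono fun x hx => ?_) (h ‖z‖ (norm_pos_iff.2 hz))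
    exact ⟨hx.2, hx.1⟩
  simp only [gapIntegrand, hind]
  rw [lintegral_const_mul _ (by fun_prop), lintegral_mul_const _ (by fun_prop),
    MeasureTheory.lintegral_add_left measurable_const, lintegral_const,
    Measure.restrict_apply_univ, lintegral_const_mul _ hmi, lintegral_indicator_one hm,
    Measure.restrict_apply hm]
  calc _ ≤ ENNReal.ofReal s * ((a * ‖z‖ₑ * volume A + b * (Cb * ‖z‖ₑ)) *
        ENNReal.ofReal (Real.exp (-(r * ‖z‖ ^ d)))) := by gcongr
    _ = _ := by ring

end Kernel

end StabScores

end

/-! ### Invariance in law, measurability, and scaling of stationary covariances -/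

noncomputable section

namespace StabScores

variable {d m : ℕ} {𝕄 : Type*} [MeasurableSpace 𝕄] {Ω : Type*} [MeasurableSpace Ω]

open Config

variable {Q : Measure 𝕄} [IsProbabilityMeasure Q] {μ : Measure Ω} [IsProbabilityMeasure μ]

section Law

variable {X X' : Ω → Config d 𝕄} (hX : Measurable X) (hX' : Measurable X')
  (h : μ.map X = μ.map X')

include hX hX' h

lemma covar_of_map_eq (a b : E d) {η₁ η₂ : 𝕄 → Config d 𝕄 → ℝ}
    (h₁ : Measurable (Function.uncurry η₁)) (h₂ : Measurable (Function.uncurry η₂)) :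
    covar μ Q X a b η₁ η₂ = covar μ Q X' a b η₁ η₂ := by
  have g₁ : Measurable fun q : Config d 𝕄 × 𝕄 × 𝕄 => (q.2.1, q.1.ins (b, q.2.2)) :=
    measurable_snd.fst.prodMk (measurable_ins measurable_fst (by fun_prop))
  have g₂ : Measurable fun q : Config d 𝕄 × 𝕄 × 𝕄 => (q.2.2, q.1.ins (a, q.2.1)) :=
    measurable_snd.snd.prodMk (measurable_ins measurable_fst (by fun_prop))
  have e₁ := integral_of_map_eq (ν := Q.prod Q) hX hX' h ((h₁.comp g₁).mul (h₂.comp g₂))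
  have e₂ := integral_of_map_eq (ν := Q) hX hX' h (h₁.comp measurable_swap)
  have e₃ := integral_of_map_eq (ν := Q) hX hX' h (h₂.comp measurable_swap)
  exact congrArg₂ (· - ·) e₁ (congrArg₂ (· * ·) e₂ e₃)

lemma scoreMixed_of_map_eq {ζ₁ ζ₂ : Score d 𝕄} (h₁ : Measurable (Function.uncurry ζ₁))
    (h₂ : Measurable (Function.uncurry ζ₂)) (x : E d) :
    scoreMixed μ Q X ζ₁ ζ₂ x = scoreMixed μ Q X' ζ₁ ζ₂ x := by
  have g₁ : Measurable fun q : Config d 𝕄 × 𝕄 => ((x, q.2), q.1) := by fun_prop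
  exact integral_of_map_eq (ν := Q) hX hX' h ((h₁.comp g₁).mul (h₂.comp g₁))

lemma shiftCov_of_map_eq {ζ₁ ζ₂ : Score d 𝕄} (h₁ : Measurable (Function.uncurry ζ₁))
    (h₂ : Measurable (Function.uncurry ζ₂)) (x v : E d) :
    shiftCov μ Q X ζ₁ ζ₂ x v = shiftCov μ Q X' ζ₁ ζ₂ x v := by
  have g₁ : Measurable fun q : 𝕄 × Config d 𝕄 => ((x, q.1), q.2) := by fun_prop
  have g₂ : Measurable fun q : 𝕄 × Config d 𝕄 => ((x, q.1), q.2.translate (-v)) :=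
    (by fun_prop : Measurable fun q : 𝕄 × Config d 𝕄 => (x, q.1)).prodMk
      (measurable_translate measurable_snd measurable_const)
  exact covar_of_map_eq hX hX' h x (x + v) (h₁.comp g₁) (h₂.comp g₂)

end Law

section Measurability

variable {T : Type*} [MeasurableSpace T] {X : T → Ω → Config d 𝕄}
  (hX : Measurable (Function.uncurry X))

include hX

lemma measurable_covar {a b : T → E d} (ha : Measurable a) (hb : Measurable b)
    {η₁ η₂ : T → 𝕄 → Config d 𝕄 → ℝ}
    (h₁ : Measurable fun q : T × 𝕄 × Config d 𝕄 => η₁ q.1 q.2.1 q.2.2)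
    (h₂ : Measurable fun q : T × 𝕄 × Config d 𝕄 => η₂ q.1 q.2.1 q.2.2) :
    Measurable fun t => covar μ Q (X t) (a t) (b t) (η₁ t) (η₂ t) := by
  have hX2 : Measurable fun q : T × Ω × 𝕄 × 𝕄 => X q.1 q.2.1 :=
    hX.comp (measurable_fst.prodMk measurable_snd.fst)
  have hX1 : Measurable fun q : T × Ω × 𝕄 => X q.1 q.2.1 :=
    hX.comp (measurable_fst.prodMk measurable_snd.fst)
  have g₁ : Measurable fun q : T × Ω × 𝕄 × 𝕄 =>
      (q.1, q.2.2.1, (X q.1 q.2.1).ins (b q.1, q.2.2.2)) :=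
    measurable_fst.prodMk (measurable_snd.snd.fst.prodMk (measurable_ins hX2 (by fun_prop)))
  have g₂ : Measurable fun q : T × Ω × 𝕄 × 𝕄 =>
      (q.1, q.2.2.2, (X q.1 q.2.1).ins (a q.1, q.2.2.1)) :=
    measurable_fst.prodMk (measurable_snd.snd.snd.prodMk (measurable_ins hX2 (by fun_prop)))
  have g₃ : Measurable fun q : T × Ω × 𝕄 => (q.1, q.2.2, X q.1 q.2.1) :=
    measurable_fst.prodMk (measurable_snd.snd.prodMk hX1)
  have e₁ := ((h₁.comp g₁).mul (h₂.comp g₂)).stronglyMeasurable.integral_prod_right'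
    (ν := μ.prod (Q.prod Q))
  have e₂ := (h₁.comp g₃).stronglyMeasurable.integral_prod_right' (ν := μ.prod Q)
  have e₃ := (h₂.comp g₃).stronglyMeasurable.integral_prod_right' (ν := μ.prod Q)
  exact e₁.measurable.sub (e₂.measurable.mul e₃.measurable)

lemma measurable_scoreMixed {ζ₁ ζ₂ : Score d 𝕄} (h₁ : Measurable (Function.uncurry ζ₁))
    (h₂ : Measurable (Function.uncurry ζ₂)) {a : T → E d} (ha : Measurable a) :
    Measurable fun t => scoreMixed μ Q (X t) ζ₁ ζ₂ (a t) := by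
  have g : Measurable fun q : T × Ω × 𝕄 => ((a q.1, q.2.2), X q.1 q.2.1) :=
    (by fun_prop : Measurable fun q : T × Ω × 𝕄 => (a q.1, q.2.2)).prodMk
      (hX.comp (measurable_fst.prodMk measurable_snd.fst))
  exact (((h₁.comp g).mul (h₂.comp g)).stronglyMeasurable.integral_prod_right'
    (ν := μ.prod Q)).measurable

lemma measurable_shiftCov {ζ₁ ζ₂ : Score d 𝕄} (h₁ : Measurable (Function.uncurry ζ₁))
    (h₂ : Measurable (Function.uncurry ζ₂)) {x v : T → E d} (hx : Measurable x)
    (hv : Measurable v) :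
    Measurable fun t => shiftCov μ Q (X t) ζ₁ ζ₂ (x t) (v t) := by
  have g₁ : Measurable fun q : T × 𝕄 × Config d 𝕄 => ((x q.1, q.2.1), q.2.2) := by fun_prop
  have g₂ : Measurable fun q : T × 𝕄 × Config d 𝕄 => ((x q.1, q.2.1), q.2.2.translate (-v q.1)) :=
    (by fun_prop : Measurable fun q : T × 𝕄 × Config d 𝕄 => (x q.1, q.2.1)).prodMk
      (measurable_translate measurable_snd.snd (by fun_prop))
  exact measurable_covar hX hx (hx.add hv) (h₁.comp g₁) (h₂.comp g₂)

lemma measurable_scoreCov {ζ₁ ζ₂ : Score d 𝕄} (h₁ : Measurable (Function.uncurry ζ₁))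
    (h₂ : Measurable (Function.uncurry ζ₂)) {x y : T → E d} (hx : Measurable x)
    (hy : Measurable y) :
    Measurable fun t => scoreCov μ Q (X t) ζ₁ ζ₂ (x t) (y t) := by
  have g₁ : Measurable fun q : T × 𝕄 × Config d 𝕄 => ((x q.1, q.2.1), q.2.2) := by fun_prop
  have g₂ : Measurable fun q : T × 𝕄 × Config d 𝕄 => ((y q.1, q.2.1), q.2.2) := by fun_prop
  exact measurable_covar hX hx hy (h₁.comp g₁) (h₂.comp g₂)

end Measurability

section Scaling

/-- The stationary process of intensity `u` obtained from that of intensity one. -/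
def rescaled (Y : Ω → Config d 𝕄) (u : ℝ) (ω : Ω) : Config d 𝕄 :=
  (Y ω).dilate 0 (u ^ (-(1 / (d : ℝ))))

/-- Nothing relates the given stationary processes of different intensities, so their dependence on
the intensity need not be measurable. Since only laws matter, they are replaced by rescalings of a
single process, which depend measurably on the intensity. -/
lemma IsMecke.rescaled (hd : d ≠ 0) {Y : Ω → Config d 𝕄}
    (hY : IsMecke μ Y (intensity (fun _ => 1) Q)) {u : ℝ} (hu : 0 < u) :
    IsMecke μ (rescaled Y u) (intensity (fun _ => u) Q) := by
  have h := hY.dilate_const 0 (Real.rpow_pos_of_pos hu (-(1 / (d : ℝ))))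
  have e : 1 / (u ^ (-(1 / (d : ℝ)))) ^ d = u := by
    rw [Real.rpow_neg hu.le, inv_pow, one_div (d : ℝ), Real.rpow_inv_natCast_pow hu.le hd,
      one_div, inv_inv]
  rwa [e] at h

lemma measurable_rescaled {T : Type*} [MeasurableSpace T] {Y : Ω → Config d 𝕄}
    (hY : Measurable Y) {u : T → ℝ} (hu : Measurable u) :
    Measurable (Function.uncurry fun t => rescaled Y (u t)) :=
  measurable_dilate (hY.comp measurable_snd) measurable_const
    ((hu.comp measurable_fst).pow_const _)

lemma scaledScore_one (ξ : Score d 𝕄) : scaledScore ξ 1 = ξ := by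
  funext p S
  rw [scaledScore, Real.one_rpow]
  congr 1
  ext1
  rw [dilate_pts _ _ one_pos]
  simp

variable {Y Y' : Ω → Config d 𝕄} {u s : ℝ} (hd : d ≠ 0) (hs : 0 < s)
  (hY : IsMecke μ Y (intensity (fun _ => u) Q)) (hY' : IsMecke μ Y' (intensity (fun _ => s * u) Q))
  {ξ₁ ξ₂ : Score d 𝕄} (h₁ : Measurable (Function.uncurry ξ₁))
  (h₂ : Measurable (Function.uncurry ξ₂)) (x : E d)

include hd hs hY hY'

lemma isMecke_dilate_scale :
    IsMecke μ (fun ω => (Y' ω).dilate x (s ^ (1 / (d : ℝ)))) (intensity (fun _ => u) Q) := by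
  have h := hY'.dilate_const x (Real.rpow_pos_of_pos hs (1 / (d : ℝ)))
  rwa [one_div (d : ℝ), Real.rpow_inv_natCast_pow hs.le hd, mul_div_cancel_left₀ _ hs.ne',
    ← one_div] at h

include h₁ h₂

/-- A scaled score dilates its input about `x` by $s^{1/d}$, and the process of intensity `s * u`,
dilated in this way, has intensity `u`. -/
lemma scoreMixed_scale :
    scoreMixed μ Q Y ξ₁ ξ₂ x = scoreMixed μ Q Y' (scaledScore ξ₁ s) (scaledScore ξ₂ s) x := by
  have h := isMecke_dilate_scale hd hs hY hY' x
  exact scoreMixed_of_map_eq hY.measurable h.measurable (hY.map_eq h) h₁ h₂ x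

/-- Beyond the scaling of the input, a translation by `w` before the dilation corresponds to one by
$s^{1/d}w$ after it; inserted points are carried along. -/
lemma shiftCov_scale (w : E d) :
    shiftCov μ Q Y ξ₁ ξ₂ x (s ^ (1 / (d : ℝ)) • w) =
      shiftCov μ Q Y' (scaledScore ξ₁ s) (scaledScore ξ₂ s) x w := by
  have h := isMecke_dilate_scale hd hs hY hY' x
  have hα : 0 < s ^ (1 / (d : ℝ)) := Real.rpow_pos_of_pos hs _
  rw [shiftCov_of_map_eq hY.measurable h.measurable (hY.map_eq h) h₁ h₂, shiftCov, shiftCov,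
    covar, covar]
  simp only [scaledScore, ins_dilate _ _ _ hα, ← dilate_translate_neg _ _ _ hα,
    add_sub_cancel_left, sub_self, smul_zero, add_zero]

end Scaling

section Sigma

variable {Z : ℝ → Ω → Config d 𝕄} {g : E d → ℝ} {ξ₁ ξ₂ : Score d 𝕄} {f₁ f₂ : E d → ℝ} {x : E d}

/-- The statement adds points, the proof inserts them; the positions are almost surely free. -/
lemma sigmaOff_eq (hZ : ∀ z : E d, ∀ᵐ ω ∂μ, z ∉ (Z (g x) ω).proj) (v : E d) :
    sigmaOff Q μ Z g ξ₁ ξ₂ f₁ f₂ x v =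
      shiftCov μ Q (Z (g x)) ξ₁ ξ₂ x v * (f₁ x * f₂ x * g x ^ 2) := by
  rw [sigmaOff, shiftCov, covar]
  congr 2
  refine integral_congr_ae ?_
  filter_upwards [ae_notMem_proj hZ x, ae_notMem_proj hZ (x + v)] with q h1 h2
  rw [ins_of_notMem (by exact h2), ins_of_notMem (by exact h1)]

end Sigma

end StabScores

end

/-! ### Variation of densities and weights under small displacements -/

noncomputable section

namespace StabScores

variable {d m : ℕ} {𝕄 : Type*} [MeasurableSpace 𝕄] {Ω : Type*} [MeasurableSpace Ω]

/-- If both points are in `A`, the Lipschitz bound applies; if neither is, the difference vanishes.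
If exactly one is, the other value is zero, the jump is at most `b`, and `x` is within `‖w‖` of the
frontier. -/
lemma ofReal_abs_sub_le_near {A : Set (E d)} {G : E d → ℝ} {b L : ℝ} (h0 : ∀ x, x ∉ A → G x = 0)
    (hb : ∀ x, |G x| ≤ b) (hL : ∀ x ∈ A, ∀ y ∈ A, |G y - G x| ≤ L * dist x y) (x w : E d) :
    ENNReal.ofReal |G (x + w) - G x| ≤ ENNReal.ofReal L * ‖w‖ₑ +
      ENNReal.ofReal b * (nearPairs (frontier A)).indicator 1 (x, w) := by
  have hmem : (x ∈ A ↔ x + w ∉ A) → (x, w) ∈ nearPairs (frontier A) := by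
    intro h
    have := infEDist_frontier_le h
    rwa [dist_self_add_right, ofReal_norm] at this
  by_cases hx : x ∈ A <;> by_cases hy : x + w ∈ A
  · refine le_trans ?_ le_self_add
    rw [← ofReal_norm, ← ENNReal.ofReal_mul' (norm_nonneg _)]
    refine ENNReal.ofReal_le_ofReal ((hL x hx _ hy).trans_eq ?_)
    rw [dist_self_add_right]
  · refine le_trans ?_ le_add_self
    rw [indicator_of_mem (hmem (by tauto)), h0 _ hy, zero_sub, abs_neg, Pi.one_apply, mul_one]
    exact ENNReal.ofReal_le_ofReal (hb x)
  · refine le_trans ?_ le_add_self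
    rw [indicator_of_mem (hmem (by tauto)), h0 _ hx, sub_zero, Pi.one_apply, mul_one]
    exact ENNReal.ofReal_le_ofReal (hb _)
  · rw [h0 _ hx, h0 _ hy]
    simp

lemma integrable_of_kernel_bound {A : Set (E d)} (hA : MeasurableSet A)
    (hb : Bornology.IsBounded A) {u : E d × E d → ℝ} (hu : Measurable u) {r c : ℝ}
    (hr : kernelMoment d 0 1 r ≠ ∞) (h0 : ∀ x w, x ∉ A → u (x, w) = 0)
    [NullSingletonClass (volume : Measure (E d))]
    (h : ∀ x w, x ∈ A → w ≠ 0 → |u (x, w)| ≤ c * Real.exp (-(r * ‖w‖ ^ d))) :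
    Integrable u (volume.prod volume) := by
  refine integrable_prod_of_ae_le hu hA hb.measure_lt_top.ne
    (c := ENNReal.ofReal c * kernelMoment d 0 1 r) (by finiteness)
    (Eventually.of_forall fun x => ?_)
  by_cases hx : x ∈ A
  · rw [indicator_of_mem hx, kernelMoment, ← lintegral_const_mul _ (by fun_prop)]
    have hne : ∀ᵐ w : E d, w ≠ 0 :=
      measure_eq_zero_iff_ae_notMem.1 (measure_singleton (μ := (volume : Measure (E d))) 0)
    refine lintegral_mono_ae (hne.mono fun w hw => ?_)
    rw [pow_zero, one_mul, ENNReal.ofReal_one, one_mul, Real.enorm_eq_ofReal_abs,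
      ← ENNReal.ofReal_mul' (Real.exp_pos _).le]
    exact ENNReal.ofReal_le_ofReal (h x w hx hw)
  · simp [h0 x _ hx]

lemma integrable_of_bounded_support {A : Set (E d)} (hA : MeasurableSet A)
    (hb : Bornology.IsBounded A) {u : E d → ℝ} (hu : Measurable u) {c : ℝ}
    (h0 : ∀ x, x ∉ A → u x = 0) (h : ∀ x ∈ A, |u x| ≤ c) : Integrable u := by
  refine Integrable.mono' (g := A.indicator fun _ => c)
    ((integrable_indicator_iff hA).2 (integrableOn_const hb.measure_lt_top.ne))
    hu.aestronglyMeasurable (Eventually.of_forall fun x => ?_)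
  by_cases hx : x ∈ A
  · rw [indicator_of_mem hx]
    exact h x hx
  · rw [indicator_of_notMem hx, h0 x hx, norm_zero]

namespace IsModel

variable {W : Set (E d)} {g : E d → ℝ} {B s : ℝ} {Q : Measure 𝕄} [IsProbabilityMeasure Q]
  {μ : Measure Ω} [IsProbabilityMeasure μ] {X : Ω → Config d 𝕄} {Z : ℝ → Ω → Config d 𝕄}
  {ζ : Fin m → Score d 𝕄} {R : E d × 𝕄 → Config d 𝕄 → ℝ≥0} {Ct : Fin m → ℝ} {K C κ : ℝ}
  [NullSingletonClass (volume : Measure (E d))]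
  (M : IsModel W g B s Q μ X Z ζ R Ct K C κ) (i j : Fin m) {L : ℝ}
  (hgL : ∀ x ∈ W, ∀ y ∈ W, |g y - g x| ≤ L * dist x y)

include M hgL

omit [IsProbabilityMeasure Q] [IsProbabilityMeasure μ]
  [NullSingletonClass (volume : Measure (E d))] in
-- The density is extended by zero outside `W`, so its variation has a Lipschitz part and a jump at
-- the frontier of `W`.
lemma intensityGap_le {x : E d} (hx : x ∈ W) : intensityGap W g s κ x ≤
    ∫⁻ z, gapIntegrand (frontier W) s (slowRate d κ) (ENNReal.ofReal L) (ENNReal.ofReal B) (x, z) := by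
  rw [intensityGap, ← lintegral_add_left_eq_self _ x]
  refine lintegral_mono fun w => ?_
  rw [gapIntegrand, dist_self_add_left, ← mul_assoc]
  refine mul_le_mul' ?_ le_rfl
  have h1 : g x = W.indicator g x := (indicator_of_mem hx g).symm
  rw [h1, ← mul_sub, abs_mul, abs_of_pos M.scale_pos, ENNReal.ofReal_mul M.scale_pos.le]
  refine mul_le_mul' le_rfl (ofReal_abs_sub_le_near (fun z hz => indicator_of_notMem hz g)
    (fun z => ?_) (fun a ha b hb => ?_) x w)
  · rw [abs_of_nonneg (M.indicator_nonneg z)]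
    exact M.indicator_le z
  · rw [indicator_of_mem ha, indicator_of_mem hb]
    exact hgL a ha b hb

variable {φ₁ φ₂ : E d → ℝ} {A₁ A₂ : Set (E d)} {b₁ b₂ : ℝ} (h₁ : IsWeight W A₁ φ₁ b₁)
  (h₂ : IsWeight W A₂ φ₂ b₂) {L₂ : ℝ} (hφL : ∀ x ∈ A₂, ∀ y ∈ A₂, |φ₂ y - φ₂ x| ≤ L₂ * dist x y)

omit [IsProbabilityMeasure Q] [IsProbabilityMeasure μ]
  [NullSingletonClass (volume : Measure (E d))] in
include h₂ in
omit hgL in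
lemma abs_density_mul_le (x : E d) : |W.indicator g x * φ₂ x| ≤ B * b₂ := by
  rw [abs_mul, abs_of_nonneg (M.indicator_nonneg x)]
  exact mul_le_mul (M.indicator_le x) (h₂.abs_le x) (abs_nonneg _) M.bound_nonneg

omit [IsProbabilityMeasure Q] [IsProbabilityMeasure μ]
  [NullSingletonClass (volume : Measure (E d))] in
include h₂ hφL in
-- The product rule for the density times the weight; the only jump that counts is at the frontier
-- of `A₂`, because the weight vanishes outside `A₂`, a subset of `W`.
lemma density_mul_near (x w : E d) :
    ENNReal.ofReal |W.indicator g (x + w) * φ₂ (x + w) - W.indicator g x * φ₂ x| ≤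
      ENNReal.ofReal (B * L₂ + L * b₂) * ‖w‖ₑ +
      ENNReal.ofReal (B * b₂) * (nearPairs (frontier A₂)).indicator 1 (x, w) := by
  refine ofReal_abs_sub_le_near (G := fun x => W.indicator g x * φ₂ x)
    (fun z hz => by rw [h₂.support z hz, mul_zero]) (M.abs_density_mul_le h₂) (fun a ha b hb => ?_) x w
  rw [indicator_of_mem (h₂.subset ha), indicator_of_mem (h₂.subset hb)]
  have e : g b * φ₂ b - g a * φ₂ a = g b * (φ₂ b - φ₂ a) + (g b - g a) * φ₂ a := by ring
  rw [e]
  refine (abs_add_le _ _).trans ?_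
  rw [abs_mul, abs_mul, abs_of_nonneg (M.density_nonneg b (h₂.subset hb)), add_mul]
  refine add_le_add ?_ ?_
  · rw [mul_assoc]
    exact mul_le_mul (M.density_le b (h₂.subset hb)) (hφL a ha b hb) (abs_nonneg _) M.bound_nonneg
  · have h3 := hgL a (h₂.subset ha) b (h₂.subset hb)
    calc _ ≤ L * dist a b * b₂ := mul_le_mul h3 (h₂.abs_le a) (abs_nonneg _) ((abs_nonneg _).trans h3)
      _ = _ := by ring

end IsModel

end StabScores

end

/-! ### Approximation of the diagonal and the off-diagonal parts -/

noncomputable section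

namespace StabScores

variable {d m : ℕ} {𝕄 : Type*} [MeasurableSpace 𝕄] {Ω : Type*} [MeasurableSpace Ω]

/-- Constant in the bound of the covariance of two scores. -/
def covConst (K C : ℝ) : ℝ := 3 * K * K * (2 * C) ^ (1 / 4 : ℝ)

/-- Constant in the comparison of the covariances of two scores on different inputs. -/
def covGapConst (K C : ℝ) : ℝ := 20 * K * K * (2 * C) ^ (1 / 2 : ℝ)

/-- Constant in the comparison of the mixed moments of two scores on different inputs. -/
def mixGapConst (K C : ℝ) : ℝ := 4 * K * K * C ^ (1 / 4 : ℝ)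

/-- Constant in the bound of the effect of a translation of the second score. -/
def shiftConst (K C c : ℝ) : ℝ := 3 * K * c * (2 * (2 * C)) ^ (1 / 4 : ℝ)

lemma covConst_nonneg {K C : ℝ} (hK : 0 ≤ K) (hC : 0 ≤ C) : 0 ≤ covConst K C := by
  unfold covConst
  positivity

namespace IsModel

variable {W : Set (E d)} {g : E d → ℝ} {B s : ℝ} {Q : Measure 𝕄} [IsProbabilityMeasure Q]
  {μ : Measure Ω} [IsProbabilityMeasure μ] {X : Ω → Config d 𝕄} {Z : ℝ → Ω → Config d 𝕄}
  {ζ : Fin m → Score d 𝕄} {R : E d × 𝕄 → Config d 𝕄 → ℝ≥0} {Ct : Fin m → ℝ} {K C κ : ℝ}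
  [NullSingletonClass (volume : Measure (E d))]
  (M : IsModel W g B s Q μ X Z ζ R Ct K C κ) (i j : Fin m) {L : ℝ}
  (hgL : ∀ x ∈ W, ∀ y ∈ W, |g y - g x| ≤ L * dist x y)
  {φ₁ φ₂ : E d → ℝ} {A₁ A₂ : Set (E d)} {b₁ b₂ : ℝ} (h₁ : IsWeight W A₁ φ₁ b₁)
  (h₂ : IsWeight W A₂ φ₂ b₂) {L₂ : ℝ} (hφL : ∀ x ∈ A₂, ∀ y ∈ A₂, |φ₂ y - φ₂ x| ≤ L₂ * dist x y)

include M

include hgL h₂ hφL in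
/-- Comparison of the covariance of the scores at `x` and `x + w` with its stationary analogue. -/
lemma off_pointwise {x w : E d} (hx : x ∈ W) (hgx : 0 < g x) (hw : w ≠ 0) :
    ENNReal.ofReal s * ENNReal.ofReal |W.indicator g (x + w) * φ₂ (x + w) *
        scoreCov μ Q X (ζ i) (ζ j) x (x + w) -
      W.indicator g x * φ₂ x * shiftCov μ Q (Z (s * g x)) (ζ i) (ζ j) x w| ≤
    ENNReal.ofReal s * (‖w‖ₑ ^ 0 * ENNReal.ofReal (Real.exp (-(slowRate d κ * ‖w‖ ^ d)))) *
      (ENNReal.ofReal (B * b₂) * ENNReal.ofReal (covGapConst K C) *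
        ∫⁻ z, gapIntegrand (frontier W) s (slowRate d κ) (ENNReal.ofReal L)
          (ENNReal.ofReal B) (x, z)) +
    gapIntegrand (frontier A₂) s (slowRate d κ)
      (ENNReal.ofReal (B * b₂) * ENNReal.ofReal (shiftConst K C (Ct j)) +
        ENNReal.ofReal (B * L₂ + L * b₂) * ENNReal.ofReal (covConst K C))
      (ENNReal.ofReal (B * b₂) * ENNReal.ofReal (covConst K C)) (x, w) := by
  have hxy : x ≠ x + w := by simpa using hw
  set Γ := ∫⁻ z, gapIntegrand (frontier W) s (slowRate d κ) (ENNReal.ofReal L)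
    (ENNReal.ofReal B) (x, z) with hΓ
  set e := Real.exp (-(slowRate d κ * ‖w‖ ^ d)) with he
  have he0 : 0 ≤ e := (Real.exp_pos _).le
  set Ψ := fun z => W.indicator g z * φ₂ z with hΨ
  set c := scoreCov μ Q X (ζ i) (ζ j) x (x + w)
  set c₀ := scoreCov μ Q (Z (s * g x)) (ζ i) (ζ j) x (x + w)
  set h := shiftCov μ Q (Z (s * g x)) (ζ i) (ζ j) x w
  -- Change of the input. The bounds on the scores require `x + w` to lie in the window; outside
  -- `A₂` the weight vanishes and nothing is to be shown.
  have k1 : ENNReal.ofReal (|Ψ (x + w)| * |c - c₀|) ≤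
      ENNReal.ofReal (B * b₂) * (ENNReal.ofReal (covGapConst K C) * ENNReal.ofReal e * Γ) := by
    by_cases hy : x + w ∈ A₂
    · rw [ENNReal.ofReal_mul (abs_nonneg _), ← ENNReal.ofReal_mul' he0]
      refine mul_le_mul' (ENNReal.ofReal_le_ofReal (M.abs_density_mul_le h₂ _)) ?_
      refine (M.scoreCov_sub_stat_le i j hx hgx (h₂.subset hy) hxy).trans ?_
      rw [dist_self_add_right]
      exact mul_le_mul' le_rfl (M.intensityGap_le hgL hx)
    · simp [hΨ, h₂.support _ hy]
  -- Change of the position of the second score.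
  have k2 : ENNReal.ofReal (|Ψ (x + w)| * |c₀ - h|) ≤
      ENNReal.ofReal (B * b₂) * (ENNReal.ofReal (shiftConst K C (Ct j)) * ‖w‖ₑ *
        ENNReal.ofReal e) := by
    by_cases hy : x + w ∈ A₂
    · rw [ENNReal.ofReal_mul (abs_nonneg _), ← ofReal_norm, ← ENNReal.ofReal_mul' (norm_nonneg _),
        ← ENNReal.ofReal_mul' he0]
      refine mul_le_mul' (ENNReal.ofReal_le_ofReal (M.abs_density_mul_le h₂ _))
        (ENNReal.ofReal_le_ofReal ?_)
      have := M.scoreCov_sub_shiftCov_le i j hx hgx (h₂.subset hy) hxy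
      rw [dist_self_add_right, add_sub_cancel_left] at this
      refine this.trans_eq ?_
      rw [shiftConst]
      ring
    · simp [hΨ, h₂.support _ hy]
  -- Change of the density and weight. The shifted covariance makes sense for all `w`, so no case
  -- distinction on `x + w` is needed.
  have k3 : ENNReal.ofReal (|Ψ (x + w) - Ψ x| * |h|) ≤
      (ENNReal.ofReal (B * L₂ + L * b₂) * ‖w‖ₑ +
        ENNReal.ofReal (B * b₂) * (nearPairs (frontier A₂)).indicator 1 (x, w)) *
        (ENNReal.ofReal (covConst K C) * ENNReal.ofReal e) := by
    rw [ENNReal.ofReal_mul (abs_nonneg _), ← ENNReal.ofReal_mul' he0]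
    exact mul_le_mul' (M.density_mul_near hgL h₂ hφL x w)
      (ENNReal.ofReal_le_ofReal (M.abs_shiftCov_le i j hx hgx hw))
  have key : |Ψ (x + w) * c - Ψ x * h| ≤
      |Ψ (x + w)| * |c - c₀| + |Ψ (x + w)| * |c₀ - h| + |Ψ (x + w) - Ψ x| * |h| := by
    rw [← abs_mul, ← abs_mul, ← abs_mul]
    refine le_trans (le_of_eq ?_) (abs_add_three _ _ _)
    congr 1
    ring
  calc ENNReal.ofReal s * ENNReal.ofReal |Ψ (x + w) * c - Ψ x * h|
      ≤ ENNReal.ofReal s * (ENNReal.ofReal (|Ψ (x + w)| * |c - c₀|) +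
          ENNReal.ofReal (|Ψ (x + w)| * |c₀ - h|) +
          ENNReal.ofReal (|Ψ (x + w) - Ψ x| * |h|)) := by
        gcongr
        rw [← ENNReal.ofReal_add (by positivity) (by positivity),
          ← ENNReal.ofReal_add (by positivity) (by positivity)]
        exact ENNReal.ofReal_le_ofReal key
    _ ≤ _ := mul_le_mul' le_rfl (add_le_add (add_le_add k1 k2) k3)
    _ = _ := by
        simp only [gapIntegrand, ← he]
        ring

include h₁ h₂

include hgL in
/-- Approximation of the diagonal part of the covariance. -/
lemma diag_approx {T₀ : E d → ℝ} (hT₀m : Measurable T₀)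
    (hT₀ : ∀ x ∈ W, 0 < g x → T₀ x = scoreMixed μ Q (Z (s * g x)) (ζ i) (ζ j) x)
    {Cb : ℝ≥0∞} (hW : LinearBoundary A₁ (frontier W) Cb) :
    (Integrable fun x => W.indicator g x * (φ₁ x * φ₂ x * T₀ x)) ∧
    ENNReal.ofReal |(∫ x, W.indicator g x * (φ₁ x * φ₂ x * T₀ x)) -
        (∫ x, s * W.indicator g x * (φ₁ x * φ₂ x * scoreMixed μ Q X (ζ i) (ζ j) x)) / s| ≤
      ENNReal.ofReal (B * b₁) * ENNReal.ofReal b₂ * (ENNReal.ofReal (mixGapConst K C) *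
        ((ENNReal.ofReal L * volume A₁ + ENNReal.ofReal B * Cb) *
          kernelMoment d 1 s (slowRate d κ))) := by
  have hT : Measurable fun x => scoreMixed μ Q X (ζ i) (ζ j) x :=
    measurable_scoreMixed (X := fun _ : E d => X) (M.mecke.measurable.comp measurable_snd)
      (M.measurable_score i) (M.measurable_score j) measurable_id
  have hfac : ∀ x, |W.indicator g x * φ₁ x * φ₂ x| ≤ B * b₁ * b₂ := fun x => by
    rw [abs_mul]
    exact mul_le_mul (M.abs_density_mul_le h₁ x) (h₂.abs_le x) (abs_nonneg _)
      ((abs_nonneg _).trans (M.abs_density_mul_le h₁ x))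
  have hKK := mul_nonneg M.K_nonneg M.K_nonneg
  -- Where the density vanishes there is no stationary input to compare with, but both integrands
  -- are zero.
  have hpos : ∀ x ∈ W, W.indicator g x = 0 ∨ 0 < g x := fun x hx => by
    rw [indicator_of_mem hx]
    exact (M.density_nonneg x hx).eq_or_lt.imp_left Eq.symm
  have i₁ : Integrable fun x => W.indicator g x * (φ₁ x * φ₂ x * T₀ x) := by
    refine integrable_of_bounded_support h₁.measurableSet h₁.bounded
      (M.measurable_density.mul ((h₁.measurable.mul h₂.measurable).mul hT₀m))
      (c := B * b₁ * b₂ * (K * K)) (fun x hx => by simp [h₁.support x hx]) fun x hx => ?_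
    have hxW := h₁.subset hx
    rw [show W.indicator g x * (φ₁ x * φ₂ x * T₀ x) = W.indicator g x * φ₁ x * φ₂ x * T₀ x by ring]
    rcases hpos x hxW with h0 | hgx
    · rw [h0]
      simp only [zero_mul, abs_zero]
      exact mul_nonneg ((abs_nonneg _).trans (hfac x)) hKK
    · rw [abs_mul, hT₀ x hxW hgx]
      exact mul_le_mul (hfac x) (M.abs_scoreMixed_le_of_moments i j hxW
        (M.mecke_stat _ (mul_pos M.scale_pos hgx)).measurable (M.moments_stat i x hxW x hxW hgx)
        (M.moments_stat j x hxW x hxW hgx)) (abs_nonneg _) ((abs_nonneg _).trans (hfac x))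
  have i₂ : Integrable fun x => W.indicator g x * (φ₁ x * φ₂ x * scoreMixed μ Q X (ζ i) (ζ j) x) := by
    refine integrable_of_bounded_support h₁.measurableSet h₁.bounded
      (M.measurable_density.mul ((h₁.measurable.mul h₂.measurable).mul hT))
      (c := B * b₁ * b₂ * (K * K)) (fun x hx => by simp [h₁.support x hx]) fun x hx => ?_
    have hxW := h₁.subset hx
    rw [show ∀ t, W.indicator g x * (φ₁ x * φ₂ x * t) = W.indicator g x * φ₁ x * φ₂ x * t by
      intro t; ring, abs_mul]
    exact mul_le_mul (hfac x) (M.abs_scoreMixed_le_of_moments i j hxW M.mecke.measurable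
      (M.moments i x hxW) (M.moments j x hxW)) (abs_nonneg _) ((abs_nonneg _).trans (hfac x))
  have e₂ : (∫ x, s * W.indicator g x * (φ₁ x * φ₂ x * scoreMixed μ Q X (ζ i) (ζ j) x)) / s =
      ∫ x, W.indicator g x * (φ₁ x * φ₂ x * scoreMixed μ Q X (ζ i) (ζ j) x) := by
    simp only [mul_assoc s]
    rw [integral_const_mul, mul_div_cancel_left₀ _ M.scale_pos.ne']
  refine ⟨i₁, ?_⟩
  rw [e₂, ← integral_sub i₁ i₂, ← Real.enorm_eq_ofReal_abs]
  refine (enorm_integral_le_lintegral_enorm _).trans ?_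
  set Γ := fun x => ∫⁻ z, gapIntegrand (frontier W) s (slowRate d κ) (ENNReal.ofReal L)
    (ENNReal.ofReal B) (x, z) with hΓ
  have hΓm : Measurable Γ := (measurable_gapIntegrand _ _ _ _ _).lintegral_prod_right'
  refine le_trans (lintegral_mono (g := A₁.indicator fun x => ENNReal.ofReal (B * b₁) *
    ENNReal.ofReal b₂ * (ENNReal.ofReal (mixGapConst K C) * Γ x)) fun x => ?_) ?_
  · by_cases hx : x ∈ A₁
    · have hxW := h₁.subset hx
      rw [indicator_of_mem hx]
      rcases hpos x hxW with h0 | hgx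
      · simp [h0]
      · rw [show ∀ t t', W.indicator g x * (φ₁ x * φ₂ x * t) - W.indicator g x * (φ₁ x * φ₂ x * t') =
          W.indicator g x * φ₁ x * φ₂ x * (t - t') by intro t t'; ring, Real.enorm_eq_ofReal_abs,
          abs_mul, abs_mul, abs_sub_comm, ENNReal.ofReal_mul (by positivity),
          ENNReal.ofReal_mul (by positivity), hT₀ x hxW hgx]
        refine mul_le_mul' (mul_le_mul' (ENNReal.ofReal_le_ofReal (M.abs_density_mul_le h₁ x))
          (ENNReal.ofReal_le_ofReal (h₂.abs_le x))) ?_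
        exact (M.scoreMixed_sub_stat_le i j hxW hgx).trans
          (mul_le_mul' le_rfl (M.intensityGap_le hgL hxW))
    · simp [h₁.support x hx]
  · rw [lintegral_indicator h₁.measurableSet, lintegral_const_mul _ (hΓm.const_mul _),
      lintegral_const_mul _ hΓm]
    exact mul_le_mul' le_rfl (mul_le_mul' le_rfl
      (lintegral_gapIntegrand_le hW h₁.measurableSet _ _ _ _))

include hgL hφL in
/-- Approximation of the off-diagonal part of the covariance. -/
lemma off_approx (hd : d ≠ 0) {h : E d × E d → ℝ} (hm : Measurable h)
    (hh : ∀ x ∈ W, 0 < g x → ∀ w, h (x, s ^ (1 / (d : ℝ)) • w) =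
      shiftCov μ Q (Z (s * g x)) (ζ i) (ζ j) x w)
    (hr : kernelMoment d 0 1 (slowRate d κ) ≠ ∞)
    {Cb Cb' : ℝ≥0∞} (hW : LinearBoundary A₁ (frontier W) Cb)
    (hA : LinearBoundary A₁ (frontier A₂) Cb') :
    Integrable (fun q : E d × E d => s * (W.indicator g q.1 * φ₁ q.1) *
      (W.indicator g q.1 * φ₂ q.1 * h (q.1, s ^ (1 / (d : ℝ)) • q.2))) (volume.prod volume) ∧
    ENNReal.ofReal |(∫ x, ∫ v, W.indicator g x * φ₁ x * (W.indicator g x * φ₂ x * h (x, v))) -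
        (∫ r : E d × E d, s * W.indicator g r.1 * (s * W.indicator g r.2) *
        (φ₁ r.1 * φ₂ r.2 * scoreCov μ Q X (ζ i) (ζ j) r.1 r.2) ∂(volume.prod volume)) / s| ≤
      ENNReal.ofReal (B * b₁) *
        (kernelMoment d 0 s (slowRate d κ) *
          (ENNReal.ofReal (B * b₂) * ENNReal.ofReal (covGapConst K C) *
          ((ENNReal.ofReal L * volume A₁ + ENNReal.ofReal B * Cb) *
            kernelMoment d 1 s (slowRate d κ))) +
        ((ENNReal.ofReal (B * b₂) * ENNReal.ofReal (shiftConst K C (Ct j)) +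
            ENNReal.ofReal (B * L₂ + L * b₂) * ENNReal.ofReal (covConst K C)) * volume A₁ +
          ENNReal.ofReal (B * b₂) * ENNReal.ofReal (covConst K C) * Cb') *
          kernelMoment d 1 s (slowRate d κ)) := by
  have hs := M.scale_pos
  set α := s ^ (1 / (d : ℝ)) with hα
  have hα0 : 0 < α := Real.rpow_pos_of_pos hs _
  have hαd : α ^ d = s := by rw [hα, one_div, Real.rpow_inv_natCast_pow hs.le hd]
  have hG := M.measurable_density
  have hφ₁ := h₁.measurable
  have hφ₂ := h₂.measurable
  have hcm : Measurable fun r : E d × E d => scoreCov μ Q X (ζ i) (ζ j) r.1 r.2 :=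
    measurable_scoreCov (X := fun _ : E d × E d => X) (M.mecke.measurable.comp measurable_snd)
      (M.measurable_score i) (M.measurable_score j) measurable_fst measurable_snd
  have hpos : ∀ x ∈ W, W.indicator g x = 0 ∨ 0 < g x := fun x hx => by
    rw [indicator_of_mem hx]
    exact (M.density_nonneg x hx).eq_or_lt.imp_left Eq.symm
  have hk0 := covConst_nonneg M.K_nonneg M.C_nonneg
  -- Both integrals are brought to the same variables, position and displacement: `F` represents the
  -- covariance divided by `s`, `H` the limiting integral.
  set F : E d × E d → ℝ := fun q => s * (W.indicator g q.1 * φ₁ q.1) *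
    (W.indicator g (q.1 + q.2) * φ₂ (q.1 + q.2) * scoreCov μ Q X (ζ i) (ζ j) q.1 (q.1 + q.2)) with hF
  set H : E d × E d → ℝ := fun q => s * (W.indicator g q.1 * φ₁ q.1) *
    (W.indicator g q.1 * φ₂ q.1 * h (q.1, α • q.2)) with hH
  have hadd : Measurable fun q : E d × E d => (q.1, q.1 + q.2) := by fun_prop
  have hIm : Measurable fun r : E d × E d => s * W.indicator g r.1 * (s * W.indicator g r.2) *
      (φ₁ r.1 * φ₂ r.2 * scoreCov μ Q X (ζ i) (ζ j) r.1 r.2) := by fun_prop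
  have hFm : Measurable F := by
    have h1 : Measurable fun q : E d × E d => scoreCov μ Q X (ζ i) (ζ j) q.1 (q.1 + q.2) :=
      hcm.comp hadd
    rw [hF]
    fun_prop
  have hHm : Measurable H := by
    rw [hH]
    fun_prop
  have hfac : ∀ x y t u, |t| ≤ u → |s * (W.indicator g x * φ₁ x) * (W.indicator g y * φ₂ y * t)| ≤
      s * (B * b₁) * (B * b₂) * u := by
    intro x y t u ht
    rw [abs_mul, abs_mul s, abs_of_pos hs, abs_mul _ t, mul_assoc (s * (B * b₁))]
    have p1 := M.abs_density_mul_le h₁ x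
    have p2 := M.abs_density_mul_le h₂ y
    have q1 := (abs_nonneg _).trans p1
    have q2 := (abs_nonneg _).trans p2
    gcongr
  have hbnn : 0 ≤ s * (B * b₁) * (B * b₂) * covConst K C := by
    have := hfac 0 0 0 (covConst K C) (by simpa using hk0)
    exact (abs_nonneg _).trans this
  have iF : Integrable F (volume.prod volume) := by
    refine integrable_of_kernel_bound h₁.measurableSet h₁.bounded hFm hr
      (c := s * (B * b₁) * (B * b₂) * covConst K C)
      (fun x w hx => by simp [hF, h₁.support x hx]) fun x w hx hw => ?_
    by_cases hy : x + w ∈ A₂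
    · have := M.abs_scoreCov_le i j (h₁.subset hx) (h₂.subset hy) (by simpa using hw)
      rw [dist_self_add_right] at this
      exact (hfac _ _ _ _ this).trans_eq (by rw [covConst]; ring)
    · simp only [hF, h₂.support _ hy, mul_zero, zero_mul, abs_zero]
      positivity
  have iH : Integrable H (volume.prod volume) := by
    refine integrable_of_kernel_bound h₁.measurableSet h₁.bounded hHm hr
      (c := s * (B * b₁) * (B * b₂) * covConst K C)
      (fun x w hx => by simp [hH, h₁.support x hx]) fun x w hx hw => ?_
    rcases hpos x (h₁.subset hx) with h0 | hgx
    · simp only [hH, h0, mul_zero, zero_mul, abs_zero]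
      positivity
    · have := M.abs_shiftCov_le i j (h₁.subset hx) hgx hw
      rw [← hh x (h₁.subset hx) hgx w] at this
      exact (hfac _ _ _ _ this).trans_eq (by rw [covConst]; ring)
  have eF : (∫ r : E d × E d, s * W.indicator g r.1 * (s * W.indicator g r.2) *
        (φ₁ r.1 * φ₂ r.2 * scoreCov μ Q X (ζ i) (ζ j) r.1 r.2) ∂(volume.prod volume)) / s =
      ∫ q, F q ∂(volume.prod volume) := by
    -- The shear `(x, w) ↦ (x, x + w)`; the division cancels one of the two factors `s`.
    have mp := measurePreserving_prod_add (volume : Measure (E d)) (volume : Measure (E d))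
    have e1 := integral_map mp.measurable.aemeasurable (μ := (volume : Measure (E d)).prod volume)
      hIm.aestronglyMeasurable
    rw [mp.map_eq] at e1
    rw [e1, ← integral_div]
    refine integral_congr_ae (Eventually.of_forall fun q => ?_)
    simp only [hF]
    field_simp
  have eH : ∫ x, ∫ v, W.indicator g x * φ₁ x * (W.indicator g x * φ₂ x * h (x, v)) =
      ∫ q, H q ∂(volume.prod volume) := by
    rw [integral_prod _ iH]
    refine integral_congr_ae (Eventually.of_forall fun x => ?_)
    simp only [hH]
    -- The substitution $v=s^{1/d}w$ produces the factor `s` in front of `H`.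
    rw [integral_const_mul, integral_const_mul, integral_const_mul, integral_const_mul,
      Measure.integral_comp_smul volume (fun v => h (x, v)), finrank_euclideanSpace_fin, hαd,
      abs_of_pos (by positivity), smul_eq_mul]
    field_simp
  refine ⟨iH, ?_⟩
  rw [eF, eH, ← integral_sub iH iF, ← Real.enorm_eq_ofReal_abs]
  refine (enorm_integral_le_lintegral_enorm _).trans ?_
  rw [lintegral_prod _ (hHm.fun_sub hFm).enorm.aemeasurable]
  set Γ := fun x => ∫⁻ z, gapIntegrand (frontier W) s (slowRate d κ) (ENNReal.ofReal L)
    (ENNReal.ofReal B) (x, z) with hΓ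
  have hΓm : Measurable Γ := (measurable_gapIntegrand _ _ _ _ _).lintegral_prod_right'
  set a' := ENNReal.ofReal (B * b₂) * ENNReal.ofReal (shiftConst K C (Ct j)) +
    ENNReal.ofReal (B * L₂ + L * b₂) * ENNReal.ofReal (covConst K C)
  set b' := ENNReal.ofReal (B * b₂) * ENNReal.ofReal (covConst K C)
  have hgm := measurable_gapIntegrand (frontier A₂) s (slowRate d κ) a' b'
  have hΓ'm : Measurable fun x => ∫⁻ w, gapIntegrand (frontier A₂) s (slowRate d κ) a' b' (x, w) :=
    hgm.lintegral_prod_right'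
  refine le_trans (lintegral_mono (g := A₁.indicator fun x => ENNReal.ofReal (B * b₁) *
    (kernelMoment d 0 s (slowRate d κ) *
      (ENNReal.ofReal (B * b₂) * ENNReal.ofReal (covGapConst K C) * Γ x) +
      ∫⁻ w, gapIntegrand (frontier A₂) s (slowRate d κ) a' b' (x, w))) fun x => ?_) ?_
  · by_cases hx : x ∈ A₁
    · have hxW := h₁.subset hx
      rw [indicator_of_mem hx]
      rcases hpos x hxW with h0 | hgx
      · simp [hF, hH, h0]
      · have hk : Measurable fun w : E d => ENNReal.ofReal s *
            (‖w‖ₑ ^ 0 * ENNReal.ofReal (Real.exp (-(slowRate d κ * ‖w‖ ^ d)))) := by fun_prop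
        have hgx' : Measurable fun w => gapIntegrand (frontier A₂) s (slowRate d κ) a' b' (x, w) :=
          hgm.comp measurable_prodMk_left
        rw [kernelMoment, ← lintegral_mul_const _ hk,
          ← MeasureTheory.lintegral_add_left (hk.mul_const _),
          ← lintegral_const_mul _ ((hk.mul_const _).fun_add hgx')]
        have hne : ∀ᵐ w : E d, w ≠ 0 :=
          measure_eq_zero_iff_ae_notMem.1 (measure_singleton (μ := (volume : Measure (E d))) 0)
        refine lintegral_mono_ae (hne.mono fun w hw => ?_)
        refine le_trans ?_ (mul_le_mul' le_rfl (M.off_pointwise i j hgL h₂ hφL hxW hgx hw))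
        simp only [hF, hH]
        rw [hh x hxW hgx w, ← mul_sub, Real.enorm_eq_ofReal_abs, abs_mul, abs_mul s, abs_of_pos hs,
          abs_sub_comm, mul_comm s, mul_assoc, ENNReal.ofReal_mul (abs_nonneg _),
          ENNReal.ofReal_mul hs.le]
        exact mul_le_mul' (ENNReal.ofReal_le_ofReal (M.abs_density_mul_le h₁ x)) le_rfl
    · simp [hF, hH, h₁.support x hx]
  · rw [lintegral_indicator h₁.measurableSet, lintegral_const_mul _ (by fun_prop),
      MeasureTheory.lintegral_add_left (by fun_prop), lintegral_const_mul _ (by fun_prop),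
      lintegral_const_mul _ hΓm]
    refine mul_le_mul' le_rfl (add_le_add (mul_le_mul' le_rfl (mul_le_mul' le_rfl ?_)) ?_)
    · exact lintegral_gapIntegrand_le hW h₁.measurableSet _ _ _ _
    · exact lintegral_gapIntegrand_le hA h₁.measurableSet _ _ _ _

end IsModel

end StabScores

end

/-! ### Verification of the model, and measurable versions of the limiting integrands -/

noncomputable section

namespace StabScores

variable {d m : ℕ} {𝕄 : Type*} [MeasurableSpace 𝕄] {Ω : Type*} [MeasurableSpace Ω]

open Config

variable {Q : Measure 𝕄} [IsProbabilityMeasure Q] {μ : Measure Ω} [IsProbabilityMeasure μ]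
  [NullSingletonClass (volume : Measure (E d))]

lemma slowRate_mul (κ s : ℝ) : slowRate d (κ * s) = slowRate d κ * s := by
  rw [slowRate, slowRate]
  ring

/-- The scale enters only through the intensity and the rate `cstab * s`; the other constants do not
depend on it, which makes the final constant uniform. -/
lemma exists_isModel {W : Set (E d)} (hW : MeasurableSet W) {g : E d → ℝ}
    (hg0 : ∀ x ∈ W, 0 ≤ g x) {B : ℝ} (hB : ∀ x ∈ W, g x ≤ B) (hB0 : 0 ≤ B) {L : ℝ≥0}
    (hgL : LipschitzOnWith L g W) {Ct : Fin m → ℝ} (hCt : ∀ i, 0 < Ct i)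
    {Cstab cstab p Cmom : ℝ} (hCstab : 0 < Cstab) (hcstab : 0 < cstab) (hp : 0 < p)
    (hCmom : 0 < Cmom) {P Z : ℝ → Ω → Config d 𝕄}
    (hP : ∀ s : ℝ, 1 ≤ s →
      IsPoissonProcess μ (P s) (ENNReal.ofReal s • (densityMeasure W g).prod Q))
    (hZ : ∀ u : ℝ, 0 < u →
      IsPoissonProcess μ (Z u) (ENNReal.ofReal u • (volume : Measure (E d)).prod Q))
    {ξ : Fin m → Score d 𝕄} (hξ : ∀ i, Measurable (Function.uncurry (ξ i)))
    (hT : ∀ i, TranslationLipschitz W (ξ i) (Ct i))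
    (hI : ∀ i, ∀ s : ℝ, 1 ≤ s → InsertConvention W (scaledScore (ξ i) s))
    (hE : IntrinsicallyExpStabilizing W g Q μ P Z (fun i => scaledScore (ξ i)) Cstab cstab)
    (hM : MomentCondition W Q μ P (fun i => scaledScore (ξ i)) p Cmom)
    (hS : StationaryMomentCondition W g Q μ Z (fun i => scaledScore (ξ i)) p Cmom)
    {s : ℝ} (hs : 1 ≤ s) :
    ∃ R, IsModel W g B s Q μ (P s) Z (fun i => scaledScore (ξ i) s) R Ct (momentBound Cmom)
      Cstab (cstab * s) := by
  have hs0 : 0 < s := one_pos.trans_le hs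
  obtain ⟨R, hR⟩ := hE
  obtain ⟨hRm, hstab, hmono, hloc, htail, htail'⟩ := hR s hs
  have hind : ∀ z, s * W.indicator g z ≤ s * B := fun z => by
    refine mul_le_mul_of_nonneg_left ?_ hs0.le
    by_cases h : z ∈ W
    · rw [indicator_of_mem h]
      exact hB z h
    · rwa [indicator_of_notMem h]
  have hPM : IsMecke μ (P s) (intensity (fun z => s * W.indicator g z) Q) := by
    have := hP s hs
    rw [smul_densityMeasure_prod hW g hs0.le] at this
    exact this.isMecke_intensity hind
  have hZM : ∀ u, 0 < u → IsMecke μ (Z u) (intensity (fun _ => u) Q) := fun u hu => by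
    have := hZ u hu
    rw [← intensity_const] at this
    exact this.isMecke_intensity (b := u) fun _ => le_rfl
  have hζ : ∀ i, Measurable (Function.uncurry (scaledScore (ξ i) s)) :=
    fun i => measurable_scaledScore (hξ i) s
  refine ⟨R s, hW, measurable_indicator_of_lipschitzOnWith hW hgL, hg0, hB, hB0, hs0, hPM, hZM, hζ,
    fun i x hx => isSite_of_stabilizing hRm hstab hmono hloc i (hζ i) hx,
    fun i x hx => siteMoments_of_scoreMoment hPM.measurable hPM.noAtom (hζ i) hp hCmom
      fun A hA hc hxA => hM i A hA hc s hs x hx hxA,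
    fun i x hx y hy hgy => ?_, fun x hx t ht => ?_, fun x hx y hy hgy t ht => ?_,
    fun i x hx y hy a S => ?_, fun i => hI i s hs, fun i => (hCt i).le, momentBound_nonneg hCmom,
    hCstab.le, (mul_pos hcstab hs0).le⟩
  · have hZ' := hZM _ (mul_pos hs0 hgy)
    exact siteMoments_of_scoreMoment hZ'.measurable hZ'.noAtom (hζ i) hp hCmom
      fun A _ hc hxA => hS i A hc s hs x hx hxA y hy hgy
  · rw [expTail, ← neg_mul]
    exact htail t ht x hx
  · rw [expTail, ← neg_mul]
    exact htail' t ht x hx y hy hgy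
  -- Translation carries a dilation about `y` to the dilation about `x`. The Lipschitz condition is
  -- thus used with the unscaled displacement, and its constant is not multiplied by $s^{1/d}$.
  · have h := hT i y (x - y) a (S.dilate y (s ^ (1 / (d : ℝ)))) hy (by rwa [add_sub_cancel])
    rw [dilate_translate _ _ _ (Real.rpow_pos_of_pos hs0 _), add_sub_cancel, ← dist_eq_norm] at h
    rw [neg_sub]
    exact h

/-- The mixed moment of two scores on the stationary input whose intensity is the density at `x`. -/
def statMixed (μ : Measure Ω) (Q : Measure 𝕄) (Z : ℝ → Ω → Config d 𝕄) (W : Set (E d))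
    (g : E d → ℝ) (ξ₁ ξ₂ : Score d 𝕄) (x : E d) : ℝ :=
  scoreMixed μ Q (rescaled (Z 1) (W.indicator g x)) ξ₁ ξ₂ x

/-- The covariance of two scores, at `x` and translated from `x + v`, on the stationary input whose
intensity is the density at `x`. -/
def statCov (μ : Measure Ω) (Q : Measure 𝕄) (Z : ℝ → Ω → Config d 𝕄) (W : Set (E d))
    (g : E d → ℝ) (ξ₁ ξ₂ : Score d 𝕄) (q : E d × E d) : ℝ :=
  shiftCov μ Q (rescaled (Z 1) (W.indicator g q.1)) ξ₁ ξ₂ q.1 q.2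

section Stationary

variable {Z : ℝ → Ω → Config d 𝕄} {W : Set (E d)} {g : E d → ℝ} {ξ₁ ξ₂ : Score d 𝕄}
  (hd : d ≠ 0) (hZ : ∀ u, 0 < u → IsMecke μ (Z u) (intensity (fun _ => u) Q))
  (hg0 : ∀ x ∈ W, 0 ≤ g x) (hg : Measurable (W.indicator g))
  (h₁ : Measurable (Function.uncurry ξ₁))
  (h₂ : Measurable (Function.uncurry ξ₂))

include hZ h₁ h₂

omit [NullSingletonClass (volume : Measure (E d))] in
include hg in
lemma measurable_statMixed : Measurable (statMixed μ Q Z W g ξ₁ ξ₂) :=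
  measurable_scoreMixed (measurable_rescaled (hZ 1 one_pos).measurable hg) h₁ h₂ measurable_id

omit [NullSingletonClass (volume : Measure (E d))] in
include hg in
lemma measurable_statCov : Measurable (statCov μ Q Z W g ξ₁ ξ₂) :=
  measurable_shiftCov (measurable_rescaled (hZ 1 one_pos).measurable (hg.comp measurable_fst))
    h₁ h₂ measurable_fst measurable_snd

include hd

omit [NullSingletonClass (volume : Measure (E d))] in
lemma statMixed_eq {s : ℝ} (hs : 0 < s) {x : E d} (hx : x ∈ W) (hgx : 0 < g x) :
    statMixed μ Q Z W g ξ₁ ξ₂ x =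
      scoreMixed μ Q (Z (s * g x)) (scaledScore ξ₁ s) (scaledScore ξ₂ s) x := by
  rw [statMixed, indicator_of_mem hx]
  exact scoreMixed_scale hd hs ((hZ 1 one_pos).rescaled hd hgx) (hZ _ (mul_pos hs hgx)) h₁ h₂ x

omit [NullSingletonClass (volume : Measure (E d))] in
lemma statCov_eq {s : ℝ} (hs : 0 < s) {x : E d} (hx : x ∈ W) (hgx : 0 < g x) (w : E d) :
    statCov μ Q Z W g ξ₁ ξ₂ (x, s ^ (1 / (d : ℝ)) • w) =
      shiftCov μ Q (Z (s * g x)) (scaledScore ξ₁ s) (scaledScore ξ₂ s) x w := by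
  rw [statCov, indicator_of_mem hx]
  exact shiftCov_scale hd hs ((hZ 1 one_pos).rescaled hd hgx) (hZ _ (mul_pos hs hgx)) h₁ h₂ x w

include hg0

variable {A₁ A₂ : Set (E d)} {f₁ f₂ : E d → ℝ} (hA : A₁ ⊆ W) {x : E d} (hx : x ∈ A₁ ∩ A₂)

include hA hx

omit [NullSingletonClass (volume : Measure (E d))] in
-- The case `s = 1` of the scaling identity; where the density vanishes, both sides are zero
-- whatever the process at intensity zero may be.
lemma sigmaDiag_eq_statMixed : sigmaDiag Q μ Z g ξ₁ ξ₂ f₁ f₂ x = W.indicator g x *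
    (A₁.indicator f₁ x * A₂.indicator f₂ x * statMixed μ Q Z W g ξ₁ ξ₂ x) := by
  have hxW := hA hx.1
  rw [indicator_of_mem hx.1, indicator_of_mem hx.2, indicator_of_mem hxW]
  rcases (hg0 x hxW).eq_or_lt with h0 | hgx
  · simp [sigmaDiag, ← h0]
  · rw [statMixed_eq hd hZ h₁ h₂ one_pos hxW hgx, one_mul, scaledScore_one, scaledScore_one,
      sigmaDiag, scoreMixed]
    ring

omit [NullSingletonClass (volume : Measure (E d))] in
lemma sigmaOff_eq_statCov (v : E d) : sigmaOff Q μ Z g ξ₁ ξ₂ f₁ f₂ x v =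
    W.indicator g x * A₁.indicator f₁ x * (W.indicator g x * A₂.indicator f₂ x *
      statCov μ Q Z W g ξ₁ ξ₂ (x, v)) := by
  have hxW := hA hx.1
  rw [indicator_of_mem hx.1, indicator_of_mem hx.2, indicator_of_mem hxW]
  rcases (hg0 x hxW).eq_or_lt with h0 | hgx
  · simp [sigmaOff, ← h0]
  · have := statCov_eq hd hZ h₁ h₂ one_pos hxW hgx v
    rw [Real.one_rpow, one_smul, one_mul, scaledScore_one, scaledScore_one] at this
    rw [sigmaOff_eq (hZ _ hgx).noAtom, this]
    ring

end Stationary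

end StabScores

end

/-! ### The rate of convergence at a given scale -/

noncomputable section

namespace StabScores

variable {d m : ℕ} {𝕄 : Type*} [MeasurableSpace 𝕄] {Ω : Type*} [MeasurableSpace Ω]

open Config

/-- The constant in the rate of convergence of the covariance. -/
def rateConst (d : ℕ) (B L b₁ b₂ K C c k : ℝ) (V Cb Cb' : ℝ≥0∞) : ℝ≥0∞ :=
  (ENNReal.ofReal (B * b₁) * ENNReal.ofReal b₂ * ENNReal.ofReal (mixGapConst K C) *
      (ENNReal.ofReal L * V + ENNReal.ofReal B * Cb) +
    ENNReal.ofReal (B * b₁) *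
      (kernelMoment d 0 1 c * (ENNReal.ofReal (B * b₂) * ENNReal.ofReal (covGapConst K C) *
        (ENNReal.ofReal L * V + ENNReal.ofReal B * Cb)) +
      ((ENNReal.ofReal (B * b₂) * ENNReal.ofReal (shiftConst K C k) +
        ENNReal.ofReal (B * 1 + L * b₂) * ENNReal.ofReal (covConst K C)) * V +
      ENNReal.ofReal (B * b₂) * ENNReal.ofReal (covConst K C) * Cb'))) * kernelMoment d 1 1 c

lemma rateConst_ne_top (hd : 2 ≤ d) (B L b₁ b₂ K C k : ℝ) {c : ℝ} (hc : 0 < c) {V Cb Cb' : ℝ≥0∞}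
    (hV : V ≠ ∞) (hCb : Cb ≠ ∞) (hCb' : Cb' ≠ ∞) : rateConst d B L b₁ b₂ K C c k V Cb Cb' ≠ ∞ := by
  have h0 := kernelMoment_lt_top hd 0 hc
  have h1 := kernelMoment_lt_top hd 1 hc
  unfold rateConst
  finiteness

lemma isWeight_indicator {W A : Set (E d)} (hA : MeasurableSet A) (hb : Bornology.IsBounded A)
    (hAW : A ⊆ W) {f : E d → ℝ} (hf : LipschitzOnWith 1 f A) {b : ℝ} (hfb : ∀ x ∈ A, |f x| ≤ b) :
    IsWeight W A (A.indicator f) (max b 0) := by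
  refine ⟨measurable_indicator_of_lipschitzOnWith hA hf, fun x => ?_,
    fun x hx => indicator_of_notMem hx f, hA, hb, hAW⟩
  by_cases hx : x ∈ A
  · rw [indicator_of_mem hx]
    exact (hfb x hx).trans (le_max_left _ _)
  · rw [indicator_of_notMem hx, abs_zero]
    exact le_max_right _ _

lemma abs_sub_le_of_lipschitzOnWith {A : Set (E d)} {f : E d → ℝ} {L : ℝ≥0}
    (hf : LipschitzOnWith L f A) {x y : E d} (hx : x ∈ A) (hy : y ∈ A) :
    |f y - f x| ≤ L * dist x y := by
  rw [dist_comm, ← Real.dist_eq]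
  exact hf.dist_le_mul y hy x hx

variable {W : Set (E d)} {g : E d → ℝ} {B s : ℝ} {Q : Measure 𝕄} [IsProbabilityMeasure Q]
  {μ : Measure Ω} [IsProbabilityMeasure μ] {X : Ω → Config d 𝕄} {Z : ℝ → Ω → Config d 𝕄}
  {ξ : Fin m → Score d 𝕄} {R : E d × 𝕄 → Config d 𝕄 → ℝ≥0} {Ct : Fin m → ℝ} {K C c : ℝ}
  [NullSingletonClass (volume : Measure (E d))]
  {L : ℝ≥0} {A₁ A₂ : Set (E d)} {f₁ f₂ : E d → ℝ} {b₁ b₂ : ℝ}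

lemma sigma_eq_statistic (hd : d ≠ 0)
    (hZ : ∀ u, 0 < u → IsMecke μ (Z u) (intensity (fun _ => u) Q))
    (hg0 : ∀ x ∈ W, 0 ≤ g x) {ξ₁ ξ₂ : Score d 𝕄} (hξ₁ : Measurable (Function.uncurry ξ₁))
    (hξ₂ : Measurable (Function.uncurry ξ₂)) (hA : A₁ ⊆ W) (hm : MeasurableSet (A₁ ∩ A₂)) :
    sigma Q μ Z g A₁ A₂ ξ₁ ξ₂ f₁ f₂ =
      (∫ x, W.indicator g x * (A₁.indicator f₁ x * A₂.indicator f₂ x *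
        statMixed μ Q Z W g ξ₁ ξ₂ x)) +
      ∫ x, ∫ v, W.indicator g x * A₁.indicator f₁ x * (W.indicator g x * A₂.indicator f₂ x *
        statCov μ Q Z W g ξ₁ ξ₂ (x, v)) := by
  have h0 : ∀ x, x ∉ A₁ ∩ A₂ → A₁.indicator f₁ x = 0 ∨ A₂.indicator f₂ x = 0 := fun x hx => by
    by_cases h1 : x ∈ A₁
    · exact Or.inr (indicator_of_notMem (fun h2 => hx ⟨h1, h2⟩) _)
    · exact Or.inl (indicator_of_notMem h1 _)
  rw [sigma, ← integral_indicator hm, ← integral_indicator hm]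
  congr 1
  · refine integral_congr_ae (Eventually.of_forall fun x => ?_)
    by_cases hx : x ∈ A₁ ∩ A₂
    · simp only [indicator_of_mem hx]
      exact sigmaDiag_eq_statMixed hd hZ hg0 hξ₁ hξ₂ hA hx
    · simp only [indicator_of_notMem hx]
      rcases h0 x hx with h | h <;> simp [h]
  · refine integral_congr_ae (Eventually.of_forall fun x => ?_)
    by_cases hx : x ∈ A₁ ∩ A₂
    · simp only [indicator_of_mem hx]
      exact integral_congr_ae (Eventually.of_forall
        fun v => sigmaOff_eq_statCov hd hZ hg0 hξ₁ hξ₂ hA hx v)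
    · simp only [indicator_of_notMem hx]
      rcases h0 x hx with h | h <;> simp [h]

section Rate

variable (M : IsModel W g B s Q μ X Z (fun i => scaledScore (ξ i) s) R Ct K C (c * s))
  (hξ : ∀ i, Measurable (Function.uncurry (ξ i))) (i j : Fin m)
  (h₁ : IsWeight W A₁ (A₁.indicator f₁) b₁) (h₂ : IsWeight W A₂ (A₂.indicator f₂) b₂)

include M h₁

lemma memLp_pairing : MemLp (pairing A₁ f₁ (scaledScore (ξ i) s) X) 2 μ := by
  rw [show pairing A₁ f₁ (scaledScore (ξ i) s) X = _ from
    funext (pairing_eq_integral h₁.bounded h₁.measurable (M.measurable_score i) X)]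
  exact (M.covariance_statistic i i h₁ h₁).1

include h₂

lemma covariance_pairing :
    cov[centeredPairing μ A₁ f₁ (scaledScore (ξ i) s) X,
      centeredPairing μ A₂ f₂ (scaledScore (ξ j) s) X; μ] =
      (∫ x, s * W.indicator g x * (A₁.indicator f₁ x * A₂.indicator f₂ x *
        scoreMixed μ Q X (scaledScore (ξ i) s) (scaledScore (ξ j) s) x)) +
      ∫ r : E d × E d, s * W.indicator g r.1 * (s * W.indicator g r.2) *
        (A₁.indicator f₁ r.1 * A₂.indicator f₂ r.2 *
          scoreCov μ Q X (scaledScore (ξ i) s) (scaledScore (ξ j) s) r.1 r.2)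
        ∂(volume.prod volume) := by
  have m₁ := memLp_pairing M i h₁
  have m₂ := memLp_pairing M j h₂
  unfold centeredPairing
  rw [covariance_sub_const_left (m₁.integrable (by norm_num)),
    covariance_sub_const_right (m₂.integrable (by norm_num)), covariance_eq_sub m₁ m₂]
  simp only [Pi.mul_apply, pairing_eq_integral h₁.bounded h₁.measurable (M.measurable_score i),
    pairing_eq_integral h₂.bounded h₂.measurable (M.measurable_score j)]
  exact (M.covariance_statistic i j h₁ h₂).2

include hξ in
-- Adds the estimates of `diag_approx` and `off_approx`. The functions `statMixed` and `statCov`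
-- serve all scales at once, which is what makes the limit independent of `s`.
lemma covariance_rate (hd : 2 ≤ d) (hc : 0 < c) (hgL : LipschitzOnWith L g W)
    (hfL : LipschitzOnWith 1 f₂ A₂) {Cb Cb' : ℝ≥0∞} (hW : LinearBoundary A₁ (frontier W) Cb)
    (hA : LinearBoundary A₁ (frontier A₂) Cb') :
    (Integrable fun x => W.indicator g x * (A₁.indicator f₁ x * A₂.indicator f₂ x *
      statMixed μ Q Z W g (ξ i) (ξ j) x)) ∧
    Integrable (fun q : E d × E d => s * (W.indicator g q.1 * A₁.indicator f₁ q.1) *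
      (W.indicator g q.1 * A₂.indicator f₂ q.1 *
        statCov μ Q Z W g (ξ i) (ξ j) (q.1, s ^ (1 / (d : ℝ)) • q.2))) (volume.prod volume) ∧
    ENNReal.ofReal |sigma Q μ Z g A₁ A₂ (ξ i) (ξ j) f₁ f₂ -
        cov[centeredPairing μ A₁ f₁ (scaledScore (ξ i) s) X,
          centeredPairing μ A₂ f₂ (scaledScore (ξ j) s) X; μ] / s| ≤
      rateConst d B L b₁ b₂ K C (slowRate d c) (Ct j) (volume A₁) Cb Cb' *
        ENNReal.ofReal (s ^ (-(1 / (d : ℝ)))) := by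
  have hd0 : d ≠ 0 := by omega
  have hs := M.scale_pos
  have hc' : ∀ t, 0 < t → 0 < slowRate d (c * t) := fun t ht => by
    unfold slowRate
    positivity
  have hgL' : ∀ x ∈ W, ∀ y ∈ W, |g y - g x| ≤ (L : ℝ) * dist x y :=
    fun x hx y hy => abs_sub_le_of_lipschitzOnWith hgL hx hy
  have hfL' : ∀ x ∈ A₂, ∀ y ∈ A₂, |A₂.indicator f₂ y - A₂.indicator f₂ x| ≤ 1 * dist x y := by
    intro x hx y hy
    rw [indicator_of_mem hx, indicator_of_mem hy]
    exact abs_sub_le_of_lipschitzOnWith hfL hx hy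
  obtain ⟨i₁, k₁⟩ := M.diag_approx i j hgL' h₁ h₂
    (measurable_statMixed M.mecke_stat M.measurable_density (hξ i) (hξ j))
    (fun x hx hgx => statMixed_eq hd0 M.mecke_stat (hξ i) (hξ j) hs hx hgx) hW
  obtain ⟨i₂, k₂⟩ := M.off_approx i j hgL' h₁ h₂ hfL' hd0
    (measurable_statCov M.mecke_stat M.measurable_density (hξ i) (hξ j))
    (fun x hx hgx w => statCov_eq hd0 M.mecke_stat (hξ i) (hξ j) hs hx hgx w)
    (kernelMoment_lt_top hd 0 (hc' s hs)) hW hA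
  refine ⟨i₁, i₂, ?_⟩
  rw [sigma_eq_statistic hd0 M.mecke_stat M.density_nonneg (hξ i) (hξ j) h₁.subset
    (h₁.measurableSet.inter h₂.measurableSet), covariance_pairing M i j h₁ h₂, add_div,
    add_sub_add_comm]
  refine (ENNReal.ofReal_le_ofReal (abs_add_le _ _)).trans
    (ENNReal.ofReal_add_le.trans ((add_le_add k₁ k₂).trans_eq ?_))
  -- Every error term contains the first kernel moment exactly once, hence $s^{-1/d}$ exactly once;
  -- the zeroth moment loses its dependence on the scale.
  rw [slowRate_mul, kernelMoment_scale hd0 0 hs, kernelMoment_scale hd0 1 hs, pow_zero, pow_one,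
    one_mul, rateConst]
  ring

end Rate

end StabScores

end

/-! ### The theorem -/

theorem mainTheorem4 (d : ℕ) (hd : 2 ≤ d)
    (W : Set (E d)) (hW : MeasurableSet W) (hWbd : WindowBoundaryCondition W)
    (g : E d → ℝ) (hg0 : ∀ x ∈ W, 0 ≤ g x) (hgbdd : ∃ B : ℝ, ∀ x ∈ W, g x ≤ B)
    (hgLip : ∃ L : ℝ≥0, LipschitzOnWith L g W)
    (m : ℕ) (A : Fin m → Set (E d)) (hAm : ∀ i, MeasurableSet (A i))
    (hAb : ∀ i, Bornology.IsBounded (A i)) (hAW : ∀ i, A i ⊆ W)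
    (hApos : ∀ i, 0 < volume (A i)) (hAbd : ∀ i, BoundaryCondition (A i))
    (fnorm : Fin m → ℝ) (Ctrans : Fin m → ℝ) (hCtrans : ∀ i, 0 < Ctrans i)
    (Cstab cstab p Cmom : ℝ) (hCstab : 0 < Cstab) (hcstab : 0 < cstab) (hp : 0 < p)
    (hCmom : 0 < Cmom) :
    ∃ Ccov : ℝ, 0 < Ccov ∧
      ∀ (𝕄 : Type*) [MeasurableSpace 𝕄] (Q : Measure 𝕄) [IsProbabilityMeasure Q]
        (Ω : Type*) [MeasurableSpace Ω] (μ : Measure Ω) [IsProbabilityMeasure μ]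
        (P Z : ℝ → Ω → Config d 𝕄),
        (∀ s : ℝ, 1 ≤ s →
          IsPoissonProcess μ (P s) (ENNReal.ofReal s • (densityMeasure W g).prod Q)) →
        (∀ u : ℝ, 0 < u →
          IsPoissonProcess μ (Z u) (ENNReal.ofReal u • (volume : Measure (E d)).prod Q)) →
        ∀ (f : Fin m → E d → ℝ),
        (∀ i, LipschitzOnWith 1 (f i) (A i)) →
        (∀ i, ∀ x ∈ A i, |f i x| ≤ fnorm i) →
        (∀ i, 0 < volume {x ∈ A i | f i x ≠ 0}) →
        ∀ (ξ : Fin m → Score d 𝕄),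
        (∀ i, Measurable (Function.uncurry (ξ i))) →
        (∀ i, TranslationLipschitz W (ξ i) (Ctrans i)) →
        (∀ i, ∀ s : ℝ, 1 ≤ s → InsertConvention W (scaledScore (ξ i) s)) →
        IntrinsicallyExpStabilizing W g Q μ P Z (fun i => scaledScore (ξ i)) Cstab cstab →
        MomentCondition W Q μ P (fun i => scaledScore (ξ i)) p Cmom →
        StationaryMomentCondition W g Q μ Z (fun i => scaledScore (ξ i)) p Cmom →
        -- the covariances and the integrals defining `σ_{ij}` exist
        (∀ i, ∀ s : ℝ, 1 ≤ s → MemLp (pairing (A i) (f i) (scaledScore (ξ i) s) (P s)) 2 μ) ∧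
        (∀ i j,
          IntegrableOn (sigmaDiag Q μ Z g (ξ i) (ξ j) (f i) (f j)) (A i ∩ A j) ∧
          Integrable (Function.uncurry (sigmaOff Q μ Z g (ξ i) (ξ j) (f i) (f j)))
            ((volume.restrict (A i ∩ A j)).prod volume)) ∧
        -- the rate of convergence of the covariances
        (∀ i j, ∀ s : ℝ, 1 ≤ s →
          |sigma Q μ Z g (A i) (A j) (ξ i) (ξ j) (f i) (f j)
            - cov[centeredPairing μ (A i) (f i) (scaledScore (ξ i) s) (P s),
                centeredPairing μ (A j) (f j) (scaledScore (ξ j) s) (P s); μ] / s|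
            ≤ Ccov * s ^ (-(1 / (d : ℝ)))) ∧
        -- in particular, the rate of convergence of the variances
        (∀ i, ∀ s : ℝ, 1 ≤ s →
          |sigma Q μ Z g (A i) (A i) (ξ i) (ξ i) (f i) (f i)
            - Var[pairing (A i) (f i) (scaledScore (ξ i) s) (P s); μ] / s|
            ≤ Ccov * s ^ (-(1 / (d : ℝ)))) := by
  classical
  haveI : Nonempty (Fin d) := ⟨⟨0, by omega⟩⟩
  have hd0 : d ≠ 0 := by omega
  obtain ⟨B₀, hB₀⟩ := hgbdd
  obtain ⟨L, hgL⟩ := hgLip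
  have hB : ∀ x ∈ W, g x ≤ max B₀ 0 := fun x hx => (hB₀ x hx).trans (le_max_left _ _)
  choose Cb hCb hCbW using fun i => hWbd.exists_linearBoundary (hAm i) (hAb i) (hAW i)
  choose Cb' hCb' hCbA using fun i j => (hAbd j).exists_linearBoundary (hAb i)
  -- The constants are fixed before marks, processes, weights and scores are introduced. The maxima
  -- with zero are taken because the given bounds are not assumed nonnegative.
  set κ : Fin m → Fin m → ℝ≥0∞ := fun i j =>
    rateConst d (max B₀ 0) L (max (fnorm i) 0) (max (fnorm j) 0) (momentBound Cmom) Cstab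
      (slowRate d cstab) (Ctrans j) (volume (A i)) (Cb i) (Cb' i j) with hκ
  have hrate : 0 < slowRate d cstab := by
    unfold slowRate
    positivity
  have hκt : ∀ i j, κ i j ≠ ∞ := fun i j =>
    rateConst_ne_top hd _ _ _ _ _ _ _ hrate (hAb i).measure_lt_top.ne (hCb i) (hCb' i j)
  have hle : ∀ i j, (κ i j).toReal ≤ 1 + ∑ i, ∑ j, (κ i j).toReal := fun i j => by
    have h1 := Finset.single_le_sum (f := fun i => ∑ j, (κ i j).toReal)
      (fun i _ => Finset.sum_nonneg fun j _ => ENNReal.toReal_nonneg) (Finset.mem_univ i)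
    have h2 := Finset.single_le_sum (f := fun j => (κ i j).toReal)
      (fun j _ => ENNReal.toReal_nonneg) (Finset.mem_univ j)
    linarith
  -- The sum dominates each pair of indices, and the summand 1 makes the constant positive.
  refine ⟨1 + ∑ i, ∑ j, (κ i j).toReal, by positivity, ?_⟩
  intro 𝕄 _ Q _ Ω _ μ _ P Z hP hZ f hfL hfb _ ξ hξ hT hI hE hM hS
  have hmodel : ∀ s : ℝ, 1 ≤ s → ∃ R, IsModel W g (max B₀ 0) s Q μ (P s) Z
      (fun i => scaledScore (ξ i) s) R Ctrans (momentBound Cmom) Cstab (cstab * s) :=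
    fun s hs => exists_isModel hW hg0 hB (le_max_right _ _) hgL hCtrans hCstab hcstab hp hCmom
      hP hZ hξ hT hI hE hM hS hs
  have hw : ∀ i, IsWeight W (A i) ((A i).indicator (f i)) (max (fnorm i) 0) := fun i =>
    isWeight_indicator (hAm i) (hAb i) (hAW i) (hfL i) (hfb i)
  have hmem : ∀ i, ∀ s : ℝ, 1 ≤ s →
      MemLp (pairing (A i) (f i) (scaledScore (ξ i) s) (P s)) 2 μ := fun i s hs => by
    obtain ⟨R, M⟩ := hmodel s hs
    exact memLp_pairing M i (hw i)
  have hcov : ∀ i j, ∀ s : ℝ, 1 ≤ s →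
      |sigma Q μ Z g (A i) (A j) (ξ i) (ξ j) (f i) (f j)
        - cov[centeredPairing μ (A i) (f i) (scaledScore (ξ i) s) (P s),
            centeredPairing μ (A j) (f j) (scaledScore (ξ j) s) (P s); μ] / s|
        ≤ (1 + ∑ i, ∑ j, (κ i j).toReal) * s ^ (-(1 / (d : ℝ))) := fun i j s hs => by
    obtain ⟨R, M⟩ := hmodel s hs
    have h := (covariance_rate M hξ i j (hw i) (hw j) hd hcstab hgL (hfL j) (hCbW i)
      (hCbA i j)).2.2
    have hs0 : 0 ≤ s ^ (-(1 / (d : ℝ))) := Real.rpow_nonneg (zero_le_one.trans hs) _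
    have h' := ENNReal.toReal_mono (ENNReal.mul_ne_top (hκt i j) ENNReal.ofReal_ne_top) h
    rw [ENNReal.toReal_ofReal (abs_nonneg _), ENNReal.toReal_mul, ENNReal.toReal_ofReal hs0] at h'
    exact h'.trans (mul_le_mul_of_nonneg_right (hle i j) hs0)
  refine ⟨hmem, fun i j => ?_, hcov, fun i s hs => ?_⟩
  -- The integrals defining the limit do not involve the scale, so their absolute convergence may be
  -- read off at scale one.
  · obtain ⟨R, M⟩ := hmodel 1 le_rfl
    obtain ⟨i₁, i₂, -⟩ := covariance_rate M hξ i j (hw i) (hw j) hd hcstab hgL (hfL j) (hCbW i)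
      (hCbA i j)
    have hmij := (hAm i).inter (hAm j)
    constructor
    · exact (i₁.integrableOn (s := A i ∩ A j)).congr_fun (fun x hx => (sigmaDiag_eq_statMixed hd0
        M.mecke_stat hg0 (hξ i) (hξ j) (hAW i) hx).symm) hmij
    · simp only [Real.one_rpow, one_smul, one_mul] at i₂
      have e : (volume.restrict (A i ∩ A j)).prod (volume : Measure (E d)) =
          (volume.prod volume).restrict ((A i ∩ A j) ×ˢ univ) := by
        rw [← Measure.prod_restrict, Measure.restrict_univ]
      rw [e]
      exact (i₂.integrableOn (s := (A i ∩ A j) ×ˢ univ)).congr_fun (fun q hq =>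
        (sigmaOff_eq_statCov hd0 M.mecke_stat hg0 (hξ i) (hξ j) (hAW i) hq.1 q.2).symm)
        (hmij.prod MeasurableSet.univ)
  · have h := hcov i i s hs
    -- Centering does not affect the covariance, and the covariance of a variable with itself is its
    -- variance.
    have hint := (hmem i s hs).integrable (by norm_num)
    unfold centeredPairing at h
    rwa [covariance_sub_const_left hint, covariance_sub_const_right hint,
      covariance_self (hmem i s hs).aestronglyMeasurable.aemeasurable] at h
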